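/- Let $M$ be a smooth oriented $4$-manifold with (possibly empty) boundary, $\jmath:\partial M\hookrightarrow M$ the inclusion, $\Lambda,\gamma\in\mathbb R$ with $\gamma\neq 0$. All fields are smooth. **Metric variables.** Consider pairs $(g,Q)$, where $g$ is a Lorentzian metric (signature $(-,+,+,+)$) for which $\partial M$ is timelike and $Q$ is an arbitrary tensor field $Q^\alpha{}_{\beta\sigma}$. Let $\nabla$ be the Levi-Civita connection of $g$, and let $\widetilde\nabla=\nabla+Q$, that is $\widetilde\nabla_\beta Y^\alpha=\nabla_\beta Y^\alpha+Q^\alpha{}_{\beta\sigma}Y^\sigma$ (torsion and non-metricity are allowed). Let $\widetilde R^\alpha{}_{\beta\mu\nu}$, $\widetilde R=g^{\beta\nu}\widetilde R^{\alpha}{}_{\beta\alpha\nu}$ be its curvature (first index pair the endomorphism indices, $\widetilde R(X,Y)Z=\widetilde\nabla_X\widetilde\nabla_YZ-\widetilde\nabla_Y\widetilde\nabla_XZ-\widetilde\nabla_{[X,Y]}Z$, $(\widetilde R(X,Y)Z)^\alpha=\widetilde R^\alpha{}_{\beta\mu\nu}Z^\beta X^\mu Y^\nu$). Let $\nu$ be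 the outward unit normal of $\partial M$, $\bar g=\jmath^*g$, $K=\bar g^{ab}\nabla_a\nu_b$, $\widetilde K=\tfrac12\bar g^{ab}(\widetilde\nabla_a\nu_b+g_{a\gamma}\widetilde\nabla_b\nu^\gamma)$, and $q^\mu=(\mathrm{vol}_g)^{\mu\alpha\beta\nu}Q_{\alpha\beta\nu}$. The Einstein-Hilbert (with Gibbons-Hawking-York term), Palatini and Hojman-Mukku-Sayed (HMS) actions are $\int_M L-\int_{\partial M}\bar\ell$ with $$L_{EH}=(R-2\Lambda)\mathrm{vol}_g,\quad \bar\ell_{GHY}=-2K\,\mathrm{vol}_{\bar g};\qquad L_{PT}=(\widetilde R-2\Lambda)\mathrm{vol}_g,\quad \bar\ell_{PT}=-2\widetilde K\,\mathrm{vol}_{\bar g};$$ $$L_{HMS}=\Big(\widetilde R-2\Lambda-\tfrac1{2\gamma}(\mathrm{vol}_g)^{\alpha\beta\mu\nu}\widetilde R_{\alpha\beta\mu\nu}\Big)\mathrm{vol}_g,\quad \bar\ell_{HMS}=-2\widetilde K\,\mathrm{vol}_{\bar g}+\tfrac1\gamma\jmath^*(\iota_q\mathrm{vol}_g).$$ For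 an action $\mathbb S$ with Lagrangian pair $(L,\bar\ell)$, $\mathrm{Sol}(\mathbb S)$ denotes the set of admissible fields that solve its field equations in the bulk and on the boundary, i.e. those for which $\delta\mathbb S=\int_M\delta L-\int_{\partial M}\delta\bar\ell$ vanishes for all compactly supported smooth variations (the support may meet $\partial M$; boundary values are free). **Tetrad variables.** Consider triples $(\mathrm e,\widehat\omega,S)$, where $\mathrm e=(\mathrm e^I)_{I=0}^3$ is a cotetrad on $M$ such that $g=\eta_{IJ}\mathrm e^I\otimes\mathrm e^J$ is a metric as above, with dual tetrad $E_I$, and $\widehat\omega_{IJ}=-\widehat\omega_{JI}$, $S_{IJ}=S_{JI}$ are matrices of one-forms. Put $\widetilde\omega=\widehat\omega+S$, $\omega_\mu{}^K{}_J=\mathrm e^K_\alpha\nabla_\mu E^\alpha_J$ and $Q^\beta{}_{\mu\alpha}=E^\beta_K\mathrm e^J_\alpha(\widetilde\omega_\mu{}^K{}_J-\omega_\mu{}^K{}_J)$. The tetrad versions $\mathbb S^{(t)}_{PT}$, $\mathbb S^{(t)}_{HMS}$ are the Palatini and HMS actions evaluated on this $(g,Q)$. The Holst action on pairs $(\mathrm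 e,\widehat\omega)$ is given by $$L_{Holst}=\tfrac12H_{IJKL}\big(\widehat F^{IJ}-\tfrac\Lambda6\mathrm e^I\wedge\mathrm e^J\big)\wedge\mathrm e^K\wedge\mathrm e^L,$$ $$\bar\ell=-\tfrac12H_{IJKL}\big(2\mathrm N^I\mathrm d\mathrm N^J-\jmath^*\widehat\omega^{IJ}\big)\wedge\bar{\mathrm e}^K\wedge\bar{\mathrm e}^L-\tfrac1\gamma\mathrm d\bar{\mathrm e}_I\wedge\bar{\mathrm e}^I,$$ with $H_{IJKL}=\epsilon_{IJKL}+\frac1\gamma(\eta_{IK}\eta_{JL}-\eta_{IL}\eta_{JK})$, $\epsilon_{0123}=1$, $\widehat F_{IJ}=\mathrm d\widehat\omega_{IJ}+\widehat\omega_{IK}\wedge\widehat\omega^K{}_J$, $\mathrm N^I=\mathrm e^I(\nu)$, $\bar{\mathrm e}^I=\jmath^*\mathrm e^I$. **Theorem.** 1. $\mathrm{Sol}(\mathbb S^{(m)}_{HMS})=\{(g,Q)\mid g\in\mathrm{Sol}(\mathbb S^{(m)}_{EH}),\ Q^\alpha{}_{\beta\sigma}=\delta^\alpha_\sigma U_\beta\text{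 for some }U\in\Omega^1(M)\}$. 2. $\mathrm{Sol}(\mathbb S^{(m)}_{HMS})=\mathrm{Sol}(\mathbb S^{(m)}_{PT})$. 3. $(\mathrm e,\widehat\omega,S)\in\mathrm{Sol}(\mathbb S^{(t)}_{HMS})$ if and only if $(\mathrm e,\widehat\omega)$ is a solution of the Holst action and $S_{IJ}=\eta_{IJ}U_K\mathrm e^K$ for some smooth functions $U_0,\dots,U_3$ on $M$. 4. $\mathrm{Sol}(\mathbb S^{(t)}_{HMS})=\mathrm{Sol}(\mathbb S^{(t)}_{PT})$. -/

import Mathlib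

open scoped Manifold ContDiff
open MeasureTheory

noncomputable section

namespace HMS

/-! ## Calculus in one coordinate patch of the half-space -/

/-- Coordinate space. Points of a manifold with boundary have coordinates with `0 ≤ x 0`. -/
abbrev E4 : Type := EuclideanSpace ℝ (Fin 4)

/-- Coordinate space of the boundary. -/
abbrev E3 : Type := EuclideanSpace ℝ (Fin 3)

/-- The closed half-space `0 ≤ x 0`, the range of the model `𝓡∂ 4`. -/
def halfSpace : Set E4 := {x | 0 ≤ x 0}

/-- The boundary point with tangential coordinates `y`. -/
def bdryPt (y : E3) : E4 := WithLp.toLp 2 (Fin.cons (0 : ℝ) (fun a : Fin 3 => y a))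

/-- The partial derivative `∂_μ f`, one-sided at the boundary. -/
def pd (μ : Fin 4) (f : E4 → ℝ) (x : E4) : ℝ :=
  fderivWithin ℝ f halfSpace x (EuclideanSpace.single μ 1)

/-- Levi-Civita symbol, `eps 0 1 2 3 = 1`. -/
def eps (i j k l : Fin 4) : ℝ :=
  Matrix.det (Matrix.of fun a b : Fin 4 => if ![i, j, k, l] a = b then (1 : ℝ) else 0)

/-- Diagonal entries of the Minkowski metric, signature `(-,+,+,+)`. -/
def η (I : Fin 4) : ℝ := if I = 0 then -1 else 1

/-- The Minkowski metric `η_{IJ} = η^{IJ}`. -/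
def minkowski (I J : Fin 4) : ℝ := if I = J then η I else 0

/-- Components `g_{αβ}` of a symmetric tensor in a patch, `g x α β`. -/
abbrev LMetric : Type := E4 → Fin 4 → Fin 4 → ℝ

/-- Three-index components in a patch. For the coefficients `C` of a connection and for a
tensor `Q` of type `(1,2)`, `C x α β σ` stands for `C^α_{βσ}`, and the convention is
`∇_β Y^α = ∂_β Y^α + C^α_{βσ} Y^σ`. -/
abbrev LConn : Type := E4 → Fin 4 → Fin 4 → Fin 4 → ℝ

/-- The inverse metric `g^{αβ}`. -/
def gInv (g : LMetric) (x : E4) (α β : Fin 4) : ℝ := (Matrix.of (g x))⁻¹ α β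

/-- `√|det g|`, so that `vol_g = √|det g| dx⁰∧dx¹∧dx²∧dx³` in a positively oriented patch. -/
def sqrtDet (g : LMetric) (x : E4) : ℝ := Real.sqrt |Matrix.det (Matrix.of (g x))|

/-- `(vol_g)^{αβμν}`. Raising the indices of `√|det g| eps` with a Lorentzian metric multiplies
by `det g⁻¹ = -1 / |det g|`. -/
def volUp (g : LMetric) (x : E4) (α β μ ν : Fin 4) : ℝ := -(eps α β μ ν) / sqrtDet g x

/-- Christoffel symbols `Γ^α_{βσ}` of the Levi-Civita connection. -/
def christoffel (g : LMetric) : LConn := fun x α β σ =>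
  (1 / 2) * ∑ μ, gInv g x α μ *
    (pd β (fun y => g y μ σ) x + pd σ (fun y => g y β μ) x - pd μ (fun y => g y β σ) x)

/-- The connection `∇̃ = ∇ + Q`, with `∇` the Levi-Civita connection of `g`. -/
def fullConn (g : LMetric) (Q : LConn) : LConn := fun x α β σ =>
  christoffel g x α β σ + Q x α β σ

/-- Riemann tensor `R^ρ_{σμν}` of a connection. -/
def riemann (C : LConn) (x : E4) (ρ σ μ ν : Fin 4) : ℝ :=
  pd μ (fun y => C y ρ ν σ) x - pd ν (fun y => C y ρ μ σ) x
    + ∑ l, (C x ρ μ l * C x l ν σ - C x ρ ν l * C x l μ σ)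

/-- Riemann tensor with its first index lowered, `R_{αβμν}`. -/
def riemannLow (g : LMetric) (C : LConn) (x : E4) (α β μ ν : Fin 4) : ℝ :=
  ∑ l, g x α l * riemann C x l β μ ν

/-- The scalar curvature `g^{βδ} R^α_{βαδ}`. -/
def scalarCurv (g : LMetric) (C : LConn) (x : E4) : ℝ :=
  ∑ β, ∑ δ, gInv g x β δ * ∑ α, riemann C x α β α δ

/-- Lower components `ν_α` of the outward unit conormal of the boundary `x 0 = 0`. (The formula
also makes sense off the boundary, but only tangential derivatives at the boundary are used.) -/
def nuLow (g : LMetric) (x : E4) (α : Fin 4) : ℝ :=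
  if α = 0 then -1 / Real.sqrt (gInv g x 0 0) else 0

/-- Upper components `ν^α`. -/
def nuUp (g : LMetric) (x : E4) (α : Fin 4) : ℝ := ∑ β, gInv g x α β * nuLow g x β

/-- The metric induced on the boundary. -/
def gBdry (g : LMetric) (x : E4) : Matrix (Fin 3) (Fin 3) ℝ :=
  Matrix.of fun a b => g x a.succ b.succ

/-- `√|det ḡ|`, the density of `vol_ḡ`. -/
def sqrtDetBdry (g : LMetric) (x : E4) : ℝ := Real.sqrt |(gBdry g x).det|

/-- Trace `K` of the extrinsic curvature `K_{ab} = ∇_a ν_b` of the boundary, for the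
Levi-Civita connection. -/
def meanCurv (g : LMetric) (x : E4) : ℝ :=
  ∑ a : Fin 3, ∑ b : Fin 3, (gBdry g x)⁻¹ a b *
    (pd a.succ (fun y => nuLow g y b.succ) x
      - ∑ l, christoffel g x l a.succ b.succ * nuLow g x l)

/-- Trace `K̃` of the generalised extrinsic curvature
`K̃_{ab} = (1/2) (∇̃_a ν_b + g_{aγ} ∇̃_b ν^γ)` of a connection `C`. -/
def genMeanCurv (g : LMetric) (C : LConn) (x : E4) : ℝ :=
  ∑ a : Fin 3, ∑ b : Fin 3, (gBdry g x)⁻¹ a b * ((1 / 2) *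
    ((pd a.succ (fun y => nuLow g y b.succ) x - ∑ l, C x l a.succ b.succ * nuLow g x l)
      + ∑ c, g x a.succ c *
        (pd b.succ (fun y => nuUp g y c) x + ∑ l, C x c b.succ l * nuUp g x l)))

/-- The vector `q^μ = (vol_g)^{μαβν} Q_{αβν}`. -/
def qVec (g : LMetric) (Q : LConn) (x : E4) (μ : Fin 4) : ℝ :=
  ∑ α, ∑ β, ∑ ν, volUp g x μ α β ν * ∑ l, g x α l * Q x l β ν

/-! ### Lagrangian pairs in metric variables

A bulk Lagrangian is written as the coefficient of `dx⁰∧dx¹∧dx²∧dx³`, a boundary Lagrangian as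
its density with respect to `dx¹dx²dx³` for the boundary orientation, in which `vol_ḡ` has
density `√|det ḡ|` and `ȷ^*(ι_q vol_g) = ν_α q^α vol_ḡ`. -/

/-- `(R - 2Λ) vol_g`. -/
def bulkEH (Λ : ℝ) (g : LMetric) (x : E4) : ℝ :=
  (scalarCurv g (christoffel g) x - 2 * Λ) * sqrtDet g x

/-- The Gibbons-Hawking-York term `-2 K vol_ḡ`. -/
def bdryGHY (g : LMetric) (x : E4) : ℝ := -2 * meanCurv g x * sqrtDetBdry g x

/-- `(R̃ - 2Λ) vol_g`. -/
def bulkPT (Λ : ℝ) (g : LMetric) (Q : LConn) (x : E4) : ℝ :=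
  (scalarCurv g (fullConn g Q) x - 2 * Λ) * sqrtDet g x

/-- `-2 K̃ vol_ḡ`. -/
def bdryPT (g : LMetric) (Q : LConn) (x : E4) : ℝ :=
  -2 * genMeanCurv g (fullConn g Q) x * sqrtDetBdry g x

/-- `(R̃ - 2Λ - (1/(2γ)) (vol_g)^{αβμν} R̃_{αβμν}) vol_g`. -/
def bulkHMS (Λ γ : ℝ) (g : LMetric) (Q : LConn) (x : E4) : ℝ :=
  (scalarCurv g (fullConn g Q) x - 2 * Λ
    - 1 / (2 * γ) * ∑ α, ∑ β, ∑ μ, ∑ ν,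
        volUp g x α β μ ν * riemannLow g (fullConn g Q) x α β μ ν) * sqrtDet g x

/-- `-2 K̃ vol_ḡ + (1/γ) ȷ^*(ι_q vol_g)`. -/
def bdryHMS (γ : ℝ) (g : LMetric) (Q : LConn) (x : E4) : ℝ :=
  -2 * genMeanCurv g (fullConn g Q) x * sqrtDetBdry g x
    + 1 / γ * ((∑ μ, nuLow g x μ * qVec g Q x μ) * sqrtDetBdry g x)

/-! ### Tetrad variables -/

/-- Components `e^I_α` of a cotetrad, `e x I α`. -/
abbrev LTetrad : Type := E4 → Fin 4 → Fin 4 → ℝ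

/-- Components `ω_{μ IJ}` of a connection form with lowered internal indices, `ω x μ I J`. -/
abbrev LSpin : Type := E4 → Fin 4 → Fin 4 → Fin 4 → ℝ

/-- `g_{αβ} = η_{IJ} e^I_α e^J_β`. -/
def tetradMetric (e : LTetrad) : LMetric := fun x α β => ∑ I, η I * (e x I α * e x I β)

/-- The dual tetrad `E^α_I`. -/
def dualTetrad (e : LTetrad) (x : E4) (α I : Fin 4) : ℝ := (Matrix.of (e x))⁻¹ α I

/-- The Levi-Civita spin connection `ω_μ^K_I = e^K_α ∇_μ E^α_I`, as `lcSpin e x μ K I`. -/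
def lcSpin (e : LTetrad) (x : E4) (μ K I : Fin 4) : ℝ :=
  ∑ α, e x K α * (pd μ (fun y => dualTetrad e y α I) x
    + ∑ l, christoffel (tetradMetric e) x α μ l * dualTetrad e x l I)

/-- `Q^β_{μα} = E^β_K e^J_α (ω̃_μ^K_J - ω_μ^K_J)`. -/
def tetradQ (e : LTetrad) (w : LSpin) : LConn := fun x β μ α =>
  ∑ K, ∑ J, dualTetrad e x β K * e x J α * (η K * w x μ K J - lcSpin e x μ K J)

/-- Curvature components `F_{μν}^{IJ}` of
`F_{IJ} = dω_{IJ} + ω_{IK} ∧ ω^K_J`, internal indices raised. -/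
def spinCurv (w : LSpin) (x : E4) (I J μ ν : Fin 4) : ℝ :=
  η I * η J * (pd μ (fun y => w y ν I J) x - pd ν (fun y => w y μ I J) x
    + ∑ K, η K * (w x μ I K * w x ν K J - w x ν I K * w x μ K J))

/-- `H_{IJKL} = ε_{IJKL} + (1/γ) (η_{IK} η_{JL} - η_{IL} η_{JK})`. -/
def Hten (γ : ℝ) (I J K L : Fin 4) : ℝ :=
  eps I J K L + 1 / γ * (minkowski I K * minkowski J L - minkowski I L * minkowski J K)

/-- The Holst Lagrangian
`(1/2) H_{IJKL} (F^{IJ} - (Λ/6) e^I ∧ e^J) ∧ e^K ∧ e^L`. -/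
def bulkHolst (Λ γ : ℝ) (e : LTetrad) (w : LSpin) (x : E4) : ℝ :=
  (1 / 2) * ∑ I, ∑ J, ∑ K, ∑ L, Hten γ I J K L *
    ∑ μ, ∑ ν, ∑ ρ, ∑ σ, eps μ ν ρ σ *
      ((1 / 2 * spinCurv w x I J μ ν - Λ / 6 * (e x I μ * e x J ν)) * (e x K ρ * e x L σ))

/-- The internal normal `N^I = ν^α e^I_α`. -/
def intNormal (e : LTetrad) (I : Fin 4) (x : E4) : ℝ :=
  ∑ α, nuUp (tetradMetric e) x α * e x I α

/-- The Holst boundary Lagrangian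
`-(1/2) H_{IJKL} (2 N^I dN^J - ȷ^*ω^{IJ}) ∧ ē^K ∧ ē^L - (1/γ) dē_I ∧ ē^I`.
Its coefficient with respect to `dx¹∧dx²∧dx³` carries a minus sign, because the outward normal
is `-∂_0` and so `dx¹∧dx²∧dx³` is negative for the boundary orientation. -/
def bdryHolst (γ : ℝ) (e : LTetrad) (w : LSpin) (x : E4) : ℝ :=
  -∑ a : Fin 3, ∑ b : Fin 3, ∑ c : Fin 3, eps 0 a.succ b.succ c.succ *
    (-(1 / 2) * (∑ I, ∑ J, ∑ K, ∑ L, Hten γ I J K L *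
        ((2 * intNormal e I x * pd a.succ (intNormal e J) x - η I * η J * w x a.succ I J)
          * (e x K b.succ * e x L c.succ)))
      - 1 / γ * ∑ I, η I * (pd a.succ (fun y => e y I b.succ) x * e x I c.succ))

/-! ### First variation -/

/-- Components of variations with compact support in the coordinate domain `T`. -/
def IsVariation (T : Set E4) (f : E4 → ℝ) : Prop :=
  ContDiffOn ℝ ∞ f halfSpace ∧ ∃ K : Set E4, IsCompact K ∧ K ⊆ T ∧ ∀ x, x ∉ K → f x = 0

/-- `δ𝕊 = ∫_M δL - ∫_{∂M} δℓ` along a curve `t ↦ (L t, ℓ t)` of Lagrangian pairs that varies only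
in the coordinate domain `T`. -/
def firstVariation (T : Set E4) (L l : ℝ → E4 → ℝ) : ℝ :=
  (∫ x in T, deriv (fun t => L t x) 0)
    - ∫ y in {y : E3 | bdryPt y ∈ T}, deriv (fun t => l t (bdryPt y)) 0

/-! ## Fields on a manifold with boundary -/

section Manifold

variable (M : Type*) [TopologicalSpace M] [ChartedSpace (EuclideanHalfSpace 4) M]

/-- An orientation of `M`: a smooth atlas whose transition maps have positive Jacobian. -/
structure OrientedAtlas [IsManifold (𝓡∂ 4) ∞ M] where
  charts : Set (OpenPartialHomeomorph M (EuclideanHalfSpace 4))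
  smooth : charts ⊆ IsManifold.maximalAtlas (𝓡∂ 4) ∞ M
  cover : ∀ p : M, ∃ φ ∈ charts, p ∈ φ.source
  positive : ∀ φ ∈ charts, ∀ ψ ∈ charts,
    ∀ y ∈ ((φ.extend (𝓡∂ 4)).symm.trans (ψ.extend (𝓡∂ 4))).source,
      0 < (fderivWithin ℝ (ψ.extend (𝓡∂ 4) ∘ (φ.extend (𝓡∂ 4)).symm) halfSpace y).det

/-- Sections of `T*M ⊗ T*M`. -/
abbrev BilinField : Type _ :=
  (p : M) → TangentSpace (𝓡∂ 4) p →ₗ[ℝ] TangentSpace (𝓡∂ 4) p →ₗ[ℝ] ℝ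

/-- Sections of `TM ⊗ T*M ⊗ T*M`, `Q p X Y = Q^α_{βσ} X^β Y^σ`. -/
abbrev DiffField : Type _ :=
  (p : M) → TangentSpace (𝓡∂ 4) p →ₗ[ℝ] TangentSpace (𝓡∂ 4) p →ₗ[ℝ] TangentSpace (𝓡∂ 4) p

/-- One-forms (not necessarily smooth). -/
abbrev FormField : Type _ := (p : M) → TangentSpace (𝓡∂ 4) p →ₗ[ℝ] ℝ

variable {M}

/-- The coordinate vector `∂_μ` of the chart `φ` at the point with coordinates `y`. -/
def coordVec (φ : OpenPartialHomeomorph M (EuclideanHalfSpace 4)) (y : E4) (μ : Fin 4) :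
    TangentSpace (𝓡∂ 4) ((φ.extend (𝓡∂ 4)).symm y) :=
  mfderivWithin 𝓘(ℝ, E4) (𝓡∂ 4) (φ.extend (𝓡∂ 4)).symm halfSpace y
    (EuclideanSpace.single μ (1 : ℝ) : E4)

/-- The components `v^α = dx^α(v)` of a tangent vector in the chart `φ`. -/
def coordOf (φ : OpenPartialHomeomorph M (EuclideanHalfSpace 4)) {p : M}
    (v : TangentSpace (𝓡∂ 4) p) (α : Fin 4) : ℝ :=
  (show E4 from mfderiv (𝓡∂ 4) 𝓘(ℝ, E4) (φ.extend (𝓡∂ 4)) p v) α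

/-- Components of a bilinear form field. -/
def compBilin (φ : OpenPartialHomeomorph M (EuclideanHalfSpace 4)) (g : BilinField M) :
    LMetric := fun y α β => g ((φ.extend (𝓡∂ 4)).symm y) (coordVec φ y α) (coordVec φ y β)

/-- Components `Q^α_{βσ}`. -/
def compDiff (φ : OpenPartialHomeomorph M (EuclideanHalfSpace 4)) (Q : DiffField M) :
    LConn := fun y α β σ =>
  coordOf φ (Q ((φ.extend (𝓡∂ 4)).symm y) (coordVec φ y β) (coordVec φ y σ)) α

/-- Components of a one-form. -/
def compForm (φ : OpenPartialHomeomorph M (EuclideanHalfSpace 4)) (θ : FormField M)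
    (y : E4) (μ : Fin 4) : ℝ := θ ((φ.extend (𝓡∂ 4)).symm y) (coordVec φ y μ)

/-- Components of a cotetrad. -/
def compTetrad (φ : OpenPartialHomeomorph M (EuclideanHalfSpace 4)) (e : Fin 4 → FormField M) :
    LTetrad := fun y I α => compForm φ (e I) y α

/-- Components of a matrix of one-forms. -/
def compSpin (φ : OpenPartialHomeomorph M (EuclideanHalfSpace 4))
    (w : Fin 4 → Fin 4 → FormField M) : LSpin := fun y μ I J => compForm φ (w I J) y μ

variable [IsManifold (𝓡∂ 4) ∞ M] (A : OrientedAtlas M)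

/-- `θ ∈ Ω¹(M)`. -/
def IsSmoothForm (θ : FormField M) : Prop :=
  ∀ φ ∈ A.charts, ∀ μ, ContDiffOn ℝ ∞ (fun y => compForm φ θ y μ) (φ.extend (𝓡∂ 4)).target

/-- Smooth tensor fields of the type of `Q`. -/
def IsSmoothDiff (Q : DiffField M) : Prop :=
  ∀ φ ∈ A.charts, ∀ α β σ,
    ContDiffOn ℝ ∞ (fun y => compDiff φ Q y α β σ) (φ.extend (𝓡∂ 4)).target

/-- Smooth Lorentzian metrics for which the boundary is timelike, that is, every tangent
hyperplane of the boundary contains a timelike vector. -/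
structure IsMetric (g : BilinField M) : Prop where
  smooth : ∀ φ ∈ A.charts, ∀ α β,
    ContDiffOn ℝ ∞ (fun y => compBilin φ g y α β) (φ.extend (𝓡∂ 4)).target
  lorentzian : ∀ p, ∃ b : Module.Basis (Fin 4) ℝ (TangentSpace (𝓡∂ 4) p),
    ∀ I J, g p (b I) (b J) = minkowski I J
  timelikeBdry : ∀ φ ∈ A.charts, ∀ y ∈ (φ.extend (𝓡∂ 4)).target, y 0 = 0 →
    ∃ v : Fin 4 → ℝ, v 0 = 0 ∧ ∑ α, ∑ β, compBilin φ g y α β * (v α * v β) < 0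

/-- The metric `g = η_{IJ} e^I ⊗ e^J`. -/
def metricOf (e : Fin 4 → FormField M) : BilinField M := fun p =>
  ∑ I, η I • (e I p).smulRight (e I p)

/-- Smooth cotetrads whose metric is an admissible metric; in particular `e` is a coframe. -/
def IsTetrad (e : Fin 4 → FormField M) : Prop :=
  (∀ I, IsSmoothForm A (e I)) ∧ IsMetric A (metricOf e)

/-- Antisymmetric matrices of smooth one-forms: `ω̂_{IJ} = -ω̂_{JI}`. -/
def IsAntisymm (w : Fin 4 → Fin 4 → FormField M) : Prop :=
  (∀ I J, IsSmoothForm A (w I J)) ∧ ∀ I J p, w I J p = -w J I p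

/-- Symmetric matrices of smooth one-forms: `S_{IJ} = S_{JI}`. -/
def IsSymm (s : Fin 4 → Fin 4 → FormField M) : Prop :=
  (∀ I J, IsSmoothForm A (s I J)) ∧ ∀ I J p, s I J p = s J I p

/-! ## Solution spaces

A field is a solution when the action is stationary under every variation with compact support
in a coordinate domain (compactly supported variations are finite sums of such ones). The
support may meet the boundary, and the boundary values are free. -/

/-- `Sol` of an action on metrics with Lagrangian pair `(L, l)`. -/
def solMetric (L l : LMetric → E4 → ℝ) : Set (BilinField M) :=
  {g | IsMetric A g ∧ ∀ φ ∈ A.charts, ∀ h : LMetric,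
    (∀ α β, IsVariation (φ.extend (𝓡∂ 4)).target (fun x => h x α β)) →
    (∀ x α β, h x α β = h x β α) →
    firstVariation (φ.extend (𝓡∂ 4)).target
      (fun t => L (compBilin φ g + t • h)) (fun t => l (compBilin φ g + t • h)) = 0}

/-- `Sol` of an action on pairs `(g, Q)` with Lagrangian pair `(L, l)`. -/
def solMetricAffine (L l : LMetric → LConn → E4 → ℝ) : Set (BilinField M × DiffField M) :=
  {x | IsMetric A x.1 ∧ IsSmoothDiff A x.2 ∧ ∀ φ ∈ A.charts, ∀ (h : LMetric) (P : LConn),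
    (∀ α β, IsVariation (φ.extend (𝓡∂ 4)).target (fun x => h x α β)) →
    (∀ x α β, h x α β = h x β α) →
    (∀ α β σ, IsVariation (φ.extend (𝓡∂ 4)).target (fun x => P x α β σ)) →
    firstVariation (φ.extend (𝓡∂ 4)).target
      (fun t => L (compBilin φ x.1 + t • h) (compDiff φ x.2 + t • P))
      (fun t => l (compBilin φ x.1 + t • h) (compDiff φ x.2 + t • P)) = 0}

/-- `Sol` of an action on `(e, ω̂)`, `ω̂` antisymmetric, with Lagrangian pair `(L, l)`. -/
def solTetrad (L l : LTetrad → LSpin → E4 → ℝ) :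
    Set ((Fin 4 → FormField M) × (Fin 4 → Fin 4 → FormField M)) :=
  {x | IsTetrad A x.1 ∧ IsAntisymm A x.2 ∧ ∀ φ ∈ A.charts, ∀ (f : LTetrad) (u : LSpin),
    (∀ I α, IsVariation (φ.extend (𝓡∂ 4)).target (fun x => f x I α)) →
    (∀ μ I J, IsVariation (φ.extend (𝓡∂ 4)).target (fun x => u x μ I J)) →
    (∀ x μ I J, u x μ I J = -u x μ J I) →
    firstVariation (φ.extend (𝓡∂ 4)).target
      (fun t => L (compTetrad φ x.1 + t • f) (compSpin φ x.2 + t • u))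
      (fun t => l (compTetrad φ x.1 + t • f) (compSpin φ x.2 + t • u)) = 0}

/-- `Sol` of an action on `(e, ω̂, S)`, `ω̂` antisymmetric and `S` symmetric, which is obtained
from an action on pairs `(g, Q)` with Lagrangian pair `(L, l)` by the change of variables
`g = η_{IJ} e^I ⊗ e^J`, `Q = φ(e, ω̃)`, `ω̃ = ω̂ + S`. -/
def solTetradAffine (L l : LMetric → LConn → E4 → ℝ) :
    Set ((Fin 4 → FormField M) × (Fin 4 → Fin 4 → FormField M) ×
      (Fin 4 → Fin 4 → FormField M)) :=
  {x | IsTetrad A x.1 ∧ IsAntisymm A x.2.1 ∧ IsSymm A x.2.2 ∧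
    ∀ φ ∈ A.charts, ∀ (f : LTetrad) (u s : LSpin),
    (∀ I α, IsVariation (φ.extend (𝓡∂ 4)).target (fun x => f x I α)) →
    (∀ μ I J, IsVariation (φ.extend (𝓡∂ 4)).target (fun x => u x μ I J)) →
    (∀ x μ I J, u x μ I J = -u x μ J I) →
    (∀ μ I J, IsVariation (φ.extend (𝓡∂ 4)).target (fun x => s x μ I J)) →
    (∀ x μ I J, s x μ I J = s x μ J I) →
    firstVariation (φ.extend (𝓡∂ 4)).target
      (fun t => L (tetradMetric (compTetrad φ x.1 + t • f))
        (tetradQ (compTetrad φ x.1 + t • f)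
          ((compSpin φ x.2.1 + t • u) + (compSpin φ x.2.2 + t • s))))
      (fun t => l (tetradMetric (compTetrad φ x.1 + t • f))
        (tetradQ (compTetrad φ x.1 + t • f)
          ((compSpin φ x.2.1 + t • u) + (compSpin φ x.2.2 + t • s)))) = 0}

/-- Einstein-Hilbert action with Gibbons-Hawking-York term. -/
def solEH (Λ : ℝ) : Set (BilinField M) := solMetric A (bulkEH Λ) bdryGHY

/-- Palatini action in metric variables. -/
def solPT (Λ : ℝ) : Set (BilinField M × DiffField M) :=
  solMetricAffine A (bulkPT Λ) bdryPT

/-- Hojman-Mukku-Sayed action in metric variables. -/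
def solHMS (Λ γ : ℝ) : Set (BilinField M × DiffField M) :=
  solMetricAffine A (bulkHMS Λ γ) (bdryHMS γ)

/-- Holst action. -/
def solHolst (Λ γ : ℝ) : Set ((Fin 4 → FormField M) × (Fin 4 → Fin 4 → FormField M)) :=
  solTetrad A (bulkHolst Λ γ) (bdryHolst γ)

/-- Palatini action in tetrad variables. -/
def solPTTetrad (Λ : ℝ) : Set ((Fin 4 → FormField M) × (Fin 4 → Fin 4 → FormField M) ×
    (Fin 4 → Fin 4 → FormField M)) :=
  solTetradAffine A (bulkPT Λ) bdryPT

/-- Hojman-Mukku-Sayed action in tetrad variables. -/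
def solHMSTetrad (Λ γ : ℝ) : Set ((Fin 4 → FormField M) × (Fin 4 → Fin 4 → FormField M) ×
    (Fin 4 → Fin 4 → FormField M)) :=
  solTetradAffine A (bulkHMS Λ γ) (bdryHMS γ)

/-- The tensor `δ^α_σ U_β`, that is `(X, Y) ↦ U(X) Y`. -/
def deltaTensor (U : FormField M) : DiffField M := fun p => (U p).smulRight LinearMap.id

/-- The matrix of one-forms `η_{IJ} U_K e^K`. -/
def etaTensor (U : Fin 4 → M → ℝ) (e : Fin 4 → FormField M) : Fin 4 → Fin 4 → FormField M :=
  fun I J p => minkowski I J • ∑ K, U K p • e K p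

end Manifold

end HMS

end

/-!
# Equivalence of the Hojman-Mukku-Sayed, Palatini, Holst and Einstein-Hilbert actions

All the actions are instances of one generalised action with Lagrangian pair `bulkGen a b Λ`,
`bdryGen a b`, in which the Palatini terms are multiplied by a locally constant sign `a` and the dual
(Hojman-Mukku-Sayed) terms by a constant `b`: Palatini is `a = 1`, `b = 0`, Hojman-Mukku-Sayed is
`a = 1`, `b = 1 / γ`, and the Holst action evaluated on `(e, ω)` is, pointwise and including the
boundary terms, the case where `a` is the sign of `det e` and `b = 1 / γ`, evaluated on the metric of
`e` and on the tensor `Q` of `ω` (`TetradAt.bulkHolst_eq`, `TetradAt.bdryHolst_eq`).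

Expanding the curvature of `∇ + Q` gives (`bulkGen_eq`, `bdryGen_eq`)

  `bulkGen = a bulkEH + ∂_μ W^μ + A(Q, Q)`,  `bdryGen = a bdryGHY - W^0`,

with a vector density `W` linear in `Q` and a quadratic form `A` that contains no derivatives of `Q`.
By the divergence theorem the terms in `W` cancel in the first variation
(`IsFamily.firstVariation_gen`), so that only the Einstein-Hilbert action and `∫ A(Q, Q)` remain.

The symmetric bilinear form obtained by polarising `A` has, at each point and for every `b`, the
kernel `{δ^α_σ U_β}`: in an orthonormal frame its equations decouple into small linear systems
(`polarForm_kernel`, `genPolar_kernel`). Stationarity under variations of `Q` therefore means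
`Q = δ^α_σ U_β`. As `A(Q, Q)` depends only on the class of `Q` modulo this kernel, for such `Q` it
is stationary under all variations of the metric as well, and what remains is stationarity for the
Einstein-Hilbert action; the value of `b` has disappeared.

In tetrad variables every variation of `Q` is induced by a variation of `ω̃`, so the same argument
applies. For the Holst action only variations with values in the Lorentz algebra are available.
The polarised form does not couple these to the self-adjoint ones, and the Levi-Civita spin connection
takes values in the Lorentz algebra, so the conclusion is `Q = 0`
(`eq_zero_of_polarForm_lorentz`). The weight `a` is removed by absorbing it into the variation of the
tetrad, because all Lagrangians are local (`firstVariation_weight`). Finally, for `ω̃ = ω̂ + S` the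
condition `Q = δ^α_σ U_β` splits into `ω̂` being the Levi-Civita spin connection and
`S_{IJ} = η_{IJ} U` (`TetradAt.tetradQ_add_eq_deltaArr_iff`).
-/

namespace HMS

open Set Filter Topology

/-! ### Smooth families of functions on the half-space -/

theorem halfSpace_eq_range : halfSpace = range (𝓡∂ 4) :=
  (range_modelWithCornersEuclideanHalfSpace 4).symm

theorem uniqueDiffOn_halfSpace : UniqueDiffOn ℝ halfSpace := by
  rw [halfSpace_eq_range]; exact (𝓡∂ 4).uniqueDiffOn

theorem isClosed_halfSpace : IsClosed halfSpace := by
  rw [halfSpace_eq_range]; exact (𝓡∂ 4).isClosed_range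

section Matrix

variable {E : Type*} [NormedAddCommGroup E] [NormedSpace ℝ E] {s : Set E} {z : E} {n : ℕ}
  {m : ℕ∞ω} {A : E → Matrix (Fin n) (Fin n) ℝ}

theorem contDiffWithinAt_det (h : ∀ i j, ContDiffWithinAt ℝ m (fun y => A y i j) s z) :
    ContDiffWithinAt ℝ m (fun y => (A y).det) s z := by
  simp only [Matrix.det_apply']
  exact ContDiffWithinAt.sum fun σ _ =>
    contDiffWithinAt_const.mul (contDiffWithinAt_prod fun i _ => h _ _)

theorem contDiffWithinAt_matrix_inv (h : ∀ i j, ContDiffWithinAt ℝ m (fun y => A y i j) s z)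
    (h0 : (A z).det ≠ 0) (i j : Fin n) : ContDiffWithinAt ℝ m (fun y => (A y)⁻¹ i j) s z := by
  simp only [Matrix.inv_def, Matrix.smul_apply, Matrix.adjugate_apply, Ring.inverse_eq_inv',
    smul_eq_mul]
  refine ((contDiffWithinAt_det h).inv h0).mul (contDiffWithinAt_det fun k l => ?_)
  by_cases hk : k = j
  · subst hk
    simpa using contDiffWithinAt_const
  · simpa [Matrix.updateRow_ne hk] using h k l

end Matrix

/-- `F t y` is a smooth one-parameter family of functions near the parameter value `0` and the
point `x` of the half-space. -/
def SmoothFamilyAt (F : ℝ → E4 → ℝ) (x : E4) : Prop :=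
  ContDiffWithinAt ℝ ∞ (Function.uncurry F) (univ ×ˢ halfSpace) (0, x)

/-- The rate of change of a family at the parameter value `0`. -/
noncomputable def variation (F : ℝ → E4 → ℝ) (y : E4) : ℝ := deriv (fun t => F t y) 0

namespace SmoothFamilyAt

variable {F G : ℝ → E4 → ℝ} {x : E4}

theorem congr (hF : SmoothFamilyAt F x) (h : ∀ t y, G t y = F t y) : SmoothFamilyAt G x := by
  have : G = F := funext₂ h
  rwa [this]

theorem comp {E : Type*} [NormedAddCommGroup E] [NormedSpace ℝ E] (hF : SmoothFamilyAt F x)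
    {φ : E → ℝ × E4} (hφ : ContDiff ℝ ∞ φ) {s : Set E} (hs : ∀ z ∈ s, (φ z).2 ∈ halfSpace) {p : E}
    (hp : φ p = (0, x)) : ContDiffWithinAt ℝ ∞ (fun z => F (φ z).1 (φ z).2) s p := by
  unfold SmoothFamilyAt at hF
  rw [← hp] at hF
  exact hF.comp p hφ.contDiffWithinAt (fun z hz => ⟨trivial, hs z hz⟩)

theorem of_contDiffWithinAt {f : E4 → ℝ} (hf : ContDiffWithinAt ℝ ∞ f halfSpace x) :
    SmoothFamilyAt (fun _ => f) x :=
  ContDiffWithinAt.comp (0, x) hf contDiffWithinAt_snd (fun _ hz => hz.2)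

theorem const (c : ℝ) : SmoothFamilyAt (fun _ _ => c) x := contDiffWithinAt_const

theorem param : SmoothFamilyAt (fun t _ => t) x := contDiffWithinAt_fst

theorem add (hF : SmoothFamilyAt F x) (hG : SmoothFamilyAt G x) :
    SmoothFamilyAt (fun t y => F t y + G t y) x := ContDiffWithinAt.add hF hG

theorem sub (hF : SmoothFamilyAt F x) (hG : SmoothFamilyAt G x) :
    SmoothFamilyAt (fun t y => F t y - G t y) x := ContDiffWithinAt.sub hF hG

theorem neg (hF : SmoothFamilyAt F x) : SmoothFamilyAt (fun t y => -F t y) x :=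
  ContDiffWithinAt.neg hF

theorem mul (hF : SmoothFamilyAt F x) (hG : SmoothFamilyAt G x) :
    SmoothFamilyAt (fun t y => F t y * G t y) x := ContDiffWithinAt.mul hF hG

theorem inv (hF : SmoothFamilyAt F x) (h : F 0 x ≠ 0) : SmoothFamilyAt (fun t y => (F t y)⁻¹) x :=
  ContDiffWithinAt.inv hF h

theorem div (hF : SmoothFamilyAt F x) (hG : SmoothFamilyAt G x) (h : G 0 x ≠ 0) :
    SmoothFamilyAt (fun t y => F t y / G t y) x :=
  (hF.mul (hG.inv h)).congr fun _ _ => div_eq_mul_inv _ _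

theorem sqrt (hF : SmoothFamilyAt F x) (h : F 0 x ≠ 0) :
    SmoothFamilyAt (fun t y => Real.sqrt (F t y)) x := ContDiffWithinAt.sqrt hF h

theorem abs (hF : SmoothFamilyAt F x) (h : F 0 x ≠ 0) : SmoothFamilyAt (fun t y => |F t y|) x :=
  (contDiffAt_abs h).comp_contDiffWithinAt (0, x) hF

theorem sum {ι : Type*} {s : Finset ι} {F : ι → ℝ → E4 → ℝ}
    (h : ∀ i ∈ s, SmoothFamilyAt (F i) x) : SmoothFamilyAt (fun t y => ∑ i ∈ s, F i t y) x :=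
  ContDiffWithinAt.sum h

theorem det {n : ℕ} {F : ℝ → E4 → Matrix (Fin n) (Fin n) ℝ}
    (h : ∀ i j, SmoothFamilyAt (fun t y => F t y i j) x) :
    SmoothFamilyAt (fun t y => (F t y).det) x :=
  contDiffWithinAt_det (A := fun z : ℝ × E4 => F z.1 z.2) h

theorem matrix_inv {n : ℕ} {F : ℝ → E4 → Matrix (Fin n) (Fin n) ℝ}
    (h : ∀ i j, SmoothFamilyAt (fun t y => F t y i j) x) (h0 : (F 0 x).det ≠ 0) (i j : Fin n) :
    SmoothFamilyAt (fun t y => (F t y)⁻¹ i j) x :=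
  contDiffWithinAt_matrix_inv (A := fun z : ℝ × E4 => F z.1 z.2) h h0 i j

theorem pd (hx : x ∈ halfSpace) (hF : SmoothFamilyAt F x) (μ : Fin 4) :
    SmoothFamilyAt (fun t y => HMS.pd μ (F t) y) x := by
  have : ContDiffWithinAt ℝ ∞ (Function.uncurry (fun (z : ℝ × E4) (y : E4) => F z.1 y))
      ((univ ×ˢ halfSpace) ×ˢ halfSpace) ((0, x), x) :=
    hF.comp (φ := fun z : (ℝ × E4) × E4 => (z.1.1, z.2))
      ((contDiff_fst.comp contDiff_fst).prodMk contDiff_snd) (fun z hz => hz.2) rfl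
  exact ContDiffWithinAt.fderivWithin_apply (k := fun _ => EuclideanSpace.single μ 1) this
    contDiffWithinAt_snd contDiffWithinAt_const uniqueDiffOn_halfSpace le_rfl ⟨trivial, hx⟩
    (fun z hz => hz.2)

theorem slice (hF : SmoothFamilyAt F x) : ContDiffWithinAt ℝ ∞ (F 0) halfSpace x :=
  hF.comp ((contDiff_const (c := (0 : ℝ))).prodMk contDiff_id) (fun _ hy => hy) rfl

theorem contDiffAt_param (hx : x ∈ halfSpace) (hF : SmoothFamilyAt F x) :
    ContDiffAt ℝ ∞ (fun t => F t x) 0 := by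
  rw [← contDiffWithinAt_univ]
  exact hF.comp (contDiff_id.prodMk (contDiff_const (c := x))) (fun _ _ => hx) rfl

theorem differentiableAt_param (hx : x ∈ halfSpace) (hF : SmoothFamilyAt F x) :
    DifferentiableAt ℝ (fun t => F t x) 0 :=
  (hF.contDiffAt_param hx).differentiableAt (by simp)

theorem eventually_ne (hx : x ∈ halfSpace) (hF : SmoothFamilyAt F x) (h : F 0 x ≠ 0) :
    ∀ᶠ t in 𝓝 (0 : ℝ), F t x ≠ 0 :=
  (hF.contDiffAt_param hx).continuousAt.eventually_ne h

theorem eventually_contDiffWithinAt (hx : x ∈ halfSpace) (hF : SmoothFamilyAt F x) :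
    ∀ᶠ t in 𝓝 (0 : ℝ), ContDiffWithinAt ℝ 2 (F t) halfSpace x := by
  have h2 : ContDiffWithinAt ℝ 2 (Function.uncurry F) (univ ×ˢ halfSpace) (0, x) :=
    contDiffWithinAt_infty.1 hF 2
  have h3 := h2.eventually (by simp)
  have hmem : ((0 : ℝ), x) ∈ (univ ×ˢ halfSpace : Set (ℝ × E4)) := ⟨trivial, hx⟩
  rw [insert_eq_of_mem hmem] at h3
  have hc : Tendsto (fun t : ℝ => (t, x)) (𝓝 0) (𝓝[univ ×ˢ halfSpace] ((0 : ℝ), x)) :=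
    tendsto_nhdsWithin_iff.2 ⟨by
      have : Continuous fun t : ℝ => (t, x) := by fun_prop
      exact this.tendsto 0, Eventually.of_forall fun t => ⟨trivial, hx⟩⟩
  filter_upwards [hc.eventually h3] with t ht
  exact ContDiffWithinAt.comp (t := univ ×ˢ halfSpace) x ht
    ((contDiff_const (c := t)).prodMk contDiff_id).contDiffWithinAt (fun y hy => ⟨trivial, hy⟩)

theorem variation (hx : x ∈ halfSpace) (hF : SmoothFamilyAt F x) :
    ContDiffWithinAt ℝ ∞ (HMS.variation F) halfSpace x := by
  have : ContDiffWithinAt ℝ ∞ (Function.uncurry (fun (y : E4) (t : ℝ) => F t y))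
      (halfSpace ×ˢ univ) (x, 0) :=
    hF.comp (φ := fun z : E4 × ℝ => (z.2, z.1)) (contDiff_snd.prodMk contDiff_fst)
      (fun z hz => hz.1) rfl
  have h2 := ContDiffWithinAt.fderivWithin_apply (k := fun _ => (1 : ℝ)) (m := ∞)
    (g := fun _ => (0 : ℝ)) this
    contDiffWithinAt_const contDiffWithinAt_const uniqueDiffOn_univ le_rfl hx
    (fun z hz => trivial)
  simp only [fderivWithin_univ, fderiv_apply_one_eq_deriv] at h2
  exact h2

end SmoothFamilyAt

theorem interior_halfSpace_eq : interior halfSpace = {x : E4 | 0 < x 0} := by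
  rw [halfSpace_eq_range, interior_range_modelWithCornersEuclideanHalfSpace]

theorem halfSpace_subset_closure_interior : halfSpace ⊆ closure (interior halfSpace) := by
  rw [halfSpace_eq_range]; exact (𝓡∂ 4).range_subset_closure_interior

/-- Differentiation in the parameter commutes with the (one-sided) partial derivatives, because the
second derivative on a set contained in the closure of its interior is symmetric. -/
theorem SmoothFamilyAt.variation_pd {F : ℝ → E4 → ℝ} {x : E4} (hx : x ∈ halfSpace)
    (hF : SmoothFamilyAt F x) (μ : Fin 4) :
    HMS.variation (fun t => HMS.pd μ (F t)) x = HMS.pd μ (HMS.variation F) x := by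
  set S : Set (ℝ × E4) := univ ×ˢ halfSpace with hS
  set f := Function.uncurry F with hf
  have hmem : ∀ t : ℝ, ∀ y ∈ halfSpace, (t, y) ∈ S := fun t y hy => ⟨trivial, hy⟩
  have hU : UniqueDiffOn ℝ S := uniqueDiffOn_univ.prod uniqueDiffOn_halfSpace
  have h2 : ContDiffWithinAt ℝ 2 f S (0, x) :=
    contDiffWithinAt_infty.1 hF 2
  have hsymm : IsSymmSndFDerivWithinAt ℝ f S (0, x) := by
    refine h2.isSymmSndFDerivWithinAt (by simp) hU ?_ (hmem _ _ hx)
    rw [hS, interior_prod_eq, closure_prod_eq]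
    exact ⟨by simp, halfSpace_subset_closure_interior hx⟩
  have hev : ∀ᶠ z in 𝓝[S] ((0 : ℝ), x), DifferentiableWithinAt ℝ f S z := by
    have := h2.eventually (by simp)
    rw [insert_eq_of_mem (hmem _ _ hx)] at this
    exact this.mono fun z hz => hz.differentiableWithinAt (by simp)
  have hD : DifferentiableWithinAt ℝ (fderivWithin ℝ f S) S (0, x) :=
    (h2.fderivWithin_right (m := 1) hU (by norm_num) (hmem _ _ hx)).differentiableWithinAt
      (by simp)
  have ht : Tendsto (fun t : ℝ => (t, x)) (𝓝 0) (𝓝[S] ((0 : ℝ), x)) :=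
    tendsto_nhdsWithin_iff.2 ⟨by
      have : Continuous fun t : ℝ => (t, x) := by fun_prop
      exact this.tendsto 0, Eventually.of_forall fun t => hmem _ _ hx⟩
  have hy : Tendsto (fun y : E4 => ((0 : ℝ), y)) (𝓝[halfSpace] x) (𝓝[S] ((0 : ℝ), x)) :=
    tendsto_nhdsWithin_iff.2 ⟨by
      have : Continuous fun y : E4 => ((0 : ℝ), y) := by fun_prop
      exact (this.tendsto x).mono_left nhdsWithin_le_nhds,
      eventually_mem_nhdsWithin.mono fun y hy => hmem _ _ hy⟩
  have hpd : ∀ z ∈ S, DifferentiableWithinAt ℝ f S z →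
      HMS.pd μ (F z.1) z.2 = fderivWithin ℝ f S z (0, EuclideanSpace.single μ 1) := by
    rintro ⟨t, y⟩ hz hd
    have h1 : HasFDerivWithinAt (fun y : E4 => (t, y)) (ContinuousLinearMap.inr ℝ ℝ E4)
        halfSpace y := (hasFDerivAt_prodMk_right t y).hasFDerivWithinAt
    have h3 : HasFDerivWithinAt (F t) ((fderivWithin ℝ f S (t, y)).comp
        (ContinuousLinearMap.inr ℝ ℝ E4)) halfSpace y :=
      HasFDerivWithinAt.comp (g := f) (t := S) y hd.hasFDerivWithinAt h1
        (fun y hy => hmem _ _ hy)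
    simp only [HMS.pd]
    rw [h3.fderivWithin (uniqueDiffOn_halfSpace y hz.2)]
    simp
  have hvar : ∀ y ∈ halfSpace, DifferentiableWithinAt ℝ f S (0, y) →
      HMS.variation F y = fderivWithin ℝ f S (0, y) (1, 0) := by
    intro y hy' hd
    have h1 : HasFDerivWithinAt (fun t : ℝ => (t, y)) (ContinuousLinearMap.inl ℝ ℝ E4)
        univ 0 := (hasFDerivAt_prodMk_left 0 y).hasFDerivWithinAt
    have h3 := HasFDerivWithinAt.comp (g := f) (t := S) (0 : ℝ) hd.hasFDerivWithinAt h1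
        (fun t _ => hmem _ _ hy')
    have h4 := h3.hasDerivWithinAt.hasDerivAt univ_mem
    simp only [HMS.variation]
    have h5 : (fun t => F t y) = f ∘ fun t : ℝ => (t, y) := rfl
    rw [h5, h4.deriv]
    simp
  have e1 : HMS.variation (fun t => HMS.pd μ (F t)) x =
      fderivWithin ℝ (fderivWithin ℝ f S) S (0, x) (1, 0) (0, EuclideanSpace.single μ 1) := by
    have h1 : HasFDerivWithinAt (fun t : ℝ => (t, x)) (ContinuousLinearMap.inl ℝ ℝ E4)
        univ 0 := (hasFDerivAt_prodMk_left 0 x).hasFDerivWithinAt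
    have h3 := HasFDerivWithinAt.comp (g := fderivWithin ℝ f S) (t := S) (0 : ℝ)
      hD.hasFDerivWithinAt h1 (fun t _ => hmem _ _ hx)
    have h4 := h3.hasDerivWithinAt.hasDerivAt univ_mem
    have h6 := h4.clm_apply (hasDerivAt_const (0 : ℝ) ((0, EuclideanSpace.single μ 1) : ℝ × E4))
    have h5 : (fun t => HMS.pd μ (F t) x) =ᶠ[𝓝 0]
        fun t => fderivWithin ℝ f S (t, x) (0, EuclideanSpace.single μ 1) := by
      filter_upwards [ht.eventually hev] with t h
      exact hpd (t, x) (hmem _ _ hx) h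
    simp only [HMS.variation]
    rw [h5.deriv_eq]
    refine h6.deriv.trans ?_
    simp
  have e2 : HMS.pd μ (HMS.variation F) x =
      fderivWithin ℝ (fderivWithin ℝ f S) S (0, x) (0, EuclideanSpace.single μ 1) (1, 0) := by
    have h1 : HasFDerivWithinAt (fun y : E4 => ((0 : ℝ), y)) (ContinuousLinearMap.inr ℝ ℝ E4)
        halfSpace x := (hasFDerivAt_prodMk_right (0 : ℝ) x).hasFDerivWithinAt
    have h3 := HasFDerivWithinAt.comp (g := fderivWithin ℝ f S) (t := S) x
      hD.hasFDerivWithinAt h1 (fun y hy => hmem _ _ hy)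
    have h6 := h3.clm_apply (hasFDerivWithinAt_const ((1, 0) : ℝ × E4) x halfSpace)
    have h5 : HMS.variation F =ᶠ[𝓝[halfSpace] x]
        fun y => fderivWithin ℝ f S (0, y) (1, 0) := by
      filter_upwards [hy.eventually hev, self_mem_nhdsWithin] with y h hy'
      exact hvar y hy' h
    simp only [HMS.pd]
    rw [h5.fderivWithin_eq_of_mem hx]
    refine (DFunLike.congr_fun (HasFDerivWithinAt.fderivWithin h6 (uniqueDiffOn_halfSpace x hx))
      _).trans ?_
    simp
  rw [e1, e2]
  exact hsymm _ _

/-! ### Integration over coordinate domains -/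

/-- Coordinate domains: relatively open subsets of the half-space. -/
def IsPatch (T : Set E4) : Prop := ∃ O : Set E4, IsOpen O ∧ T = O ∩ halfSpace

theorem measurableSet_halfSpace : MeasurableSet halfSpace := isClosed_halfSpace.measurableSet

theorem pd_congr {f h : E4 → ℝ} {x : E4} (hx : x ∈ halfSpace) (hfh : f =ᶠ[𝓝[halfSpace] x] h)
    (μ : Fin 4) : pd μ f x = pd μ h x := by
  unfold pd
  rw [hfh.fderivWithin_eq_of_mem hx]

theorem pd_const (c : ℝ) (x : E4) (μ : Fin 4) : pd μ (fun _ => c) x = 0 := by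
  simp [pd]

/-- The partial derivatives of a function vanishing off a closed set vanish there as well; off the
half-space they vanish by convention. -/
theorem pd_eq_zero_of_notMem {f : E4 → ℝ} {K : Set E4} (hK : IsClosed K)
    (hf : ∀ x, x ∉ K → f x = 0) {x : E4} (hx : x ∉ K) (μ : Fin 4) : pd μ f x = 0 := by
  by_cases hxH : x ∈ halfSpace
  · rw [pd_congr hxH (h := fun _ => 0) ?_ μ, pd_const]
    exact nhdsWithin_le_nhds ((hK.isOpen_compl.eventually_mem hx).mono fun y hy => hf y hy)
  · unfold pd
    rw [fderivWithin_zero_of_notMem_closure (by rwa [isClosed_halfSpace.closure_eq])]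
    rfl

namespace IsPatch

variable {T : Set E4} (hT : IsPatch T)

include hT

theorem subset : T ⊆ halfSpace := by
  obtain ⟨O, -, rfl⟩ := hT
  exact inter_subset_right

theorem measurableSet : MeasurableSet T := by
  obtain ⟨O, hO, rfl⟩ := hT
  exact hO.measurableSet.inter measurableSet_halfSpace

theorem mem_nhdsWithin {x : E4} (hx : x ∈ T) : T ∈ 𝓝[halfSpace] x := by
  obtain ⟨O, hO, rfl⟩ := hT
  exact inter_mem (nhdsWithin_le_nhds (hO.mem_nhds hx.1)) self_mem_nhdsWithin

theorem contDiffWithinAt {f : E4 → ℝ} {n : ℕ∞ω} (hf : ContDiffOn ℝ n f T) {x : E4} (hx : x ∈ T) :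
    ContDiffWithinAt ℝ n f halfSpace x :=
  (hf x hx).mono_of_mem_nhdsWithin (hT.mem_nhdsWithin hx)

theorem contDiffOn {f : E4 → ℝ} {n : ℕ∞ω} (hf : ∀ x ∈ T, ContDiffWithinAt ℝ n f halfSpace x) :
    ContDiffOn ℝ n f T := fun x hx => (hf x hx).mono hT.subset

theorem continuousOn {f : E4 → ℝ} (hf : ∀ x ∈ T, ContDiffWithinAt ℝ ∞ f halfSpace x) :
    ContinuousOn f T := fun x hx => (hf x hx).continuousWithinAt.mono hT.subset

theorem subset_closure_interior : T ⊆ closure (interior T) := by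
  obtain ⟨O, hO, rfl⟩ := hT
  rintro x ⟨hxO, hxH⟩
  rw [interior_inter, hO.interior_eq]
  exact hO.inter_closure ⟨hxO, halfSpace_subset_closure_interior hxH⟩

end IsPatch

theorem continuous_bdryPt : Continuous bdryPt := by
  unfold bdryPt
  refine (PiLp.continuous_toLp 2 _).comp (continuous_pi fun i => ?_)
  refine Fin.cases ?_ (fun j => ?_) i
  · simpa using continuous_const
  · simp only [Fin.cons_succ]
    fun_prop

theorem bdryPt_zero (y : E3) : bdryPt y 0 = 0 := rfl

theorem bdryPt_mem_halfSpace (y : E3) : bdryPt y ∈ halfSpace := (bdryPt_zero y).ge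

theorem isCompact_preimage_bdryPt {K : Set E4} (hK : IsCompact K) : IsCompact (bdryPt ⁻¹' K) := by
  refine Metric.isCompact_of_isClosed_isBounded (hK.isClosed.preimage continuous_bdryPt) ?_
  obtain ⟨R, hR⟩ := hK.isBounded.exists_norm_le
  refine isBounded_iff_forall_norm_le.2 ⟨R, fun y hy => le_trans (le_of_eq ?_) (hR _ hy)⟩
  rw [EuclideanSpace.norm_eq, EuclideanSpace.norm_eq, Fin.sum_univ_succ (n := 3)]
  have h : ∀ i : Fin 3, (bdryPt y).ofLp i.succ = y i := fun i => rfl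
  simp only [h, bdryPt_zero, norm_zero]
  ring_nf

theorem integrableOn_of_eq_zero_off {X : Type*} [TopologicalSpace X] [T2Space X] [MeasurableSpace X]
    [OpensMeasurableSpace X] {μ : Measure X} [IsFiniteMeasureOnCompacts μ]
    {T K : Set X} (hT : MeasurableSet T)
    (hK : IsCompact K) (hKT : K ⊆ T) {f : X → ℝ} (hf : ContinuousOn f T) (h0 : ∀ x ∈ T, x ∉ K → f x = 0) :
    IntegrableOn f T μ :=
  ((hf.mono hKT).integrableOn_compact hK).of_forall_sdiff_eq_zero hT fun x hx => h0 x hx.1 hx.2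

theorem measurableSet_preimage_bdryPt {T : Set E4} (hT : IsPatch T) :
    MeasurableSet {y : E3 | bdryPt y ∈ T} := hT.measurableSet.preimage continuous_bdryPt.measurable

theorem integrableOn_bdry {T K : Set E4} (hT : IsPatch T) (hK : IsCompact K) (hKT : K ⊆ T)
    {f : E4 → ℝ} (hf : ∀ y : E3, bdryPt y ∈ T → ContDiffWithinAt ℝ ∞ f halfSpace (bdryPt y))
    (h0 : ∀ x, x ∉ K → f x = 0) :
    IntegrableOn (fun y => f (bdryPt y)) {y : E3 | bdryPt y ∈ T} := by
  refine integrableOn_of_eq_zero_off (measurableSet_preimage_bdryPt hT)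
    (isCompact_preimage_bdryPt hK) (fun y hy => hKT hy) (fun y hy => ?_) (fun y _ hy => h0 _ hy)
  have h1 : Tendsto bdryPt (𝓝[{y : E3 | bdryPt y ∈ T}] y) (𝓝[halfSpace] (bdryPt y)) :=
    tendsto_nhdsWithin_iff.2 ⟨continuous_bdryPt.continuousAt.mono_left nhdsWithin_le_nhds,
      Eventually.of_forall bdryPt_mem_halfSpace⟩
  exact (hf y hy).continuousWithinAt.tendsto.comp h1

/-- The divergence theorem on the half-space for one component of a compactly supported vector
field: the only contribution of the boundary comes from the normal component. -/
theorem setIntegral_pd {T K : Set E4} (hT : IsPatch T) (hK : IsCompact K) (hKT : K ⊆ T)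
    {W : E4 → ℝ} (hW : ∀ x ∈ T, ContDiffWithinAt ℝ ∞ W halfSpace x)
    (h0 : ∀ x, x ∉ K → W x = 0) (μ : Fin 4) :
    ∫ x in T, pd μ W x = if μ = 0 then -∫ y in {y : E3 | bdryPt y ∈ T}, W (bdryPt y) else 0 := by
  have hpd0 : ∀ x, x ∉ K → pd μ W x = 0 := fun x hx => pd_eq_zero_of_notMem hK.isClosed h0 hx μ
  have hWH : ContDiffOn ℝ 1 W halfSpace := by
    intro x hx
    by_cases hxK : x ∈ K
    · exact contDiffWithinAt_infty.1 (hW x (hKT hxK)) 1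
    · refine (contDiffWithinAt_const (c := (0 : ℝ))).congr_of_eventuallyEq ?_ (h0 x hxK)
      exact nhdsWithin_le_nhds ((hK.isClosed.isOpen_compl.eventually_mem hxK).mono
        fun y hy => h0 y hy)
  have hfd : ContinuousOn (fderivWithin ℝ W halfSpace) halfSpace :=
    hWH.continuousOn_fderivWithin uniqueDiffOn_halfSpace le_rfl
  obtain ⟨R, hR0, hR⟩ : ∃ R > 0, ∀ x ∈ K, ∀ i, |x i| < R := by
    obtain ⟨R, hR⟩ := hK.isBounded.exists_norm_le
    refine ⟨|R| + 1, by positivity, fun x hx i => ?_⟩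
    have h1 := PiLp.norm_apply_le x i
    rw [Real.norm_eq_abs] at h1
    have h2 := hR x hx
    have h3 := le_abs_self R
    linarith
  let eL : (Fin 4 → ℝ) ≃L[ℝ] E4 := (EuclideanSpace.equiv (Fin 4) ℝ).symm
  have heL : ∀ z, eL z = WithLp.toLp 2 z := fun z => rfl
  let a : Fin 4 → ℝ := fun i => if i = 0 then 0 else -R
  let b : Fin 4 → ℝ := fun _ => R
  have hle : a ≤ b := by
    intro i
    by_cases hi : i = 0
    · simp [a, b, hi, hR0.le]
    · simp only [a, b, hi, if_false]; linarith
  have hnot : ∀ z : Fin 4 → ℝ, (∃ i, R ≤ |z i|) → eL z ∉ K := by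
    rintro z ⟨i, hi⟩ hz
    exact absurd (hR _ hz i) (not_lt.2 hi)
  have hIccH : ∀ z ∈ Icc a b, eL z ∈ halfSpace := by
    intro z hz
    have h1 : (0 : ℝ) ≤ z 0 := by simpa [a] using hz.1 0
    exact h1
  let f : Fin 4 → (Fin 4 → ℝ) → ℝ := fun i z => if i = μ then W (eL z) else 0
  let f' : Fin 4 → (Fin 4 → ℝ) → (Fin 4 → ℝ) →L[ℝ] ℝ := fun i z =>
    if i = μ then (fderivWithin ℝ W halfSpace (eL z)).comp (eL : (Fin 4 → ℝ) →L[ℝ] E4) else 0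
  have hsum : ∀ z, ∑ i, f' i z (Pi.single i 1) = pd μ W (eL z) := by
    intro z
    rw [Finset.sum_eq_single μ (fun i _ hi => by simp [f', hi]) (by simp)]
    simp only [f', if_true]
    rfl
  have hdiv := integral_divergence_of_hasFDerivAt_off_countable' a b hle f f' ∅ countable_empty
    (fun i => by
      by_cases hi : i = μ
      · simp only [f, hi, if_true]
        exact hWH.continuousOn.comp eL.continuous.continuousOn (fun z hz => hIccH z hz)
      · simp only [f, hi, if_false]; exact continuousOn_const)
    (fun z hz i => by
      by_cases hi : i = μ
      · simp only [f, f', hi, if_true]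
        have hz0 : 0 < eL z 0 := by
          have h1 : (0 : ℝ) < z 0 := by simpa [a] using (hz.1 0 trivial).1
          exact h1
        have hnh : halfSpace ∈ 𝓝 (eL z) := by
          rw [mem_nhds_iff]
          exact ⟨interior halfSpace, interior_subset, isOpen_interior, by
            rw [interior_halfSpace_eq]; exact hz0⟩
        have h1 : HasFDerivAt W (fderivWithin ℝ W halfSpace (eL z)) (eL z) :=
          (((hWH _ (mem_of_mem_nhds hnh)).differentiableWithinAt
            (by simp)).hasFDerivWithinAt).hasFDerivAt hnh
        exact h1.comp z eL.hasFDerivAt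
      · simp only [f, f', hi, if_false]; exact hasFDerivAt_const _ _)
    (by
      simp only [hsum]
      refine ContinuousOn.integrableOn_compact isCompact_Icc ?_
      exact (hfd.comp eL.continuous.continuousOn (fun z hz => hIccH z hz)).clm_apply
        continuousOn_const)
  have hL : ∫ x in T, pd μ W x = ∫ z in Icc a b, pd μ W (eL z) := by
    rw [setIntegral_eq_integral_of_forall_compl_eq_zero (fun x hx => hpd0 x fun h => hx (hKT h)),
      setIntegral_eq_integral_of_forall_compl_eq_zero, ← (PiLp.volume_preserving_toLp
        (Fin 4)).integral_comp (MeasurableEquiv.toLp 2 (Fin 4 → ℝ)).measurableEmbedding]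
    · rfl
    · intro z hz
      by_cases hzK : eL z ∈ K
      · refine absurd ?_ hz
        have h1 := hR _ hzK
        have h2 : 0 ≤ z 0 := hT.subset (hKT hzK)
        refine ⟨fun i => ?_, fun i => ((abs_lt.1 (h1 i)).2).le⟩
        by_cases hi : i = 0
        · subst hi; simpa [a] using h2
        · simp only [a, hi, if_false]; exact ((abs_lt.1 (h1 i)).1).le
      · exact hpd0 _ hzK
  rw [hL]
  simp only [hsum] at hdiv
  rw [hdiv]
  rw [Finset.sum_eq_single μ (fun i _ hi => by simp [f, hi]) (by simp)]
  simp only [f, if_true]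
  have hfront : ∀ w : Fin 3 → ℝ, W (eL (Fin.insertNth μ (b μ) w)) = 0 := by
    intro w
    refine h0 _ (hnot _ ⟨μ, ?_⟩)
    simp only [Fin.insertNth_apply_same, b]
    exact le_abs_self R
  simp only [hfront, integral_zero, zero_sub]
  by_cases hμ : μ = 0
  · subst hμ
    simp only [if_true, neg_inj]
    rw [setIntegral_eq_integral_of_forall_compl_eq_zero
        (s := {y : E3 | bdryPt y ∈ T}) (fun x hx => h0 _ fun h => hx (hKT h)),
      setIntegral_eq_integral_of_forall_compl_eq_zero, ← (PiLp.volume_preserving_toLp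
        (Fin 3)).integral_comp (MeasurableEquiv.toLp 2 (Fin 3 → ℝ)).measurableEmbedding]
    · congr 1
      ext w
      congr 1
      change WithLp.toLp 2 (Fin.insertNth (α := fun _ => ℝ) (0 : Fin 4) (a 0) w) = _
      rw [Fin.insertNth_zero']
      rfl
    · intro w hw
      refine h0 _ fun hK' => hw ?_
      refine ⟨fun i => ?_, fun i => ?_⟩
      · have := (abs_lt.1 (hR _ hK' ((0 : Fin 4).succAbove i))).1
        simp only [heL, Fin.insertNth_apply_succAbove] at this
        simp only [Function.comp, a, Fin.succAbove_ne, if_false]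
        exact this.le
      · have := (abs_lt.1 (hR _ hK' ((0 : Fin 4).succAbove i))).2
        simp only [heL, Fin.insertNth_apply_succAbove] at this
        exact this.le
  · have hback : ∀ w : Fin 3 → ℝ, W (eL (Fin.insertNth μ (a μ) w)) = 0 := by
      intro w
      refine h0 _ (hnot _ ⟨μ, ?_⟩)
      simp only [Fin.insertNth_apply_same, a, hμ, if_false, abs_neg]
      exact le_abs_self R
    simp [hback, hμ]

/-- The fundamental lemma of the calculus of variations on a coordinate domain. -/
theorem eq_zero_of_forall_integral_variation {T : Set E4} (hT : IsPatch T) {c : E4 → ℝ}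
    (hc : ContinuousOn c T) (h : ∀ χ : E4 → ℝ, IsVariation T χ → ∫ x in T, χ x * c x = 0) :
    ∀ x ∈ T, c x = 0 := by
  have hae : ∀ᵐ x, x ∈ interior T → c x = 0 := by
    refine isOpen_interior.ae_eq_zero_of_integral_contDiff_smul_eq_zero
      ((hc.mono interior_subset).locallyIntegrableOn isOpen_interior.measurableSet) fun χ hχ hcs hsupp => ?_
    have h1 := h χ ⟨hχ.contDiffOn, tsupport χ, hcs, hsupp.trans interior_subset,
      fun x hx => image_eq_zero_of_notMem_tsupport hx⟩
    rw [setIntegral_eq_integral_of_forall_compl_eq_zero] at h1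
    · simpa using h1
    · intro x hx
      rw [image_eq_zero_of_notMem_tsupport fun h => hx (interior_subset (hsupp h)), zero_mul]
  have hint : EqOn c 0 (interior T) := by
    have h1 : ∀ᵐ x ∂(volume.restrict (interior T)), c x = 0 :=
      (ae_restrict_iff' isOpen_interior.measurableSet).2 hae
    exact Measure.eqOn_open_of_ae_eq h1 isOpen_interior (hc.mono interior_subset) continuousOn_const
  intro x hx
  exact hint.of_subset_closure hc continuousOn_const interior_subset hT.subset_closure_interior hx

/-! ### The Levi-Civita symbol -/

/-- The Levi-Civita symbol as an integer, in a form that the kernel evaluates quickly. -/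
def epsInt (i j k l : Fin 4) : ℤ :=
  let s : Fin 4 → Fin 4 → ℤ := fun a b => if a < b then 1 else if b < a then -1 else 0
  s i j * s i k * s i l * s j k * s j l * s k l

/-- The determinant formula for the Levi-Civita symbol, expanded along the first two rows. -/
def epsDet (i j k l : Fin 4) : ℤ :=
  let d : Fin 4 → Fin 4 → ℤ := fun a b => if a = b then 1 else 0
  let m : Fin 4 → Fin 4 → ℤ := fun a b => d k a * d l b - d k b * d l a
  d i 0 * (d j 1 * m 2 3 - d j 2 * m 1 3 + d j 3 * m 1 2)
    - d i 1 * (d j 0 * m 2 3 - d j 2 * m 0 3 + d j 3 * m 0 2)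
    + d i 2 * (d j 0 * m 1 3 - d j 1 * m 0 3 + d j 3 * m 0 1)
    - d i 3 * (d j 0 * m 1 2 - d j 1 * m 0 2 + d j 2 * m 0 1)

theorem epsDet_eq : ∀ i j k l, epsDet i j k l = epsInt i j k l := by decide +kernel

theorem eps_eq_epsInt (i j k l : Fin 4) : eps i j k l = (epsInt i j k l : ℝ) := by
  rw [← epsDet_eq]
  let d : Fin 4 → Fin 4 → ℤ := fun a b => if a = b then 1 else 0
  have h : eps i j k l = ((Matrix.det (Matrix.of fun a b : Fin 4 => d (![i, j, k, l] a) b) : ℤ)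
      : ℝ) := by
    rw [eps, ← eq_intCast (Int.castRingHom ℝ), RingHom.map_det]
    congr 1
    ext a b
    simp [d]
  rw [h, Int.cast_inj, Matrix.det_succ_row_zero]
  change _ = d i 0 * (d j 1 * (d k 2 * d l 3 - d k 3 * d l 2)
      - d j 2 * (d k 1 * d l 3 - d k 3 * d l 1) + d j 3 * (d k 1 * d l 2 - d k 2 * d l 1))
    - d i 1 * (d j 0 * (d k 2 * d l 3 - d k 3 * d l 2)
      - d j 2 * (d k 0 * d l 3 - d k 3 * d l 0) + d j 3 * (d k 0 * d l 2 - d k 2 * d l 0))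
    + d i 2 * (d j 0 * (d k 1 * d l 3 - d k 3 * d l 1)
      - d j 1 * (d k 0 * d l 3 - d k 3 * d l 0) + d j 3 * (d k 0 * d l 1 - d k 1 * d l 0))
    - d i 3 * (d j 0 * (d k 1 * d l 2 - d k 2 * d l 1)
      - d j 1 * (d k 0 * d l 2 - d k 2 * d l 0) + d j 2 * (d k 0 * d l 1 - d k 1 * d l 0))
  generalize d = d
  simp only [Matrix.det_fin_three, Fin.sum_univ_four, Matrix.submatrix_apply, Matrix.of_apply]
  simp [Fin.succAbove, Fin.succ, Fin.castSucc, Fin.lt_def]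
  ring

theorem eps_swap12 (i j k l : Fin 4) : eps j i k l = -eps i j k l := by
  have : ∀ i j k l, epsInt j i k l = -epsInt i j k l := by decide +kernel
  rw [eps_eq_epsInt, eps_eq_epsInt, this, Int.cast_neg]

theorem eps_swap23 (i j k l : Fin 4) : eps i k j l = -eps i j k l := by
  have : ∀ i j k l, epsInt i k j l = -epsInt i j k l := by decide +kernel
  rw [eps_eq_epsInt, eps_eq_epsInt, this, Int.cast_neg]

theorem eps_swap34 (i j k l : Fin 4) : eps i j l k = -eps i j k l := by
  have : ∀ i j k l, epsInt i j l k = -epsInt i j k l := by decide +kernel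
  rw [eps_eq_epsInt, eps_eq_epsInt, this, Int.cast_neg]

/-- Contraction of two Levi-Civita symbols over two indices. -/
theorem sum_eps_mul_eps (α β μ ν : Fin 4) : ∑ ρ, ∑ σ, eps α β ρ σ * eps μ ν ρ σ =
    2 * ((if α = μ then 1 else 0) * (if β = ν then 1 else 0)
      - (if α = ν then 1 else 0) * (if β = μ then 1 else 0)) := by
  have : ∀ α β μ ν, ∑ ρ, ∑ σ, epsInt α β ρ σ * epsInt μ ν ρ σ =
      2 * ((if α = μ then 1 else 0) * (if β = ν then 1 else 0)
        - (if α = ν then 1 else 0) * (if β = μ then 1 else 0)) := by decide +kernel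
  have h := congrArg (Int.cast : ℤ → ℝ) (this α β μ ν)
  simp only [eps_eq_epsInt]
  push_cast at h
  exact h

/-- The Leibniz formula in terms of the Levi-Civita symbol. -/
theorem sum_eps_mul_rows (N : Fin 4 → Fin 4 → ℝ) :
    ∑ I, ∑ J, ∑ K, ∑ L, eps I J K L * (N 0 I * N 1 J * N 2 K * N 3 L) = (Matrix.of N).det := by
  rw [Matrix.det_succ_row_zero]
  simp only [Matrix.det_fin_three, Fin.sum_univ_four, Matrix.submatrix_apply, Matrix.of_apply,
    eps_eq_epsInt]
  simp [Fin.succAbove, Fin.succ, Fin.castSucc, Fin.lt_def, epsInt]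
  ring

/-- The determinant as the factor by which a matrix scales the Levi-Civita symbol. -/
theorem sum_eps_mul_mul (e : Fin 4 → Fin 4 → ℝ) (μ ν ρ σ : Fin 4) :
    ∑ I, ∑ J, ∑ K, ∑ L, eps I J K L * (e I μ * e J ν * e K ρ * e L σ) =
      (Matrix.of e).det * eps μ ν ρ σ := by
  have h := sum_eps_mul_rows (fun a I => e I (![μ, ν, ρ, σ] a))
  simp only [Matrix.cons_val_zero, Matrix.cons_val_one, Matrix.cons_val] at h
  rw [h, eps, ← Matrix.det_transpose (Matrix.of e), mul_comm, ← Matrix.det_mul]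
  congr 1
  ext a b
  simp [Matrix.mul_apply]

/-! ### Partial derivatives and the Levi-Civita connection -/

/-- Differentiability within the half-space. -/
abbrev DiffAt (f : E4 → ℝ) (x : E4) : Prop := DifferentiableWithinAt ℝ f halfSpace x

section pd

variable {f h : E4 → ℝ} {x : E4} (hx : x ∈ halfSpace) (μ : Fin 4)

include hx

theorem pd_add (hf : DiffAt f x) (hh : DiffAt h x) :
    pd μ (fun y => f y + h y) x = pd μ f x + pd μ h x := by
  simp only [pd]
  rw [fderivWithin_fun_add (uniqueDiffOn_halfSpace x hx) hf hh]
  rfl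

theorem pd_neg : pd μ (fun y => -f y) x = -pd μ f x := by
  simp only [pd]
  rw [fderivWithin_fun_neg (uniqueDiffOn_halfSpace x hx)]
  rfl

theorem pd_mul (hf : DiffAt f x) (hh : DiffAt h x) :
    pd μ (fun y => f y * h y) x = pd μ f x * h x + f x * pd μ h x := by
  simp only [pd]
  rw [fderivWithin_fun_mul (uniqueDiffOn_halfSpace x hx) hf hh]
  simp
  ring

theorem pd_const_mul (c : ℝ) (hf : DiffAt f x) :
    pd μ (fun y => c * f y) x = c * pd μ f x := by
  rw [pd_mul hx μ (differentiableWithinAt_const c) hf, pd_const]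
  ring

theorem pd_sum {ι : Type*} {s : Finset ι} {F : ι → E4 → ℝ} (hF : ∀ i ∈ s, DiffAt (F i) x) :
    pd μ (fun y => ∑ i ∈ s, F i y) x = ∑ i ∈ s, pd μ (F i) x := by
  simp only [pd]
  rw [fderivWithin_fun_sum (uniqueDiffOn_halfSpace x hx) hF]
  simp

theorem contDiffWithinAt_pd {m n : ℕ∞ω} (hf : ContDiffWithinAt ℝ n f halfSpace x)
    (hmn : m + 1 ≤ n) : ContDiffWithinAt ℝ m (pd μ f) halfSpace x :=
  hf.fderivWithin_right_apply contDiffWithinAt_const uniqueDiffOn_halfSpace hmn hx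

/-- Second partial derivatives commute. -/
theorem pd_comm (hf : ContDiffWithinAt ℝ 2 f halfSpace x) (ν : Fin 4) :
    pd μ (pd ν f) x = pd ν (pd μ f) x := by
  have hs : IsSymmSndFDerivWithinAt ℝ f halfSpace x :=
    hf.isSymmSndFDerivWithinAt (by simp) uniqueDiffOn_halfSpace
      (halfSpace_subset_closure_interior hx) hx
  have hD : DifferentiableWithinAt ℝ (fderivWithin ℝ f halfSpace) halfSpace x :=
    (hf.fderivWithin_right (m := 1) uniqueDiffOn_halfSpace (by norm_num) hx).differentiableWithinAt
      (by simp)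
  have h : ∀ κ lam : Fin 4, pd κ (pd lam f) x =
      fderivWithin ℝ (fderivWithin ℝ f halfSpace) halfSpace x (EuclideanSpace.single κ 1)
        (EuclideanSpace.single lam 1) := by
    intro κ lam
    have h1 := hD.hasFDerivWithinAt.clm_apply
      (hasFDerivWithinAt_const (EuclideanSpace.single lam (1 : ℝ) : E4) x halfSpace)
    refine (DFunLike.congr_fun (HasFDerivWithinAt.fderivWithin h1 (uniqueDiffOn_halfSpace x hx))
      _).trans ?_
    simp
  rw [h, h]
  exact hs _ _

end pd

/-- A metric that is `C²` and nondegenerate at a point of the half-space. -/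
structure MetricAt (g : LMetric) (x : E4) : Prop where
  mem : x ∈ halfSpace
  symm : ∀ y α β, g y α β = g y β α
  det_ne : (Matrix.of (g x)).det ≠ 0
  contDiff : ∀ α β, ContDiffWithinAt ℝ 2 (fun y => g y α β) halfSpace x

namespace MetricAt

variable {g : LMetric} {x : E4} (hg : MetricAt g x)

include hg

theorem diffAt (α β : Fin 4) : DiffAt (fun y => g y α β) x :=
  (hg.contDiff α β).differentiableWithinAt (by simp)

theorem contDiff_gInv (α β : Fin 4) : ContDiffWithinAt ℝ 2 (fun y => gInv g y α β) halfSpace x :=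
  contDiffWithinAt_matrix_inv (A := fun y => Matrix.of (g y)) hg.contDiff hg.det_ne α β

theorem diffAt_gInv (α β : Fin 4) : DiffAt (fun y => gInv g y α β) x :=
  (hg.contDiff_gInv α β).differentiableWithinAt (by simp)

theorem contDiff_sqrtDet : ContDiffWithinAt ℝ 2 (sqrtDet g) halfSpace x := by
  have h1 := contDiffWithinAt_det (A := fun y => Matrix.of (g y)) hg.contDiff
  have h2 : ContDiffWithinAt ℝ 2 (fun y => |(Matrix.of (g y)).det|) halfSpace x :=
    ContDiffAt.comp_contDiffWithinAt (g := fun u : ℝ => |u|) x (contDiffAt_abs hg.det_ne) h1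
  exact h2.sqrt (abs_ne_zero.2 hg.det_ne)

theorem diffAt_sqrtDet : DiffAt (sqrtDet g) x :=
  hg.contDiff_sqrtDet.differentiableWithinAt (by simp)

theorem contDiff_christoffel (α β σ : Fin 4) :
    ContDiffWithinAt ℝ 1 (fun y => christoffel g y α β σ) halfSpace x := by
  unfold christoffel
  refine contDiffWithinAt_const.mul (ContDiffWithinAt.sum fun μ _ => ?_)
  refine ((hg.contDiff_gInv α μ).of_le (by norm_num)).mul ?_
  exact ((contDiffWithinAt_pd hg.mem _ (hg.contDiff _ _) (by norm_num)).add
    (contDiffWithinAt_pd hg.mem _ (hg.contDiff _ _) (by norm_num))).sub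
    (contDiffWithinAt_pd hg.mem _ (hg.contDiff _ _) (by norm_num))

theorem diffAt_christoffel (α β σ : Fin 4) : DiffAt (fun y => christoffel g y α β σ) x :=
  (hg.contDiff_christoffel α β σ).differentiableWithinAt (by simp)

omit hg in
theorem gInv_symm_of_symm (hs : ∀ y α β, g y α β = g y β α) (y : E4) (α β : Fin 4) :
    gInv g y α β = gInv g y β α := by
  have h : (Matrix.of (g y)).transpose = Matrix.of (g y) := by
    ext α β
    exact hs y β α
  unfold gInv
  conv_lhs => rw [← h, ← Matrix.transpose_nonsing_inv]
  rfl

theorem gInv_symm (y : E4) (α β : Fin 4) : gInv g y α β = gInv g y β α :=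
  gInv_symm_of_symm hg.symm y α β

omit hg in
theorem christoffel_symm_of_symm (hs : ∀ y α β, g y α β = g y β α) (y : E4) (α β σ : Fin 4) :
    christoffel g y α β σ = christoffel g y α σ β := by
  unfold christoffel
  congr 1
  refine Finset.sum_congr rfl fun μ _ => ?_
  have h1 : (fun y => g y β σ) = fun y => g y σ β := funext fun y => hs y β σ
  have h2 : (fun y => g y μ σ) = fun y => g y σ μ := funext fun y => hs y μ σ
  have h3 : (fun y => g y β μ) = fun y => g y μ β := funext fun y => hs y β μ
  rw [h1, h2, h3]
  ring

theorem christoffel_symm (y : E4) (α β σ : Fin 4) :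
    christoffel g y α β σ = christoffel g y α σ β := christoffel_symm_of_symm hg.symm y α β σ

theorem sum_g_mul_gInv (α β : Fin 4) :
    ∑ s, g x α s * gInv g x s β = if α = β then 1 else 0 := by
  have h := congrFun₂ (Matrix.mul_nonsing_inv (Matrix.of (g x)) (isUnit_iff_ne_zero.2 hg.det_ne)) α β
  rw [Matrix.mul_apply, Matrix.one_apply] at h
  exact h

theorem sum_gInv_mul_g (α β : Fin 4) :
    ∑ s, gInv g x α s * g x s β = if α = β then 1 else 0 := by
  have h := congrFun₂ (Matrix.nonsing_inv_mul (Matrix.of (g x)) (isUnit_iff_ne_zero.2 hg.det_ne)) α β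
  rw [Matrix.mul_apply, Matrix.one_apply] at h
  exact h

/-- Christoffel symbols of the first kind. -/
theorem sum_g_mul_christoffel (α β σ : Fin 4) : ∑ s, g x α s * christoffel g x s β σ =
    (1 / 2) * (pd β (fun y => g y α σ) x + pd σ (fun y => g y β α) x
      - pd α (fun y => g y β σ) x) := by
  have h : ∀ s, g x α s * christoffel g x s β σ = ∑ μ, (g x α s * gInv g x s μ) *
      ((1 / 2) * (pd β (fun y => g y μ σ) x + pd σ (fun y => g y β μ) x
        - pd μ (fun y => g y β σ) x)) := by
    intro s
    unfold christoffel
    rw [← mul_assoc, Finset.mul_sum]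
    exact Finset.sum_congr rfl fun μ _ => by ring
  simp only [h]
  rw [Finset.sum_comm]
  simp only [← Finset.sum_mul, hg.sum_g_mul_gInv, ite_mul, one_mul, zero_mul, Finset.sum_ite_eq,
    Finset.mem_univ, if_true]

/-- The Levi-Civita connection is compatible with the metric. -/
theorem pd_metric (μ α β : Fin 4) : pd μ (fun y => g y α β) x =
    ∑ s, (g x α s * christoffel g x s μ β + g x β s * christoffel g x s μ α) := by
  rw [Finset.sum_add_distrib, hg.sum_g_mul_christoffel, hg.sum_g_mul_christoffel]
  have h1 : (fun y => g y μ α) = fun y => g y α μ := funext fun y => hg.symm y μ α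
  have h2 : (fun y => g y μ β) = fun y => g y β μ := funext fun y => hg.symm y μ β
  have h3 : (fun y => g y β α) = fun y => g y α β := funext fun y => hg.symm y β α
  rw [h1, h2, h3]
  ring

theorem eventually_det_ne : ∀ᶠ y in 𝓝[halfSpace] x, (Matrix.of (g y)).det ≠ 0 :=
  (contDiffWithinAt_det (A := fun y => Matrix.of (g y)) hg.contDiff).continuousWithinAt.eventually_ne
    hg.det_ne

theorem pd_gInv (μ α β : Fin 4) : pd μ (fun y => gInv g y α β) x =
    -∑ s, (christoffel g x α μ s * gInv g x s β + christoffel g x β μ s * gInv g x s α) := by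
  -- Differentiate `g⁻¹ g = 1` and multiply by `g⁻¹` from the right.
  have h0 : ∀ γ, ∑ s, (pd μ (fun y => gInv g y α s) x * g x s γ
      + gInv g x α s * pd μ (fun y => g y s γ) x) = 0 := by
    intro γ
    have h1 : (fun y => ∑ s, gInv g y α s * g y s γ) =ᶠ[𝓝[halfSpace] x]
        fun _ => if α = γ then 1 else 0 := by
      filter_upwards [hg.eventually_det_ne] with y hy
      have h := congrFun₂ (Matrix.nonsing_inv_mul (Matrix.of (g y)) (isUnit_iff_ne_zero.2 hy)) α γ
      rw [Matrix.mul_apply, Matrix.one_apply] at h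
      exact h
    have h2 := pd_congr hg.mem h1 μ
    rw [pd_const, pd_sum (F := fun s y => gInv g y α s * g y s γ) hg.mem μ
      fun s _ => (hg.diffAt_gInv α s).mul (hg.diffAt s γ)] at h2
    rw [← h2]
    exact Finset.sum_congr rfl fun s _ => (pd_mul hg.mem μ (hg.diffAt_gInv α s)
      (hg.diffAt s γ)).symm
  let D : Matrix (Fin 4) (Fin 4) ℝ := Matrix.of fun α β => pd μ (fun y => gInv g y α β) x
  let G : Matrix (Fin 4) (Fin 4) ℝ := Matrix.of (g x)
  let C : Matrix (Fin 4) (Fin 4) ℝ := Matrix.of fun s β => christoffel g x s μ β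
  have hunit := isUnit_iff_ne_zero.2 hg.det_ne
  have hdG : (Matrix.of fun α β => pd μ (fun y => g y α β) x) = G * C + C.transpose * G := by
    ext a b
    rw [Matrix.add_apply, Matrix.mul_apply, Matrix.mul_apply, Matrix.of_apply, hg.pd_metric,
      Finset.sum_add_distrib]
    congr 1
    refine Finset.sum_congr rfl fun s _ => ?_
    rw [hg.symm x b s, mul_comm]
    rfl
  have hrow : ∀ γ, (D * G + G⁻¹ * (G * C + C.transpose * G)) α γ = 0 := by
    intro γ
    rw [← hdG, Matrix.add_apply, Matrix.mul_apply, Matrix.mul_apply, ← Finset.sum_add_distrib]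
    exact h0 γ
  have hrow2 : ((D * G + G⁻¹ * (G * C + C.transpose * G)) * G⁻¹) α β = 0 := by
    rw [Matrix.mul_apply]
    simp only [hrow, zero_mul, Finset.sum_const_zero]
  have h3 : (D * G + G⁻¹ * (G * C + C.transpose * G)) * G⁻¹ = D + C * G⁻¹ + G⁻¹ * C.transpose := by
    have e1 : G * G⁻¹ = 1 := Matrix.mul_nonsing_inv G hunit
    have e2 : G⁻¹ * G = 1 := Matrix.nonsing_inv_mul G hunit
    rw [Matrix.mul_add, ← Matrix.mul_assoc, e2, Matrix.one_mul, ← Matrix.mul_assoc, add_mul, add_mul,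
      Matrix.mul_assoc, e1, Matrix.mul_one, Matrix.mul_assoc _ G, e1, Matrix.mul_one, add_assoc]
  rw [h3, Matrix.add_apply, Matrix.add_apply, Matrix.mul_apply, Matrix.mul_apply] at hrow2
  have h4 : ∀ s, G⁻¹ α s * C.transpose s β = christoffel g x β μ s * gInv g x s α := by
    intro s
    rw [hg.gInv_symm x s α, mul_comm]
    rfl
  simp only [h4] at hrow2
  rw [Finset.sum_add_distrib]
  change pd μ (fun y => gInv g y α β) x + (∑ s, christoffel g x α μ s * gInv g x s β) +
    ∑ s, christoffel g x β μ s * gInv g x s α = 0 at hrow2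
  linarith

theorem sqrtDet_pos : 0 < sqrtDet g x := Real.sqrt_pos.2 (abs_pos.2 hg.det_ne)

end MetricAt

/-- Jacobi's formula for the derivative of the determinant. -/
theorem pd_det {A : E4 → Matrix (Fin 4) (Fin 4) ℝ} {x : E4} (hx : x ∈ halfSpace)
    (hA : ∀ i j, DiffAt (fun y => A y i j) x) (h0 : (A x).det ≠ 0) (μ : Fin 4) :
    pd μ (fun y => (A y).det) x =
      (A x).det * ∑ i, ∑ j, (A x)⁻¹ i j * pd μ (fun y => A y j i) x := by
  let d : (Fin 4 → Fin 4 → ℝ) → ℝ := fun B => (Matrix.of B).det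
  have hd : Differentiable ℝ d := by
    simp only [d, Matrix.det_apply', Matrix.of_apply]
    fun_prop
  let B : E4 → Fin 4 → Fin 4 → ℝ := fun y => A y
  have hB : DifferentiableWithinAt ℝ B halfSpace x :=
    differentiableWithinAt_pi.2 fun i => differentiableWithinAt_pi.2 fun j => hA i j
  let H : Fin 4 → Fin 4 → ℝ := fderivWithin ℝ B halfSpace x (EuclideanSpace.single μ 1)
  have hH : ∀ i j, H i j = pd μ (fun y => A y i j) x := by
    intro i j
    have h1 := (hasFDerivWithinAt_pi'.1 (hasFDerivWithinAt_pi'.1 hB.hasFDerivWithinAt i) j).fderivWithin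
      (uniqueDiffOn_halfSpace x hx)
    exact (DFunLike.congr_fun h1 (EuclideanSpace.single μ (1 : ℝ) : E4)).symm
  have h1 : pd μ (fun y => (A y).det) x = fderiv ℝ d (B x) H := by
    have := (hd (B x)).hasFDerivAt.comp_hasFDerivWithinAt x hB.hasFDerivWithinAt
    exact DFunLike.congr_fun (this.fderivWithin (uniqueDiffOn_halfSpace x hx))
      (EuclideanSpace.single μ (1 : ℝ) : E4)
  have h2 : HasDerivAt (fun t : ℝ => d (B x + t • H)) (fderiv ℝ d (B x) H) 0 := by
    have h3 : HasDerivAt (fun t : ℝ => B x + t • H) H 0 := by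
      simpa using ((hasDerivAt_id (0 : ℝ)).smul_const H).const_add (B x)
    have h4 : HasFDerivAt d (fderiv ℝ d (B x)) (B x + (0 : ℝ) • H) := by
      simpa using (hd (B x)).hasFDerivAt
    exact h4.comp_hasDerivAt (0 : ℝ) h3
  have h5 : ∀ t : ℝ, d (B x + t • H) =
      (A x).det * (1 + Matrix.trace ((A x)⁻¹ * Matrix.of H) * t +
        (Matrix.det (1 + (Polynomial.X : Polynomial ℝ) •
          ((A x)⁻¹ * Matrix.of H).map Polynomial.C)).divX.divX.eval t * t ^ 2) := by
    intro t
    rw [← Matrix.det_one_add_smul, ← Matrix.det_mul, Matrix.mul_add, Matrix.mul_one,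
      Matrix.mul_smul, ← Matrix.mul_assoc, Matrix.mul_nonsing_inv _ (isUnit_iff_ne_zero.2 h0),
      Matrix.one_mul]
    rfl
  have h6 : HasDerivAt (fun t : ℝ => d (B x + t • H))
      ((A x).det * Matrix.trace ((A x)⁻¹ * Matrix.of H)) 0 := by
    simp only [h5]
    generalize (Matrix.det (1 + (Polynomial.X : Polynomial ℝ) •
          ((A x)⁻¹ * Matrix.of H).map Polynomial.C)).divX.divX = p
    have h7 := (((hasDerivAt_id (0 : ℝ)).const_mul
      (Matrix.trace ((A x)⁻¹ * Matrix.of H))).const_add 1).add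
      ((p.hasDerivAt 0).mul (hasDerivAt_pow 2 (0 : ℝ)))
    have h8 := h7.const_mul (A x).det
    refine h8.congr_deriv ?_
    simp
  rw [h1, h2.unique h6, Matrix.trace]
  simp only [Matrix.diag_apply, Matrix.mul_apply, Matrix.of_apply, hH]

/-- The derivative of `√|det g|` is governed by the trace of the Christoffel symbols. -/
theorem MetricAt.pd_sqrtDet {g : LMetric} {x : E4} (hg : MetricAt g x) (μ : Fin 4) :
    pd μ (sqrtDet g) x = sqrtDet g x * ∑ s, christoffel g x s s μ := by
  have hdet : DiffAt (fun y => (Matrix.of (g y)).det) x :=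
    (contDiffWithinAt_det (A := fun y => Matrix.of (g y)) hg.contDiff).differentiableWithinAt
      (by simp)
  have h1 := pd_det (A := fun y => Matrix.of (g y)) hg.mem hg.diffAt hg.det_ne μ
  have h2 : ∑ i, ∑ j, (Matrix.of (g x))⁻¹ i j * pd μ (fun y => Matrix.of (g y) j i) x =
      2 * ∑ s, christoffel g x s s μ := by
    have e : ∀ i j, (Matrix.of (g x))⁻¹ i j * pd μ (fun y => Matrix.of (g y) j i) x =
        ∑ s, (gInv g x i j * g x j s * christoffel g x s μ i
          + gInv g x j i * g x i s * christoffel g x s μ j) := by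
      intro i j
      have : pd μ (fun y => Matrix.of (g y) j i) x = pd μ (fun y => g y j i) x := rfl
      rw [this, hg.pd_metric, Finset.mul_sum]
      refine Finset.sum_congr rfl fun s _ => ?_
      rw [hg.gInv_symm x j i]
      simp only [gInv]
      ring
    simp only [e, Finset.sum_add_distrib]
    have e1 : ∑ i, ∑ j, ∑ s, gInv g x i j * g x j s * christoffel g x s μ i =
        ∑ s, christoffel g x s s μ := by
      refine Finset.sum_congr rfl fun i _ => ?_
      rw [Finset.sum_comm]
      simp only [← Finset.sum_mul, hg.sum_gInv_mul_g, ite_mul, one_mul, zero_mul,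
        Finset.sum_ite_eq, Finset.mem_univ, if_true]
      exact hg.christoffel_symm x i μ i
    have e2 : ∑ i, ∑ j, ∑ s, gInv g x j i * g x i s * christoffel g x s μ j =
        ∑ s, christoffel g x s s μ := by rw [Finset.sum_comm]; exact e1
    rw [e1, e2]
    ring
  rw [h2] at h1
  have h3 : HasFDerivWithinAt (sqrtDet g) (((sqrtDet g x) / (2 * (Matrix.of (g x)).det)) •
      fderivWithin ℝ (fun y => (Matrix.of (g y)).det) halfSpace x) halfSpace x := by
    have k1 : HasDerivAt (fun u : ℝ => Real.sqrt |u|)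
        ((sqrtDet g x) / (2 * (Matrix.of (g x)).det)) (Matrix.of (g x)).det := by
      have k2 := (hasDerivAt_abs hg.det_ne).sqrt (abs_ne_zero.2 hg.det_ne)
      refine k2.congr_deriv ?_
      have k3 : sqrtDet g x = Real.sqrt |(Matrix.of (g x)).det| := rfl
      have hp := hg.sqrtDet_pos
      rw [← k3]
      have k4 : sqrtDet g x * sqrtDet g x = |(Matrix.of (g x)).det| := Real.mul_self_sqrt (abs_nonneg _)
      have hne := hg.det_ne
      rw [div_eq_div_iff (by positivity) (by simpa using hne)]
      have k5 := sign_mul_abs (Matrix.of (g x)).det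
      have k6 : ((SignType.sign (Matrix.of (g x)).det : SignType) : ℝ) * (Matrix.of (g x)).det =
        |(Matrix.of (g x)).det| := sign_mul_self _
      linear_combination 2 * k6 - 2 * k4
    exact HasDerivAt.comp_hasFDerivWithinAt (h₂ := fun u : ℝ => Real.sqrt |u|)
      (f := fun y => (Matrix.of (g y)).det) x k1 hdet.hasFDerivWithinAt
  have h4 := DFunLike.congr_fun (h3.fderivWithin (uniqueDiffOn_halfSpace x hg.mem))
    (EuclideanSpace.single μ (1 : ℝ) : E4)
  change pd μ (sqrtDet g) x = _ * pd μ (fun y => (Matrix.of (g y)).det) x at h4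
  rw [h4, h1]
  have hne := hg.det_ne
  field_simp

/-! ### Splitting off the Levi-Civita part of the Lagrangians -/

section Relabel

variable {f h : Fin 4 → Fin 4 → Fin 4 → Fin 4 → ℝ}

theorem sum4_congr (hfh : ∀ i j k l, f i j k l = h i j k l) :
    ∑ i, ∑ j, ∑ k, ∑ l, f i j k l = ∑ i, ∑ j, ∑ k, ∑ l, h i j k l := by simp only [hfh]

theorem sum4_swap12 (f : Fin 4 → Fin 4 → Fin 4 → Fin 4 → ℝ) :
    ∑ i, ∑ j, ∑ k, ∑ l, f i j k l = ∑ i, ∑ j, ∑ k, ∑ l, f j i k l := Finset.sum_comm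

theorem sum4_swap23 (f : Fin 4 → Fin 4 → Fin 4 → Fin 4 → ℝ) :
    ∑ i, ∑ j, ∑ k, ∑ l, f i j k l = ∑ i, ∑ j, ∑ k, ∑ l, f i k j l :=
  Finset.sum_congr rfl fun _ _ => Finset.sum_comm

theorem sum4_swap34 (f : Fin 4 → Fin 4 → Fin 4 → Fin 4 → ℝ) :
    ∑ i, ∑ j, ∑ k, ∑ l, f i j k l = ∑ i, ∑ j, ∑ k, ∑ l, f i j l k :=
  Finset.sum_congr rfl fun _ _ => Finset.sum_congr rfl fun _ _ => Finset.sum_comm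

/-- A contraction of the Levi-Civita symbol with an array symmetric in the second and fourth
index vanishes. -/
theorem sum_eps_eq_zero_of_symm24 (hf : ∀ i j k l, f i l k j = f i j k l) :
    ∑ i, ∑ j, ∑ k, ∑ l, eps i j k l * f i j k l = 0 := by
  have e : ∀ i j k l, eps i l k j = -eps i j k l := by
    intro i j k l
    rw [eps_swap23 i k l j, eps_swap34 i k j l, eps_swap23 i j k l]
    ring
  have h1 : ∑ i, ∑ j, ∑ k, ∑ l, eps i j k l * f i j k l =
      ∑ i, ∑ j, ∑ k, ∑ l, eps i l k j * f i l k j :=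
    (sum4_swap23 _).trans ((sum4_swap34 _).trans (sum4_swap23 _))
  have h2 : ∑ i, ∑ j, ∑ k, ∑ l, eps i l k j * f i l k j =
      -∑ i, ∑ j, ∑ k, ∑ l, eps i j k l * f i j k l := by
    simp only [← Finset.sum_neg_distrib]
    exact sum4_congr fun i j k l => by rw [e, hf]; ring
  linarith

theorem sum_eps_eq_zero_of_symm13 (hf : ∀ i j k l, f k j i l = f i j k l) :
    ∑ i, ∑ j, ∑ k, ∑ l, eps i j k l * f i j k l = 0 := by
  have e : ∀ i j k l, eps k j i l = -eps i j k l := by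
    intro i j k l
    rw [eps_swap12 j k i l, eps_swap23 j i k l, eps_swap12 i j k l]
    ring
  have h1 : ∑ i, ∑ j, ∑ k, ∑ l, eps i j k l * f i j k l =
      ∑ i, ∑ j, ∑ k, ∑ l, eps k j i l * f k j i l :=
    (sum4_swap12 _).trans ((sum4_swap23 _).trans (sum4_swap12 _))
  have h2 : ∑ i, ∑ j, ∑ k, ∑ l, eps k j i l * f k j i l =
      -∑ i, ∑ j, ∑ k, ∑ l, eps i j k l * f i j k l := by
    simp only [← Finset.sum_neg_distrib]
    exact sum4_congr fun i j k l => by rw [e, hf]; ring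
  linarith

end Relabel

/-- Three-index arrays: the components of a tensor `Q^α_{βσ}` at one point. -/
abbrev Arr3 : Type := Fin 4 → Fin 4 → Fin 4 → ℝ

/-- The bilinear form whose quadratic form is the part of the scalar curvature quadratic in `Q`. -/
noncomputable def scalForm (I : Fin 4 → Fin 4 → ℝ) (Q P : Arr3) : ℝ :=
  ∑ β, ∑ δ, I β δ * ∑ α, ∑ l, (Q α α l * P l δ β - Q α δ l * P l α β)

/-- The bilinear form whose quadratic form is the part of the dual curvature scalar quadratic
in `Q`. -/
noncomputable def dualForm (G : Fin 4 → Fin 4 → ℝ) (Q P : Arr3) : ℝ :=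
  ∑ α, ∑ β, ∑ μ, ∑ ν, eps α β μ ν * ∑ l, G α l * ∑ s, Q l μ s * P s ν β

/-- The vector density whose divergence is the part of `R̃ √|det g|` linear in `Q`. -/
noncomputable def palVec (g : LMetric) (Q : LConn) (x : E4) (α : Fin 4) : ℝ :=
  sqrtDet g x * (∑ β, ∑ δ, gInv g x β δ * Q x α δ β - ∑ β, ∑ l, gInv g x β α * Q x l l β)

/-- The vector density `√|det g| q^μ`. -/
noncomputable def dualVec (g : LMetric) (Q : LConn) (x : E4) (μ : Fin 4) : ℝ :=
  -∑ α, ∑ β, ∑ ν, eps μ α β ν * ∑ l, g x α l * Q x l β ν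

/-- The terms of the scalar curvature linear in `Q` form a divergence. The arrays `dI`, `dQ` stand for
the derivatives of the inverse metric `I` and of `Q`, and the trace of `Γ` for the derivative of the
logarithm of the volume density. -/
theorem scalar_linear_part (I : Fin 4 → Fin 4 → ℝ) (dI : Arr3) (Γ Q : Arr3) (dQ : Fin 4 → Arr3)
    (hI : ∀ α β, I α β = I β α) (hΓ : ∀ α β σ, Γ α β σ = Γ α σ β)
    (hdI : ∀ μ α β, dI μ α β = -∑ s, (Γ α μ s * I s β + Γ β μ s * I s α)) :
    ∑ β, ∑ δ, I β δ * ∑ α, ((dQ α α δ β - dQ δ α α β)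
      + ∑ l, (Γ α α l * Q l δ β + Q α α l * Γ l δ β - Γ α δ l * Q l α β - Q α δ l * Γ l α β)) =
    ∑ μ, ((∑ s, Γ s s μ) * (∑ β, ∑ δ, I β δ * Q μ δ β - ∑ β, ∑ l, I β μ * Q l l β)
      + (∑ β, ∑ δ, (dI μ β δ * Q μ δ β + I β δ * dQ μ μ δ β)
        - ∑ β, ∑ l, (dI μ β μ * Q l l β + I β μ * dQ μ l l β))) := by
  have hL : ∑ β, ∑ δ, I β δ * ∑ α, ((dQ α α δ β - dQ δ α α β)
      + ∑ l, (Γ α α l * Q l δ β + Q α α l * Γ l δ β - Γ α δ l * Q l α β - Q α δ l * Γ l α β)) =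
      (∑ β, ∑ δ, ∑ α, I β δ * dQ α α δ β - ∑ β, ∑ δ, ∑ α, I β δ * dQ δ α α β)
      + (∑ β, ∑ δ, ∑ α, ∑ l, I β δ * (Γ α α l * Q l δ β)
        + ∑ β, ∑ δ, ∑ α, ∑ l, I β δ * (Q α α l * Γ l δ β)
        - ∑ β, ∑ δ, ∑ α, ∑ l, I β δ * (Γ α δ l * Q l α β)
        - ∑ β, ∑ δ, ∑ α, ∑ l, I β δ * (Q α δ l * Γ l α β)) := by
    simp only [mul_add, mul_sub, Finset.mul_sum, Finset.sum_add_distrib, Finset.sum_sub_distrib]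
  have hR1 : ∑ μ, (∑ s, Γ s s μ) * (∑ β, ∑ δ, I β δ * Q μ δ β - ∑ β, ∑ l, I β μ * Q l l β) =
      ∑ μ, ∑ s, ∑ β, ∑ δ, Γ s s μ * (I β δ * Q μ δ β)
        - ∑ μ, ∑ s, ∑ β, ∑ l, Γ s s μ * (I β μ * Q l l β) := by
    simp only [Finset.sum_mul]
    simp only [mul_sub, Finset.mul_sum, Finset.sum_sub_distrib]
  have hR2 : ∑ μ, (∑ β, ∑ δ, (dI μ β δ * Q μ δ β + I β δ * dQ μ μ δ β)
        - ∑ β, ∑ l, (dI μ β μ * Q l l β + I β μ * dQ μ l l β)) =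
      (∑ μ, ∑ β, ∑ δ, I β δ * dQ μ μ δ β - ∑ μ, ∑ β, ∑ l, I β μ * dQ μ l l β)
      - (∑ μ, ∑ β, ∑ δ, ∑ s, Γ β μ s * I s δ * Q μ δ β
        + ∑ μ, ∑ β, ∑ δ, ∑ s, Γ δ μ s * I s β * Q μ δ β)
      + (∑ μ, ∑ β, ∑ l, ∑ s, Γ β μ s * I s μ * Q l l β
        + ∑ μ, ∑ β, ∑ l, ∑ s, Γ μ μ s * I s β * Q l l β) := by
    simp only [hdI, neg_mul, Finset.sum_mul, add_mul, Finset.sum_add_distrib,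
      Finset.sum_sub_distrib, Finset.sum_neg_distrib]
    ring
  have e1 : ∑ β, ∑ δ, ∑ α, I β δ * dQ α α δ β = ∑ μ, ∑ β, ∑ δ, I β δ * dQ μ μ δ β := by
    rw [Finset.sum_comm' (t' := Finset.univ) (s' := fun _ => Finset.univ) (by simp)]
    conv_rhs => rw [Finset.sum_comm]
    rw [Finset.sum_comm]
    exact Finset.sum_congr rfl fun β _ => Finset.sum_comm
  have e2 : ∑ β, ∑ δ, ∑ α, I β δ * dQ δ α α β = ∑ μ, ∑ β, ∑ l, I β μ * dQ μ l l β :=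
    Finset.sum_comm
  have e3 : ∑ β, ∑ δ, ∑ α, ∑ l, I β δ * (Γ α α l * Q l δ β) =
      ∑ μ, ∑ s, ∑ β, ∑ δ, Γ s s μ * (I β δ * Q μ δ β) := by
    refine (sum4_swap34 _).trans ((sum4_swap23 _).trans ((sum4_swap12 _).trans
      ((sum4_swap34 _).trans ((sum4_swap23 _).trans (sum4_congr fun μ s β δ => ?_)))))
    ring
  have e4 : ∑ β, ∑ δ, ∑ α, ∑ l, I β δ * (Q α α l * Γ l δ β) =
      ∑ μ, ∑ β, ∑ l, ∑ s, Γ β μ s * I s μ * Q l l β := by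
    refine (sum4_swap34 _).trans ((sum4_swap12 _).trans ((sum4_swap23 _).trans
      ((sum4_swap34 _).trans (sum4_congr fun μ β l s => ?_))))
    ring
  have e5 : ∑ β, ∑ δ, ∑ α, ∑ l, I β δ * (Γ α δ l * Q l α β) =
      ∑ μ, ∑ β, ∑ δ, ∑ s, Γ δ μ s * I s β * Q μ δ β := by
    refine (sum4_swap34 _).trans ((sum4_swap23 _).trans ((sum4_swap12 _).trans
      ((sum4_swap34 _).trans (sum4_congr fun μ β δ s => ?_))))
    rw [hI s β, hΓ δ s μ]; ring
  have e6 : ∑ β, ∑ δ, ∑ α, ∑ l, I β δ * (Q α δ l * Γ l α β) =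
      ∑ μ, ∑ β, ∑ δ, ∑ s, Γ β μ s * I s δ * Q μ δ β := by
    refine (sum4_swap23 _).trans ((sum4_swap12 _).trans ((sum4_swap34 _).trans
      ((sum4_swap23 _).trans
      ((sum4_swap34 _).trans (sum4_congr fun μ β δ s => ?_)))))
    ring
  have e7 : ∑ μ, ∑ s, ∑ β, ∑ l, Γ s s μ * (I β μ * Q l l β) =
      ∑ μ, ∑ β, ∑ l, ∑ s, Γ μ μ s * I s β * Q l l β := by
    refine (sum4_swap12 _).trans ((sum4_swap23 _).trans
      ((sum4_swap34 _).trans (sum4_congr fun μ β δ s => ?_)))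
    rw [hI s β]; ring
  rw [hL, Finset.sum_add_distrib, hR1, hR2, e1, e2, e3, e4, e5, e6, e7]
  ring

/-- The dual analogue: the terms of the dual curvature scalar linear in `Q`. -/
theorem dual_linear_part (G : Fin 4 → Fin 4 → ℝ) (dG : Arr3) (Γ Q : Arr3) (dΓ dQ : Fin 4 → Arr3)
    (hΓ : ∀ α β σ, Γ α β σ = Γ α σ β) (hdΓ : ∀ μ α β σ, dΓ μ α β σ = dΓ μ α σ β)
    (hdG : ∀ μ α β, dG μ α β = ∑ s, (G α s * Γ s μ β + G β s * Γ s μ α)) :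
    ∑ α, ∑ β, ∑ μ, ∑ ν, eps α β μ ν * ∑ l, G α l * (dΓ μ l ν β + dQ μ l ν β
      + ∑ s, (Γ l μ s + Q l μ s) * (Γ s ν β + Q s ν β)) =
    ∑ μ, (-∑ α, ∑ β, ∑ ν, eps μ α β ν * ∑ l, (dG μ α l * Q l β ν + G α l * dQ μ l β ν))
      + dualForm G Q Q := by
  have hsym : ∑ α, ∑ β, ∑ μ, ∑ ν, eps α β μ ν * ∑ l, G α l * (dΓ μ l ν β
      + ∑ s, (Γ l μ s + Q l μ s) * Γ s ν β) = 0 := by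
    refine sum_eps_eq_zero_of_symm24 (f := fun α β μ ν => ∑ l, G α l * (dΓ μ l ν β
      + ∑ s, (Γ l μ s + Q l μ s) * Γ s ν β)) fun α β μ ν => Finset.sum_congr rfl fun l _ => ?_
    rw [hdΓ μ l β ν]
    simp only [hΓ _ β ν]
  have hsym' : ∑ α, ∑ β, ∑ μ, ∑ ν, eps α β μ ν * ∑ l, ∑ s, G l s * Γ s μ α * Q l ν β = 0 := by
    refine sum_eps_eq_zero_of_symm13 (f := fun α β μ ν => ∑ l, ∑ s, G l s * Γ s μ α * Q l ν β)
      fun α β μ ν => ?_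
    simp only [hΓ _ α μ]
  have hR : ∑ μ, (-∑ α, ∑ β, ∑ ν, eps μ α β ν * ∑ l, (dG μ α l * Q l β ν + G α l * dQ μ l β ν)) =
      ∑ α, ∑ β, ∑ μ, ∑ ν, eps α β μ ν * ∑ l, (dG μ α l * Q l ν β + G α l * dQ μ l ν β) := by
    simp only [← Finset.sum_neg_distrib]
    refine (sum4_swap12 _).trans ((sum4_swap34 _).trans ((sum4_swap23 _).trans
      (sum4_congr fun α β μ ν => ?_)))
    have : eps μ α ν β = -eps α β μ ν := by
      rw [eps_swap34 μ α β ν, eps_swap12 α μ β ν, eps_swap23 α β μ ν]; ring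
    rw [this]
    ring
  have hsplit : ∀ α β μ ν, eps α β μ ν * ∑ l, G α l * (dΓ μ l ν β + dQ μ l ν β
      + ∑ s, (Γ l μ s + Q l μ s) * (Γ s ν β + Q s ν β)) =
      eps α β μ ν * (∑ l, G α l * (dΓ μ l ν β + ∑ s, (Γ l μ s + Q l μ s) * Γ s ν β))
      + (eps α β μ ν * (∑ l, (dG μ α l * Q l ν β + G α l * dQ μ l ν β))
      - eps α β μ ν * ∑ l, ∑ s, G l s * Γ s μ α * Q l ν β)
      + eps α β μ ν * ∑ l, G α l * ∑ s, Q l μ s * Q s ν β := by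
    intro α β μ ν
    have h1 : ∑ l, ∑ s, G α s * Γ s μ l * Q l ν β = ∑ l, G α l * ∑ s, Γ l μ s * Q s ν β := by
      rw [Finset.sum_comm]
      refine Finset.sum_congr rfl fun l _ => ?_
      rw [Finset.mul_sum]
      exact Finset.sum_congr rfl fun s _ => by ring
    rw [← mul_sub, ← mul_add, ← mul_add]
    congr 1
    simp only [hdG, Finset.sum_mul, add_mul, mul_add, Finset.sum_add_distrib, h1]
    ring
  rw [hR]
  simp only [hsplit, Finset.sum_add_distrib, Finset.sum_sub_distrib, hsym, hsym', dualForm]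
  ring

/-- Arrays of the form `∂_μ C^l_{νβ} + C^l_{μs} C^s_{νβ}` antisymmetrised in `μ, ν` make up the
Riemann tensor. -/
theorem dual_riemann (g : LMetric) (C : LConn) (x : E4) :
    ∑ α, ∑ β, ∑ μ, ∑ ν, eps α β μ ν * riemannLow g C x α β μ ν =
    2 * ∑ α, ∑ β, ∑ μ, ∑ ν, eps α β μ ν * ∑ l, g x α l *
      (pd μ (fun y => C y l ν β) x + ∑ s, C x l μ s * C x s ν β) := by
  have h1 : ∀ α β μ ν, eps α β μ ν * riemannLow g C x α β μ ν =
      eps α β μ ν * (∑ l, g x α l * (pd μ (fun y => C y l ν β) x + ∑ s, C x l μ s * C x s ν β))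
      + eps α β ν μ *
        (∑ l, g x α l * (pd ν (fun y => C y l μ β) x + ∑ s, C x l ν s * C x s μ β)) := by
    intro α β μ ν
    rw [eps_swap34 α β μ ν, neg_mul, ← sub_eq_add_neg, ← mul_sub, ← Finset.sum_sub_distrib]
    congr 1
    refine Finset.sum_congr rfl fun l _ => ?_
    rw [riemann, Finset.sum_sub_distrib]
    ring
  simp only [h1, Finset.sum_add_distrib]
  have h2 := sum4_swap34 fun α β μ ν => eps α β ν μ *
        (∑ l, g x α l * (pd ν (fun y => C y l μ β) x + ∑ s, C x l ν s * C x s μ β))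
  rw [h2]
  ring

section Pointwise

variable {g : LMetric} {Q : LConn} {x : E4} (hg : MetricAt g x)
  (hQ : ∀ α β σ, DiffAt (fun y => Q y α β σ) x)

include hg hQ

theorem pd_fullConn (μ α β σ : Fin 4) : pd μ (fun y => fullConn g Q y α β σ) x =
    pd μ (fun y => christoffel g y α β σ) x + pd μ (fun y => Q y α β σ) x :=
  pd_add hg.mem μ (hg.diffAt_christoffel α β σ) (hQ α β σ)

omit hg hQ in
theorem pd_christoffel_symm (hs : ∀ y α β, g y α β = g y β α) (μ α β σ : Fin 4) :
    pd μ (fun y => christoffel g y α β σ) x = pd μ (fun y => christoffel g y α σ β) x := by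
  have : (fun y => christoffel g y α β σ) = fun y => christoffel g y α σ β :=
    funext fun y => MetricAt.christoffel_symm_of_symm hs y α β σ
  rw [this]

/-- The dual curvature scalar of the Levi-Civita connection vanishes, so only a divergence and a
quadratic form in `Q` are left. -/
theorem dual_fullConn : ∑ α, ∑ β, ∑ μ, ∑ ν, eps α β μ ν * riemannLow g (fullConn g Q) x α β μ ν =
    2 * (∑ μ, pd μ (fun y => dualVec g Q y μ) x + dualForm (g x) (Q x) (Q x)) := by
  rw [dual_riemann]
  simp only [pd_fullConn hg hQ]
  simp only [fullConn]
  rw [dual_linear_part (g x) (fun μ α β => pd μ (fun y => g y α β) x) (christoffel g x) (Q x)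
    (fun μ α β σ => pd μ (fun y => christoffel g y α β σ) x)
    (fun μ α β σ => pd μ (fun y => Q y α β σ) x) (hg.christoffel_symm x)
    (fun μ α β σ => pd_christoffel_symm hg.symm μ α β σ) hg.pd_metric]
  congr 2
  refine Finset.sum_congr rfl fun μ _ => ?_
  have hp : ∀ α β ν l, DiffAt (fun y => g y α l * Q y l β ν) x :=
    fun α β ν l => (hg.diffAt α l).mul (hQ l β ν)
  have hq : ∀ α β ν, DiffAt (fun y => ∑ l, g y α l * Q y l β ν) x :=
    fun α β ν => DifferentiableWithinAt.fun_sum fun l _ => hp α β ν l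
  unfold dualVec
  rw [pd_neg hg.mem, pd_sum (F := fun α y => ∑ β, ∑ ν, eps μ α β ν * ∑ l, g y α l * Q y l β ν)
    hg.mem μ fun α _ => DifferentiableWithinAt.fun_sum fun β _ =>
      DifferentiableWithinAt.fun_sum fun ν _ => (hq α β ν).const_mul _]
  congr 1
  refine Finset.sum_congr rfl fun α _ => ?_
  rw [pd_sum (F := fun β y => ∑ ν, eps μ α β ν * ∑ l, g y α l * Q y l β ν)
    hg.mem μ fun β _ => DifferentiableWithinAt.fun_sum fun ν _ => (hq α β ν).const_mul _]
  refine Finset.sum_congr rfl fun β _ => ?_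
  rw [pd_sum (F := fun ν y => eps μ α β ν * ∑ l, g y α l * Q y l β ν)
    hg.mem μ fun ν _ => (hq α β ν).const_mul _]
  refine Finset.sum_congr rfl fun ν _ => ?_
  rw [pd_const_mul hg.mem μ _ (hq α β ν), pd_sum (F := fun l y => g y α l * Q y l β ν) hg.mem μ
    fun l _ => hp α β ν l]
  congr 1
  exact Finset.sum_congr rfl fun l _ => (pd_mul hg.mem μ (hg.diffAt α l) (hQ l β ν)).symm

/-- The scalar curvature density of `∇ + Q` is the Levi-Civita one plus a divergence plus a quadratic
form in `Q`. -/
theorem scalarCurv_fullConn : scalarCurv g (fullConn g Q) x * sqrtDet g x =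
    scalarCurv g (christoffel g) x * sqrtDet g x + ∑ μ, pd μ (fun y => palVec g Q y μ) x
      + sqrtDet g x * scalForm (gInv g x) (Q x) (Q x) := by
  have hriem : ∀ ρ σ μ ν, riemann (fullConn g Q) x ρ σ μ ν = riemann (christoffel g) x ρ σ μ ν
      + ((pd μ (fun y => Q y ρ ν σ) x - pd ν (fun y => Q y ρ μ σ) x)
        + ∑ l, (christoffel g x ρ μ l * Q x l ν σ + Q x ρ μ l * christoffel g x l ν σ
          - christoffel g x ρ ν l * Q x l μ σ - Q x ρ ν l * christoffel g x l μ σ))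
      + ∑ l, (Q x ρ μ l * Q x l ν σ - Q x ρ ν l * Q x l μ σ) := by
    intro ρ σ μ ν
    unfold riemann
    rw [pd_fullConn hg hQ, pd_fullConn hg hQ]
    have : ∑ l, (fullConn g Q x ρ μ l * fullConn g Q x l ν σ
          - fullConn g Q x ρ ν l * fullConn g Q x l μ σ) =
        ∑ l, (christoffel g x ρ μ l * christoffel g x l ν σ
          - christoffel g x ρ ν l * christoffel g x l μ σ)
        + ∑ l, (christoffel g x ρ μ l * Q x l ν σ + Q x ρ μ l * christoffel g x l ν σ
          - christoffel g x ρ ν l * Q x l μ σ - Q x ρ ν l * christoffel g x l μ σ)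
        + ∑ l, (Q x ρ μ l * Q x l ν σ - Q x ρ ν l * Q x l μ σ) := by
      rw [← Finset.sum_add_distrib, ← Finset.sum_add_distrib]
      exact Finset.sum_congr rfl fun l _ => by simp only [fullConn]; ring
    rw [this]
    ring
  have hIQ : ∀ μ β δ, DiffAt (fun y => gInv g y β δ * Q y μ δ β) x :=
    fun μ β δ => (hg.diffAt_gInv β δ).mul (hQ μ δ β)
  have hIQ' : ∀ μ β l, DiffAt (fun y => gInv g y β μ * Q y l l β) x :=
    fun μ β l => (hg.diffAt_gInv β μ).mul (hQ l l β)
  have hV1 : ∀ μ, DiffAt (fun y => ∑ β, ∑ δ, gInv g y β δ * Q y μ δ β) x := fun μ =>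
    DifferentiableWithinAt.fun_sum fun β _ => DifferentiableWithinAt.fun_sum fun δ _ => hIQ μ β δ
  have hV2 : ∀ μ, DiffAt (fun y => ∑ β, ∑ l, gInv g y β μ * Q y l l β) x := fun μ =>
    DifferentiableWithinAt.fun_sum fun β _ => DifferentiableWithinAt.fun_sum fun δ _ => hIQ' μ β δ
  have hdiv : ∀ μ, pd μ (fun y => palVec g Q y μ) x = sqrtDet g x *
      ((∑ s, christoffel g x s s μ) *
        (∑ β, ∑ δ, gInv g x β δ * Q x μ δ β - ∑ β, ∑ l, gInv g x β μ * Q x l l β)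
      + (∑ β, ∑ δ, (pd μ (fun y => gInv g y β δ) x * Q x μ δ β
          + gInv g x β δ * pd μ (fun y => Q y μ δ β) x)
        - ∑ β, ∑ l, (pd μ (fun y => gInv g y β μ) x * Q x l l β
          + gInv g x β μ * pd μ (fun y => Q y l l β) x))) := by
    intro μ
    unfold palVec
    have hneg : (fun y => sqrtDet g y * (∑ β, ∑ δ, gInv g y β δ * Q y μ δ β
        - ∑ β, ∑ l, gInv g y β μ * Q y l l β)) = fun y => sqrtDet g y *
        (∑ β, ∑ δ, gInv g y β δ * Q y μ δ β + -∑ β, ∑ l, gInv g y β μ * Q y l l β) := by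
      funext y; ring
    have h1 : pd μ (fun y => ∑ β, ∑ δ, gInv g y β δ * Q y μ δ β) x = ∑ β, ∑ δ,
        (pd μ (fun y => gInv g y β δ) x * Q x μ δ β
          + gInv g x β δ * pd μ (fun y => Q y μ δ β) x) := by
      rw [pd_sum (F := fun β y => ∑ δ, gInv g y β δ * Q y μ δ β) hg.mem μ fun β _ =>
        DifferentiableWithinAt.fun_sum fun δ _ => hIQ μ β δ]
      refine Finset.sum_congr rfl fun β _ => ?_
      rw [pd_sum (F := fun δ y => gInv g y β δ * Q y μ δ β) hg.mem μ fun δ _ => hIQ μ β δ]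
      exact Finset.sum_congr rfl fun δ _ => pd_mul hg.mem μ (hg.diffAt_gInv β δ) (hQ μ δ β)
    have h2 : pd μ (fun y => ∑ β, ∑ l, gInv g y β μ * Q y l l β) x = ∑ β, ∑ l,
        (pd μ (fun y => gInv g y β μ) x * Q x l l β
          + gInv g x β μ * pd μ (fun y => Q y l l β) x) := by
      rw [pd_sum (F := fun β y => ∑ l, gInv g y β μ * Q y l l β) hg.mem μ fun β _ =>
        DifferentiableWithinAt.fun_sum fun δ _ => hIQ' μ β δ]
      refine Finset.sum_congr rfl fun β _ => ?_
      rw [pd_sum (F := fun l y => gInv g y β μ * Q y l l β) hg.mem μ fun δ _ => hIQ' μ β δ]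
      exact Finset.sum_congr rfl fun l _ => pd_mul hg.mem μ (hg.diffAt_gInv β μ) (hQ l l β)
    have hV3 : DiffAt (fun y => -∑ β, ∑ l, gInv g y β μ * Q y l l β) x := (hV2 μ).fun_neg
    have hV4 : DiffAt (fun y => ∑ β, ∑ δ, gInv g y β δ * Q y μ δ β
        + -∑ β, ∑ l, gInv g y β μ * Q y l l β) x := (hV1 μ).fun_add hV3
    rw [hneg, pd_mul hg.mem μ hg.diffAt_sqrtDet hV4, pd_add hg.mem μ (hV1 μ) hV3, pd_neg hg.mem, h1, h2,
      hg.pd_sqrtDet]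
    ring
  simp only [hdiv]
  rw [← Finset.mul_sum, ← scalar_linear_part (gInv g x) (fun μ α β => pd μ (fun y => gInv g y α β) x)
    (christoffel g x) (Q x) (fun μ α β σ => pd μ (fun y => Q y α β σ) x) (hg.gInv_symm x)
    (hg.christoffel_symm x) hg.pd_gInv]
  unfold scalarCurv scalForm
  simp only [hriem, Finset.sum_add_distrib, mul_add]
  ring

end Pointwise

/-! ### The generalised Lagrangian pair and its decomposition -/

/-- The bulk Lagrangian `a (R̃ - 2Λ) vol_g - (b/2) (vol_g)^{αβμν} R̃_{αβμν} vol_g`. -/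
noncomputable def bulkGen (a : E4 → ℝ) (b Λ : ℝ) (g : LMetric) (Q : LConn) (x : E4) : ℝ :=
  a x * bulkPT Λ g Q x - b / 2 * ((∑ α, ∑ β, ∑ μ, ∑ ν,
    volUp g x α β μ ν * riemannLow g (fullConn g Q) x α β μ ν) * sqrtDet g x)

/-- The boundary Lagrangian `-2 a K̃ vol_ḡ + b ȷ^*(ι_q vol_g)`. -/
noncomputable def bdryGen (a : E4 → ℝ) (b : ℝ) (g : LMetric) (Q : LConn) (x : E4) : ℝ :=
  a x * bdryPT g Q x + b * ((∑ μ, nuLow g x μ * qVec g Q x μ) * sqrtDetBdry g x)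

theorem bulkHMS_eq_bulkGen (Λ γ : ℝ) : bulkHMS Λ γ = bulkGen (fun _ => 1) (1 / γ) Λ := by
  funext g Q x
  simp only [bulkHMS, bulkGen, bulkPT]
  ring

theorem bdryHMS_eq_bdryGen (γ : ℝ) : bdryHMS γ = bdryGen (fun _ => 1) (1 / γ) := by
  funext g Q x
  simp only [bdryHMS, bdryGen, bdryPT]
  ring

theorem bulkPT_eq_bulkGen (Λ : ℝ) : bulkPT Λ = bulkGen (fun _ => 1) 0 Λ := by
  funext g Q x
  simp only [bulkGen]
  ring

theorem bdryPT_eq_bdryGen : bdryPT = bdryGen (fun _ => 1) 0 := by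
  funext g Q x
  simp only [bdryGen]
  ring

/-- The vector density whose divergence is the part of the generalised Lagrangian linear in
`Q`. -/
noncomputable def divVec (a : E4 → ℝ) (b : ℝ) (g : LMetric) (Q : LConn) (μ : Fin 4) (x : E4) : ℝ :=
  a x * palVec g Q x μ + b * dualVec g Q x μ

/-- The bilinear form whose quadratic form is the part of the generalised Lagrangian quadratic in
`Q`; the arrays `G`, `I` are the components of the metric and of its inverse, `r = √|det G|`. -/
noncomputable def genForm (a b : ℝ) (G I : Fin 4 → Fin 4 → ℝ) (r : ℝ) (Q P : Arr3) : ℝ :=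
  a * (r * scalForm I Q P) + b * dualForm G Q P

theorem sqrtDet_mul_sum_volUp {g : LMetric} {x : E4} (hr : sqrtDet g x ≠ 0)
    (F : Fin 4 → Fin 4 → Fin 4 → Fin 4 → ℝ) :
    (∑ α, ∑ β, ∑ μ, ∑ ν, volUp g x α β μ ν * F α β μ ν) * sqrtDet g x =
      -∑ α, ∑ β, ∑ μ, ∑ ν, eps α β μ ν * F α β μ ν := by
  simp only [Finset.sum_mul, ← Finset.sum_neg_distrib]
  refine sum4_congr fun α β μ ν => ?_
  simp only [volUp]
  field_simp

/-- The generalised bulk Lagrangian is the Einstein-Hilbert Lagrangian plus a divergence plus a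
quadratic form in `Q`. -/
theorem bulkGen_eq {a : E4 → ℝ} (b Λ : ℝ) {g : LMetric} {Q : LConn} {x : E4} (hg : MetricAt g x)
    (hQ : ∀ α β σ, ContDiffWithinAt ℝ 2 (fun y => Q y α β σ) halfSpace x)
    (ha : ∀ᶠ y in 𝓝[halfSpace] x, a y = a x) :
    bulkGen a b Λ g Q x = a x * bulkEH Λ g x + ∑ μ, pd μ (divVec a b g Q μ) x
      + genForm (a x) b (g x) (gInv g x) (sqrtDet g x) (Q x) (Q x) := by
  have hQ' : ∀ α β σ, DiffAt (fun y => Q y α β σ) x := fun α β σ =>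
    (hQ α β σ).differentiableWithinAt (by simp)
  have h1 := scalarCurv_fullConn hg hQ'
  have h2 := dual_fullConn hg hQ'
  have hpal : ∀ μ, DiffAt (fun y => palVec g Q y μ) x := fun μ =>
    hg.diffAt_sqrtDet.mul ((DifferentiableWithinAt.fun_sum fun β _ =>
      DifferentiableWithinAt.fun_sum fun δ _ => (hg.diffAt_gInv β δ).mul (hQ' μ δ β)).sub
      (DifferentiableWithinAt.fun_sum fun β _ =>
      DifferentiableWithinAt.fun_sum fun l _ => (hg.diffAt_gInv β μ).mul (hQ' l l β)))
  have hdual : ∀ μ, DiffAt (fun y => dualVec g Q y μ) x := fun μ =>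
    DifferentiableWithinAt.fun_neg (DifferentiableWithinAt.fun_sum fun α _ =>
      DifferentiableWithinAt.fun_sum fun β _ => DifferentiableWithinAt.fun_sum fun ν _ =>
      DifferentiableWithinAt.const_mul (DifferentiableWithinAt.fun_sum fun l _ =>
        (hg.diffAt α l).mul (hQ' l β ν)) _)
  have h3 : ∀ μ, pd μ (divVec a b g Q μ) x = a x * pd μ (fun y => palVec g Q y μ) x
      + b * pd μ (fun y => dualVec g Q y μ) x := by
    intro μ
    have e : divVec a b g Q μ =ᶠ[𝓝[halfSpace] x]
        fun y => a x * palVec g Q y μ + b * dualVec g Q y μ := by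
      filter_upwards [ha] with y hy
      rw [divVec, hy]
    rw [pd_congr hg.mem e, pd_add hg.mem μ ((hpal μ).const_mul _) ((hdual μ).const_mul _),
      pd_const_mul hg.mem μ _ (hpal μ), pd_const_mul hg.mem μ _ (hdual μ)]
  simp only [h3, Finset.sum_add_distrib, ← Finset.mul_sum]
  rw [bulkGen, sqrtDet_mul_sum_volUp hg.sqrtDet_pos.ne', h2]
  simp only [bulkPT, bulkEH, genForm, sub_mul, h1]
  ring

section Boundary

variable {g : LMetric} {x : E4} (hg : MetricAt g x) (h00 : 0 < gInv g x 0 0)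

include hg

omit hg in
theorem gInv_zero_zero : gInv g x 0 0 = (gBdry g x).det / (Matrix.of (g x)).det := by
  have h : (Matrix.of (g x)).adjugate 0 0 = (gBdry g x).det := by
    rw [Matrix.adjugate_fin_succ_eq_det_submatrix]
    simp only [Fin.val_zero, add_zero, pow_zero, one_mul]
    rfl
  rw [gInv, Matrix.inv_def, Matrix.smul_apply, h, Ring.inverse_eq_inv', smul_eq_mul]
  ring

include h00

omit hg in
theorem det_gBdry_ne : (gBdry g x).det ≠ 0 := by
  intro h
  rw [gInv_zero_zero, h, zero_div] at h00
  exact lt_irrefl _ h00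

theorem MetricAt.sqrtDetBdry_eq : sqrtDetBdry g x = sqrtDet g x * Real.sqrt (gInv g x 0 0) := by
  have h1 : |(gBdry g x).det| = |(Matrix.of (g x)).det| * gInv g x 0 0 := by
    rw [← abs_of_pos h00, ← abs_mul, gInv_zero_zero]
    congr 1
    have := hg.det_ne
    field_simp
  rw [sqrtDetBdry, sqrtDet, h1, Real.sqrt_mul (abs_nonneg _)]

omit hg h00 in
theorem nuLow_zero : nuLow g x 0 = -1 / Real.sqrt (gInv g x 0 0) := by simp [nuLow]

omit hg h00 in
theorem nuLow_succ (a : Fin 3) : nuLow g x a.succ = 0 := by simp [nuLow]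

omit hg h00 in
theorem sum_mul_nuLow (f : Fin 4 → ℝ) : ∑ l, f l * nuLow g x l = f 0 * nuLow g x 0 := by
  rw [Fin.sum_univ_succ]
  simp [nuLow_succ]

omit hg h00 in
theorem nuUp_eq (α : Fin 4) : nuUp g x α = gInv g x α 0 * nuLow g x 0 := by
  rw [nuUp, sum_mul_nuLow]

omit hg in
theorem nuLow_zero_mul_self : nuLow g x 0 * nuLow g x 0 * gInv g x 0 0 = 1 := by
  have hN : Real.sqrt (gInv g x 0 0) * Real.sqrt (gInv g x 0 0) = gInv g x 0 0 :=
    Real.mul_self_sqrt h00.le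
  have hpos := Real.sqrt_pos.2 h00
  rw [nuLow_zero]
  field_simp
  linarith

omit h00 in
theorem MetricAt.sum_g_mul_nuUp (α : Fin 4) : ∑ c, g x α c * nuUp g x c = nuLow g x α := by
  simp only [nuUp_eq, ← mul_assoc, ← Finset.sum_mul, hg.sum_g_mul_gInv]
  refine Fin.cases ?_ (fun a => ?_) α
  · simp
  · simp [nuLow_succ]

/-- The inverse of the induced metric, extended to four indices, is the projection
`g^{αβ} - ν^α ν^β`. -/
theorem MetricAt.sum_gBdry_inv (X : Fin 4 → Fin 4 → ℝ) :
    ∑ a : Fin 3, ∑ b : Fin 3, (gBdry g x)⁻¹ a b * X a.succ b.succ =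
      ∑ α, ∑ β, (gInv g x α β - nuUp g x α * nuUp g x β) * X α β := by
  have hν := nuLow_zero_mul_self h00
  have h0 : ∀ β, gInv g x 0 β - nuUp g x 0 * nuUp g x β = 0 := by
    intro β
    rw [nuUp_eq, nuUp_eq, hg.gInv_symm x β 0]
    linear_combination (-gInv g x 0 β) * hν
  have h0' : ∀ α, gInv g x α 0 - nuUp g x α * nuUp g x 0 = 0 := by
    intro α
    rw [mul_comm, hg.gInv_symm x α 0]
    exact h0 α
  have hinv : (gBdry g x)⁻¹ = Matrix.of fun a b : Fin 3 =>
      gInv g x a.succ b.succ - nuUp g x a.succ * nuUp g x b.succ := by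
    refine Matrix.inv_eq_left_inv ?_
    ext a c
    have h1 : ∑ β, (gInv g x a.succ β - nuUp g x a.succ * nuUp g x β) * g x β c.succ =
        if a = c then 1 else 0 := by
      have e1 : ∑ β, nuUp g x β * g x β c.succ = 0 := by
        rw [← nuLow_succ (g := g) (x := x) c, ← hg.sum_g_mul_nuUp]
        exact Finset.sum_congr rfl fun β _ => by rw [hg.symm x c.succ β]; ring
      simp only [sub_mul, Finset.sum_sub_distrib, hg.sum_gInv_mul_g, mul_assoc, ← Finset.mul_sum,
        e1, mul_zero, sub_zero, Fin.succ_inj]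
    rw [Fin.sum_univ_succ, h0', zero_mul, zero_add] at h1
    rw [Matrix.mul_apply, Matrix.one_apply, ← h1]
    rfl
  rw [Fin.sum_univ_succ (n := 3)]
  simp only [h0, zero_mul, Finset.sum_const_zero, zero_add]
  refine Finset.sum_congr rfl fun a _ => ?_
  rw [Fin.sum_univ_succ (n := 3), h0', zero_mul, zero_add]
  simp only [hinv, Matrix.of_apply]

theorem MetricAt.contDiff_nuLow (α : Fin 4) :
    ContDiffWithinAt ℝ 2 (fun y => nuLow g y α) halfSpace x := by
  unfold nuLow
  by_cases hα : α = 0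
  · simp only [hα, if_true]
    exact contDiffWithinAt_const.div ((hg.contDiff_gInv 0 0).sqrt h00.ne')
      (Real.sqrt_pos.2 h00).ne'
  · simp only [hα, if_false]
    exact contDiffWithinAt_const

theorem MetricAt.contDiff_nuUp (α : Fin 4) :
    ContDiffWithinAt ℝ 2 (fun y => nuUp g y α) halfSpace x :=
  ContDiffWithinAt.sum fun β _ => (hg.contDiff_gInv α β).mul (hg.contDiff_nuLow h00 β)

/-- The covariant derivatives of `ν_α` and `ν^α` for a connection that differs from the
Levi-Civita connection by `Q`. -/
theorem MetricAt.lower_nabla_nuUp (Q : LConn) (μ α : Fin 4) :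
    ∑ c, g x α c * (pd μ (fun y => nuUp g y c) x + ∑ l, fullConn g Q x c μ l * nuUp g x l) =
      (pd μ (fun y => nuLow g y α) x - ∑ l, christoffel g x l μ α * nuLow g x l)
        + ∑ c, g x α c * ∑ l, Q x c μ l * nuUp g x l := by
  have hd : ∀ c, DiffAt (fun y => nuUp g y c) x := fun c =>
    (hg.contDiff_nuUp h00 c).differentiableWithinAt (by simp)
  have h1 : (fun y => nuLow g y α) =ᶠ[𝓝[halfSpace] x] fun y => ∑ c, g y α c * nuUp g y c := by
    filter_upwards [hg.eventually_det_ne] with y hy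
    have e : ∀ β, ∑ s, g y α s * gInv g y s β = if α = β then 1 else 0 := by
      intro β
      have h := congrFun₂ (Matrix.mul_nonsing_inv (Matrix.of (g y)) (isUnit_iff_ne_zero.2 hy)) α β
      rw [Matrix.mul_apply, Matrix.one_apply] at h
      exact h
    simp only [nuUp_eq, ← mul_assoc, ← Finset.sum_mul, e]
    refine Fin.cases ?_ (fun a => ?_) α
    · simp
    · simp [nuLow_succ]
  have h2 : pd μ (fun y => nuLow g y α) x = ∑ c, (∑ s, (g x α s * christoffel g x s μ c
      + g x c s * christoffel g x s μ α) * nuUp g x c + g x α c * pd μ (fun y => nuUp g y c) x) := by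
    rw [pd_congr hg.mem h1, pd_sum (F := fun c y => g y α c * nuUp g y c) hg.mem μ
      fun c _ => (hg.diffAt α c).mul (hd c)]
    refine Finset.sum_congr rfl fun c _ => ?_
    rw [pd_mul hg.mem μ (hg.diffAt α c) (hd c), hg.pd_metric, Finset.sum_mul]
  have h3 : ∑ l, christoffel g x l μ α * nuLow g x l =
      ∑ c, ∑ s, g x c s * christoffel g x s μ α * nuUp g x c := by
    rw [Finset.sum_comm]
    refine Finset.sum_congr rfl fun l _ => ?_
    rw [← hg.sum_g_mul_nuUp, Finset.mul_sum]
    exact Finset.sum_congr rfl fun c _ => by rw [hg.symm x l c]; ring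
  have h4 : ∑ c, g x α c * ∑ l, christoffel g x c μ l * nuUp g x l =
      ∑ c, ∑ s, g x α s * christoffel g x s μ c * nuUp g x c := by
    rw [Finset.sum_comm]
    refine Finset.sum_congr rfl fun l _ => ?_
    rw [Finset.mul_sum]
    exact Finset.sum_congr rfl fun c _ => by ring
  rw [h2, h3]
  simp only [fullConn, add_mul, mul_add, Finset.sum_add_distrib, h4]
  ring

/-- The term that `Q` adds to the mean curvature is, up to a factor, the normal component of the
vector whose divergence occurs in the scalar curvature; it will cancel the boundary term of that
divergence. -/
theorem MetricAt.genMeanCurv_fullConn (Q : LConn) :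
    genMeanCurv g (fullConn g Q) x = meanCurv g x
      - (1 / 2) * (nuLow g x 0 * (∑ β, ∑ δ, gInv g x β δ * Q x 0 δ β
        - ∑ β, ∑ l, gInv g x β 0 * Q x l l β)) := by
  have hsum : ∀ X Y : Fin 3 → Fin 3 → ℝ, ∑ a : Fin 3, ∑ b : Fin 3, (gBdry g x)⁻¹ a b * ((1 / 2) *
      (X a b + Y a b)) = (1 / 2) * (∑ a : Fin 3, ∑ b : Fin 3, (gBdry g x)⁻¹ a b * X a b
        + ∑ a : Fin 3, ∑ b : Fin 3, (gBdry g x)⁻¹ a b * Y a b) := by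
    intro X Y
    simp only [Finset.mul_sum, ← Finset.sum_add_distrib]
    exact Finset.sum_congr rfl fun a _ => Finset.sum_congr rfl fun b _ => by ring
  have hsymm : ∀ a b, (gBdry g x)⁻¹ a b = (gBdry g x)⁻¹ b a := by
    intro a b
    have h : (gBdry g x).transpose = gBdry g x := by
      ext a b
      exact hg.symm x _ _
    conv_lhs => rw [← h, ← Matrix.transpose_nonsing_inv]
    rfl
  have hsplit : ∀ X Y : Fin 3 → Fin 3 → ℝ, ∑ a : Fin 3, ∑ b : Fin 3, (gBdry g x)⁻¹ a b *
      (X a b + Y a b) = ∑ a : Fin 3, ∑ b : Fin 3, (gBdry g x)⁻¹ a b * X a b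
        + ∑ a : Fin 3, ∑ b : Fin 3, (gBdry g x)⁻¹ a b * Y a b := by
    intro X Y
    simp only [← Finset.sum_add_distrib]
    exact Finset.sum_congr rfl fun a _ => Finset.sum_congr rfl fun b _ => by ring
  have h1 : ∑ a : Fin 3, ∑ b : Fin 3, (gBdry g x)⁻¹ a b * (pd a.succ (fun y => nuLow g y b.succ) x
      - ∑ l, fullConn g Q x l a.succ b.succ * nuLow g x l) = meanCurv g x
      + ∑ a : Fin 3, ∑ b : Fin 3, (gBdry g x)⁻¹ a b * -(Q x 0 a.succ b.succ * nuLow g x 0) := by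
    unfold meanCurv
    rw [← hsplit]
    refine Finset.sum_congr rfl fun a _ => Finset.sum_congr rfl fun b _ => ?_
    rw [sum_mul_nuLow, sum_mul_nuLow, fullConn]
    ring
  have h2 : ∑ a : Fin 3, ∑ b : Fin 3, (gBdry g x)⁻¹ a b * ∑ c, g x a.succ c *
        (pd b.succ (fun y => nuUp g y c) x + ∑ l, fullConn g Q x c b.succ l * nuUp g x l) =
      meanCurv g x + ∑ a : Fin 3, ∑ b : Fin 3, (gBdry g x)⁻¹ a b *
        ∑ c, g x a.succ c * ∑ l, Q x c b.succ l * nuUp g x l := by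
    have e : ∑ a : Fin 3, ∑ b : Fin 3, (gBdry g x)⁻¹ a b * ∑ c, g x a.succ c *
        (pd b.succ (fun y => nuUp g y c) x + ∑ l, fullConn g Q x c b.succ l * nuUp g x l) =
        ∑ a : Fin 3, ∑ b : Fin 3, (gBdry g x)⁻¹ a b * ((pd b.succ (fun y => nuLow g y a.succ) x
          - ∑ l, christoffel g x l b.succ a.succ * nuLow g x l)
          + ∑ c, g x a.succ c * ∑ l, Q x c b.succ l * nuUp g x l) :=
      Finset.sum_congr rfl fun a _ => Finset.sum_congr rfl fun b _ => by
        rw [hg.lower_nabla_nuUp h00]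
    rw [e, hsplit (fun a b => pd b.succ (fun y => nuLow g y a.succ) x
          - ∑ l, christoffel g x l b.succ a.succ * nuLow g x l)]
    congr 1
    rw [Finset.sum_comm]
    exact Finset.sum_congr rfl fun a _ => Finset.sum_congr rfl fun b _ => by rw [hsymm a b]
  unfold genMeanCurv
  rw [hsum, h1, h2, hg.sum_gBdry_inv h00 fun α β => -(Q x 0 α β * nuLow g x 0),
    hg.sum_gBdry_inv h00 fun α β => ∑ c, g x α c * ∑ l, Q x c β l * nuUp g x l]
  have t1 : ∑ α, ∑ β, (gInv g x α β - nuUp g x α * nuUp g x β) * -(Q x 0 α β * nuLow g x 0) =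
      -(nuLow g x 0 * ∑ α, ∑ β, gInv g x α β * Q x 0 α β)
        + nuLow g x 0 * ∑ α, ∑ β, nuUp g x α * nuUp g x β * Q x 0 α β := by
    simp only [Finset.mul_sum, ← Finset.sum_add_distrib, ← Finset.sum_neg_distrib]
    exact Finset.sum_congr rfl fun a _ => Finset.sum_congr rfl fun b _ => by ring
  have t2 : ∑ α, ∑ β, (gInv g x α β - nuUp g x α * nuUp g x β) *
      ∑ c, g x α c * ∑ l, Q x c β l * nuUp g x l =
      ∑ β, ∑ l, Q x β β l * nuUp g x l
        - ∑ β, nuUp g x β * (nuLow g x 0 * ∑ l, Q x 0 β l * nuUp g x l) := by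
    have e1 : ∀ β c, ∑ α, (gInv g x α β - nuUp g x α * nuUp g x β) * g x α c =
        (if β = c then 1 else 0) - nuUp g x β * nuLow g x c := by
      intro β c
      rw [← hg.sum_gInv_mul_g, ← hg.sum_g_mul_nuUp, Finset.mul_sum, ← Finset.sum_sub_distrib]
      exact Finset.sum_congr rfl fun α _ => by rw [hg.gInv_symm x β α, hg.symm x c α]; ring
    have e2 : ∑ α, ∑ β, (gInv g x α β - nuUp g x α * nuUp g x β) *
        ∑ c, g x α c * ∑ l, Q x c β l * nuUp g x l =
        ∑ β, ∑ c, (∑ α, (gInv g x α β - nuUp g x α * nuUp g x β) * g x α c) *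
          ∑ l, Q x c β l * nuUp g x l := by
      rw [Finset.sum_comm]
      refine Finset.sum_congr rfl fun β _ => ?_
      simp only [Finset.sum_mul]
      rw [Finset.sum_comm]
      refine Finset.sum_congr rfl fun α _ => ?_
      rw [Finset.mul_sum]
      exact Finset.sum_congr rfl fun c _ => by ring
    rw [e2, ← Finset.sum_sub_distrib]
    refine Finset.sum_congr rfl fun β _ => ?_
    simp only [e1]
    simp only [sub_mul, Finset.sum_sub_distrib, ite_mul, one_mul, zero_mul, Finset.sum_ite_eq,
      Finset.mem_univ, if_true]
    congr 1
    have h5 := sum_mul_nuLow (g := g) (x := x)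
      fun c => nuUp g x β * ∑ l, Q x c β l * nuUp g x l
    rw [mul_comm (nuLow g x 0), ← mul_assoc, ← h5]
    exact Finset.sum_congr rfl fun c _ => by ring
  have t3 : ∑ β, ∑ l, Q x β β l * nuUp g x l =
      nuLow g x 0 * ∑ β, ∑ l, gInv g x β 0 * Q x l l β := by
    rw [Finset.sum_comm]
    simp only [Finset.mul_sum, nuUp_eq]
    exact Finset.sum_congr rfl fun a _ => Finset.sum_congr rfl fun b _ => by ring
  have t4 : ∑ β, nuUp g x β * (nuLow g x 0 * ∑ l, Q x 0 β l * nuUp g x l) =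
      nuLow g x 0 * ∑ α, ∑ β, nuUp g x α * nuUp g x β * Q x 0 α β := by
    simp only [Finset.mul_sum]
    exact Finset.sum_congr rfl fun a _ => Finset.sum_congr rfl fun b _ => by ring
  have t5 : ∑ α, ∑ β, gInv g x α β * Q x 0 α β = ∑ β, ∑ δ, gInv g x β δ * Q x 0 δ β := by
    rw [Finset.sum_comm]
    exact Finset.sum_congr rfl fun a _ => Finset.sum_congr rfl fun b _ => by
      rw [hg.gInv_symm x b a]
  rw [t1, t2, t3, t4, t5]
  ring

theorem MetricAt.nuLow_zero_mul_sqrtDetBdry : nuLow g x 0 * sqrtDetBdry g x = -sqrtDet g x := by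
  have hpos := Real.sqrt_pos.2 h00
  rw [hg.sqrtDetBdry_eq h00, nuLow_zero]
  field_simp

theorem MetricAt.normal_qVec_mul_sqrtDetBdry (Q : LConn) :
    (∑ μ, nuLow g x μ * qVec g Q x μ) * sqrtDetBdry g x = -dualVec g Q x 0 := by
  have hN := hg.nuLow_zero_mul_sqrtDetBdry h00
  have e : qVec g Q x 0 * sqrtDet g x = dualVec g Q x 0 := by
    have hr := hg.sqrtDet_pos.ne'
    simp only [qVec, dualVec, Finset.sum_mul, ← Finset.sum_neg_distrib]
    refine Finset.sum_congr rfl fun α _ => Finset.sum_congr rfl fun β _ =>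
      Finset.sum_congr rfl fun ν _ => ?_
    simp only [volUp]
    field_simp
  simp only [mul_comm (nuLow g x _) _, sum_mul_nuLow]
  linear_combination qVec g Q x 0 * hN - e

/-- The generalised boundary Lagrangian is the Gibbons-Hawking-York term up to the normal component
of the vector density in the decomposition of the bulk Lagrangian. -/
theorem bdryGen_eq (a : E4 → ℝ) (b : ℝ) (Q : LConn) :
    bdryGen a b g Q x = a x * bdryGHY g x - divVec a b g Q 0 x := by
  have hN := hg.nuLow_zero_mul_sqrtDetBdry h00
  have h1 : bdryPT g Q x = bdryGHY g x - palVec g Q x 0 := by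
    unfold bdryPT bdryGHY palVec
    rw [hg.genMeanCurv_fullConn h00]
    linear_combination (∑ β, ∑ δ, gInv g x β δ * Q x 0 δ β
      - ∑ β, ∑ l, gInv g x β 0 * Q x l l β) * hN
  rw [bdryGen, h1, hg.normal_qVec_mul_sqrtDetBdry h00, divVec]
  ring

end Boundary

/-! ### Tetrads and the Holst Lagrangian -/

theorem η_mul_self (I : Fin 4) : η I * η I = 1 := by
  unfold η
  split_ifs <;> norm_num

/-- A cotetrad that is `C²` and nondegenerate at a point of the half-space. -/
structure TetradAt (e : LTetrad) (x : E4) : Prop where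
  mem : x ∈ halfSpace
  det_ne : (Matrix.of (e x)).det ≠ 0
  contDiff : ∀ I α, ContDiffWithinAt ℝ 2 (fun y => e y I α) halfSpace x

theorem tetradMetric_symm (e : LTetrad) (y : E4) (α β : Fin 4) :
    tetradMetric e y α β = tetradMetric e y β α :=
  Finset.sum_congr rfl fun I _ => by ring

theorem tetradMetric_eq_mul (e : LTetrad) (x : E4) : Matrix.of (tetradMetric e x) =
    (Matrix.of (e x)).transpose * (Matrix.diagonal η * Matrix.of (e x)) := by
  ext α β
  rw [Matrix.mul_apply]
  simp only [Matrix.diagonal_mul, Matrix.transpose_apply, Matrix.of_apply, tetradMetric]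
  exact Finset.sum_congr rfl fun I _ => by ring

theorem det_tetradMetric (e : LTetrad) (x : E4) :
    (Matrix.of (tetradMetric e x)).det = -((Matrix.of (e x)).det * (Matrix.of (e x)).det) := by
  rw [tetradMetric_eq_mul, Matrix.det_mul, Matrix.det_mul, Matrix.det_transpose,
    Matrix.det_diagonal]
  simp [η]

theorem sqrtDet_tetradMetric (e : LTetrad) (x : E4) :
    sqrtDet (tetradMetric e) x = |(Matrix.of (e x)).det| := by
  rw [sqrtDet, det_tetradMetric, abs_neg, abs_mul, Real.sqrt_mul_self (abs_nonneg _)]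

theorem sum_tetrad_mul_dual {e : LTetrad} {x : E4} (h : (Matrix.of (e x)).det ≠ 0) (I J : Fin 4) :
    ∑ α, e x I α * dualTetrad e x α J = if I = J then 1 else 0 := by
  have h := congrFun₂ (Matrix.mul_nonsing_inv (Matrix.of (e x)) (isUnit_iff_ne_zero.2 h)) I J
  rw [Matrix.mul_apply, Matrix.one_apply] at h
  exact h

theorem sum_dual_mul_tetrad {e : LTetrad} {x : E4} (h : (Matrix.of (e x)).det ≠ 0) (α β : Fin 4) :
    ∑ I, dualTetrad e x α I * e x I β = if α = β then 1 else 0 := by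
  have h := congrFun₂ (Matrix.nonsing_inv_mul (Matrix.of (e x)) (isUnit_iff_ne_zero.2 h)) α β
  rw [Matrix.mul_apply, Matrix.one_apply] at h
  exact h

theorem gInv_tetradMetric {e : LTetrad} {x : E4} (h : (Matrix.of (e x)).det ≠ 0) (α β : Fin 4) :
    gInv (tetradMetric e) x α β = ∑ I, η I * (dualTetrad e x α I * dualTetrad e x β I) := by
  have hu := isUnit_iff_ne_zero.2 h
  have h1 : (Matrix.of (tetradMetric e x))⁻¹ = (Matrix.of (e x))⁻¹ *
      (Matrix.diagonal η * ((Matrix.of (e x))⁻¹).transpose) := by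
    refine Matrix.inv_eq_right_inv ?_
    have hη : Matrix.diagonal η * Matrix.diagonal η = 1 := by
      rw [Matrix.diagonal_mul_diagonal, ← Matrix.diagonal_one]
      simp only [η_mul_self]
    rw [tetradMetric_eq_mul]
    calc (Matrix.of (e x)).transpose * (Matrix.diagonal η * Matrix.of (e x)) *
        ((Matrix.of (e x))⁻¹ * (Matrix.diagonal η * ((Matrix.of (e x))⁻¹).transpose))
        = (Matrix.of (e x)).transpose * (Matrix.diagonal η * (Matrix.of (e x) *
          (Matrix.of (e x))⁻¹) * Matrix.diagonal η) * ((Matrix.of (e x))⁻¹).transpose := by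
          simp only [Matrix.mul_assoc]
      _ = 1 := by
          rw [Matrix.mul_nonsing_inv _ hu, Matrix.mul_one, hη, Matrix.mul_one,
            ← Matrix.transpose_mul, Matrix.nonsing_inv_mul _ hu, Matrix.transpose_one]
  rw [gInv, h1, Matrix.mul_apply]
  refine Finset.sum_congr rfl fun I _ => ?_
  rw [Matrix.diagonal_mul, Matrix.transpose_apply, dualTetrad, dualTetrad]
  ring

theorem TetradAt.metricAt {e : LTetrad} {x : E4} (he : TetradAt e x) :
    MetricAt (tetradMetric e) x where
  mem := he.mem
  symm := tetradMetric_symm e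
  det_ne := by
    rw [det_tetradMetric]
    simpa using he.det_ne
  contDiff α β := ContDiffWithinAt.sum fun I _ =>
    contDiffWithinAt_const.mul ((he.contDiff I α).mul (he.contDiff I β))

namespace TetradAt

variable {e : LTetrad} {x : E4} (he : TetradAt e x)

include he

theorem diffAt (I α : Fin 4) : DiffAt (fun y => e y I α) x :=
  (he.contDiff I α).differentiableWithinAt (by simp)

theorem contDiff_dual (α I : Fin 4) :
    ContDiffWithinAt ℝ 2 (fun y => dualTetrad e y α I) halfSpace x :=
  contDiffWithinAt_matrix_inv (A := fun y => Matrix.of (e y)) he.contDiff he.det_ne α I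

theorem diffAt_dual (α I : Fin 4) : DiffAt (fun y => dualTetrad e y α I) x :=
  (he.contDiff_dual α I).differentiableWithinAt (by simp)

theorem eventually_det_ne : ∀ᶠ y in 𝓝[halfSpace] x, (Matrix.of (e y)).det ≠ 0 :=
  (contDiffWithinAt_det (A := fun y => Matrix.of (e y)) he.contDiff).continuousWithinAt.eventually_ne
    he.det_ne

theorem eventually : ∀ᶠ y in 𝓝[halfSpace] x, TetradAt e y := by
  have h : ∀ I α, ∀ᶠ y in 𝓝[halfSpace] x,
      ContDiffWithinAt ℝ 2 (fun y => e y I α) halfSpace y := by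
    intro I α
    have := (he.contDiff I α).eventually (by simp)
    rwa [insert_eq_of_mem he.mem] at this
  filter_upwards [he.eventually_det_ne, self_mem_nhdsWithin,
    eventually_all.2 fun I => eventually_all.2 fun α => h I α] with y h1 h2 h3
  exact ⟨h2, h1, h3⟩

theorem sum_tetrad_mul_pd_dual (μ K J : Fin 4) :
    ∑ α, e x K α * pd μ (fun y => dualTetrad e y α J) x =
      -∑ α, pd μ (fun y => e y K α) x * dualTetrad e x α J := by
  have h1 : (fun y => ∑ α, e y K α * dualTetrad e y α J) =ᶠ[𝓝[halfSpace] x]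
      fun _ => if K = J then 1 else 0 := by
    filter_upwards [he.eventually_det_ne] with y hy
    exact sum_tetrad_mul_dual hy K J
  have h2 := pd_congr he.mem h1 μ
  rw [pd_const, pd_sum (F := fun α y => e y K α * dualTetrad e y α J) he.mem μ
    fun α _ => (he.diffAt K α).mul (he.diffAt_dual α J)] at h2
  have h3 : ∀ α, pd μ (fun y => e y K α * dualTetrad e y α J) x =
      pd μ (fun y => e y K α) x * dualTetrad e x α J
        + e x K α * pd μ (fun y => dualTetrad e y α J) x :=
    fun α => pd_mul he.mem μ (he.diffAt K α) (he.diffAt_dual α J)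
  simp only [h3, Finset.sum_add_distrib] at h2
  linarith

/-- The tetrad postulate: `Q = φ(e, ω)` is defined in such a way that the tetrad is parallel for
the connection with coefficients `Γ + Q` and connection form `ω`. -/
theorem tetrad_mul_fullConn (w : LSpin) (K μ β : Fin 4) :
    ∑ α, e x K α * fullConn (tetradMetric e) (tetradQ e w) x α μ β =
      pd μ (fun y => e y K β) x + ∑ J, η K * w x μ K J * e x J β := by
  have h1 : ∑ α, e x K α * tetradQ e w x α μ β =
      ∑ J, e x J β * (η K * w x μ K J - lcSpin e x μ K J) := by
    have e1 : ∀ α, e x K α * tetradQ e w x α μ β = ∑ L, (e x K α * dualTetrad e x α L) *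
        ∑ J, e x J β * (η L * w x μ L J - lcSpin e x μ L J) := by
      intro α
      simp only [tetradQ, Finset.mul_sum]
      exact Finset.sum_congr rfl fun L _ => Finset.sum_congr rfl fun J _ => by ring
    simp only [e1]
    rw [Finset.sum_comm]
    simp only [← Finset.sum_mul, sum_tetrad_mul_dual he.det_ne, ite_mul, one_mul, zero_mul,
      Finset.sum_ite_eq, Finset.mem_univ, if_true]
  have h2 : ∑ J, e x J β * lcSpin e x μ K J = -pd μ (fun y => e y K β) x
      + ∑ α, e x K α * christoffel (tetradMetric e) x α μ β := by
    have e2 : ∀ J, lcSpin e x μ K J = -∑ α, pd μ (fun y => e y K α) x * dualTetrad e x α J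
        + ∑ α, e x K α * ∑ l, christoffel (tetradMetric e) x α μ l * dualTetrad e x l J := by
      intro J
      rw [← he.sum_tetrad_mul_pd_dual, ← Finset.sum_add_distrib]
      exact Finset.sum_congr rfl fun α _ => by ring
    have e3 : ∑ J, e x J β * ∑ α, pd μ (fun y => e y K α) x * dualTetrad e x α J =
        pd μ (fun y => e y K β) x := by
      simp only [Finset.mul_sum]
      rw [Finset.sum_comm]
      have : ∀ α, ∑ J, e x J β * (pd μ (fun y => e y K α) x * dualTetrad e x α J) =
          (if α = β then 1 else 0) * pd μ (fun y => e y K α) x := by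
        intro α
        rw [← sum_dual_mul_tetrad he.det_ne, Finset.sum_mul]
        exact Finset.sum_congr rfl fun J _ => by ring
      simp only [this, ite_mul, one_mul, zero_mul, Finset.sum_ite_eq', Finset.mem_univ, if_true]
    have e4 : ∑ J, e x J β * ∑ α, e x K α *
          ∑ l, christoffel (tetradMetric e) x α μ l * dualTetrad e x l J =
        ∑ α, e x K α * christoffel (tetradMetric e) x α μ β := by
      simp only [Finset.mul_sum]
      rw [Finset.sum_comm]
      refine Finset.sum_congr rfl fun α _ => ?_
      rw [Finset.sum_comm]
      have : ∀ l, ∑ J, e x J β * (e x K α *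
          (christoffel (tetradMetric e) x α μ l * dualTetrad e x l J)) =
          (if l = β then 1 else 0) * (e x K α * christoffel (tetradMetric e) x α μ l) := by
        intro l
        rw [← sum_dual_mul_tetrad he.det_ne, Finset.sum_mul]
        exact Finset.sum_congr rfl fun J _ => by ring
      simp only [this, ite_mul, one_mul, zero_mul, Finset.sum_ite_eq', Finset.mem_univ, if_true]
    simp only [e2, mul_add, mul_neg, Finset.sum_add_distrib, Finset.sum_neg_distrib, e3, e4]
  simp only [fullConn, mul_add, Finset.sum_add_distrib, h1]
  simp only [mul_sub, Finset.sum_sub_distrib, h2]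
  have h3 : ∑ J, e x J β * (η K * w x μ K J) = ∑ J, η K * w x μ K J * e x J β :=
    Finset.sum_congr rfl fun J _ => by ring
  rw [h3]
  ring

theorem fullConn_eq (w : LSpin) (α μ β : Fin 4) :
    fullConn (tetradMetric e) (tetradQ e w) x α μ β = ∑ K, dualTetrad e x α K *
      (pd μ (fun y => e y K β) x + ∑ J, η K * w x μ K J * e x J β) := by
  simp only [← he.tetrad_mul_fullConn, Finset.mul_sum]
  rw [Finset.sum_comm]
  simp only [← mul_assoc, ← Finset.sum_mul, sum_dual_mul_tetrad he.det_ne, ite_mul, one_mul,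
    zero_mul, Finset.sum_ite_eq, Finset.mem_univ, if_true]

theorem diffAt_fullConn {w : LSpin} (hw : ∀ μ I J, DiffAt (fun y => w y μ I J) x) (α μ β : Fin 4) :
    DiffAt (fun y => fullConn (tetradMetric e) (tetradQ e w) y α μ β) x := by
  have h1 : (fun y => fullConn (tetradMetric e) (tetradQ e w) y α μ β) =ᶠ[𝓝[halfSpace] x]
      fun y => ∑ K, dualTetrad e y α K *
        (pd μ (fun y => e y K β) y + ∑ J, η K * w y μ K J * e y J β) := by
    filter_upwards [he.eventually] with y hy
    exact hy.fullConn_eq w α μ β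
  refine DifferentiableWithinAt.congr_of_eventuallyEq ?_ h1 (he.fullConn_eq w α μ β)
  refine DifferentiableWithinAt.fun_sum fun K _ => (he.diffAt_dual α K).mul
    (DifferentiableWithinAt.add ?_ (DifferentiableWithinAt.fun_sum fun J _ =>
      ((hw μ K J).const_mul _).mul (he.diffAt J β)))
  exact (contDiffWithinAt_pd (m := 1) he.mem μ (he.contDiff K β)
    (by norm_num)).differentiableWithinAt (by simp)

end TetradAt

/-- Curvature of a connection form with its first internal index raised, `F_{μν}^K_J`. -/
noncomputable def spinCurvMixed (w : LSpin) (x : E4) (K J μ ν : Fin 4) : ℝ :=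
  η K * (pd μ (fun y => w y ν K J) x - pd ν (fun y => w y μ K J) x
    + ∑ L, η L * (w x μ K L * w x ν L J - w x ν K L * w x μ L J))

theorem spinCurv_eq (w : LSpin) (x : E4) (I J μ ν : Fin 4) :
    spinCurv w x I J μ ν = η J * spinCurvMixed w x I J μ ν := by
  rw [spinCurv, spinCurvMixed]; ring

theorem spinCurv_swap (w : LSpin) (x : E4) (I J μ ν : Fin 4) :
    spinCurv w x I J ν μ = -spinCurv w x I J μ ν := by
  have : ∑ K, η K * (w x ν I K * w x μ K J - w x μ I K * w x ν K J) =
      -∑ K, η K * (w x μ I K * w x ν K J - w x ν I K * w x μ K J) := by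
    rw [← Finset.sum_neg_distrib]
    exact Finset.sum_congr rfl fun K _ => by ring
  rw [spinCurv, spinCurv, this]
  ring

/-- Cartan's second structure equation: the curvature of the connection form is the curvature of
the connection. -/
theorem TetradAt.tetrad_mul_riemann {e : LTetrad} {x : E4} (he : TetradAt e x) {w : LSpin}
    (hw : ∀ μ I J, DiffAt (fun y => w y μ I J) x) (K β μ ν : Fin 4) :
    ∑ ρ, e x K ρ * riemann (fullConn (tetradMetric e) (tetradQ e w)) x ρ β μ ν =
      ∑ J, spinCurvMixed w x K J μ ν * e x J β := by
  set C := fullConn (tetradMetric e) (tetradQ e w) with hC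
  let me : Matrix (Fin 4) (Fin 4) ℝ := Matrix.of (e x)
  let mC : Fin 4 → Matrix (Fin 4) (Fin 4) ℝ := fun μ => Matrix.of fun α β => C x α μ β
  let mW : Fin 4 → Matrix (Fin 4) (Fin 4) ℝ := fun μ => Matrix.of fun I J => η I * w x μ I J
  let de : Fin 4 → Matrix (Fin 4) (Fin 4) ℝ := fun μ =>
    Matrix.of fun I α => pd μ (fun y => e y I α) x
  let dC : Fin 4 → Fin 4 → Matrix (Fin 4) (Fin 4) ℝ := fun μ ν =>
    Matrix.of fun α β => pd μ (fun y => C y α ν β) x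
  let dW : Fin 4 → Fin 4 → Matrix (Fin 4) (Fin 4) ℝ := fun μ ν =>
    Matrix.of fun I J => η I * pd μ (fun y => w y ν I J) x
  let dde : Fin 4 → Fin 4 → Matrix (Fin 4) (Fin 4) ℝ := fun μ ν =>
    Matrix.of fun I α => pd μ (pd ν (fun y => e y I α)) x
  have hdde : dde μ ν = dde ν μ := by
    ext I α
    exact pd_comm he.mem μ (he.contDiff I α) ν
  have h1 : ∀ μ, me * mC μ = de μ + mW μ * me := by
    intro μ
    ext K β
    rw [Matrix.mul_apply, Matrix.add_apply, Matrix.mul_apply]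
    exact he.tetrad_mul_fullConn w K μ β
  have h2 : ∀ μ ν, de μ * mC ν + me * dC μ ν = dde μ ν + dW μ ν * me + mW ν * de μ := by
    intro μ ν
    ext K β
    have e1 : (fun y => ∑ α, e y K α * C y α ν β) =ᶠ[𝓝[halfSpace] x]
        fun y => pd ν (fun y => e y K β) y + ∑ J, η K * w y ν K J * e y J β := by
      filter_upwards [he.eventually] with y hy
      exact hy.tetrad_mul_fullConn w K ν β
    have e2 := pd_congr he.mem e1 μ
    have hdC : ∀ α, DiffAt (fun y => C y α ν β) x := fun α => he.diffAt_fullConn hw α ν β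
    have hp : DiffAt (pd ν (fun y => e y K β)) x :=
      (contDiffWithinAt_pd (m := 1) he.mem ν (he.contDiff K β)
        (by norm_num)).differentiableWithinAt (by simp)
    have hwe : ∀ J, DiffAt (fun y => η K * w y ν K J * e y J β) x := fun J =>
      ((hw ν K J).const_mul _).mul (he.diffAt J β)
    rw [pd_sum (F := fun α y => e y K α * C y α ν β) he.mem μ
        fun α _ => (he.diffAt K α).mul (hdC α),
      pd_add he.mem μ hp (DifferentiableWithinAt.fun_sum fun J _ => hwe J),
      pd_sum (F := fun J y => η K * w y ν K J * e y J β) he.mem μ fun J _ => hwe J] at e2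
    have e3 : ∀ α, pd μ (fun y => e y K α * C y α ν β) x =
        pd μ (fun y => e y K α) x * C x α ν β + e x K α * pd μ (fun y => C y α ν β) x :=
      fun α => pd_mul he.mem μ (he.diffAt K α) (hdC α)
    have e4 : ∀ J, pd μ (fun y => η K * w y ν K J * e y J β) x =
        η K * pd μ (fun y => w y ν K J) x * e x J β
          + η K * w x ν K J * pd μ (fun y => e y J β) x := by
      intro J
      rw [pd_mul he.mem μ ((hw ν K J).const_mul _) (he.diffAt J β),
        pd_const_mul he.mem μ _ (hw ν K J)]
    simp only [e3, e4, Finset.sum_add_distrib] at e2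
    rw [← add_assoc] at e2
    simp only [Matrix.add_apply, Matrix.mul_apply]
    exact e2
  have h3 : me * (dC μ ν - dC ν μ + (mC μ * mC ν - mC ν * mC μ)) =
      (dW μ ν - dW ν μ + (mW μ * mW ν - mW ν * mW μ)) * me := by
    have a1 : me * dC μ ν = dde μ ν + dW μ ν * me + mW ν * de μ - de μ * mC ν :=
      eq_sub_of_add_eq' (h2 μ ν)
    have a2 : me * dC ν μ = dde ν μ + dW ν μ * me + mW μ * de ν - de ν * mC μ :=
      eq_sub_of_add_eq' (h2 ν μ)
    have b1 : me * (mC μ * mC ν) = de μ * mC ν + mW μ * (de ν + mW ν * me) := by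
      rw [← Matrix.mul_assoc, h1, add_mul, Matrix.mul_assoc, h1]
    have b2 : me * (mC ν * mC μ) = de ν * mC μ + mW ν * (de μ + mW μ * me) := by
      rw [← Matrix.mul_assoc, h1, add_mul, Matrix.mul_assoc, h1]
    rw [mul_add, mul_sub, mul_sub, a1, a2, b1, b2, hdde]
    noncomm_ring
  have h4 := congrFun₂ h3 K β
  rw [Matrix.mul_apply, Matrix.mul_apply] at h4
  refine Eq.trans (Finset.sum_congr rfl fun ρ _ => ?_)
    (h4.trans (Finset.sum_congr rfl fun J _ => ?_))
  · congr 1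
    simp only [riemann, Finset.sum_sub_distrib]
    rfl
  · congr 1
    simp only [spinCurvMixed, Matrix.add_apply, Matrix.sub_apply, Matrix.mul_apply, mul_add,
      mul_sub, Finset.mul_sum, Finset.sum_sub_distrib]
    simp only [dW, mW, Matrix.of_apply]
    congr 1
    congr 1 <;> exact Finset.sum_congr rfl fun L _ => by ring

/-! ### The bulk Holst Lagrangian -/

theorem sum_exchange (H X : Fin 4 → Fin 4 → ℝ) (Z : Fin 4 → Fin 4 → Fin 4 → Fin 4 → ℝ) :
    ∑ K, ∑ L, H K L * ∑ μ, ∑ ν, X μ ν * Z K L μ ν =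
      ∑ μ, ∑ ν, X μ ν * ∑ K, ∑ L, H K L * Z K L μ ν := by
  simp only [Finset.mul_sum]
  exact (sum4_swap23 _).trans ((sum4_swap12 _).trans ((sum4_swap34 _).trans ((sum4_swap23 _).trans
    (sum4_congr fun μ ν K L => by ring))))

section Bulk

variable {e : LTetrad} {x : E4} (h : (Matrix.of (e x)).det ≠ 0)

include h

/-- Contracting the internal Levi-Civita symbol with two tetrad components. -/
theorem sum_eps_tetrad_tetrad (I J ρ σ : Fin 4) : ∑ K, ∑ L, eps I J K L * (e x K ρ * e x L σ) =
    (Matrix.of (e x)).det * ∑ α, ∑ β, dualTetrad e x α I * dualTetrad e x β J * eps α β ρ σ := by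
  let G : Fin 4 → Fin 4 → ℝ := fun I J => ∑ K, ∑ L, eps I J K L * (e x K ρ * e x L σ)
  have h1 : ∀ α β, (Matrix.of (e x)).det * eps α β ρ σ =
      ∑ I, ∑ J, e x I α * e x J β * G I J := by
    intro α β
    rw [← sum_eps_mul_mul]
    simp only [G, Finset.mul_sum]
    exact sum4_congr fun I J K L => by ring
  have h2 : ∑ α, ∑ β, dualTetrad e x α I * dualTetrad e x β J *
      ∑ I', ∑ J', G I' J' * (e x I' α * e x J' β) = G I J := by
    rw [← sum_exchange]
    have h3 : ∀ I' J', ∑ α, ∑ β, dualTetrad e x α I * dualTetrad e x β J *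
        (e x I' α * e x J' β) = (if I' = I then 1 else 0) * (if J' = J then 1 else 0) := by
      intro I' J'
      rw [← sum_tetrad_mul_dual h, ← sum_tetrad_mul_dual h, Finset.sum_mul_sum]
      exact Finset.sum_congr rfl fun α _ => Finset.sum_congr rfl fun β _ => by ring
    simp only [h3]
    simp
  change G I J = _
  rw [← h2, Finset.mul_sum]
  refine Finset.sum_congr rfl fun α _ => ?_
  rw [Finset.mul_sum]
  refine Finset.sum_congr rfl fun β _ => ?_
  have h4 := h1 α β
  have h5 : ∑ I', ∑ J', G I' J' * (e x I' α * e x J' β) = (Matrix.of (e x)).det * eps α β ρ σ := by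
    rw [h4]
    exact Finset.sum_congr rfl fun α _ => Finset.sum_congr rfl fun β _ => by ring
  rw [h5]
  ring

/-- The two-form `H_{IJKL} e^K ∧ e^L` in terms of the dual tetrad. -/
theorem sum_Hten_tetrad_tetrad (γ : ℝ) (I J μ ν : Fin 4) :
    ∑ K, ∑ L, Hten γ I J K L * ∑ ρ, ∑ σ, eps μ ν ρ σ * (e x K ρ * e x L σ) =
      2 * (Matrix.of (e x)).det * (dualTetrad e x μ I * dualTetrad e x ν J
        - dualTetrad e x ν I * dualTetrad e x μ J)
      + 2 / γ * (η I * η J * ∑ ρ, ∑ σ, eps μ ν ρ σ * (e x I ρ * e x J σ)) := by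
  have h1 : ∑ K, ∑ L, eps I J K L * ∑ ρ, ∑ σ, eps μ ν ρ σ * (e x K ρ * e x L σ) =
      2 * (Matrix.of (e x)).det * (dualTetrad e x μ I * dualTetrad e x ν J
        - dualTetrad e x ν I * dualTetrad e x μ J) := by
    rw [sum_exchange]
    simp only [sum_eps_tetrad_tetrad h]
    have e1 : ∀ ρ σ, eps μ ν ρ σ * ((Matrix.of (e x)).det * ∑ α, ∑ β,
        dualTetrad e x α I * dualTetrad e x β J * eps α β ρ σ) = eps μ ν ρ σ *
        ∑ α, ∑ β, ((Matrix.of (e x)).det * (dualTetrad e x α I * dualTetrad e x β J))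
          * eps α β ρ σ := by
      intro ρ σ
      congr 1
      simp only [Finset.mul_sum]
      exact Finset.sum_congr rfl fun α _ => Finset.sum_congr rfl fun β _ => by ring
    simp only [e1]
    rw [sum_exchange]
    have e2 : ∀ α β, ∑ ρ, ∑ σ, eps μ ν ρ σ * eps α β ρ σ =
        2 * ((if α = μ then 1 else 0) * (if β = ν then 1 else 0)
          - (if α = ν then 1 else 0) * (if β = μ then 1 else 0)) := by
      intro α β
      rw [← sum_eps_mul_eps]
      exact Finset.sum_congr rfl fun α _ => Finset.sum_congr rfl fun β _ => by ring
    simp only [e2, mul_sub, Finset.sum_sub_distrib]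
    simp
    ring
  have h2 : ∑ K, ∑ L, (minkowski I K * minkowski J L - minkowski I L * minkowski J K) *
      ∑ ρ, ∑ σ, eps μ ν ρ σ * (e x K ρ * e x L σ) =
      2 * (η I * η J * ∑ ρ, ∑ σ, eps μ ν ρ σ * (e x I ρ * e x J σ)) := by
    have e1 : ∑ ρ, ∑ σ, eps μ ν ρ σ * (e x J ρ * e x I σ) =
        -∑ ρ, ∑ σ, eps μ ν ρ σ * (e x I ρ * e x J σ) := by
      rw [Finset.sum_comm]
      simp only [← Finset.sum_neg_distrib]
      exact Finset.sum_congr rfl fun α _ => Finset.sum_congr rfl fun β _ => by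
        rw [eps_swap34 μ ν α β]; ring
    simp only [sub_mul, Finset.sum_sub_distrib]
    have e2 : ∀ f : Fin 4 → Fin 4 → ℝ, ∑ K, ∑ L, minkowski I K * minkowski J L * f K L =
        η I * η J * f I J := by
      intro f
      simp [minkowski]
    have e3 : ∀ f : Fin 4 → Fin 4 → ℝ, ∑ K, ∑ L, minkowski I L * minkowski J K * f K L =
        η I * η J * f J I := by
      intro f
      simp [minkowski]
    rw [e2 fun K L => ∑ ρ, ∑ σ, eps μ ν ρ σ * (e x K ρ * e x L σ),
      e3 fun K L => ∑ ρ, ∑ σ, eps μ ν ρ σ * (e x K ρ * e x L σ), e1]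
    ring
  have h3 : ∀ K L, Hten γ I J K L * ∑ ρ, ∑ σ, eps μ ν ρ σ * (e x K ρ * e x L σ) =
      eps I J K L * ∑ ρ, ∑ σ, eps μ ν ρ σ * (e x K ρ * e x L σ) +
      1 / γ * ((minkowski I K * minkowski J L - minkowski I L * minkowski J K) *
        ∑ ρ, ∑ σ, eps μ ν ρ σ * (e x K ρ * e x L σ)) := by
    intro K L
    rw [Hten]
    ring
  simp only [h3, Finset.sum_add_distrib, ← Finset.mul_sum, h1, h2]
  ring

theorem sum_dual_tetrad_self : ∑ I, ∑ J, ∑ μ, ∑ ν, (e x I μ * e x J ν) *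
    (dualTetrad e x μ I * dualTetrad e x ν J - dualTetrad e x ν I * dualTetrad e x μ J) = 12 := by
  have h1 : ∀ I J, ∑ μ, ∑ ν, (e x I μ * e x J ν) *
      (dualTetrad e x μ I * dualTetrad e x ν J - dualTetrad e x ν I * dualTetrad e x μ J) =
      (if I = I then 1 else 0) * (if J = J then 1 else 0)
        - (if I = J then 1 else 0) * (if J = I then 1 else 0) := by
    intro I J
    rw [← sum_tetrad_mul_dual h, ← sum_tetrad_mul_dual h, ← sum_tetrad_mul_dual h,
      ← sum_tetrad_mul_dual h, Finset.sum_mul_sum, Finset.sum_mul_sum, ← Finset.sum_sub_distrib]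
    refine Finset.sum_congr rfl fun μ _ => ?_
    rw [← Finset.sum_sub_distrib]
    exact Finset.sum_congr rfl fun ν _ => by ring
  simp only [h1]
  simp
  norm_num

end Bulk

section Curvature

variable {e : LTetrad} {x : E4} (he : TetradAt e x) {w : LSpin}
  (hw : ∀ μ I J, DiffAt (fun y => w y μ I J) x)

include he hw

theorem TetradAt.riemann_eq (α β μ ν : Fin 4) :
    riemann (fullConn (tetradMetric e) (tetradQ e w)) x α β μ ν =
      ∑ K, dualTetrad e x α K * ∑ J, spinCurvMixed w x K J μ ν * e x J β := by
  simp only [← he.tetrad_mul_riemann hw]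
  simp only [Finset.mul_sum]
  rw [Finset.sum_comm]
  simp only [← mul_assoc, ← Finset.sum_mul, sum_dual_mul_tetrad he.det_ne, ite_mul, one_mul,
    zero_mul, Finset.sum_ite_eq, Finset.mem_univ, if_true]

theorem TetradAt.riemannLow_eq (α β μ ν : Fin 4) :
    riemannLow (tetradMetric e) (fullConn (tetradMetric e) (tetradQ e w)) x α β μ ν =
      ∑ K, ∑ J, (η K * spinCurvMixed w x K J μ ν) * (e x K α * e x J β) := by
  have h1 : ∀ l, tetradMetric e x α l *
      riemann (fullConn (tetradMetric e) (tetradQ e w)) x l β μ ν =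
      ∑ K, η K * e x K α * (e x K l *
        riemann (fullConn (tetradMetric e) (tetradQ e w)) x l β μ ν) := by
    intro l
    rw [tetradMetric, Finset.sum_mul]
    exact Finset.sum_congr rfl fun K _ => by ring
  unfold riemannLow
  simp only [h1]
  rw [Finset.sum_comm]
  refine Finset.sum_congr rfl fun K _ => ?_
  rw [← Finset.mul_sum, he.tetrad_mul_riemann hw, Finset.mul_sum]
  exact Finset.sum_congr rfl fun J _ => by ring

theorem TetradAt.scalarCurv_eq :
    scalarCurv (tetradMetric e) (fullConn (tetradMetric e) (tetradQ e w)) x =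
      ∑ I, ∑ J, ∑ μ, ∑ ν, spinCurv w x I J μ ν * (dualTetrad e x μ I * dualTetrad e x ν J) := by
  have h1 : ∀ δ J, ∑ β, gInv (tetradMetric e) x β δ * e x J β = η J * dualTetrad e x δ J := by
    intro δ J
    simp only [gInv_tetradMetric he.det_ne, Finset.sum_mul]
    rw [Finset.sum_comm]
    have : ∀ I, ∑ β, η I * (dualTetrad e x β I * dualTetrad e x δ I) * e x J β =
        (if J = I then 1 else 0) * (η I * dualTetrad e x δ I) := by
      intro I
      rw [← sum_tetrad_mul_dual he.det_ne, Finset.sum_mul]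
      exact Finset.sum_congr rfl fun β _ => by ring
    simp only [this, ite_mul, one_mul, zero_mul, Finset.sum_ite_eq, Finset.mem_univ, if_true]
  have h2 : ∀ β δ, gInv (tetradMetric e) x β δ *
      ∑ α, riemann (fullConn (tetradMetric e) (tetradQ e w)) x α β α δ =
      ∑ α, ∑ K, ∑ J, (dualTetrad e x α K * spinCurvMixed w x K J α δ) *
        (gInv (tetradMetric e) x β δ * e x J β) := by
    intro β δ
    simp only [he.riemann_eq hw, Finset.mul_sum]
    exact Finset.sum_congr rfl fun α _ => Finset.sum_congr rfl fun K _ =>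
      Finset.sum_congr rfl fun J _ => by ring
  have h3 : ∀ δ, ∑ β, gInv (tetradMetric e) x β δ *
      ∑ α, riemann (fullConn (tetradMetric e) (tetradQ e w)) x α β α δ =
      ∑ α, ∑ K, ∑ J, spinCurv w x K J α δ * (dualTetrad e x α K * dualTetrad e x δ J) := by
    intro δ
    simp only [h2]
    rw [Finset.sum_comm]
    refine Finset.sum_congr rfl fun α _ => ?_
    rw [Finset.sum_comm]
    refine Finset.sum_congr rfl fun K _ => ?_
    rw [Finset.sum_comm]
    refine Finset.sum_congr rfl fun J _ => ?_
    rw [← Finset.mul_sum, h1, spinCurv_eq]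
    ring
  unfold scalarCurv
  rw [Finset.sum_comm]
  simp only [h3]
  exact (sum4_swap23 _).trans ((sum4_swap34 _).trans ((sum4_swap12 _).trans
    ((sum4_swap23 _).trans (sum4_swap34 _))))

/-- The Holst Lagrangian of `(e, ω)` is the generalised Lagrangian of `(g, Q) = (η e e, φ(e, ω))`
whose first coefficient is the orientation sign of the tetrad. -/
theorem TetradAt.bulkHolst_eq {a : E4 → ℝ} (ha : a x = SignType.sign (Matrix.of (e x)).det)
    (Λ γ : ℝ) : bulkHolst Λ γ e w x =
      bulkGen a (1 / γ) Λ (tetradMetric e) (tetradQ e w) x := by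
  set d := (Matrix.of (e x)).det with hd
  have had : a x * |d| = d := by rw [ha]; exact sign_mul_abs d
  let X : Fin 4 → Fin 4 → Fin 4 → Fin 4 → ℝ := fun I J μ ν =>
    1 / 2 * spinCurv w x I J μ ν - Λ / 6 * (e x I μ * e x J ν)
  have h1 : bulkHolst Λ γ e w x = 1 / 2 * ∑ I, ∑ J, ∑ μ, ∑ ν, X I J μ ν *
      (2 * d * (dualTetrad e x μ I * dualTetrad e x ν J - dualTetrad e x ν I * dualTetrad e x μ J)
      + 2 / γ * (η I * η J * ∑ ρ, ∑ σ, eps μ ν ρ σ * (e x I ρ * e x J σ))) := by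
    unfold bulkHolst
    congr 1
    refine Finset.sum_congr rfl fun I _ => Finset.sum_congr rfl fun J _ => ?_
    simp only [hd, ← sum_Hten_tetrad_tetrad he.det_ne γ]
    rw [← sum_exchange]
    refine Finset.sum_congr rfl fun K _ => Finset.sum_congr rfl fun L _ => ?_
    congr 1
    refine Finset.sum_congr rfl fun μ _ => Finset.sum_congr rfl fun ν _ => ?_
    simp only [Finset.mul_sum]
    exact Finset.sum_congr rfl fun ρ _ => Finset.sum_congr rfl fun σ _ => by ring
  have h2 : ∀ I J μ ν, X I J μ ν *
      (2 * d * (dualTetrad e x μ I * dualTetrad e x ν J - dualTetrad e x ν I * dualTetrad e x μ J)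
      + 2 / γ * (η I * η J * ∑ ρ, ∑ σ, eps μ ν ρ σ * (e x I ρ * e x J σ))) =
      d * (spinCurv w x I J μ ν * (dualTetrad e x μ I * dualTetrad e x ν J)
        - spinCurv w x I J μ ν * (dualTetrad e x ν I * dualTetrad e x μ J))
      - Λ / 3 * d * ((e x I μ * e x J ν) *
        (dualTetrad e x μ I * dualTetrad e x ν J - dualTetrad e x ν I * dualTetrad e x μ J))
      + 1 / γ * ((η I * spinCurvMixed w x I J μ ν) *
        ∑ ρ, ∑ σ, eps μ ν ρ σ * (e x I ρ * e x J σ))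
      - Λ / (3 * γ) * (∑ ρ, ∑ σ, eps μ ν ρ σ * ((η I * (e x I μ * e x I ρ))
        * (η J * (e x J ν * e x J σ)))) := by
    intro I J μ ν
    have e1 : (e x I μ * e x J ν) * (η I * η J * ∑ ρ, ∑ σ, eps μ ν ρ σ * (e x I ρ * e x J σ)) =
        ∑ ρ, ∑ σ, eps μ ν ρ σ * ((η I * (e x I μ * e x I ρ)) * (η J * (e x J ν * e x J σ))) := by
      simp only [Finset.mul_sum]
      exact Finset.sum_congr rfl fun ρ _ => Finset.sum_congr rfl fun σ _ => by ring
    rw [← e1]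
    simp only [X, spinCurv_eq]
    generalize ∑ ρ, ∑ σ, eps μ ν ρ σ * (e x I ρ * e x J σ) = Z
    have hη := η_mul_self J
    linear_combination (1 / γ * η I * spinCurvMixed w x I J μ ν * Z) * hη
  -- Both terms of the `ε` part agree, the curvature being antisymmetric in its form indices.
  have h3 : ∑ I, ∑ J, ∑ μ, ∑ ν, spinCurv w x I J μ ν * (dualTetrad e x ν I * dualTetrad e x μ J) =
      -∑ I, ∑ J, ∑ μ, ∑ ν, spinCurv w x I J μ ν * (dualTetrad e x μ I * dualTetrad e x ν J) := by
    rw [sum4_swap34]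
    simp only [← Finset.sum_neg_distrib]
    exact sum4_congr fun I J μ ν => by rw [spinCurv_swap]; ring
  -- The `1/γ` part of the volume term contracts the Levi-Civita symbol with `g_{μρ} g_{νσ}`.
  have h4 : ∑ I, ∑ J, ∑ μ, ∑ ν, ∑ ρ, ∑ σ, eps μ ν ρ σ * ((η I * (e x I μ * e x I ρ))
        * (η J * (e x J ν * e x J σ))) = 0 := by
    have e1 : ∑ I, ∑ J, ∑ μ, ∑ ν, ∑ ρ, ∑ σ, eps μ ν ρ σ * ((η I * (e x I μ * e x I ρ))
        * (η J * (e x J ν * e x J σ))) = ∑ μ, ∑ ν, ∑ ρ, ∑ σ, eps μ ν ρ σ *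
        (tetradMetric e x μ ρ * tetradMetric e x ν σ) := by
      refine (sum4_swap23 _).trans ((sum4_swap12 _).trans ((sum4_swap34 _).trans
        ((sum4_swap23 _).trans ?_)))
      refine Finset.sum_congr rfl fun μ _ => Finset.sum_congr rfl fun ν _ => ?_
      refine (sum4_swap23 _).trans ((sum4_swap12 _).trans ((sum4_swap34 _).trans
        ((sum4_swap23 _).trans ?_)))
      refine Finset.sum_congr rfl fun ρ _ => Finset.sum_congr rfl fun σ _ => ?_
      simp only [tetradMetric]
      rw [Finset.sum_mul_sum, Finset.mul_sum]
      refine Finset.sum_congr rfl fun I _ => ?_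
      rw [Finset.mul_sum]
    rw [e1]
    exact sum_eps_eq_zero_of_symm13 (f := fun μ ν ρ σ => tetradMetric e x μ ρ *
      tetradMetric e x ν σ) fun μ ν ρ σ => by rw [tetradMetric_symm e x ρ μ]
  -- The `1/γ` part of the curvature term is the dual curvature scalar.
  have h5 : ∑ α, ∑ β, ∑ μ, ∑ ν, eps α β μ ν *
      riemannLow (tetradMetric e) (fullConn (tetradMetric e) (tetradQ e w)) x α β μ ν =
      ∑ I, ∑ J, ∑ μ, ∑ ν, (η I * spinCurvMixed w x I J μ ν) *
        ∑ ρ, ∑ σ, eps μ ν ρ σ * (e x I ρ * e x J σ) := by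
    have e1 : ∑ I, ∑ J, ∑ μ, ∑ ν, (η I * spinCurvMixed w x I J μ ν) *
        ∑ ρ, ∑ σ, eps μ ν ρ σ * (e x I ρ * e x J σ) =
        ∑ μ, ∑ ν, ∑ ρ, ∑ σ, eps μ ν ρ σ * ∑ I, ∑ J, (η I * spinCurvMixed w x I J μ ν) *
          (e x I ρ * e x J σ) := by
      refine (sum4_swap23 _).trans ((sum4_swap12 _).trans ((sum4_swap34 _).trans
        ((sum4_swap23 _).trans ?_)))
      exact Finset.sum_congr rfl fun μ _ => Finset.sum_congr rfl fun ν _ => sum_exchange _ _ _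
    rw [e1]
    refine (sum4_swap23 _).trans ((sum4_swap12 _).trans ((sum4_swap34 _).trans
        ((sum4_swap23 _).trans (sum4_congr fun μ ν ρ σ => ?_))))
    rw [he.riemannLow_eq hw]
    congr 1
    rw [eps_swap23 ρ μ σ ν, eps_swap12 μ ρ σ ν, eps_swap34 μ ρ ν σ, eps_swap23 μ ν ρ σ]
    ring
  rw [h1]
  simp only [h2, Finset.sum_add_distrib, Finset.sum_sub_distrib, ← Finset.mul_sum, h3, h4,
    sum_dual_tetrad_self he.det_ne]
  have hr : sqrtDet (tetradMetric e) x ≠ 0 := by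
    rw [sqrtDet_tetradMetric]
    exact abs_ne_zero.2 he.det_ne
  rw [bulkGen, sqrtDet_mul_sum_volUp hr, h5, bulkPT, he.scalarCurv_eq hw, sqrtDet_tetradMetric,
    ← hd]
  generalize ∑ I, ∑ J, ∑ μ, ∑ ν, spinCurv w x I J μ ν * (dualTetrad e x μ I * dualTetrad e x ν J)
    = R
  linear_combination -(R - 2 * Λ) * had

end Curvature

/-! ### The boundary Holst Lagrangian -/

theorem eps_self_left (i k l : Fin 4) : eps i i k l = 0 := by
  have h := eps_swap12 i i k l
  linarith

theorem sum_eps_zero_succ (f : Fin 4 → Fin 4 → Fin 4 → ℝ) :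
    ∑ a : Fin 3, ∑ b : Fin 3, ∑ c : Fin 3, eps 0 a.succ b.succ c.succ * f a.succ b.succ c.succ =
      ∑ ν, ∑ ρ, ∑ σ, eps 0 ν ρ σ * f ν ρ σ := by
  have h2 : ∀ ν σ, eps 0 ν 0 σ = 0 := fun ν σ => by
    rw [eps_swap23, eps_self_left, neg_zero]
  have h3 : ∀ ν ρ, eps 0 ν ρ 0 = 0 := fun ν ρ => by
    rw [eps_swap34, h2, neg_zero]
  rw [Fin.sum_univ_succ (n := 3)]
  simp only [eps_self_left, zero_mul, Finset.sum_const_zero, zero_add]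
  refine Finset.sum_congr rfl fun a _ => ?_
  rw [Fin.sum_univ_succ (n := 3)]
  simp only [h2, zero_mul, Finset.sum_const_zero, zero_add]
  refine Finset.sum_congr rfl fun b _ => ?_
  rw [Fin.sum_univ_succ (n := 3), h3, zero_mul, zero_add]

/-- The covariant derivative `∂_μ N^J + ω_μ^J_K N^K` of the internal normal. -/
noncomputable def nablaNormal (e : LTetrad) (w : LSpin) (x : E4) (μ J : Fin 4) : ℝ :=
  pd μ (intNormal e J) x + ∑ K, η J * w x μ J K * intNormal e K x

section Normal

variable {e : LTetrad} {x : E4} (he : TetradAt e x) (h00 : 0 < gInv (tetradMetric e) x 0 0)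

include he

theorem TetradAt.eventually_sum_normal_tetrad (α : Fin 4) : ∀ᶠ y in 𝓝[halfSpace] x,
    ∑ I, η I * (intNormal e I y * e y I α) = nuLow (tetradMetric e) y α := by
  filter_upwards [he.eventually] with y hy
  rw [← hy.metricAt.sum_g_mul_nuUp]
  simp only [intNormal, tetradMetric, Finset.sum_mul, Finset.mul_sum]
  rw [Finset.sum_comm]
  exact Finset.sum_congr rfl fun β _ => Finset.sum_congr rfl fun I _ => by ring

theorem TetradAt.sum_normal_tetrad (α : Fin 4) :
    ∑ I, η I * (intNormal e I x * e x I α) = nuLow (tetradMetric e) x α :=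
  (he.eventually_sum_normal_tetrad α).self_of_nhdsWithin he.mem

theorem TetradAt.intNormal_eq (I : Fin 4) :
    intNormal e I x = nuLow (tetradMetric e) x 0 * (η I * dualTetrad e x 0 I) := by
  have h1 : ∀ α, nuUp (tetradMetric e) x α * e x I α =
      nuLow (tetradMetric e) x 0 * ∑ K, η K * dualTetrad e x 0 K * (e x I α * dualTetrad e x α K) := by
    intro α
    rw [nuUp_eq, gInv_tetradMetric he.det_ne, Finset.sum_mul, Finset.sum_mul, Finset.mul_sum]
    exact Finset.sum_congr rfl fun K _ => by ring
  simp only [intNormal, h1, ← Finset.mul_sum]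
  rw [Finset.sum_comm]
  simp only [← Finset.mul_sum, sum_tetrad_mul_dual he.det_ne, mul_ite, mul_one, mul_zero,
    Finset.sum_ite_eq, Finset.mem_univ, if_true]

include h00

theorem TetradAt.diffAt_intNormal (I : Fin 4) : DiffAt (intNormal e I) x :=
  DifferentiableWithinAt.fun_sum fun α _ =>
    ((he.metricAt.contDiff_nuUp h00 α).differentiableWithinAt (by simp)).mul (he.diffAt I α)

theorem TetradAt.eventually_normal_unit : ∀ᶠ y in 𝓝[halfSpace] x,
    ∑ I, η I * (intNormal e I y * intNormal e I y) = 1 := by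
  have hpos : ∀ᶠ y in 𝓝[halfSpace] x, 0 < gInv (tetradMetric e) y 0 0 :=
    (he.metricAt.contDiff_gInv 0 0).continuousWithinAt.eventually (lt_mem_nhds h00)
  filter_upwards [he.eventually, hpos] with y hy hp
  have h1 : ∀ I, η I * (intNormal e I y * intNormal e I y) =
      (nuLow (tetradMetric e) y 0 * nuLow (tetradMetric e) y 0) *
        (η I * (dualTetrad e y 0 I * dualTetrad e y 0 I)) := by
    intro I
    rw [hy.intNormal_eq]
    linear_combination (nuLow (tetradMetric e) y 0 * nuLow (tetradMetric e) y 0 * η I *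
      (dualTetrad e y 0 I * dualTetrad e y 0 I)) * η_mul_self I
  simp only [h1, ← Finset.mul_sum]
  rw [← gInv_tetradMetric hy.det_ne]
  exact nuLow_zero_mul_self hp

theorem TetradAt.sum_normal_mul_pd (μ : Fin 4) :
    ∑ I, η I * (intNormal e I x * pd μ (intNormal e I) x) = 0 := by
  have h := pd_congr he.mem (he.eventually_normal_unit h00) μ
  have hd := he.diffAt_intNormal h00
  rw [pd_const, pd_sum (F := fun I y => η I * (intNormal e I y * intNormal e I y)) he.mem μ
    fun I _ => ((hd I).mul (hd I)).const_mul _] at h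
  have h1 : ∀ I, pd μ (fun y => η I * (intNormal e I y * intNormal e I y)) x =
      2 * (η I * (intNormal e I x * pd μ (intNormal e I) x)) := by
    intro I
    rw [pd_const_mul (f := fun y => intNormal e I y * intNormal e I y) he.mem μ _
      ((hd I).mul (hd I)), pd_mul he.mem μ (hd I) (hd I)]
    ring
  simp only [h1, ← Finset.mul_sum] at h
  linarith

variable {w : LSpin} (hw : ∀ μ I J, w x μ I J = -w x μ J I)

include hw

/-- The internal normal is a unit vector, so its covariant derivative with respect to a metric
connection is orthogonal to it. -/
theorem TetradAt.sum_normal_mul_nablaNormal (μ : Fin 4) :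
    ∑ J, η J * (intNormal e J x * nablaNormal e w x μ J) = 0 := by
  have h1 : ∑ J, ∑ K, intNormal e J x * (w x μ J K * intNormal e K x) = 0 := by
    have e1 : ∑ J, ∑ K, intNormal e J x * (w x μ J K * intNormal e K x) =
        -∑ J, ∑ K, intNormal e J x * (w x μ J K * intNormal e K x) := by
      conv_lhs => rw [Finset.sum_comm]
      simp only [← Finset.sum_neg_distrib]
      exact Finset.sum_congr rfl fun J _ => Finset.sum_congr rfl fun K _ => by
        rw [hw μ K J]; ring
    linarith
  have h2 : ∀ J, η J * (intNormal e J x * nablaNormal e w x μ J) =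
      η J * (intNormal e J x * pd μ (intNormal e J) x) +
        ∑ K, intNormal e J x * (w x μ J K * intNormal e K x) := by
    intro J
    have : ∑ K, intNormal e J x * (w x μ J K * intNormal e K x) =
        η J * (intNormal e J x * ∑ K, η J * w x μ J K * intNormal e K x) := by
      simp only [Finset.mul_sum]
      refine Finset.sum_congr rfl fun K _ => ?_
      linear_combination -(intNormal e J x * (w x μ J K * intNormal e K x)) * η_mul_self J
    rw [this, nablaNormal]
    ring
  simp only [h2, Finset.sum_add_distrib, h1, he.sum_normal_mul_pd h00, add_zero]

omit hw in
theorem TetradAt.lower_nabla_normal (w : LSpin) (μ α : Fin 4) :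
    ∑ c, tetradMetric e x α c * (pd μ (fun y => nuUp (tetradMetric e) y c) x
      + ∑ l, fullConn (tetradMetric e) (tetradQ e w) x c μ l * nuUp (tetradMetric e) x l) =
      ∑ J, η J * (e x J α * nablaNormal e w x μ J) := by
  have hν : ∀ c, DiffAt (fun y => nuUp (tetradMetric e) y c) x := fun c =>
    (he.metricAt.contDiff_nuUp h00 c).differentiableWithinAt (by simp)
  have h1 : ∀ J, ∑ c, e x J c * (pd μ (fun y => nuUp (tetradMetric e) y c) x
      + ∑ l, fullConn (tetradMetric e) (tetradQ e w) x c μ l * nuUp (tetradMetric e) x l) =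
      nablaNormal e w x μ J := by
    intro J
    have e1 : pd μ (intNormal e J) x = ∑ c, (pd μ (fun y => nuUp (tetradMetric e) y c) x * e x J c
        + nuUp (tetradMetric e) x c * pd μ (fun y => e y J c) x) := by
      unfold intNormal
      rw [pd_sum (F := fun c y => nuUp (tetradMetric e) y c * e y J c) he.mem μ
        fun c _ => (hν c).mul (he.diffAt J c)]
      exact Finset.sum_congr rfl fun c _ => pd_mul he.mem μ (hν c) (he.diffAt J c)
    have e2 : ∑ c, e x J c * ∑ l, fullConn (tetradMetric e) (tetradQ e w) x c μ l *
        nuUp (tetradMetric e) x l = ∑ l, nuUp (tetradMetric e) x l *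
          (pd μ (fun y => e y J l) x + ∑ K, η J * w x μ J K * e x K l) := by
      simp only [← he.tetrad_mul_fullConn, Finset.mul_sum]
      rw [Finset.sum_comm]
      exact Finset.sum_congr rfl fun l _ => Finset.sum_congr rfl fun c _ => by ring
    have e3 : ∑ K, η J * w x μ J K * intNormal e K x = ∑ l, nuUp (tetradMetric e) x l *
        ∑ K, η J * w x μ J K * e x K l := by
      simp only [intNormal, Finset.mul_sum]
      rw [Finset.sum_comm]
      exact Finset.sum_congr rfl fun l _ => Finset.sum_congr rfl fun c _ => by ring
    rw [nablaNormal, e1, e3]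
    simp only [mul_add, Finset.sum_add_distrib, e2]
    have e4 : ∀ c, e x J c * pd μ (fun y => nuUp (tetradMetric e) y c) x =
      pd μ (fun y => nuUp (tetradMetric e) y c) x * e x J c := fun c => mul_comm _ _
    simp only [e4]
    ring
  simp only [← h1, tetradMetric, Finset.sum_mul, Finset.mul_sum]
  rw [Finset.sum_comm]
  exact Finset.sum_congr rfl fun l _ => Finset.sum_congr rfl fun c _ => by ring

/-- The covariant derivative of the conormal, in frame components, is that of the internal normal. -/
theorem TetradAt.nabla_nuLow (μ β : Fin 4) :
    pd μ (fun y => nuLow (tetradMetric e) y β) x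
      - ∑ l, fullConn (tetradMetric e) (tetradQ e w) x l μ β * nuLow (tetradMetric e) x l =
      ∑ J, η J * (e x J β * nablaNormal e w x μ J) := by
  have hd := he.diffAt_intNormal h00
  have h1 : pd μ (fun y => nuLow (tetradMetric e) y β) x =
      ∑ J, η J * (pd μ (intNormal e J) x * e x J β + intNormal e J x * pd μ (fun y => e y J β) x) := by
    rw [← pd_congr he.mem (he.eventually_sum_normal_tetrad β),
      pd_sum (F := fun I y => η I * (intNormal e I y * e y I β)) he.mem μ
        fun I _ => ((hd I).mul (he.diffAt I β)).const_mul _]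
    refine Finset.sum_congr rfl fun J _ => ?_
    rw [pd_const_mul (f := fun y => intNormal e J y * e y J β) he.mem μ _
      ((hd J).mul (he.diffAt J β)), pd_mul he.mem μ (hd J) (he.diffAt J β)]
  have h2 : ∑ l, fullConn (tetradMetric e) (tetradQ e w) x l μ β * nuLow (tetradMetric e) x l =
      ∑ J, η J * (intNormal e J x * (pd μ (fun y => e y J β) x
        + ∑ K, η J * w x μ J K * e x K β)) := by
    simp only [← he.tetrad_mul_fullConn, ← he.sum_normal_tetrad, Finset.mul_sum]
    rw [Finset.sum_comm]
    exact Finset.sum_congr rfl fun l _ => Finset.sum_congr rfl fun c _ => by ring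
  have h3 : ∑ J, η J * (intNormal e J x * ∑ K, η J * w x μ J K * e x K β) =
      -∑ J, η J * (e x J β * ∑ K, η J * w x μ J K * intNormal e K x) := by
    simp only [Finset.mul_sum]
    rw [Finset.sum_comm]
    simp only [← Finset.sum_neg_distrib]
    refine Finset.sum_congr rfl fun J _ => Finset.sum_congr rfl fun K _ => ?_
    rw [hw μ K J]
    linear_combination (-(intNormal e K x * w x μ J K * e x J β)) * (η_mul_self K)
      + (intNormal e K x * w x μ J K * e x J β) * (η_mul_self J)
  rw [h1, h2]
  simp only [nablaNormal, mul_add, Finset.sum_add_distrib, h3]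
  have e4 : ∀ c, η c * (pd μ (intNormal e c) x * e x c β) =
      η c * (e x c β * pd μ (intNormal e c) x) := fun c => by ring
  simp only [e4]
  ring

/-- For a metric connection the generalised mean curvature is the divergence of the internal
normal. -/
theorem TetradAt.genMeanCurv_eq :
    genMeanCurv (tetradMetric e) (fullConn (tetradMetric e) (tetradQ e w)) x =
      ∑ μ, ∑ J, dualTetrad e x μ J * nablaNormal e w x μ J := by
  let X : Fin 4 → Fin 4 → ℝ := fun μ β => ∑ J, η J * (e x J β * nablaNormal e w x μ J)
  have hg := he.metricAt
  have h1 : genMeanCurv (tetradMetric e) (fullConn (tetradMetric e) (tetradQ e w)) x =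
      ∑ a : Fin 3, ∑ b : Fin 3, (gBdry (tetradMetric e) x)⁻¹ a b *
        ((1 / 2) * (X a.succ b.succ + X b.succ a.succ)) := by
    unfold genMeanCurv
    simp only [he.nabla_nuLow h00 hw, he.lower_nabla_normal h00 w]
    rfl
  have hproj : ∀ μ J, ∑ β, (gInv (tetradMetric e) x μ β
      - nuUp (tetradMetric e) x μ * nuUp (tetradMetric e) x β) * e x J β =
      η J * dualTetrad e x μ J - nuUp (tetradMetric e) x μ * intNormal e J x := by
    intro μ J
    have e1 : ∑ β, gInv (tetradMetric e) x μ β * e x J β = η J * dualTetrad e x μ J := by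
      simp only [gInv_tetradMetric he.det_ne, Finset.sum_mul]
      rw [Finset.sum_comm]
      have : ∀ I, ∑ β, η I * (dualTetrad e x μ I * dualTetrad e x β I) * e x J β =
          (if J = I then 1 else 0) * (η I * dualTetrad e x μ I) := by
        intro I
        rw [← sum_tetrad_mul_dual he.det_ne, Finset.sum_mul]
        exact Finset.sum_congr rfl fun β _ => by ring
      simp only [this, ite_mul, one_mul, zero_mul, Finset.sum_ite_eq, Finset.mem_univ, if_true]
    simp only [sub_mul, Finset.sum_sub_distrib, e1, mul_assoc, ← Finset.mul_sum]
    rfl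
  have h2 : ∀ μ, ∑ β, (gInv (tetradMetric e) x μ β
      - nuUp (tetradMetric e) x μ * nuUp (tetradMetric e) x β) * X μ β =
      ∑ J, dualTetrad e x μ J * nablaNormal e w x μ J := by
    intro μ
    have e1 : ∑ β, (gInv (tetradMetric e) x μ β
      - nuUp (tetradMetric e) x μ * nuUp (tetradMetric e) x β) * X μ β =
      ∑ J, η J * nablaNormal e w x μ J * ∑ β, (gInv (tetradMetric e) x μ β
      - nuUp (tetradMetric e) x μ * nuUp (tetradMetric e) x β) * e x J β := by
      simp only [X, Finset.mul_sum]
      rw [Finset.sum_comm]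
      exact Finset.sum_congr rfl fun l _ => Finset.sum_congr rfl fun c _ => by ring
    rw [e1]
    have e2 : ∀ J, η J * nablaNormal e w x μ J * (η J * dualTetrad e x μ J
        - nuUp (tetradMetric e) x μ * intNormal e J x) = dualTetrad e x μ J * nablaNormal e w x μ J
        - nuUp (tetradMetric e) x μ * (η J * (intNormal e J x * nablaNormal e w x μ J)) := by
      intro J
      linear_combination (nablaNormal e w x μ J * dualTetrad e x μ J) * η_mul_self J
    simp only [hproj, e2, Finset.sum_sub_distrib, ← Finset.mul_sum,
      he.sum_normal_mul_nablaNormal h00 hw, mul_zero, sub_zero]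
  have h3 : ∑ μ, ∑ β, (gInv (tetradMetric e) x μ β
      - nuUp (tetradMetric e) x μ * nuUp (tetradMetric e) x β) * X β μ =
      ∑ μ, ∑ β, (gInv (tetradMetric e) x μ β
      - nuUp (tetradMetric e) x μ * nuUp (tetradMetric e) x β) * X μ β := by
    rw [Finset.sum_comm]
    exact Finset.sum_congr rfl fun l _ => Finset.sum_congr rfl fun c _ => by
      rw [hg.gInv_symm x c l]; ring
  rw [h1, hg.sum_gBdry_inv h00 (fun α β => (1 / 2) * (X α β + X β α))]
  have h4 : ∀ α β, (gInv (tetradMetric e) x α β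
      - nuUp (tetradMetric e) x α * nuUp (tetradMetric e) x β) * ((1 / 2) * (X α β + X β α)) =
      (1 / 2) * ((gInv (tetradMetric e) x α β
      - nuUp (tetradMetric e) x α * nuUp (tetradMetric e) x β) * X α β)
      + (1 / 2) * ((gInv (tetradMetric e) x α β
      - nuUp (tetradMetric e) x α * nuUp (tetradMetric e) x β) * X β α) := by
    intro α β
    ring
  simp only [h4, Finset.sum_add_distrib, ← Finset.mul_sum, h3, h2]
  ring

/-- The Holst boundary Lagrangian is the generalised boundary Lagrangian. -/
theorem TetradAt.bdryHolst_eq {a : E4 → ℝ} (ha : a x = SignType.sign (Matrix.of (e x)).det)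
    (γ : ℝ) : bdryHolst γ e w x = bdryGen a (1 / γ) (tetradMetric e) (tetradQ e w) x := by
  have hg := he.metricAt
  set d := (Matrix.of (e x)).det with hd
  set n := nuLow (tetradMetric e) x 0 with hn
  have had : a x * |d| = d := by rw [ha]; exact sign_mul_abs d
  have hn0 : n ≠ 0 := by
    have h := nuLow_zero_mul_self h00
    rintro h'
    rw [← hn, h'] at h
    simp at h
  let Y : Fin 4 → Fin 4 → Fin 4 → ℝ := fun ν I J =>
    2 * intNormal e I x * pd ν (intNormal e J) x - η I * η J * w x ν I J
  let W : Fin 4 → Fin 4 → Fin 4 → ℝ := fun ν I J => ∑ ρ, ∑ σ, eps 0 ν ρ σ * (e x I ρ * e x J σ)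
  let Z : ℝ := ∑ ν, ∑ ρ, ∑ σ, eps 0 ν ρ σ * ∑ I, η I * (pd ν (fun y => e y I ρ) x * e x I σ)
  have h1 : bdryHolst γ e w x = (1 / 2) * ∑ ν, ∑ I, ∑ J, Y ν I J *
      (2 * d * (dualTetrad e x 0 I * dualTetrad e x ν J - dualTetrad e x ν I * dualTetrad e x 0 J)
        + 2 / γ * (η I * η J * W ν I J)) + 1 / γ * Z := by
    have e1 : bdryHolst γ e w x = ∑ ν, ∑ ρ, ∑ σ, eps 0 ν ρ σ *
        ((1 / 2) * (∑ I, ∑ J, ∑ K, ∑ L, Hten γ I J K L * (Y ν I J * (e x K ρ * e x L σ)))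
          + 1 / γ * ∑ I, η I * (pd ν (fun y => e y I ρ) x * e x I σ)) := by
      rw [← sum_eps_zero_succ (fun ν ρ σ =>
        (1 / 2) * (∑ I, ∑ J, ∑ K, ∑ L, Hten γ I J K L * (Y ν I J * (e x K ρ * e x L σ)))
          + 1 / γ * ∑ I, η I * (pd ν (fun y => e y I ρ) x * e x I σ))]
      simp only [bdryHolst, ← Finset.sum_neg_distrib]
      refine Finset.sum_congr rfl fun a _ => Finset.sum_congr rfl fun b _ =>
        Finset.sum_congr rfl fun c _ => ?_
      simp only [Y]
      ring
    have e2 : ∀ ν, ∑ ρ, ∑ σ, eps 0 ν ρ σ *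
        (∑ I, ∑ J, ∑ K, ∑ L, Hten γ I J K L * (Y ν I J * (e x K ρ * e x L σ))) =
        ∑ I, ∑ J, Y ν I J * ∑ K, ∑ L, Hten γ I J K L * ∑ ρ, ∑ σ, eps 0 ν ρ σ *
          (e x K ρ * e x L σ) := by
      intro ν
      have e3 : ∀ ρ σ, ∑ I, ∑ J, ∑ K, ∑ L, Hten γ I J K L * (Y ν I J * (e x K ρ * e x L σ)) =
          ∑ I, ∑ J, Y ν I J * ∑ K, ∑ L, Hten γ I J K L * (e x K ρ * e x L σ) := by
        intro ρ σ
        simp only [Finset.mul_sum]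
        exact sum4_congr fun I J K L => by ring
      simp only [e3]
      rw [sum_exchange]
      refine Finset.sum_congr rfl fun I _ => Finset.sum_congr rfl fun J _ => ?_
      congr 1
      exact sum_exchange _ _ (fun ρ σ K L => e x K ρ * e x L σ)
    have e4 : ∀ ν ρ σ, eps 0 ν ρ σ *
        ((1 / 2) * (∑ I, ∑ J, ∑ K, ∑ L, Hten γ I J K L * (Y ν I J * (e x K ρ * e x L σ)))
          + 1 / γ * ∑ I, η I * (pd ν (fun y => e y I ρ) x * e x I σ)) =
        (1 / 2) * (eps 0 ν ρ σ *
          ∑ I, ∑ J, ∑ K, ∑ L, Hten γ I J K L * (Y ν I J * (e x K ρ * e x L σ)))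
        + 1 / γ * (eps 0 ν ρ σ * ∑ I, η I * (pd ν (fun y => e y I ρ) x * e x I σ)) := by
      intro ν ρ σ
      ring
    rw [e1]
    simp only [e4, Finset.sum_add_distrib, ← Finset.mul_sum, e2, hd, W,
      sum_Hten_tetrad_tetrad he.det_ne γ]
    rfl
  -- The `ε` part is the divergence of the internal normal, hence the generalised mean curvature.
  have h2 : ∑ ν, ∑ I, ∑ J, Y ν I J *
      (dualTetrad e x 0 I * dualTetrad e x ν J - dualTetrad e x ν I * dualTetrad e x 0 J) =
      2 / n * ∑ μ, ∑ J, dualTetrad e x μ J * nablaNormal e w x μ J := by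
    have hE : ∀ I, dualTetrad e x 0 I = η I * intNormal e I x / n := by
      intro I
      rw [he.intNormal_eq, ← hn]
      field_simp
      linear_combination (-dualTetrad e x 0 I) * η_mul_self I
    rw [Finset.mul_sum]
    refine Finset.sum_congr rfl fun ν _ => ?_
    have e1 : ∀ I J, Y ν I J *
        (dualTetrad e x 0 I * dualTetrad e x ν J - dualTetrad e x ν I * dualTetrad e x 0 J) =
        2 / n * ((η I * (intNormal e I x * intNormal e I x)) *
            (dualTetrad e x ν J * pd ν (intNormal e J) x))
          - 2 / n * ((intNormal e I x * dualTetrad e x ν I) *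
            (η J * (intNormal e J x * pd ν (intNormal e J) x)))
          + 1 / n * (dualTetrad e x ν J * (η J * w x ν J I * intNormal e I x))
          + 1 / n * (dualTetrad e x ν I * (η I * w x ν I J * intNormal e J x)) := by
      intro I J
      rw [hE I, hE J, hw ν J I]
      simp only [Y]
      linear_combination (-(w x ν I J * η J * intNormal e I x * dualTetrad e x ν J / n)) *
        η_mul_self I + (w x ν I J * η I * intNormal e J x * dualTetrad e x ν I / n) * η_mul_self J
    have e2 : ∑ I, ∑ J, dualTetrad e x ν J * (η J * w x ν J I * intNormal e I x) =
        ∑ I, ∑ J, dualTetrad e x ν I * (η I * w x ν I J * intNormal e J x) := Finset.sum_comm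
    have e3 := (he.eventually_normal_unit h00).self_of_nhdsWithin he.mem
    have e4 : ∀ A B : Fin 4 → ℝ, ∑ I, ∑ J, A I * B J = (∑ I, A I) * ∑ J, B J :=
      fun A B => (Finset.sum_mul_sum _ _ _ _).symm
    have e5 : ∑ J, dualTetrad e x ν J * nablaNormal e w x ν J =
        ∑ J, dualTetrad e x ν J * pd ν (intNormal e J) x
        + ∑ I, ∑ J, dualTetrad e x ν I * (η I * w x ν I J * intNormal e J x) := by
      rw [← Finset.sum_add_distrib]
      refine Finset.sum_congr rfl fun J _ => ?_
      rw [nablaNormal, mul_add, Finset.mul_sum]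
    simp only [e1, Finset.sum_add_distrib, Finset.sum_sub_distrib, ← Finset.mul_sum (a := 2 / n),
      ← Finset.mul_sum (a := 1 / n), e2]
    rw [e4 _ (fun J => dualTetrad e x ν J * pd ν (intNormal e J) x), e3,
      e4 _ (fun J => η J * (intNormal e J x * pd ν (intNormal e J) x)),
      he.sum_normal_mul_pd h00, e5]
    ring
  -- The `1/γ` part, completed by `de_I ∧ e^I`, is the normal component of the dual vector density:
  -- both antisymmetrise the first structure equation, in which the Christoffel symbols cancel.
  have h3 : ∑ ν, ∑ I, ∑ J, Y ν I J * (η I * η J * W ν I J) + Z =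
      -dualVec (tetradMetric e) (tetradQ e w) x 0 := by
    have e1 : ∀ ν, ∑ I, ∑ J, Y ν I J * (η I * η J * W ν I J) =
        -∑ I, ∑ J, w x ν I J * W ν I J := by
      intro ν
      have e2 : ∀ I J, Y ν I J * (η I * η J * W ν I J) = 2 * (η J * pd ν (intNormal e J) x *
          (η I * (intNormal e I x * W ν I J))) - w x ν I J * W ν I J := by
        intro I J
        simp only [Y]
        linear_combination (-(w x ν I J * W ν I J)) * η_mul_self I
          - (w x ν I J * W ν I J * η I * η I) * η_mul_self J
      -- The conormal is proportional to `dx⁰`, which already occurs in the contraction.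
      have e3 : ∀ J, ∑ I, η I * (intNormal e I x * W ν I J) = 0 := by
        intro J
        have e4 : ∑ I, η I * (intNormal e I x * W ν I J) = ∑ ρ, (∑ I, η I * (intNormal e I x *
            e x I ρ)) * ∑ σ, eps 0 ν ρ σ * e x J σ := by
          simp only [W, Finset.sum_mul, Finset.mul_sum]
          rw [Finset.sum_comm]
          refine Finset.sum_congr rfl fun ρ _ => ?_
          rw [Finset.sum_comm]
          exact Finset.sum_congr rfl fun I _ => Finset.sum_congr rfl fun σ _ => by ring
        rw [e4]
        simp only [he.sum_normal_tetrad, mul_comm (nuLow _ _ _)]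
        rw [sum_mul_nuLow]
        have e5 : ∀ σ, eps 0 ν 0 σ = 0 := fun σ => by rw [eps_swap23, eps_self_left, neg_zero]
        simp only [e5, zero_mul, Finset.sum_const_zero]
      simp only [e2, Finset.sum_sub_distrib, ← Finset.mul_sum (a := (2 : ℝ))]
      rw [Finset.sum_comm]
      simp only [← Finset.mul_sum, e3, mul_zero, Finset.sum_const_zero, zero_sub]
    have e6 : dualVec (tetradMetric e) (tetradQ e w) x 0 =
        -∑ α, ∑ β, ∑ ν, eps 0 α β ν * ∑ l, tetradMetric e x α l *
          fullConn (tetradMetric e) (tetradQ e w) x l β ν := by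
      have e7 : ∀ α, ∑ β, ∑ ν, eps 0 α β ν * ∑ l, tetradMetric e x α l *
          christoffel (tetradMetric e) x l β ν = 0 := by
        intro α
        have e8 : ∑ β, ∑ ν, eps 0 α β ν * ∑ l, tetradMetric e x α l *
            christoffel (tetradMetric e) x l β ν = -∑ β, ∑ ν, eps 0 α β ν *
            ∑ l, tetradMetric e x α l * christoffel (tetradMetric e) x l β ν := by
          conv_lhs => rw [Finset.sum_comm]
          simp only [← Finset.sum_neg_distrib]
          refine Finset.sum_congr rfl fun β _ => Finset.sum_congr rfl fun ν _ => ?_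
          rw [eps_swap34 0 α β ν]
          simp only [hg.christoffel_symm x _ ν β]
          ring
        linarith
      simp only [dualVec, fullConn, mul_add, Finset.sum_add_distrib, e7, zero_add]
    have e9 : ∀ α β ν, ∑ l, tetradMetric e x α l *
          fullConn (tetradMetric e) (tetradQ e w) x l β ν = ∑ I, η I * (pd β (fun y => e y I ν) x
          * e x I α) + ∑ I, ∑ J, w x β I J * (e x I α * e x J ν) := by
      intro α β ν
      have e10 : ∑ l, tetradMetric e x α l *
          fullConn (tetradMetric e) (tetradQ e w) x l β ν = ∑ I, η I * (e x I α *
          (pd β (fun y => e y I ν) x + ∑ J, η I * w x β I J * e x J ν)) := by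
        simp only [← he.tetrad_mul_fullConn, tetradMetric, Finset.sum_mul, Finset.mul_sum]
        rw [Finset.sum_comm]
        exact Finset.sum_congr rfl fun ρ _ => Finset.sum_congr rfl fun I _ => by ring
      rw [e10, ← Finset.sum_add_distrib]
      refine Finset.sum_congr rfl fun I _ => ?_
      rw [mul_add, mul_add, Finset.mul_sum, Finset.mul_sum]
      congr 1
      · ring
      · refine Finset.sum_congr rfl fun J _ => ?_
        linear_combination (w x β I J * (e x I α * e x J ν)) * η_mul_self I
    rw [e6, neg_neg]
    simp only [e9, mul_add, Finset.sum_add_distrib, e1, Finset.sum_neg_distrib]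
    rw [add_comm]
    congr 1
    · simp only [Z]
      conv_rhs => rw [Finset.sum_comm]
      refine Finset.sum_congr rfl fun β _ => ?_
      conv_rhs => rw [Finset.sum_comm]
      refine Finset.sum_congr rfl fun ν _ => Finset.sum_congr rfl fun α _ => ?_
      rw [eps_swap23 0 β α ν, eps_swap34 0 β ν α, neg_neg]
    · conv_rhs => rw [Finset.sum_comm]
      rw [← Finset.sum_neg_distrib]
      refine Finset.sum_congr rfl fun β _ => ?_
      simp only [W]
      rw [sum_exchange _ _ (fun I J ρ σ => e x I ρ * e x J σ)]
      simp only [← Finset.sum_neg_distrib]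
      refine Finset.sum_congr rfl fun α _ => Finset.sum_congr rfl fun ν _ => ?_
      rw [eps_swap23 0 β α ν]
      simp only [Finset.mul_sum, ← Finset.sum_neg_distrib]
      exact Finset.sum_congr rfl fun I _ => Finset.sum_congr rfl fun J _ => by ring
  have hN := hg.nuLow_zero_mul_sqrtDetBdry h00
  rw [← hn, sqrtDet_tetradMetric, ← hd] at hN
  rw [bdryGen, hg.normal_qVec_mul_sqrtDetBdry h00, ← h3, bdryPT, he.genMeanCurv_eq h00 hw, h1]
  have h4 : ∑ ν, ∑ I, ∑ J, Y ν I J *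
      (2 * d * (dualTetrad e x 0 I * dualTetrad e x ν J - dualTetrad e x ν I * dualTetrad e x 0 J)
        + 2 / γ * (η I * η J * W ν I J)) = 2 * d * (∑ ν, ∑ I, ∑ J, Y ν I J *
      (dualTetrad e x 0 I * dualTetrad e x ν J - dualTetrad e x ν I * dualTetrad e x 0 J))
      + 2 / γ * ∑ ν, ∑ I, ∑ J, Y ν I J * (η I * η J * W ν I J) := by
    simp only [Finset.mul_sum, ← Finset.sum_add_distrib]
    exact Finset.sum_congr rfl fun ν _ => Finset.sum_congr rfl fun I _ =>
      Finset.sum_congr rfl fun J _ => by ring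
  rw [h4, h2]
  generalize ∑ μ, ∑ J, dualTetrad e x μ J * nablaNormal e w x μ J = D
  have h5 : d * (2 / n) = -2 * a x * sqrtDetBdry (tetradMetric e) x := by
    rw [← had]
    field_simp
    linear_combination (a x) * hN
  linear_combination D * h5

end Normal

/-! ### The quadratic part of the Lagrangian in an orthonormal frame -/

theorem sum4_sum4_comm (f : Fin 4 → Fin 4 → Fin 4 → Fin 4 → Fin 4 → Fin 4 → Fin 4 → Fin 4 → ℝ) :
    ∑ i, ∑ j, ∑ k, ∑ l, ∑ a, ∑ b, ∑ c, ∑ d, f i j k l a b c d =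
      ∑ a, ∑ b, ∑ c, ∑ d, ∑ i, ∑ j, ∑ k, ∑ l, f i j k l a b c d := by
  have h : ∀ g : Fin 4 → Fin 4 → Fin 4 → Fin 4 → ℝ, ∑ i, ∑ j, ∑ k, ∑ l, g i j k l =
      ∑ p : Fin 4 × Fin 4 × Fin 4 × Fin 4, g p.1 p.2.1 p.2.2.1 p.2.2.2 := by
    intro g
    simp only [Fintype.sum_prod_type]
  simp only [h]
  exact Finset.sum_comm

/-- The matrix of the endomorphism `Y ↦ Q(∂_μ, Y)`. -/
def slice (Q : Arr3) (μ : Fin 4) : Matrix (Fin 4) (Fin 4) ℝ := Matrix.of fun α σ => Q α μ σ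

theorem scalForm_eq_slice (I : Fin 4 → Fin 4 → ℝ) (Q P : Arr3) : scalForm I Q P =
    ∑ β, ∑ δ, I β δ * ∑ α, ((slice Q α * slice P δ) α β - (slice Q δ * slice P α) α β) := by
  simp only [scalForm, Matrix.mul_apply, ← Finset.sum_sub_distrib]
  rfl

theorem dualForm_eq_slice (G : Fin 4 → Fin 4 → ℝ) (Q P : Arr3) : dualForm G Q P =
    ∑ α, ∑ β, ∑ μ, ∑ ν, eps α β μ ν * ∑ l, G α l * (slice Q μ * slice P ν) l β := by
  simp only [dualForm, Matrix.mul_apply]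
  rfl

/-- The array with components `q^K_{JL}` in the frame with dual frame `e`, in coordinates. -/
noncomputable def fromFrame (e E : Matrix (Fin 4) (Fin 4) ℝ) (q : Arr3) : Arr3 := fun α μ σ =>
  (∑ J, e J μ • (E * slice q J * e)) α σ

/-- The components of an array in the frame with dual frame `e`. -/
noncomputable def toFrame (e E : Matrix (Fin 4) (Fin 4) ℝ) (Q : Arr3) : Arr3 := fun K J L =>
  (∑ μ, E μ J • (e * slice Q μ * E)) K L

theorem slice_fromFrame (e E : Matrix (Fin 4) (Fin 4) ℝ) (q : Arr3) (μ : Fin 4) :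
    slice (fromFrame e E q) μ = ∑ J, e J μ • (E * slice q J * e) := rfl

theorem slice_toFrame (e E : Matrix (Fin 4) (Fin 4) ℝ) (Q : Arr3) (J : Fin 4) :
    slice (toFrame e E Q) J = ∑ μ, E μ J • (e * slice Q μ * E) := rfl

section Frame

variable {e E : Matrix (Fin 4) (Fin 4) ℝ} (h : E * e = 1)

include h

theorem sum_frame_mul (α β : Fin 4) : ∑ I, E α I * e I β = if α = β then 1 else 0 := by
  rw [← Matrix.mul_apply, h, Matrix.one_apply]

theorem sum_coframe_mul (I J : Fin 4) : ∑ α, e I α * E α J = if I = J then 1 else 0 := by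
  rw [← Matrix.mul_apply, mul_eq_one_comm.1 h, Matrix.one_apply]

theorem fromFrame_toFrame (Q : Arr3) : fromFrame e E (toFrame e E Q) = Q := by
  funext α μ σ
  have h1 : slice (fromFrame e E (toFrame e E Q)) μ = slice Q μ := by
    have h2 : ∀ ν, E * (e * slice Q ν * E) * e = slice Q ν := by
      intro ν
      calc E * (e * slice Q ν * E) * e = (E * e) * slice Q ν * (E * e) := by
            simp only [Matrix.mul_assoc]
        _ = slice Q ν := by rw [h, Matrix.one_mul, Matrix.mul_one]
    have h3 : ∀ ν, ∑ J, (e J μ * E ν J) • slice Q ν = (if ν = μ then (1 : ℝ) else 0) • slice Q ν := by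
      intro ν
      rw [← Finset.sum_smul, ← sum_frame_mul h]
      simp only [mul_comm]
    rw [slice_fromFrame]
    simp only [slice_toFrame, Matrix.mul_sum, Matrix.sum_mul, Matrix.mul_smul, Matrix.smul_mul, h2,
      Finset.smul_sum, smul_smul]
    rw [Finset.sum_comm]
    simp only [h3, ite_smul, one_smul, zero_smul, Finset.sum_ite_eq', Finset.mem_univ, if_true]
  exact congrFun₂ h1 α σ

theorem slice_fromFrame_mul (q p : Arr3) (μ ν α β : Fin 4) :
    (slice (fromFrame e E q) μ * slice (fromFrame e E p) ν) α β =
      ∑ J, ∑ M, ∑ K, ∑ L, (E α K * e L β * e J μ * e M ν) * (slice q J * slice p M) K L := by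
  have h1 : ∀ A B : Matrix (Fin 4) (Fin 4) ℝ, E * A * e * (E * B * e) = E * (A * B) * e := by
    intro A B
    calc E * A * e * (E * B * e) = E * A * (e * E) * (B * e) := by simp only [Matrix.mul_assoc]
      _ = E * (A * B) * e := by
        rw [mul_eq_one_comm.1 h, Matrix.mul_one]
        simp only [Matrix.mul_assoc]
  have h2 : ∀ A : Matrix (Fin 4) (Fin 4) ℝ, (E * A * e) α β =
      ∑ K, ∑ L, E α K * e L β * A K L := by
    intro A
    simp only [Matrix.mul_apply, Finset.sum_mul]
    rw [Finset.sum_comm]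
    exact Finset.sum_congr rfl fun K _ => Finset.sum_congr rfl fun L _ => by ring
  simp only [slice_fromFrame, Matrix.sum_mul, Matrix.mul_smul, Matrix.smul_mul, h1,
    Matrix.sum_apply, Matrix.smul_apply, h2, smul_eq_mul, Finset.mul_sum]
  rw [sum4_swap12]
  exact sum4_congr fun J M K L => by ring

variable {G I : Fin 4 → Fin 4 → ℝ}

omit h in
theorem sum_sum4_mul (A : Fin 4 → Fin 4 → Fin 4 → ℝ) (B : Fin 4 → Fin 4 → Fin 4 → Fin 4 → ℝ) :
    ∑ α, ∑ J, ∑ M, ∑ K, ∑ L, A α J K * B J M K L =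
      ∑ J, ∑ M, ∑ K, ∑ L, (∑ α, A α J K) * B J M K L := by
  simp only [Finset.sum_mul]
  rw [Finset.sum_comm]
  refine Finset.sum_congr rfl fun J _ => ?_
  rw [Finset.sum_comm]
  refine Finset.sum_congr rfl fun M _ => ?_
  rw [Finset.sum_comm]
  refine Finset.sum_congr rfl fun K _ => ?_
  rw [Finset.sum_comm]

omit h in
theorem sum_exchange' (H X : Fin 4 → Fin 4 → ℝ) (Z : Fin 4 → Fin 4 → Fin 4 → Fin 4 → ℝ) :
    ∑ K, ∑ L, (∑ μ, ∑ ν, H μ ν * Z K L μ ν) * X K L =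
      ∑ μ, ∑ ν, H μ ν * ∑ K, ∑ L, Z K L μ ν * X K L := by
  simp only [Finset.mul_sum, Finset.sum_mul]
  exact (sum4_swap23 _).trans ((sum4_swap12 _).trans ((sum4_swap34 _).trans ((sum4_swap23 _).trans
    (sum4_congr fun μ ν K L => by ring))))

theorem scalForm_fromFrame (hI : ∀ α β, I α β = ∑ J, η J * (E α J * E β J)) (q p : Arr3) :
    scalForm I (fromFrame e E q) (fromFrame e E p) = scalForm minkowski q p := by
  have hI' : ∀ M L, ∑ β, ∑ δ, I β δ * (e L β * e M δ) = minkowski L M := by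
    intro M L
    have e1 : ∀ β δ, I β δ * (e L β * e M δ) =
        ∑ J, η J * ((e L β * E β J) * (e M δ * E δ J)) := by
      intro β δ
      rw [hI, Finset.sum_mul]
      exact Finset.sum_congr rfl fun J _ => by ring
    have e2 : ∀ β, ∑ δ, ∑ J, η J * ((e L β * E β J) * (e M δ * E δ J)) =
        η M * (e L β * E β M) := by
      intro β
      rw [Finset.sum_comm]
      simp only [← Finset.mul_sum, sum_coframe_mul h]
      simp
    simp only [e1, e2, ← Finset.mul_sum, sum_coframe_mul h, minkowski]
    by_cases hLM : L = M
    · simp [hLM]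
    · simp [hLM]
  have h1 : ∀ (q p : Arr3) β δ, ∑ α, (slice (fromFrame e E q) α * slice (fromFrame e E p) δ) α β =
      ∑ L, ∑ M, (e L β * e M δ) * ∑ K, (slice q K * slice p M) K L := by
    intro q p β δ
    simp only [slice_fromFrame_mul h]
    have e1 := sum_sum4_mul (fun α J K => e J α * E α K)
      (fun J M K L => (e L β * e M δ) * (slice q J * slice p M) K L)
    simp only [sum_coframe_mul h, ite_mul, one_mul, zero_mul] at e1
    refine Eq.trans (Finset.sum_congr rfl fun α _ => sum4_congr fun J M K L => ?_) (e1.trans ?_)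
    · ring
    · simp only [Finset.sum_ite_irrel, Finset.sum_const_zero, Finset.sum_ite_eq, Finset.mem_univ,
        if_true, Finset.mul_sum]
      exact (Finset.sum_comm.trans (Finset.sum_congr rfl fun M _ => Finset.sum_comm)).trans
        Finset.sum_comm
  have h2 : ∀ (q p : Arr3) β δ, ∑ α, (slice (fromFrame e E q) δ * slice (fromFrame e E p) α) α β =
      ∑ L, ∑ M, (e L β * e M δ) * ∑ K, (slice q M * slice p K) K L := by
    intro q p β δ
    simp only [slice_fromFrame_mul h]
    have e1 := sum_sum4_mul (fun α J K => e J α * E α K)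
      (fun J M K L => (e L β * e M δ) * (slice q M * slice p J) K L)
    simp only [sum_coframe_mul h, ite_mul, one_mul, zero_mul] at e1
    refine Eq.trans (Finset.sum_congr rfl fun α _ => (sum4_swap12 _).trans
      (sum4_congr fun J M K L => ?_)) (e1.trans ?_)
    · ring
    · simp only [Finset.sum_ite_irrel, Finset.sum_const_zero, Finset.sum_ite_eq, Finset.mem_univ,
        if_true, Finset.mul_sum]
      exact (Finset.sum_comm.trans (Finset.sum_congr rfl fun M _ => Finset.sum_comm)).trans
        Finset.sum_comm
  have h3 : ∀ β δ, ∑ α, ((slice (fromFrame e E q) α * slice (fromFrame e E p) δ) α β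
      - (slice (fromFrame e E q) δ * slice (fromFrame e E p) α) α β) =
      ∑ L, ∑ M, (e L β * e M δ) * ∑ K, ((slice q K * slice p M) K L
        - (slice q M * slice p K) K L) := by
    intro β δ
    simp only [Finset.sum_sub_distrib, h1, h2, mul_sub]
  rw [scalForm_eq_slice, scalForm_eq_slice]
  simp only [h3]
  rw [← sum_exchange']
  simp only [hI']

theorem dualForm_fromFrame (hG : ∀ α β, G α β = ∑ J, η J * (e J α * e J β)) (q p : Arr3) :
    dualForm G (fromFrame e E q) (fromFrame e E p) = e.det * dualForm minkowski q p := by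
  have h1 : ∀ α β μ ν, ∑ l, G α l * (slice (fromFrame e E q) μ * slice (fromFrame e E p) ν) l β =
      ∑ K, ∑ L, ∑ J, ∑ M, (e K α * e L β * e J μ * e M ν) *
        (η K * (slice q J * slice p M) K L) := by
    intro α β μ ν
    have e1 : ∀ K, ∑ l, G α l * E l K = η K * e K α := by
      intro K
      have : ∀ l, G α l * E l K = ∑ J, η J * e J α * (e J l * E l K) := by
        intro l
        rw [hG, Finset.sum_mul]
        exact Finset.sum_congr rfl fun J _ => by ring
      simp only [this]
      rw [Finset.sum_comm]
      simp only [← Finset.mul_sum, sum_coframe_mul h]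
      simp
    have e2 := sum_sum4_mul (fun l J K => G α l * E l K)
      (fun J M K L => (e L β * e J μ * e M ν) * (slice q J * slice p M) K L)
    simp only [e1] at e2
    refine Eq.trans (Finset.sum_congr rfl fun l _ => ?_) (e2.trans ((sum4_swap23 _).trans
      ((sum4_swap12 _).trans ((sum4_swap34 _).trans ((sum4_swap23 _).trans
        (sum4_congr fun K L J M => ?_))))))
    · rw [slice_fromFrame_mul h]
      simp only [Finset.mul_sum]
      exact sum4_congr fun J M K L => by ring
    · ring
  have h2 : ∀ Q P : Arr3, dualForm minkowski Q P =
      ∑ α, ∑ β, ∑ μ, ∑ ν, eps α β μ ν * (η α * (slice Q μ * slice P ν) α β) := by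
    intro Q P
    rw [dualForm_eq_slice]
    simp only [minkowski, ite_mul, zero_mul, Finset.sum_ite_eq, Finset.mem_univ, if_true]
  rw [dualForm_eq_slice, h2]
  simp only [h1, Finset.mul_sum]
  rw [sum4_sum4_comm]
  refine sum4_congr fun K L J M => ?_
  have h3 := sum_eps_mul_mul (fun α I => e I α) K L J M
  have h4 : (Matrix.of fun α I => e I α).det = e.det := Matrix.det_transpose e
  rw [h4] at h3
  rw [← mul_assoc, ← h3]
  simp only [Finset.sum_mul]
  exact sum4_congr fun α β μ ν => by ring

end Frame

/-! ### The kernel of the quadratic part -/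

/-- The elementary array with a single nonzero entry. -/
def basisArr (l n m : Fin 4) : Arr3 := fun i j k =>
  if i = l then if j = n then if k = m then 1 else 0 else 0 else 0

/-- The polarisation, in an orthonormal frame, of the quadratic part of the Lagrangian. -/
noncomputable def polarForm (a b : ℝ) (q p : Arr3) : ℝ :=
  a * (scalForm minkowski q p + scalForm minkowski p q)
    + b * (dualForm minkowski q p + dualForm minkowski p q)

theorem sum_minkowski_mul (f : Fin 4 → Fin 4 → ℝ) :
    ∑ β, ∑ δ, minkowski β δ * f β δ = ∑ β, η β * f β β := by
  simp [minkowski]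

theorem scalForm_basis_right (q : Arr3) (l n m : Fin 4) : scalForm minkowski q (basisArr l n m) =
    (if n = m then η n * ∑ I, q I I l else 0) - η m * q n m l := by
  rw [scalForm, sum_minkowski_mul]
  simp only [basisArr, Finset.sum_sub_distrib, mul_sub, mul_ite, mul_one, mul_zero,
    Finset.sum_ite_irrel, Finset.sum_const_zero, Finset.sum_ite_eq', Finset.mem_univ, if_true]

theorem scalForm_basis_left (q : Arr3) (l n m : Fin 4) : scalForm minkowski (basisArr l n m) q =
    (if l = n then ∑ J, η J * q m J J else 0) - η n * q m l n := by
  rw [scalForm, sum_minkowski_mul]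
  simp only [basisArr, Finset.sum_sub_distrib, mul_sub, ite_mul, one_mul, zero_mul,
    Finset.sum_ite_irrel, Finset.sum_const_zero, Finset.sum_ite_eq', Finset.mem_univ, if_true]
  simp [Finset.sum_ite_irrel]

theorem dualForm_minkowski (q p : Arr3) : dualForm minkowski q p =
    ∑ α, ∑ β, ∑ μ, ∑ ν, eps α β μ ν * (η α * ∑ s, q α μ s * p s ν β) := by
  simp [dualForm, minkowski]

theorem dualForm_basis_right (q : Arr3) (l n m : Fin 4) : dualForm minkowski q (basisArr l n m) =
    ∑ I, ∑ K, eps I m K n * (η I * q I K l) := by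
  rw [dualForm_minkowski]
  simp only [basisArr, mul_ite, mul_one, mul_zero,
    Finset.sum_ite_irrel, Finset.sum_const_zero, Finset.sum_ite_eq', Finset.mem_univ, if_true]

theorem dualForm_basis_left (q : Arr3) (l n m : Fin 4) : dualForm minkowski (basisArr l n m) q =
    η l * ∑ J, ∑ L, eps l J n L * q m L J := by
  rw [dualForm_minkowski]
  simp only [basisArr, ite_mul, one_mul, zero_mul, mul_ite, mul_zero,
    Finset.sum_ite_irrel, Finset.sum_const_zero, Finset.sum_ite_eq', Finset.mem_univ, if_true,
    Finset.mul_sum]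
  exact Finset.sum_congr rfl fun J _ => Finset.sum_congr rfl fun L _ => by ring

theorem eps_rep12 (i k l : Fin 4) : eps i i k l = 0 := eps_self_left i k l

theorem eps_rep13 (i j l : Fin 4) : eps i j i l = 0 := by rw [eps_swap23, eps_rep12, neg_zero]

theorem eps_rep14 (i j k : Fin 4) : eps i j k i = 0 := by rw [eps_swap34, eps_rep13, neg_zero]

theorem eps_rep23 (i j l : Fin 4) : eps i j j l = 0 := by rw [eps_swap12, eps_rep13, neg_zero]

theorem eps_rep24 (i j k : Fin 4) : eps i j k j = 0 := by rw [eps_swap12, eps_rep14, neg_zero]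

theorem eps_rep34 (i j k : Fin 4) : eps i j k k = 0 := by rw [eps_swap23, eps_rep24, neg_zero]

/-- The four indices are pairwise different. -/
def IsPerm4 (a b c d : Fin 4) : Prop := (Finset.univ : Finset (Fin 4)) = {a, b, c, d}

theorem isPerm4_iff (a b c d : Fin 4) :
    IsPerm4 a b c d ↔ a ≠ b ∧ a ≠ c ∧ a ≠ d ∧ b ≠ c ∧ b ≠ d ∧ c ≠ d := by
  unfold IsPerm4
  revert a b c d
  decide

namespace IsPerm4

variable {a b c d : Fin 4} (h : IsPerm4 a b c d)

include h

theorem rotate : IsPerm4 b c a d := by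
  rw [isPerm4_iff] at h ⊢
  obtain ⟨h1, h2, h3, h4, h5, h6⟩ := h
  exact ⟨h4, h1.symm, h5, h2.symm, h6, h3⟩

theorem swap : IsPerm4 a c b d := by
  rw [isPerm4_iff] at h ⊢
  obtain ⟨h1, h2, h3, h4, h5, h6⟩ := h
  exact ⟨h2, h1, h3, h4.symm, h6, h5⟩

theorem sum_eq (f : Fin 4 → ℝ) : ∑ i, f i = f a + f b + f c + f d := by
  have h' := (isPerm4_iff a b c d).1 h
  obtain ⟨h1, h2, h3, h4, h5, h6⟩ := h'
  rw [h, Finset.sum_insert (by simp [*]), Finset.sum_insert (by simp [*]),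
    Finset.sum_insert (by simp [*]), Finset.sum_singleton]
  ring

theorem η_prod : η a * η b * η c * η d = -1 := by
  have h' := (isPerm4_iff a b c d).1 h
  obtain ⟨h1, h2, h3, h4, h5, h6⟩ := h'
  have : ∏ i, η i = η a * η b * η c * η d := by
    rw [h, Finset.prod_insert (by simp [*]), Finset.prod_insert (by simp [*]),
      Finset.prod_insert (by simp [*]), Finset.prod_singleton]
    ring
  rw [← this, Fin.prod_univ_four]
  simp [η]

theorem eps_mul_self : eps a b c d * eps a b c d = 1 := by
  have h' := (isPerm4_iff a b c d).1 h
  have : ∀ a b c d : Fin 4, a ≠ b ∧ a ≠ c ∧ a ≠ d ∧ b ≠ c ∧ b ≠ d ∧ c ≠ d →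
      epsInt a b c d * epsInt a b c d = 1 := by decide
  rw [eps_eq_epsInt, ← Int.cast_mul, this a b c d h', Int.cast_one]

/-- Contraction of the first and third index of the Levi-Civita symbol. -/
theorem sum_eps_13 (F : Fin 4 → Fin 4 → ℝ) :
    ∑ I, ∑ K, eps I a K b * F I K = eps c a d b * (F c d - F d c) := by
  simp only [h.sum_eq, eps_rep12, eps_rep13, eps_rep14, eps_rep23, eps_rep34]
  rw [eps_swap12 a d c b, eps_swap23 a c d b, eps_swap12 c a d b]
  ring

/-- Contraction of the second and fourth index of the Levi-Civita symbol. -/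
theorem sum_eps_24 (F : Fin 4 → Fin 4 → ℝ) :
    ∑ J, ∑ L, eps a J b L * F J L = eps a c b d * (F c d - F d c) := by
  simp only [h.sum_eq, eps_rep12, eps_rep14, eps_rep23, eps_rep24, eps_rep34]
  rw [eps_swap23 a b d c, eps_swap34 a b c d, eps_swap23 a c b d]
  ring

end IsPerm4

theorem polarForm_basis (β : ℝ) (q : Arr3) (l n m : Fin 4) : polarForm 1 β q (basisArr l n m) =
    (if n = m then η n * ∑ I, q I I l else 0) - η m * q n m l
      + ((if l = n then ∑ J, η J * q m J J else 0) - η n * q m l n)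
      + β * (∑ I, ∑ K, eps I m K n * (η I * q I K l)
        + η l * ∑ J, ∑ L, eps l J n L * q m L J) := by
  rw [polarForm, scalForm_basis_right, scalForm_basis_left, dualForm_basis_right,
    dualForm_basis_left]
  ring

section Block

theorem eps_rotate (a b c d : Fin 4) : eps b c a d = eps a b c d := by
  rw [eps_swap23 b a c d, eps_swap12 a b c d, neg_neg]

theorem eps_dbac (a b c d : Fin 4) : eps d b a c = eps a b c d := by
  rw [eps_swap23 d a b c, eps_swap12 a d b c, eps_swap23 a b d c, eps_swap34 a b c d]
  ring

theorem eps_bdca (a b c d : Fin 4) : eps b d c a = eps a b c d := by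
  rw [eps_swap34 b d a c, eps_swap23 b a d c, eps_swap34 b a c d, eps_swap12 a b c d]
  ring

theorem eps_acdb (a b c d : Fin 4) : eps a c d b = eps a b c d := by
  rw [eps_swap34 a c b d, eps_swap23 a b c d]
  ring

variable {β : ℝ} {q : Arr3} (hq : ∀ p, polarForm 1 β q p = 0) {a b c d : Fin 4}
  (h : IsPerm4 a b c d)

include hq h

/-- The equation for the component `p^d_{aa}` of the variation. -/
theorem block_daa : q b b d + q c c d + q d d d - q a d a
    + β * (eps a b c d * η d * (η a * q a c b) - eps a b c d * η d * (η a * q a b c)) = 0 := by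
  have e := hq (basisArr d a a)
  obtain ⟨h1, h2, h3, h4, h5, h6⟩ := (isPerm4_iff a b c d).1 h
  have h' : IsPerm4 d a b c := (isPerm4_iff _ _ _ _).2 ⟨h3.symm, h5.symm, h6.symm, h1, h2, h4⟩
  rw [polarForm_basis, h'.sum_eps_24, if_pos rfl, if_neg h3.symm, h.sum_eq] at e
  simp only [eps_rep24, zero_mul, Finset.sum_const_zero] at e
  rw [eps_dbac] at e
  linear_combination η a * e - (q b b d + q c c d + q d d d - q a d a) * η_mul_self a

/-- The equation for the component `p^a_{ad}` of the variation. -/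
theorem block_aad : q d d d + η b * η d * q d b b + η c * η d * q d c c - q a d a
    + β * (eps a b c d * η d * (η b * q b c a) - eps a b c d * η d * (η c * q c b a)) = 0 := by
  have e := hq (basisArr a a d)
  obtain ⟨h1, h2, h3, h4, h5, h6⟩ := (isPerm4_iff a b c d).1 h
  have h' : IsPerm4 d a b c := (isPerm4_iff _ _ _ _).2 ⟨h3.symm, h5.symm, h6.symm, h1, h2, h4⟩
  rw [polarForm_basis, h'.sum_eps_13, if_pos rfl, if_neg h3, h.sum_eq] at e
  simp only [eps_rep13, zero_mul, Finset.sum_const_zero] at e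
  rw [eps_bdca] at e
  linear_combination η d * e - (q d d d - q a d a) * η_mul_self d

/-- The equation for the component `p^a_{da}` of the variation. -/
theorem block_ada : -(η a * η d * q d a a) - q a a d
    + β * (eps a b c d * η d * (η a * q a b c) - eps a b c d * η d * (η a * q a c b)
      - eps a b c d * η d * (η b * q b c a) + eps a b c d * η d * (η c * q c b a)) = 0 := by
  have e := hq (basisArr a d a)
  obtain ⟨h1, h2, h3, h4, h5, h6⟩ := (isPerm4_iff a b c d).1 h
  have h' : IsPerm4 a d b c := (isPerm4_iff _ _ _ _).2 ⟨h3, h1, h2, h5.symm, h6.symm, h4⟩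
  rw [polarForm_basis, h'.sum_eps_13, h'.sum_eps_24, if_neg h3.symm, if_neg h3] at e
  rw [eps_swap12 a b c d, eps_swap34 a b c d] at e
  linear_combination η d * e + q a a d * η_mul_self d

/-- The equation for the component `p^d_{dd}` of the variation. -/
theorem block_ddd : q a a d + q b b d + q c c d + η a * η d * q d a a + η b * η d * q d b b
    + η c * η d * q d c c = 0 := by
  have e := hq (basisArr d d d)
  rw [polarForm_basis, if_pos rfl, if_pos rfl, h.sum_eq, h.sum_eq] at e
  simp only [eps_rep13, eps_rep24, zero_mul, Finset.sum_const_zero] at e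
  linear_combination η d * e - (q a a d + q b b d + q c c d) * η_mul_self d

/-- The equation for the component `p^a_{bc}` of the variation. -/
theorem block_abc : -(eps a b c d * η d * (η b * q b c a)) - eps a b c d * η d * (η c * q c a b)
    + β * (η a * η d * q d a a - q a d a + q c d c - q c c d) = 0 := by
  have e := hq (basisArr a b c)
  obtain ⟨h1, h2, h3, h4, h5, h6⟩ := (isPerm4_iff a b c d).1 h
  have h' : IsPerm4 c b a d := (isPerm4_iff _ _ _ _).2 ⟨h4.symm, h2.symm, h6, h1.symm, h5, h3⟩
  have hη := h.η_prod
  have hε := h.eps_mul_self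
  rw [polarForm_basis, h'.sum_eps_13, h.sum_eps_24, if_neg h4, if_neg h1] at e
  rw [eps_acdb, eps_swap23 a b c d] at e
  have ha := η_mul_self a
  have hb := η_mul_self b
  have hc := η_mul_self c
  have hd := η_mul_self d
  have hbc : η b * η c = -(η a * η d) := by
    linear_combination η a * η d * hη - η b * η c * ha - η b * η c * η a * η a * hd
  linear_combination (eps a b c d * η d * (η b * η c)) * e
    + (eps a b c d * η d * η b * q b c a) * hc
    + (eps a b c d * η d * η c * q c a b) * hb
    - β * (q a d a - q c d c + q c c d) * (η a * η b * η c * η d) * hε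
    - β * (q a d a - q c d c + q c c d) * hη
    + β * q d a a * (η d * η d * η b * η c) * hε + β * q d a a * (η b * η c) * hd
    + β * q d a a * hbc

/-- The sixteen equations with indices in the block of `d`, which couple `q_{aad}`, `q_{daa}`, `q_{ada}`,
`q_{ddd}` and the components with three different indices other than `d`, determine these up to the
trace part. -/
theorem block_eq_zero : q a a d = 0 ∧ q d a a = 0 ∧ q a b c = 0 ∧ q a d a = q d d d := by
  have e_daa := block_daa hq h
  have e_dbb := block_daa hq h.rotate
  have e_dcc := block_daa hq h.rotate.rotate
  have e_aad := block_aad hq h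
  have e_bbd := block_aad hq h.rotate
  have e_ccd := block_aad hq h.rotate.rotate
  have e_ada := block_ada hq h
  have e_bdb := block_ada hq h.rotate
  have e_cdc := block_ada hq h.rotate.rotate
  have e_abc := block_abc hq h
  have e_bca := block_abc hq h.rotate
  have e_cab := block_abc hq h.rotate.rotate
  have e_acb := block_abc hq h.swap
  have e_cba := block_abc hq h.swap.rotate
  have e_bac := block_abc hq h.swap.rotate.rotate
  have r1 := eps_rotate a b c d
  have r2 := eps_rotate b c a d
  have r3 := eps_rotate a c b d
  have r4 := eps_rotate c b a d
  rw [r1] at r2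
  rw [eps_swap23 a b c d] at r3
  rw [r3] at r4
  rw [r1] at e_dbb e_bbd e_bdb e_bca
  rw [r2] at e_dcc e_ccd e_cdc e_cab
  rw [eps_swap23 a b c d] at e_acb
  rw [r3] at e_cba
  rw [r4] at e_bac
  have e_ddd := block_ddd hq h
  clear r1 r2 r3 r4
  have ha := η_mul_self a
  have hd := η_mul_self d
  have hε := h.eps_mul_self
  -- The multipliers below come from inverting this linear system for indeterminate `β`. The factors
  -- `1 + 10 β² + 9 β⁴ = (1 + β²) (1 + 9 β²)` and `1 + 9 β²` have no real zero.
  have h1 : (1 + 10 * β ^ 2 + 9 * β ^ 4) * q a a d = 0 := by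
    linear_combination
      e_daa * (-1/4 - 13/4 * β ^ 2 - 1 * β ^ 4) + e_aad * (1/4 + 5/4 * β ^ 2 - 1 * β ^ 4)
      + e_ada * (-1/2 - 3 * β ^ 2 - 5/2 * β ^ 4) + e_dbb * (1/4 + 11/4 * β ^ 2 + 1/2 * β ^ 4)
      + e_bbd * (-1/4 - 7/4 * β ^ 2 + 1/2 * β ^ 4) + e_dcc * (1/4 + 11/4 * β ^ 2 + 1/2 * β ^ 4)
      + e_ccd * (-1/4 - 7/4 * β ^ 2 + 1/2 * β ^ 4) + e_abc * (1/4 * β - 7/4 * β ^ 3)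
      + e_acb * (1/4 * β - 7/4 * β ^ 3) + e_bca * (-3/4 * β - 11/4 * β ^ 3)
      + e_bac * (1/4 * β + 9/4 * β ^ 3) + e_cab * (1/4 * β + 9/4 * β ^ 3)
      + e_cba * (-3/4 * β - 11/4 * β ^ 3) + e_bdb * (-1 * β ^ 2 - 1 * β ^ 4)
      + e_cdc * (-1 * β ^ 2 - 1 * β ^ 4)
  have h2 : (1 + 10 * β ^ 2 + 9 * β ^ 4) * (η a * η d * q d a a) = 0 := by
    linear_combination
      e_daa * (1/4 + 5/4 * β ^ 2 - 1 * β ^ 4) + e_aad * (-1/4 - 13/4 * β ^ 2 - 1 * β ^ 4)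
      + e_ada * (-1/2 - 3 * β ^ 2 - 5/2 * β ^ 4) + e_dbb * (-1/4 - 7/4 * β ^ 2 + 1/2 * β ^ 4)
      + e_bbd * (1/4 + 11/4 * β ^ 2 + 1/2 * β ^ 4) + e_dcc * (-1/4 - 7/4 * β ^ 2 + 1/2 * β ^ 4)
      + e_ccd * (1/4 + 11/4 * β ^ 2 + 1/2 * β ^ 4) + e_abc * (3/4 * β + 11/4 * β ^ 3)
      + e_acb * (3/4 * β + 11/4 * β ^ 3) + e_bca * (-1/4 * β + 7/4 * β ^ 3)
      + e_bac * (-1/4 * β - 9/4 * β ^ 3) + e_cab * (-1/4 * β - 9/4 * β ^ 3)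
      + e_cba * (-1/4 * β + 7/4 * β ^ 3) + e_bdb * (-1 * β ^ 2 - 1 * β ^ 4)
      + e_cdc * (-1 * β ^ 2 - 1 * β ^ 4)
  have h3 : (1 + 10 * β ^ 2 + 9 * β ^ 4) * (eps a b c d * η d * (η a * q a b c)) = 0 := by
    linear_combination
      e_abc * (1/2 + 7/4 * β ^ 2 - 3/4 * β ^ 4) + e_bca * (-1/2 - 13/4 * β ^ 2 - 3/4 * β ^ 4)
      + e_cab * (-1/2 - 13/4 * β ^ 2 - 3/4 * β ^ 4) + e_daa * (-3/4 * β - 11/4 * β ^ 3)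
      + e_aad * (-1/4 * β + 7/4 * β ^ 3) + e_ada * (1 * β + 1 * β ^ 3)
      + e_dbb * (1/4 * β + 9/4 * β ^ 3) + e_bbd * (-1/4 * β - 9/4 * β ^ 3)
      + e_dcc * (1/4 * β - 7/4 * β ^ 3) + e_ccd * (3/4 * β + 11/4 * β ^ 3)
      + e_cdc * (-1 * β - 1 * β ^ 3) + e_acb * (-5/4 * β ^ 2 + 3/4 * β ^ 4)
      + e_bac * (-5/4 * β ^ 2 + 3/4 * β ^ 4) + e_cba * (11/4 * β ^ 2 + 3/4 * β ^ 4)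
  have h4 : (1 + 9 * β ^ 2) * (q a d a - q d d d) = 0 := by
    linear_combination
      e_daa * (-1/2 - 5/2 * β ^ 2) + e_aad * (-1/2 - 5/2 * β ^ 2)
      + e_bdb * (-1/2 - 5/2 * β ^ 2) + e_cdc * (-1/2 - 5/2 * β ^ 2) + e_abc * (-1 * β)
      + e_acb * (-1 * β) + e_bca * (1 * β) + e_cba * (1 * β) + e_ada * (-4 * β ^ 2)
      + e_dbb * (-1 * β ^ 2) + e_bbd * (-1 * β ^ 2) + e_dcc * (-1 * β ^ 2)
      + e_ccd * (-1 * β ^ 2)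
  have hβ : 1 + 10 * β ^ 2 + 9 * β ^ 4 ≠ 0 := by positivity
  have hβ' : 1 + 9 * β ^ 2 ≠ 0 := by positivity
  refine ⟨(mul_eq_zero.1 h1).resolve_left hβ, ?_, ?_,
    sub_eq_zero.1 ((mul_eq_zero.1 h4).resolve_left hβ')⟩
  · have := (mul_eq_zero.1 h2).resolve_left hβ
    linear_combination η a * η d * this - q d a a * η d * η d * ha - q d a a * hd
  · have := (mul_eq_zero.1 h3).resolve_left hβ
    linear_combination eps a b c d * η d * η a * this
      - q a b c * η d * η d * η a * η a * hε - q a b c * η d * η d * ha - q a b c * hd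

end Block

theorem exists_isPerm4_ends : ∀ a d : Fin 4, a ≠ d → ∃ b c, IsPerm4 a b c d := by
  unfold IsPerm4
  decide

theorem exists_isPerm4_last : ∀ a b c : Fin 4, a ≠ b → a ≠ c → b ≠ c → ∃ d, IsPerm4 a b c d := by
  unfold IsPerm4
  decide

/-- In an orthonormal frame the kernel of the polarised quadratic part consists of the arrays
`δ^I_K u_J`. -/
theorem polarForm_kernel {a b : ℝ} (ha : a ≠ 0) {q : Arr3} (hq : ∀ p, polarForm a b q p = 0)
    (I J K : Fin 4) : q I J K = if I = K then q J J J else 0 := by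
  have hq' : ∀ p, polarForm 1 (b / a) q p = 0 := by
    intro p
    have h := hq p
    have e : polarForm 1 (b / a) q p = polarForm a b q p / a := by
      unfold polarForm
      field_simp
    rw [e, h, zero_div]
  by_cases hIK : I = K
  · subst hIK
    rw [if_pos rfl]
    by_cases hIJ : I = J
    · rw [hIJ]
    · obtain ⟨b, c, h⟩ := exists_isPerm4_ends I J hIJ
      exact (block_eq_zero hq' h).2.2.2
  · rw [if_neg hIK]
    by_cases hIJ : I = J
    · subst hIJ
      obtain ⟨b, c, h⟩ := exists_isPerm4_ends I K hIK
      exact (block_eq_zero hq' h).1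
    · by_cases hJK : J = K
      · subst hJK
        obtain ⟨b, c, h⟩ := exists_isPerm4_ends J I (Ne.symm hIJ)
        exact (block_eq_zero hq' h).2.1
      · obtain ⟨d, h⟩ := exists_isPerm4_last I J K hIJ hIK hJK
        exact (block_eq_zero hq' h).2.2.1

/-- The array `δ^α_σ U_β`. -/
def deltaArr (U : Fin 4 → ℝ) : Arr3 := fun α β σ => if α = σ then U β else 0

section Bilinear

theorem sum_congr2 {f g : Fin 4 → Fin 4 → ℝ} (h : ∀ i j, f i j = g i j) :
    ∑ i, ∑ j, f i j = ∑ i, ∑ j, g i j := by simp only [h]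

variable (I G : Fin 4 → Fin 4 → ℝ)

theorem scalForm_add_left (Q R P : Arr3) :
    scalForm I (Q + R) P = scalForm I Q P + scalForm I R P := by
  simp only [scalForm, Pi.add_apply, ← Finset.sum_add_distrib, ← mul_add]
  refine sum_congr2 fun β δ => ?_
  congr 1
  exact sum_congr2 fun α l => by ring

theorem scalForm_add_right (Q R P : Arr3) :
    scalForm I P (Q + R) = scalForm I P Q + scalForm I P R := by
  simp only [scalForm, Pi.add_apply, ← Finset.sum_add_distrib, ← mul_add]
  refine sum_congr2 fun β δ => ?_
  congr 1
  exact sum_congr2 fun α l => by ring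

theorem scalForm_smul_left (c : ℝ) (Q P : Arr3) : scalForm I (c • Q) P = c * scalForm I Q P := by
  simp only [scalForm, Pi.smul_apply, smul_eq_mul, Finset.mul_sum]
  exact sum4_congr fun β δ α l => by ring

theorem scalForm_smul_right (c : ℝ) (Q P : Arr3) : scalForm I P (c • Q) = c * scalForm I P Q := by
  simp only [scalForm, Pi.smul_apply, smul_eq_mul, Finset.mul_sum]
  exact sum4_congr fun β δ α l => by ring

theorem dualForm_add_left (Q R P : Arr3) :
    dualForm G (Q + R) P = dualForm G Q P + dualForm G R P := by
  simp only [dualForm, Pi.add_apply, ← Finset.sum_add_distrib, ← mul_add, add_mul]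

theorem dualForm_add_right (Q R P : Arr3) :
    dualForm G P (Q + R) = dualForm G P Q + dualForm G P R := by
  simp only [dualForm, Pi.add_apply, ← Finset.sum_add_distrib, ← mul_add]

theorem dualForm_smul_left (c : ℝ) (Q P : Arr3) : dualForm G (c • Q) P = c * dualForm G Q P := by
  simp only [dualForm, Pi.smul_apply, smul_eq_mul, Finset.mul_sum]
  exact sum4_congr fun β δ α l => sum_congr2 fun i j => by ring

theorem dualForm_smul_right (c : ℝ) (Q P : Arr3) : dualForm G P (c • Q) = c * dualForm G P Q := by
  simp only [dualForm, Pi.smul_apply, smul_eq_mul, Finset.mul_sum]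
  exact sum4_congr fun β δ α l => sum_congr2 fun i j => by ring

end Bilinear

/-- The polarisation of the quadratic part of the generalised Lagrangian. -/
noncomputable def genPolar (a b : ℝ) (G I : Fin 4 → Fin 4 → ℝ) (r : ℝ) (Q P : Arr3) : ℝ :=
  genForm a b G I r Q P + genForm a b G I r P Q

theorem genForm_add_smul (a b : ℝ) (G I : Fin 4 → Fin 4 → ℝ) (r t : ℝ) (Q P : Arr3) :
    genForm a b G I r (Q + t • P) (Q + t • P) =
      genForm a b G I r Q Q + t * genPolar a b G I r Q P + t ^ 2 * genForm a b G I r P P := by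
  simp only [genForm, genPolar, scalForm_add_left, scalForm_add_right, scalForm_smul_left,
    scalForm_smul_right, dualForm_add_left, dualForm_add_right, dualForm_smul_left,
    dualForm_smul_right]
  ring

/-- The arrays `δ^α_σ U_β` lie in the kernel of the polarisation. -/
theorem genPolar_deltaArr (a b : ℝ) (G I : Fin 4 → Fin 4 → ℝ) (r : ℝ) (U : Fin 4 → ℝ) (P : Arr3) :
    genPolar a b G I r (deltaArr U) P = 0 := by
  have h1 : scalForm I (deltaArr U) P + scalForm I P (deltaArr U) = 0 := by
    have e1 : ∀ β δ, ∑ α, ∑ l, (deltaArr U α α l * P l δ β - deltaArr U α δ l * P l α β) =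
        ∑ α, (U α * P α δ β - U δ * P α α β) := by
      intro β δ
      refine Finset.sum_congr rfl fun α _ => ?_
      simp [deltaArr, Finset.sum_sub_distrib]
    have e2 : ∀ β δ, ∑ α, ∑ l, (P α α l * deltaArr U l δ β - P α δ l * deltaArr U l α β) =
        ∑ α, (P α α β * U δ - P α δ β * U α) := by
      intro β δ
      refine Finset.sum_congr rfl fun α _ => ?_
      simp [deltaArr, Finset.sum_sub_distrib]
    simp only [scalForm, e1, e2, ← Finset.sum_add_distrib, ← mul_add]
    refine Finset.sum_eq_zero fun β _ => Finset.sum_eq_zero fun δ _ => ?_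
    rw [Finset.sum_eq_zero fun α _ => by ring, mul_zero]
  have h2 : dualForm G (deltaArr U) P + dualForm G P (deltaArr U) = 0 := by
    have e1 : dualForm G (deltaArr U) P =
        ∑ α, ∑ β, ∑ μ, ∑ ν, eps α β μ ν * ∑ l, G α l * (U μ * P l ν β) := by
      simp [dualForm, deltaArr]
    have e2 : dualForm G P (deltaArr U) =
        ∑ α, ∑ β, ∑ μ, ∑ ν, eps α β μ ν * ∑ l, G α l * (P l μ β * U ν) := by
      simp [dualForm, deltaArr]
    rw [e1, e2, sum4_swap34 fun α β μ ν => eps α β μ ν * ∑ l, G α l * (P l μ β * U ν)]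
    simp only [← Finset.sum_add_distrib]
    refine Finset.sum_eq_zero fun α _ => Finset.sum_eq_zero fun β _ =>
      Finset.sum_eq_zero fun μ _ => Finset.sum_eq_zero fun ν _ => ?_
    rw [eps_swap34 α β μ ν]
    simp only [mul_comm (U μ)]
    ring
  unfold genPolar genForm
  linear_combination a * r * h1 + b * h2

theorem genForm_add_deltaArr (a b : ℝ) (G I : Fin 4 → Fin 4 → ℝ) (r : ℝ) (U : Fin 4 → ℝ)
    (P : Arr3) : genForm a b G I r (deltaArr U + P) (deltaArr U + P) = genForm a b G I r P P := by
  have h1 := genForm_add_smul a b G I r 1 (deltaArr U) P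
  have h2 := genPolar_deltaArr a b G I r U P
  have h3 := genPolar_deltaArr a b G I r U (deltaArr U)
  rw [one_smul] at h1
  unfold genPolar at h3
  linear_combination h1 + h2 + (1 / 2) * h3

section Frame

variable {e E : Matrix (Fin 4) (Fin 4) ℝ} (h : E * e = 1) {G I : Fin 4 → Fin 4 → ℝ}
  (hG : ∀ α β, G α β = ∑ J, η J * (e J α * e J β)) (hI : ∀ α β, I α β = ∑ J, η J * (E α J * E β J))

include h hG hI

theorem genPolar_fromFrame (a b r : ℝ) (q p : Arr3) :
    genPolar a b G I r (fromFrame e E q) (fromFrame e E p) = polarForm (a * r) (b * e.det) q p := by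
  simp only [genPolar, genForm, polarForm, scalForm_fromFrame h hI, dualForm_fromFrame h hG]
  ring

/-- The kernel of the polarisation of the quadratic part of the generalised Lagrangian. -/
theorem genPolar_kernel {a b r : ℝ} (ha : a ≠ 0) (hr : r ≠ 0) {Q : Arr3}
    (hQ : ∀ P, genPolar a b G I r Q P = 0) : ∃ U, Q = deltaArr U := by
  let q := toFrame e E Q
  have hq : ∀ I J K, q I J K = if I = K then q J J J else 0 := by
    refine polarForm_kernel (a := a * r) (b := b * e.det) (mul_ne_zero ha hr) fun p => ?_
    rw [← genPolar_fromFrame h hG hI, fromFrame_toFrame h]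
    exact hQ _
  refine ⟨fun β => ∑ J, e J β * q J J J, ?_⟩
  have hs : ∀ J, slice q J = q J J J • (1 : Matrix (Fin 4) (Fin 4) ℝ) := by
    intro J
    ext I K
    rw [slice, Matrix.of_apply, hq, Matrix.smul_apply, Matrix.one_apply, smul_eq_mul, mul_ite,
      mul_one, mul_zero]
  rw [← fromFrame_toFrame h Q]
  funext α β σ
  have h1 : ∀ J, e J β • (E * slice q J * e) =
      (e J β * q J J J) • (1 : Matrix (Fin 4) (Fin 4) ℝ) := by
    intro J
    rw [hs, Matrix.mul_smul, Matrix.mul_one, Matrix.smul_mul, h, smul_smul]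
  change (∑ J, e J β • (E * slice q J * e)) α σ = _
  simp only [h1, ← Finset.sum_smul]
  rw [Matrix.smul_apply, Matrix.one_apply, deltaArr, smul_eq_mul, mul_ite, mul_one, mul_zero]

end Frame

/-- Arrays with values in the Lorentz Lie algebra: `η_I q^I_{JK}` is antisymmetric in `I`, `K`. -/
def IsLorentz (q : Arr3) : Prop := ∀ I J K, η I * q I J K = -(η K * q K J I)

/-- Arrays with `η_I p^I_{JK}` symmetric in `I`, `K`. -/
def IsSelfAdj (p : Arr3) : Prop := ∀ I J K, η I * p I J K = η K * p K J I

theorem polarForm_lorentz_selfAdj (a b : ℝ) {q p : Arr3} (hq : IsLorentz q) (hp : IsSelfAdj p) :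
    polarForm a b q p = 0 := by
  have hq' : ∀ I J K, q I J K = -(η I * η K * q K J I) := by
    intro I J K
    linear_combination η I * hq I J K - q I J K * η_mul_self I
  have hp' : ∀ I J K, p I J K = η I * η K * p K J I := by
    intro I J K
    linear_combination η I * hp I J K - p I J K * η_mul_self I
  have h1 : scalForm minkowski q p + scalForm minkowski p q = 0 := by
    have e1 : ∀ r s : Arr3, scalForm minkowski r s =
        ∑ β, ∑ α, ∑ l, η β * (r α α l * s l β β - r α β l * s l α β) := by
      intro r s
      rw [scalForm, sum_minkowski_mul]
      simp only [Finset.mul_sum]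
    have e2 : ∀ α β l, η β * (q α α l * p l β β - q α β l * p l α β) =
        -(η α * (p β β l * q l α α - p β α l * q l β α)) := by
      intro α β l
      rw [hq' α α l, hp' l β β, hq' α β l, hp' l α β]
      linear_combination (-(η α * η β * η β * (q l α α * p β β l - q l β α * p β α l))) *
        η_mul_self l - (η α * (q l α α * p β β l - q l β α * p β α l)) * η_mul_self β
    rw [e1, e1]
    simp only [e2, Finset.sum_neg_distrib]
    rw [Finset.sum_comm, neg_add_cancel]
  have h2 : dualForm minkowski q p + dualForm minkowski p q = 0 := by
    rw [dualForm_minkowski, dualForm_minkowski]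
    have e1 : ∑ α, ∑ β, ∑ μ, ∑ ν, eps α β μ ν * (η α * ∑ s, q α μ s * p s ν β) =
        ∑ α, ∑ β, ∑ μ, ∑ ν, eps α β μ ν * -(η β * ∑ s, p β ν s * q s μ α) := by
      refine sum4_congr fun α β μ ν => ?_
      congr 1
      rw [Finset.mul_sum, Finset.mul_sum, ← Finset.sum_neg_distrib]
      refine Finset.sum_congr rfl fun s _ => ?_
      rw [hq' α μ s, hp' s ν β]
      linear_combination (-(η s * q s μ α * (η s * η β * p β ν s))) * η_mul_self α
        - (q s μ α * η β * p β ν s) * η_mul_self s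
    have e2 : ∑ α, ∑ β, ∑ μ, ∑ ν, eps α β μ ν * -(η β * ∑ s, p β ν s * q s μ α) =
        ∑ α, ∑ β, ∑ μ, ∑ ν, eps α β μ ν * -(η α * ∑ s, p α μ s * q s ν β) := by
      rw [sum4_swap12, sum4_swap34]
      refine sum4_congr fun α β μ ν => ?_
      rw [eps_swap12 α β ν μ, eps_swap34 α β μ ν, neg_neg]
    rw [e1, e2]
    simp only [mul_neg, Finset.sum_neg_distrib, neg_add_cancel]
  unfold polarForm
  linear_combination a * h1 + b * h2

/-- For an array with values in the Lorentz algebra it suffices to test the polarised quadratic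
part on such arrays. -/
theorem eq_zero_of_polarForm_lorentz {a b : ℝ} (ha : a ≠ 0) {q : Arr3} (hq : IsLorentz q)
    (h : ∀ p, IsLorentz p → polarForm a b q p = 0) : q = 0 := by
  have hall : ∀ p, polarForm a b q p = 0 := by
    intro p
    let p' : Arr3 := fun I J K => η I * η K * p K J I
    have hs : p = (1 / 2 : ℝ) • (p - p') + (1 / 2 : ℝ) • (p + p') := by
      funext I J K
      simp only [Pi.add_apply, Pi.smul_apply, Pi.sub_apply, smul_eq_mul]
      ring
    have hA : IsLorentz ((1 / 2 : ℝ) • (p - p')) := by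
      intro I J K
      simp only [Pi.smul_apply, Pi.sub_apply, smul_eq_mul, p']
      linear_combination (-(1 / 2) * η K * p K J I) * η_mul_self I
        - (1 / 2) * (η I * p I J K) * η_mul_self K
    have hS : IsSelfAdj ((1 / 2 : ℝ) • (p + p')) := by
      intro I J K
      simp only [Pi.smul_apply, Pi.add_apply, smul_eq_mul, p']
      linear_combination (1 / 2 * η K * p K J I) * η_mul_self I
        - (1 / 2) * (η I * p I J K) * η_mul_self K
    have e := h _ hA
    have e' := polarForm_lorentz_selfAdj a b hq hS
    rw [hs]
    unfold polarForm at e e' ⊢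
    simp only [scalForm_add_left, scalForm_add_right, dualForm_add_left, dualForm_add_right]
    linear_combination e + e'
  have hk := polarForm_kernel ha hall
  have hd : ∀ J, q J J J = 0 := by
    intro J
    have h1 := hq J J J
    have h2 : η J ≠ 0 := fun h0 => by
      have := η_mul_self J
      rw [h0] at this
      simp at this
    have h3 : η J * q J J J = 0 := by linarith
    exact (mul_eq_zero.1 h3).resolve_left h2
  funext I J K
  rw [hk, hd]
  simp

/-! ### First variation of the generalised Lagrangian -/

/-- Smooth dependence of the components of a family of metrics on the parameter and the point,
near the parameter value `0`, together with nondegeneracy. -/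
structure MetricFamilyAt (G : ℝ → LMetric) (x : E4) : Prop where
  mem : x ∈ halfSpace
  symm : ∀ t y α β, G t y α β = G t y β α
  det_ne : (Matrix.of (G 0 x)).det ≠ 0
  smooth : ∀ α β, SmoothFamilyAt (fun t y => G t y α β) x

namespace MetricFamilyAt

variable {G : ℝ → LMetric} {x : E4} (hG : MetricFamilyAt G x)

include hG

theorem gInv (α β : Fin 4) : SmoothFamilyAt (fun t y => gInv (G t) y α β) x :=
  SmoothFamilyAt.matrix_inv (F := fun t y => Matrix.of (G t y)) hG.smooth hG.det_ne α β

theorem det : SmoothFamilyAt (fun t y => (Matrix.of (G t y)).det) x :=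
  SmoothFamilyAt.det (F := fun t y => Matrix.of (G t y)) hG.smooth

theorem sqrtDet : SmoothFamilyAt (fun t y => sqrtDet (G t) y) x :=
  (hG.det.abs hG.det_ne).sqrt (abs_ne_zero.2 hG.det_ne)

theorem christoffel (α β σ : Fin 4) :
    SmoothFamilyAt (fun t y => christoffel (G t) y α β σ) x :=
  (SmoothFamilyAt.const _).mul (SmoothFamilyAt.sum fun μ _ => (hG.gInv α μ).mul
    ((((hG.smooth μ σ).pd hG.mem β).add ((hG.smooth β μ).pd hG.mem σ)).sub
      ((hG.smooth β σ).pd hG.mem μ)))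

theorem bulkEH (Λ : ℝ) : SmoothFamilyAt (fun t y => bulkEH Λ (G t) y) x := by
  have hC := hG.christoffel
  have hR : ∀ ρ σ μ ν, SmoothFamilyAt (fun t y => riemann (HMS.christoffel (G t)) y ρ σ μ ν) x :=
    fun ρ σ μ ν => (((hC ρ ν σ).pd hG.mem μ).sub ((hC ρ μ σ).pd hG.mem ν)).add
      (SmoothFamilyAt.sum fun l _ => ((hC ρ μ l).mul (hC l ν σ)).sub ((hC ρ ν l).mul (hC l μ σ)))
  exact ((SmoothFamilyAt.sum fun β _ => SmoothFamilyAt.sum fun δ _ => (hG.gInv β δ).mul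
    (SmoothFamilyAt.sum fun α _ => hR α β α δ)).sub (SmoothFamilyAt.const _)).mul hG.sqrtDet

theorem eventually_metricAt : ∀ᶠ t in 𝓝 (0 : ℝ), MetricAt (G t) x := by
  filter_upwards [hG.det.eventually_ne hG.mem hG.det_ne, eventually_all.2 fun α =>
    eventually_all.2 fun β => (hG.smooth α β).eventually_contDiffWithinAt hG.mem] with t h1 h2
  exact ⟨hG.mem, hG.symm t, h1, h2⟩

section Boundary

variable (h00 : 0 < HMS.gInv (G 0) x 0 0)

include h00

theorem eventually_gInv_pos : ∀ᶠ t in 𝓝 (0 : ℝ), 0 < HMS.gInv (G t) x 0 0 :=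
  ((hG.gInv 0 0).contDiffAt_param hG.mem).continuousAt.eventually (lt_mem_nhds h00)

theorem nuLow (α : Fin 4) : SmoothFamilyAt (fun t y => nuLow (G t) y α) x := by
  unfold HMS.nuLow
  by_cases hα : α = 0
  · simp only [hα, if_true]
    exact (SmoothFamilyAt.const _).div ((hG.gInv 0 0).sqrt h00.ne') (Real.sqrt_pos.2 h00).ne'
  · simp only [hα, if_false]
    exact SmoothFamilyAt.const _

theorem bdryGHY : SmoothFamilyAt (fun t y => bdryGHY (G t) y) x := by
  have hdet := det_gBdry_ne h00
  have hb : ∀ a b : Fin 3, SmoothFamilyAt (fun t y => gBdry (G t) y a b) x :=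
    fun a b => hG.smooth _ _
  have hs : SmoothFamilyAt (fun t y => sqrtDetBdry (G t) y) x :=
    ((SmoothFamilyAt.det hb).abs hdet).sqrt (abs_ne_zero.2 hdet)
  refine ((SmoothFamilyAt.const (-2)).mul (SmoothFamilyAt.sum fun a _ =>
    SmoothFamilyAt.sum fun b _ => (SmoothFamilyAt.matrix_inv hb hdet a b).mul
      (((hG.nuLow h00 b.succ).pd hG.mem a.succ).sub (SmoothFamilyAt.sum fun l _ =>
        (hG.christoffel l a.succ b.succ).mul (hG.nuLow h00 l))))).mul hs

end Boundary

variable {Q : ℝ → LConn} (hQ : ∀ α β σ, SmoothFamilyAt (fun t y => Q t y α β σ) x)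
  {a : E4 → ℝ} (ha : ∀ᶠ y in 𝓝[halfSpace] x, a y = a x)

omit hG in
theorem smoothFamilyAt_weight (hx : x ∈ halfSpace) (ha : ∀ᶠ y in 𝓝[halfSpace] x, a y = a x) :
    SmoothFamilyAt (fun _ => a) x :=
  SmoothFamilyAt.of_contDiffWithinAt (contDiffWithinAt_const.congr_of_eventuallyEq ha
    (ha.self_of_nhdsWithin hx))

include hQ ha

theorem divVec (b : ℝ) (μ : Fin 4) : SmoothFamilyAt (fun t y => divVec a b (G t) (Q t) μ y) x := by
  refine ((smoothFamilyAt_weight hG.mem ha).mul (hG.sqrtDet.mul ((SmoothFamilyAt.sum fun β _ =>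
    SmoothFamilyAt.sum fun δ _ => (hG.gInv β δ).mul (hQ μ δ β)).sub (SmoothFamilyAt.sum fun β _ =>
    SmoothFamilyAt.sum fun l _ => (hG.gInv β μ).mul (hQ l l β))))).add
    ((SmoothFamilyAt.const b).mul (SmoothFamilyAt.neg ?_))
  exact SmoothFamilyAt.sum fun α _ => SmoothFamilyAt.sum fun β _ => SmoothFamilyAt.sum fun ν _ =>
    (SmoothFamilyAt.const _).mul (SmoothFamilyAt.sum fun l _ => (hG.smooth α l).mul (hQ l β ν))

theorem genForm (b : ℝ) : SmoothFamilyAt (fun t y => genForm (a y) b (G t y) (HMS.gInv (G t) y)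
    (HMS.sqrtDet (G t) y) (Q t y) (Q t y)) x := by
  refine ((smoothFamilyAt_weight hG.mem ha).mul (hG.sqrtDet.mul (SmoothFamilyAt.sum fun β _ =>
    SmoothFamilyAt.sum fun δ _ => (hG.gInv β δ).mul (SmoothFamilyAt.sum fun α _ =>
      SmoothFamilyAt.sum fun l _ => ((hQ α α l).mul (hQ l δ β)).sub
        ((hQ α δ l).mul (hQ l α β)))))).add ((SmoothFamilyAt.const b).mul ?_)
  exact SmoothFamilyAt.sum fun α _ => SmoothFamilyAt.sum fun β _ => SmoothFamilyAt.sum fun μ _ =>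
    SmoothFamilyAt.sum fun ν _ => (SmoothFamilyAt.const _).mul (SmoothFamilyAt.sum fun l _ =>
      (hG.smooth α l).mul (SmoothFamilyAt.sum fun s _ => (hQ l μ s).mul (hQ s ν β)))

end MetricFamilyAt

/-- A smooth family of pairs `(g, Q)` on a patch `T` that is constant in the parameter off the
compact set `K`, with a locally constant weight `a`. -/
structure IsFamily (T K : Set E4) (a : E4 → ℝ) (G : ℝ → LMetric) (Q : ℝ → LConn) : Prop where
  patch : IsPatch T
  compact : IsCompact K
  subset : K ⊆ T
  metric : ∀ x ∈ T, MetricFamilyAt G x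
  conn : ∀ x ∈ T, ∀ α β σ, SmoothFamilyAt (fun t y => Q t y α β σ) x
  weight : ∀ x ∈ T, ∀ᶠ y in 𝓝[halfSpace] x, a y = a x
  bdry : ∀ x ∈ T, x 0 = 0 → 0 < gInv (G 0) x 0 0
  metric_eq : ∀ t, ∀ x, x ∉ K → G t x = G 0 x
  conn_eq : ∀ t, ∀ x, x ∉ K → Q t x = Q 0 x

theorem variation_eq_zero {F : ℝ → E4 → ℝ} {x : E4} (h : ∀ t, F t x = F 0 x) :
    variation F x = 0 := by
  unfold variation
  have : (fun t => F t x) = fun _ => F 0 x := funext h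
  rw [this, deriv_const]

theorem variation_add {F H : ℝ → E4 → ℝ} {x : E4} (hx : x ∈ halfSpace) (hF : SmoothFamilyAt F x)
    (hH : SmoothFamilyAt H x) :
    variation (fun t y => F t y + H t y) x = variation F x + variation H x :=
  deriv_fun_add (hF.differentiableAt_param hx) (hH.differentiableAt_param hx)

theorem variation_sub {F H : ℝ → E4 → ℝ} {x : E4} (hx : x ∈ halfSpace) (hF : SmoothFamilyAt F x)
    (hH : SmoothFamilyAt H x) :
    variation (fun t y => F t y - H t y) x = variation F x - variation H x :=
  deriv_fun_sub (hF.differentiableAt_param hx) (hH.differentiableAt_param hx)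

theorem variation_sum {ι : Type*} {s : Finset ι} {F : ι → ℝ → E4 → ℝ} {x : E4} (hx : x ∈ halfSpace)
    (hF : ∀ i ∈ s, SmoothFamilyAt (F i) x) :
    variation (fun t y => ∑ i ∈ s, F i t y) x = ∑ i ∈ s, variation (F i) x :=
  deriv_fun_sum fun i hi => (hF i hi).differentiableAt_param hx

theorem variation_congr {F H : ℝ → E4 → ℝ} {x : E4} (h : ∀ᶠ t in 𝓝 (0 : ℝ), F t x = H t x) :
    variation F x = variation H x :=
  Filter.EventuallyEq.deriv_eq h

theorem pd_congr_of_notMem {K : Set E4} (hK : IsClosed K) {f h : E4 → ℝ}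
    (hf : ∀ x, x ∉ K → f x = h x) {x : E4} (hx : x ∉ K) (μ : Fin 4) : pd μ f x = pd μ h x := by
  unfold pd
  rw [Filter.EventuallyEq.fderivWithin_eq (nhdsWithin_le_nhds
    ((hK.isOpen_compl.eventually_mem hx).mono fun y hy => hf y hy)) (hf x hx)]

namespace IsFamily

variable {T K : Set E4} {a : E4 → ℝ} {G : ℝ → LMetric} {Q : ℝ → LConn}
  (h : IsFamily T K a G Q)

include h

theorem gInv_eq (t : ℝ) {x : E4} (hx : x ∉ K) (α β : Fin 4) :
    gInv (G t) x α β = gInv (G 0) x α β := by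
  simp only [gInv, h.metric_eq t x hx]

theorem christoffel_eq (t : ℝ) {x : E4} (hx : x ∉ K) (α β σ : Fin 4) :
    christoffel (G t) x α β σ = christoffel (G 0) x α β σ := by
  have hp : ∀ μ α β, pd μ (fun y => G t y α β) x = pd μ (fun y => G 0 y α β) x := fun μ α β =>
    pd_congr_of_notMem h.compact.isClosed (fun y hy => by rw [h.metric_eq t y hy]) hx μ
  simp only [christoffel, h.gInv_eq t hx, hp]

theorem bulkEH_eq (Λ t : ℝ) {x : E4} (hx : x ∉ K) : bulkEH Λ (G t) x = bulkEH Λ (G 0) x := by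
  have hp : ∀ μ α β σ, pd μ (fun y => christoffel (G t) y α β σ) x =
      pd μ (fun y => christoffel (G 0) y α β σ) x := fun μ α β σ =>
    pd_congr_of_notMem h.compact.isClosed (fun y hy => h.christoffel_eq t hy α β σ) hx μ
  simp only [bulkEH, scalarCurv, riemann, h.gInv_eq t hx, hp, h.christoffel_eq t hx, sqrtDet,
    h.metric_eq t x hx]

theorem bdryGHY_eq (t : ℝ) {x : E4} (hx : x ∉ K) : bdryGHY (G t) x = bdryGHY (G 0) x := by
  have hn : ∀ y, y ∉ K → ∀ α, nuLow (G t) y α = nuLow (G 0) y α := fun y hy α => by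
    simp only [nuLow, h.gInv_eq t hy]
  have hp : ∀ μ α, pd μ (fun y => nuLow (G t) y α) x = pd μ (fun y => nuLow (G 0) y α) x :=
    fun μ α => pd_congr_of_notMem h.compact.isClosed (fun y hy => hn y hy α) hx μ
  simp only [bdryGHY, meanCurv, sqrtDetBdry, gBdry, hp, hn x hx, h.christoffel_eq t hx,
    h.metric_eq t x hx]

theorem divVec_eq (b : ℝ) (μ : Fin 4) (t : ℝ) {x : E4} (hx : x ∉ K) :
    divVec a b (G t) (Q t) μ x = divVec a b (G 0) (Q 0) μ x := by
  simp only [divVec, palVec, dualVec, sqrtDet, h.gInv_eq t hx, h.metric_eq t x hx,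
    h.conn_eq t x hx]

theorem genForm_eq (b t : ℝ) {x : E4} (hx : x ∉ K) :
    genForm (a x) b (G t x) (gInv (G t) x) (sqrtDet (G t) x) (Q t x) (Q t x) =
      genForm (a x) b (G 0 x) (gInv (G 0) x) (sqrtDet (G 0) x) (Q 0 x) (Q 0 x) := by
  have hI : gInv (G t) x = gInv (G 0) x := funext₂ fun α β => h.gInv_eq t hx α β
  rw [hI, h.metric_eq t x hx, h.conn_eq t x hx, sqrtDet, sqrtDet, h.metric_eq t x hx]

theorem mem {x : E4} (hx : x ∈ T) : x ∈ halfSpace := h.patch.subset hx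

theorem integrableOn_variation {F : ℝ → E4 → ℝ} (hF : ∀ x ∈ T, SmoothFamilyAt F x)
    (h0 : ∀ t x, x ∉ K → F t x = F 0 x) : IntegrableOn (variation F) T :=
  integrableOn_of_eq_zero_off h.patch.measurableSet h.compact h.subset
    (h.patch.continuousOn fun x hx => (hF x hx).variation (h.mem hx))
    fun x _ hx => variation_eq_zero fun t => h0 t x hx

theorem integrableOn_bdry_variation {F : ℝ → E4 → ℝ}
    (hF : ∀ x ∈ T, x 0 = 0 → SmoothFamilyAt F x) (h0 : ∀ t x, x ∉ K → F t x = F 0 x) :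
    IntegrableOn (fun y => variation F (bdryPt y)) {y : E3 | bdryPt y ∈ T} :=
  integrableOn_bdry h.patch h.compact h.subset
    (fun y hy => (hF _ hy (bdryPt_zero y)).variation (h.mem hy))
    fun x hx => variation_eq_zero fun t => h0 t x hx

/-- The first variation of the generalised action is that of the (weighted) Einstein-Hilbert action
plus that of the quadratic form in `Q`: the divergence in the bulk cancels against the boundary
terms. -/
theorem firstVariation_gen (b Λ : ℝ) :
    firstVariation T (fun t => bulkGen a b Λ (G t) (Q t)) (fun t => bdryGen a b (G t) (Q t)) =
      firstVariation T (fun t x => a x * bulkEH Λ (G t) x) (fun t x => a x * bdryGHY (G t) x)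
      + ∫ x in T, variation (fun t x => genForm (a x) b (G t x) (gInv (G t) x) (sqrtDet (G t) x)
          (Q t x) (Q t x)) x := by
  let FE : ℝ → E4 → ℝ := fun t x => a x * bulkEH Λ (G t) x
  let FG : ℝ → E4 → ℝ := fun t x => a x * bdryGHY (G t) x
  let FD : Fin 4 → ℝ → E4 → ℝ := fun μ t => divVec a b (G t) (Q t) μ
  let FQ : ℝ → E4 → ℝ := fun t x =>
    genForm (a x) b (G t x) (gInv (G t) x) (sqrtDet (G t) x) (Q t x) (Q t x)
  have sE : ∀ x ∈ T, SmoothFamilyAt FE x := fun x hx =>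
    (MetricFamilyAt.smoothFamilyAt_weight (h.mem hx) (h.weight x hx)).mul
      ((h.metric x hx).bulkEH Λ)
  have sG : ∀ x ∈ T, x 0 = 0 → SmoothFamilyAt FG x := fun x hx h0 =>
    (MetricFamilyAt.smoothFamilyAt_weight (h.mem hx) (h.weight x hx)).mul
      ((h.metric x hx).bdryGHY (h.bdry x hx h0))
  have sD : ∀ x ∈ T, ∀ μ, SmoothFamilyAt (FD μ) x := fun x hx μ =>
    (h.metric x hx).divVec (h.conn x hx) (h.weight x hx) b μ
  have sQ : ∀ x ∈ T, SmoothFamilyAt FQ x := fun x hx =>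
    (h.metric x hx).genForm (h.conn x hx) (h.weight x hx) b
  have cE : ∀ t x, x ∉ K → FE t x = FE 0 x := fun t x hx => by
    simp only [FE, h.bulkEH_eq Λ t hx]
  have cG : ∀ t x, x ∉ K → FG t x = FG 0 x := fun t x hx => by
    simp only [FG, h.bdryGHY_eq t hx]
  have cD : ∀ μ t x, x ∉ K → FD μ t x = FD μ 0 x := fun μ t x hx => h.divVec_eq b μ t hx
  have cQ : ∀ t x, x ∉ K → FQ t x = FQ 0 x := fun t x hx => h.genForm_eq b t hx
  have hbulk : ∀ x ∈ T, variation (fun t => bulkGen a b Λ (G t) (Q t)) x =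
      variation FE x + ∑ μ, pd μ (variation (FD μ)) x + variation FQ x := by
    intro x hx
    have hxH := h.mem hx
    have hev : ∀ᶠ t in 𝓝 (0 : ℝ), bulkGen a b Λ (G t) (Q t) x =
        FE t x + ∑ μ, pd μ (FD μ t) x + FQ t x := by
      filter_upwards [(h.metric x hx).eventually_metricAt, eventually_all.2 fun α =>
        eventually_all.2 fun β => eventually_all.2 fun σ =>
          (h.conn x hx α β σ).eventually_contDiffWithinAt hxH] with t h1 h2
      exact bulkGen_eq b Λ h1 h2 (h.weight x hx)
    have sP : ∀ μ, SmoothFamilyAt (fun t y => pd μ (FD μ t) y) x := fun μ =>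
      (sD x hx μ).pd hxH μ
    have e1 : variation (fun t => bulkGen a b Λ (G t) (Q t)) x =
        variation (fun t y => FE t y + ∑ μ, pd μ (FD μ t) y + FQ t y) x := variation_congr hev
    rw [e1, variation_add (F := fun t y => FE t y + ∑ μ, pd μ (FD μ t) y) hxH
      ((sE x hx).add (SmoothFamilyAt.sum fun μ _ => sP μ)) (sQ x hx),
      variation_add (F := FE) (H := fun t y => ∑ μ, pd μ (FD μ t) y) hxH (sE x hx)
      (SmoothFamilyAt.sum fun μ _ => sP μ),
      variation_sum (F := fun μ t y => pd μ (FD μ t) y) hxH fun μ _ => sP μ]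
    congr 2
    exact Finset.sum_congr rfl fun μ _ => (sD x hx μ).variation_pd hxH μ
  have hbdry : ∀ y : E3, bdryPt y ∈ T → variation (fun t => bdryGen a b (G t) (Q t)) (bdryPt y) =
      variation FG (bdryPt y) - variation (FD 0) (bdryPt y) := by
    intro y hy
    have h0 := h.bdry _ hy (bdryPt_zero y)
    have hxH := h.mem hy
    rw [← variation_sub hxH (sG _ hy (bdryPt_zero y)) (sD _ hy 0)]
    refine variation_congr ?_
    filter_upwards [(h.metric _ hy).eventually_metricAt, (h.metric _ hy).eventually_gInv_pos h0]
      with t h1 h2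
    exact bdryGen_eq h1 h2 a b (Q t)
  have iE := h.integrableOn_variation sE cE
  have iQ := h.integrableOn_variation sQ cQ
  have iG := h.integrableOn_bdry_variation sG cG
  have iD0 := h.integrableOn_bdry_variation (fun x hx _ => sD x hx 0) (cD 0)
  have vD : ∀ μ x, x ∉ K → variation (FD μ) x = 0 := fun μ x hx =>
    variation_eq_zero fun t => cD μ t x hx
  have wD : ∀ μ, ∀ x ∈ T, ContDiffWithinAt ℝ ∞ (variation (FD μ)) halfSpace x := fun μ x hx =>
    (sD x hx μ).variation (h.mem hx)
  have iD : ∀ μ, IntegrableOn (fun x => pd μ (variation (FD μ)) x) T := fun μ =>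
    integrableOn_of_eq_zero_off h.patch.measurableSet h.compact h.subset
      (h.patch.continuousOn fun x hx => contDiffWithinAt_pd (n := ∞) (h.mem hx) μ (wD μ x hx)
        (by simp))
      fun x _ hx => pd_eq_zero_of_notMem h.compact.isClosed (vD μ) hx μ
  have hdiv : ∑ μ, ∫ x in T, pd μ (variation (FD μ)) x =
      -∫ y in {y : E3 | bdryPt y ∈ T}, variation (FD 0) (bdryPt y) := by
    simp only [setIntegral_pd h.patch h.compact h.subset (wD _) (vD _), Finset.sum_ite_eq',
      Finset.mem_univ, if_true]
  have e1 : ∫ x in T, variation (fun t => bulkGen a b Λ (G t) (Q t)) x =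
      ∫ x in T, variation FE x + ∑ μ, pd μ (variation (FD μ)) x + variation FQ x :=
    setIntegral_congr_fun h.patch.measurableSet hbulk
  have e2 : ∫ y in {y : E3 | bdryPt y ∈ T}, variation (fun t => bdryGen a b (G t) (Q t)) (bdryPt y) =
      ∫ y in {y : E3 | bdryPt y ∈ T}, variation FG (bdryPt y) - variation (FD 0) (bdryPt y) :=
    setIntegral_congr_fun (measurableSet_preimage_bdryPt h.patch) hbdry
  have iS : IntegrableOn (fun x => ∑ μ, pd μ (variation (FD μ)) x) T :=
    integrable_finsetSum _ fun μ _ => iD μ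
  have iES : IntegrableOn (fun x => variation FE x + ∑ μ, pd μ (variation (FD μ)) x) T := iE.add iS
  rw [integral_add iES iQ, integral_add iE iS, integral_finsetSum _ fun μ _ => iD μ,
    hdiv] at e1
  rw [integral_sub iG iD0] at e2
  change (∫ x in T, variation (fun t => bulkGen a b Λ (G t) (Q t)) x)
    - (∫ y in {y : E3 | bdryPt y ∈ T}, variation (fun t => bdryGen a b (G t) (Q t)) (bdryPt y)) =
    ((∫ x in T, variation FE x) - ∫ y in {y : E3 | bdryPt y ∈ T}, variation FG (bdryPt y))
      + ∫ x in T, variation FQ x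
  rw [e1, e2]
  ring

/-- If `Q = δ^α_σ U_β` at the parameter value `0`, then the quadratic part does not contribute,
because it only depends on `Q` modulo such arrays. -/
theorem variation_genForm_of_delta (b : ℝ) {x : E4} (hx : x ∈ T) {U : Fin 4 → ℝ}
    (hU : Q 0 x = deltaArr U) : variation (fun t x => genForm (a x) b (G t x) (gInv (G t) x)
      (sqrtDet (G t) x) (Q t x) (Q t x)) x = 0 := by
  have hxH := h.mem hx
  let R : ℝ → Arr3 := fun t => Q t x - deltaArr U
  have hR0 : ∀ α β σ, R 0 α β σ = 0 := fun α β σ => by simp [R, hU]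
  have hR : ∀ α β σ, DifferentiableAt ℝ (fun t => R t α β σ) 0 := fun α β σ =>
    ((h.conn x hx α β σ).differentiableAt_param hxH).sub_const _
  have e1 : (fun t => genForm (a x) b (G t x) (gInv (G t) x) (sqrtDet (G t) x) (Q t x) (Q t x)) =
      fun t => genForm (a x) b (G t x) (gInv (G t) x) (sqrtDet (G t) x) (R t) (R t) := by
    funext t
    rw [← genForm_add_deltaArr _ _ _ _ _ U (R t)]
    simp [R]
  -- Functions vanishing to second order at `0` form an ideal.
  let Z : (ℝ → ℝ) → Prop := fun f => HasDerivAt f 0 0 ∧ f 0 = 0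
  have zmul : ∀ {c f : ℝ → ℝ}, DifferentiableAt ℝ c 0 → Z f → Z fun t => c t * f t := by
    intro c f hc hf
    have := hc.hasDerivAt.mul hf.1
    rw [hf.2, mul_zero, mul_zero, add_zero] at this
    exact ⟨this, by simp [hf.2]⟩
  have zsum : ∀ {f : Fin 4 → ℝ → ℝ}, (∀ i, Z (f i)) → Z fun t => ∑ i, f i t := by
    intro f hf
    have := HasDerivAt.fun_sum (u := Finset.univ) fun i _ => (hf i).1
    rw [Finset.sum_const_zero] at this
    exact ⟨this, Finset.sum_eq_zero fun i _ => (hf i).2⟩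
  have zadd : ∀ {f g : ℝ → ℝ}, Z f → Z g → Z fun t => f t + g t := by
    intro f g hf hg
    have := hf.1.add hg.1
    rw [add_zero] at this
    exact ⟨this, by simp [hf.2, hg.2]⟩
  have zsub : ∀ {f g : ℝ → ℝ}, Z f → Z g → Z fun t => f t - g t := by
    intro f g hf hg
    have := hf.1.sub hg.1
    rw [sub_zero] at this
    exact ⟨this, by simp [hf.2, hg.2]⟩
  have zR : ∀ i j k i' j' k', Z fun t => R t i j k * R t i' j' k' := by
    intro i j k i' j' k'
    have := (hR i j k).hasDerivAt.mul (hR i' j' k').hasDerivAt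
    rw [hR0, hR0, mul_zero, zero_mul, add_zero] at this
    exact ⟨this, by simp [hR0]⟩
  have hm := h.metric x hx
  have dI : ∀ α β, DifferentiableAt ℝ (fun t => gInv (G t) x α β) 0 := fun α β =>
    (hm.gInv α β).differentiableAt_param hxH
  have dG : ∀ α β, DifferentiableAt ℝ (fun t => G t x α β) 0 := fun α β =>
    (hm.smooth α β).differentiableAt_param hxH
  have dr : DifferentiableAt ℝ (fun t => sqrtDet (G t) x) 0 :=
    hm.sqrtDet.differentiableAt_param hxH
  have z : Z fun t => genForm (a x) b (G t x) (gInv (G t) x) (sqrtDet (G t) x) (R t) (R t) :=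
    zadd (zmul (differentiableAt_const _) (zmul dr (zsum fun β => zsum fun δ => zmul (dI β δ)
      (zsum fun α => zsum fun l => zsub (zR α α l l δ β) (zR α δ l l α β)))))
      (zmul (differentiableAt_const _) (zsum fun α => zsum fun β => zsum fun μ => zsum fun ν =>
        zmul (differentiableAt_const _) (zsum fun l => zmul (dG α l) (zsum fun s =>
          zR l μ s s ν β))))
  unfold variation
  rw [e1]
  exact z.1.deriv

/-- Along a family for which `Q` is initially of the form `δ^α_σ U_β` the generalised action and
the (weighted) Einstein-Hilbert action have the same first variation. -/
theorem firstVariation_gen_of_delta (b Λ : ℝ) (hU : ∀ x ∈ T, ∃ U, Q 0 x = deltaArr U) :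
    firstVariation T (fun t => bulkGen a b Λ (G t) (Q t)) (fun t => bdryGen a b (G t) (Q t)) =
      firstVariation T (fun t x => a x * bulkEH Λ (G t) x) (fun t x => a x * bdryGHY (G t) x) := by
  rw [h.firstVariation_gen, add_eq_left]
  refine setIntegral_eq_zero_of_forall_eq_zero fun x hx => ?_
  obtain ⟨U, hU⟩ := hU x hx
  exact h.variation_genForm_of_delta b hx hU

/-- First variation of the generalised action under a variation of `Q` alone. -/
theorem firstVariation_gen_of_metric_const (b Λ : ℝ) {P : LConn} (hG : ∀ t, G t = G 0)
    (hP : ∀ t, Q t = Q 0 + t • P) :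
    firstVariation T (fun t => bulkGen a b Λ (G t) (Q t)) (fun t => bdryGen a b (G t) (Q t)) =
      ∫ x in T, genPolar (a x) b (G 0 x) (gInv (G 0) x) (sqrtDet (G 0) x) (Q 0 x) (P x) := by
  rw [h.firstVariation_gen]
  have h0 : firstVariation T (fun t x => a x * bulkEH Λ (G t) x)
      (fun t x => a x * bdryGHY (G t) x) = 0 := by
    have hE : (fun t x => a x * bulkEH Λ (G t) x) = fun _ x => a x * bulkEH Λ (G 0) x := by
      funext t; rw [hG t]
    have hB : (fun t x => a x * bdryGHY (G t) x) = fun _ x => a x * bdryGHY (G 0) x := by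
      funext t; rw [hG t]
    rw [hE, hB]
    simp only [firstVariation, deriv_const, integral_zero, sub_zero]
  rw [h0, zero_add]
  refine setIntegral_congr_fun h.patch.measurableSet fun x _ => ?_
  have e1 : ∀ t, genForm (a x) b (G t x) (gInv (G t) x) (sqrtDet (G t) x) (Q t x) (Q t x) =
      genForm (a x) b (G 0 x) (gInv (G 0) x) (sqrtDet (G 0) x) (Q 0 x) (Q 0 x)
      + t * genPolar (a x) b (G 0 x) (gInv (G 0) x) (sqrtDet (G 0) x) (Q 0 x) (P x)
      + t ^ 2 * genForm (a x) b (G 0 x) (gInv (G 0) x) (sqrtDet (G 0) x) (P x) (P x) := by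
    intro t
    rw [hG t, hP t]
    exact genForm_add_smul _ _ _ _ _ _ _ _
  refine (congrArg (fun f : ℝ → ℝ => deriv f 0) (funext e1)).trans ?_
  generalize genPolar (a x) b (G 0 x) (gInv (G 0) x) (sqrtDet (G 0) x) (Q 0 x) (P x) = B
  generalize genForm (a x) b (G 0 x) (gInv (G 0) x) (sqrtDet (G 0) x) (P x) (P x) = C
  generalize genForm (a x) b (G 0 x) (gInv (G 0) x) (sqrtDet (G 0) x) (Q 0 x) (Q 0 x) = A
  have h1 : HasDerivAt (fun t : ℝ => A + t * B) (1 * B) 0 :=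
    ((hasDerivAt_id' (0 : ℝ)).mul_const B).const_add A
  have h2 : HasDerivAt (fun t : ℝ => t ^ 2 * C) (2 * (0 : ℝ) ^ 1 * C) 0 := by
    simpa using (hasDerivAt_pow 2 (0 : ℝ)).mul_const C
  have h3 : HasDerivAt (fun t : ℝ => A + t * B + t ^ 2 * C) (1 * B + 2 * (0 : ℝ) ^ 1 * C) 0 := h1.add h2
  rw [h3.deriv]
  ring

end IsFamily

/-! ### Stationary pairs on a coordinate domain -/

namespace IsVariation

variable {T : Set E4}

theorem zero : IsVariation T fun _ => 0 :=
  ⟨contDiffOn_const, ∅, isCompact_empty, empty_subset _, fun _ _ => rfl⟩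

theorem mul_const {χ : E4 → ℝ} (hχ : IsVariation T χ) (c : ℝ) : IsVariation T fun x => χ x * c := by
  obtain ⟨h1, K, hK, hKT, h0⟩ := hχ
  exact ⟨h1.mul contDiffOn_const, K, hK, hKT, fun x hx => by simp [h0 x hx]⟩

theorem add {f h : E4 → ℝ} (hf : IsVariation T f) (hh : IsVariation T h) :
    IsVariation T fun x => f x + h x := by
  obtain ⟨h1, K, hK, hKT, h0⟩ := hf
  obtain ⟨h1', K', hK', hKT', h0'⟩ := hh
  refine ⟨h1.add h1', K ∪ K', hK.union hK', union_subset hKT hKT', fun x hx => ?_⟩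
  rw [mem_union, not_or] at hx
  simp [h0 x hx.1, h0' x hx.2]

theorem contDiffWithinAt {f : E4 → ℝ} (hf : IsVariation T f) {x : E4} (hx : x ∈ halfSpace) :
    ContDiffWithinAt ℝ ∞ f halfSpace x := hf.1 x hx

/-- A locally constant factor preserves variations. -/
theorem weight_mul {f a : E4 → ℝ} (hT : IsPatch T)
    (ha : ∀ x ∈ T, ∀ᶠ y in 𝓝[halfSpace] x, a y = a x) (hf : IsVariation T f) :
    IsVariation T fun x => a x * f x := by
  obtain ⟨h1, K, hK, hKT, h0⟩ := hf
  refine ⟨fun x hx => ?_, K, hK, hKT, fun x hx => by simp [h0 x hx]⟩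
  by_cases hxT : x ∈ T
  · exact (contDiffWithinAt_const.congr_of_eventuallyEq (ha x hxT)
      ((ha x hxT).self_of_nhdsWithin (hT.subset hxT))).mul (h1 x hx)
  · have h2 : (fun x => a x * f x) =ᶠ[𝓝[halfSpace] x] fun _ => 0 :=
      nhdsWithin_le_nhds ((hK.isClosed.isOpen_compl.eventually_mem fun h => hxT (hKT h)).mono
        fun y hy => by simp [h0 y hy])
    exact contDiffWithinAt_const.congr_of_eventuallyEq h2 (h2.self_of_nhdsWithin hx)

/-- Finitely many variations have a common compact support. -/
theorem exists_compact {ι : Type*} [Finite ι] {f : ι → E4 → ℝ} (hf : ∀ i, IsVariation T (f i)) :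
    ∃ K, IsCompact K ∧ K ⊆ T ∧ ∀ i x, x ∉ K → f i x = 0 := by
  choose h1 K hK hKT h0 using hf
  exact ⟨⋃ i, K i, isCompact_iUnion hK, iUnion_subset hKT,
    fun i x hx => h0 i x fun h => hx (mem_iUnion.2 ⟨i, h⟩)⟩

end IsVariation

theorem SmoothFamilyAt.affine {f h : E4 → ℝ} {x : E4} (hf : ContDiffWithinAt ℝ ∞ f halfSpace x)
    (hh : ContDiffWithinAt ℝ ∞ h halfSpace x) : SmoothFamilyAt (fun t y => f y + t * h y) x :=
  (of_contDiffWithinAt hf).add (param.mul (of_contDiffWithinAt hh))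

/-- The components of a smooth Lorentzian metric on a coordinate domain with timelike boundary. -/
structure PatchMetric (T : Set E4) (g : LMetric) : Prop where
  patch : IsPatch T
  symm : ∀ y α β, g y α β = g y β α
  smooth : ∀ α β, ContDiffOn ℝ ∞ (fun y => g y α β) T
  frame : ∀ x ∈ T, ∃ e : Matrix (Fin 4) (Fin 4) ℝ, e.det ≠ 0 ∧
    ∀ α β, g x α β = ∑ J, η J * (e J α * e J β)
  bdry : ∀ x ∈ T, x 0 = 0 → 0 < gInv g x 0 0

theorem inverse_of_frame {g : LMetric} {x : E4} {e : Matrix (Fin 4) (Fin 4) ℝ} (he : e.det ≠ 0)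
    (hg : ∀ α β, g x α β = ∑ J, η J * (e J α * e J β)) :
    (Matrix.of (g x)).det ≠ 0 ∧ ∀ α β, gInv g x α β = ∑ J, η J * (e⁻¹ α J * e⁻¹ β J) := by
  let c : LTetrad := fun _ J α => e J α
  have hc : (Matrix.of (c x)).det ≠ 0 := he
  have h1 : g x = tetradMetric c x := funext₂ hg
  have h2 : (Matrix.of (g x)).det ≠ 0 := by
    rw [h1, det_tetradMetric]
    exact neg_ne_zero.2 (mul_ne_zero hc hc)
  refine ⟨h2, fun α β => ?_⟩
  rw [gInv, h1]
  exact gInv_tetradMetric hc α β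

theorem sqrtDet_ne_zero {g : LMetric} {x : E4} (h : (Matrix.of (g x)).det ≠ 0) : sqrtDet g x ≠ 0 :=
  (Real.sqrt_pos.2 (abs_pos.2 h)).ne'

namespace PatchMetric

variable {T : Set E4} {g : LMetric} (hg : PatchMetric T g)

include hg

theorem metricFamilyAt {h : LMetric} (hh : ∀ α β, IsVariation T fun x => h x α β)
    (hs : ∀ x α β, h x α β = h x β α) {x : E4} (hx : x ∈ T) :
    MetricFamilyAt (fun t => g + t • h) x where
  mem := hg.patch.subset hx
  symm t y α β := by
    simp only [Pi.add_apply, Pi.smul_apply, hg.symm y α β, hs y α β]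
  det_ne := by
    obtain ⟨e, he, hge⟩ := hg.frame x hx
    rw [zero_smul, add_zero]
    exact (inverse_of_frame he hge).1
  smooth α β := SmoothFamilyAt.affine (hg.patch.contDiffWithinAt (hg.smooth α β) hx)
    ((hh α β).contDiffWithinAt (hg.patch.subset hx))

theorem exists_isFamily {Q : LConn} (hQ : ∀ α β σ, ContDiffOn ℝ ∞ (fun y => Q y α β σ) T)
    {h : LMetric} {P : LConn} (hh : ∀ α β, IsVariation T fun x => h x α β)
    (hs : ∀ x α β, h x α β = h x β α) (hP : ∀ α β σ, IsVariation T fun x => P x α β σ) :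
    ∃ K, IsFamily T K (fun _ => 1) (fun t => g + t • h) fun t => Q + t • P := by
  obtain ⟨K, hK, hKT, h0⟩ := IsVariation.exists_compact (fun i : Fin 4 × Fin 4 => hh i.1 i.2)
  obtain ⟨K', hK', hKT', h0'⟩ :=
    IsVariation.exists_compact (fun i : Fin 4 × Fin 4 × Fin 4 => hP i.1 i.2.1 i.2.2)
  refine ⟨K ∪ K', hg.patch, hK.union hK', union_subset hKT hKT',
    fun x hx => hg.metricFamilyAt hh hs hx, fun x hx α β σ =>
      SmoothFamilyAt.affine (hg.patch.contDiffWithinAt (hQ α β σ) hx)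
        ((hP α β σ).contDiffWithinAt (hg.patch.subset hx)),
    fun x _ => Eventually.of_forall fun _ => rfl, ?_, ?_, ?_⟩
  · intro x hx hx0
    rw [zero_smul, add_zero]
    exact hg.bdry x hx hx0
  · intro t x hx
    rw [mem_union, not_or] at hx
    funext α β
    have := h0 (α, β) x hx.1
    simp_all
  · intro t x hx
    rw [mem_union, not_or] at hx
    funext α β σ
    have := h0' (α, β, σ) x hx.2
    simp_all

end PatchMetric

/-- The fundamental lemma of the calculus of variations for the quadratic part of the generalised
Lagrangian: the integrals of its polarisation against all multiples `χ P` determine it. -/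
theorem genPolar_eq_zero_of_integral {T : Set E4} {g : LMetric} (hg : PatchMetric T g) {a : E4 → ℝ}
    (ha : ∀ x ∈ T, ∀ᶠ y in 𝓝[halfSpace] x, a y = a x) (b : ℝ) {Q P : LConn}
    (hQ : ∀ α β σ, ContDiffOn ℝ ∞ (fun y => Q y α β σ) T)
    (hP : ∀ α β σ, ContDiffOn ℝ ∞ (fun y => P y α β σ) T)
    (h : ∀ χ, IsVariation T χ → ∫ x in T, genPolar (a x) b (g x) (gInv g x) (sqrtDet g x) (Q x)
      (χ x • P x) = 0) :
    ∀ x ∈ T, genPolar (a x) b (g x) (gInv g x) (sqrtDet g x) (Q x) (P x) = 0 := by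
  have hform : ∀ {R : LConn}, (∀ α β σ, ContDiffOn ℝ ∞ (fun y => R y α β σ) T) → ∀ x ∈ T,
      ContDiffWithinAt ℝ ∞ (fun x => genForm (a x) b (g x) (gInv g x) (sqrtDet g x) (R x) (R x))
        halfSpace x := by
    intro R hR x hx
    have hm := hg.metricFamilyAt (h := 0) (fun _ _ => IsVariation.zero) (fun _ _ _ => rfl) hx
    have := (hm.genForm (Q := fun _ => R) (fun α β σ => SmoothFamilyAt.of_contDiffWithinAt
      (hg.patch.contDiffWithinAt (hR α β σ) hx)) (ha x hx) b).slice
    rwa [smul_zero, add_zero] at this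
  have hpol : ∀ (c : ℝ) x, genPolar (a x) b (g x) (gInv g x) (sqrtDet g x) (Q x) (c • P x) =
      c * genPolar (a x) b (g x) (gInv g x) (sqrtDet g x) (Q x) (P x) := by
    intro c x
    simp only [genPolar, genForm, scalForm_smul_left, scalForm_smul_right, dualForm_smul_left,
      dualForm_smul_right]
    ring
  refine eq_zero_of_forall_integral_variation hg.patch (hg.patch.continuousOn fun x hx => ?_)
    fun χ hχ => ?_
  · have e1 : (fun x => genPolar (a x) b (g x) (gInv g x) (sqrtDet g x) (Q x) (P x)) = fun x =>
        genForm (a x) b (g x) (gInv g x) (sqrtDet g x) ((Q + P) x) ((Q + P) x)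
        - genForm (a x) b (g x) (gInv g x) (sqrtDet g x) (Q x) (Q x)
        - genForm (a x) b (g x) (gInv g x) (sqrtDet g x) (P x) (P x) := by
      funext y
      have := genForm_add_smul (a y) b (g y) (gInv g y) (sqrtDet g y) 1 (Q y) (P y)
      rw [one_smul] at this
      rw [Pi.add_apply, this]
      ring
    rw [e1]
    exact ((hform (fun α β σ => (hQ α β σ).add (hP α β σ)) x hx).sub (hform hQ x hx)).sub
      (hform hP x hx)
  · simp only [← hpol]
    exact h χ hχ

namespace PatchMetric

variable {T : Set E4} {g : LMetric} (hg : PatchMetric T g)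

include hg

/-- On a coordinate domain, a pair `(g, Q)` is stationary for the generalised action if and only if
`Q = δ^α_σ U_β` and `g` is stationary for the Einstein-Hilbert action. -/
theorem stationary_gen_iff (b Λ : ℝ) {Q : LConn}
    (hQ : ∀ α β σ, ContDiffOn ℝ ∞ (fun y => Q y α β σ) T) :
    (∀ (h : LMetric) (P : LConn), (∀ α β, IsVariation T fun x => h x α β) →
      (∀ x α β, h x α β = h x β α) → (∀ α β σ, IsVariation T fun x => P x α β σ) →
      firstVariation T (fun t => bulkGen (fun _ => 1) b Λ (g + t • h) (Q + t • P))
        (fun t => bdryGen (fun _ => 1) b (g + t • h) (Q + t • P)) = 0) ↔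
    (∀ x ∈ T, ∃ U, Q x = deltaArr U) ∧
    ∀ h : LMetric, (∀ α β, IsVariation T fun x => h x α β) → (∀ x α β, h x α β = h x β α) →
      firstVariation T (fun t => bulkEH Λ (g + t • h)) (fun t => bdryGHY (g + t • h)) = 0 := by
  have hEH : ∀ h : LMetric, (∀ α β, IsVariation T fun x => h x α β) → (∀ x α β, h x α β = h x β α) →
      ∀ P : LConn, (∀ α β σ, IsVariation T fun x => P x α β σ) →
      (∀ x ∈ T, ∃ U, Q x = deltaArr U) →
      firstVariation T (fun t => bulkGen (fun _ => 1) b Λ (g + t • h) (Q + t • P))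
        (fun t => bdryGen (fun _ => 1) b (g + t • h) (Q + t • P)) =
      firstVariation T (fun t => bulkEH Λ (g + t • h)) (fun t => bdryGHY (g + t • h)) := by
    intro h hh hs P hP hU
    obtain ⟨K, hF⟩ := hg.exists_isFamily hQ hh hs hP
    rw [hF.firstVariation_gen_of_delta b Λ fun x hx => by
      rw [zero_smul, add_zero]; exact hU x hx]
    simp only [one_mul]
  constructor
  · intro H
    have hU : ∀ x ∈ T, ∃ U, Q x = deltaArr U := by
      intro x hx
      obtain ⟨e, he, hge⟩ := hg.frame x hx
      obtain ⟨hdet, hinv⟩ := inverse_of_frame he hge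
      refine genPolar_kernel (Matrix.nonsing_inv_mul e (isUnit_iff_ne_zero.2 he)) hge hinv
        one_ne_zero (sqrtDet_ne_zero hdet) (b := b) fun P => ?_
      refine genPolar_eq_zero_of_integral hg (a := fun _ => 1)
        (fun _ _ => Eventually.of_forall fun _ => rfl) b hQ (P := fun _ => P)
        (fun _ _ _ => contDiffOn_const) (fun χ hχ => ?_) x hx
      have hP : ∀ α β σ, IsVariation T fun x => (fun x => χ x • P) x α β σ := fun α β σ =>
        hχ.mul_const (P α β σ)
      obtain ⟨K, hF⟩ := hg.exists_isFamily hQ (h := 0) (fun _ _ => IsVariation.zero)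
        (fun _ _ _ => rfl) hP
      have h1 := H 0 _ (fun _ _ => IsVariation.zero) (fun _ _ _ => rfl) hP
      rw [hF.firstVariation_gen_of_metric_const b Λ (fun t => by simp) fun t => by
        rw [zero_smul, add_zero]] at h1
      simpa using h1
    exact ⟨hU, fun h hh hs => by
      rw [← hEH h hh hs 0 (fun _ _ _ => IsVariation.zero) hU]
      exact H h 0 hh hs fun _ _ _ => IsVariation.zero⟩
  · rintro ⟨hU, H⟩ h P hh hs hP
    rw [hEH h hh hs P hP hU]
    exact H h hh hs

end PatchMetric

/-! ### The Levi-Civita spin connection and the tensor `Q` of a connection form -/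

/-- The spin connection of the Levi-Civita connection takes values in the Lorentz algebra. -/
theorem TetradAt.lcSpin_antisymm {e : LTetrad} {x : E4} (he : TetradAt e x) (μ I J : Fin 4) :
    η I * lcSpin e x μ I J = -(η J * lcSpin e x μ J I) := by
  have hg := he.metricAt
  let w : LSpin := fun y μ K J => η K * lcSpin e y μ K J
  have hQ : tetradQ e w = 0 := by
    funext y β μ α
    refine Finset.sum_eq_zero fun K _ => Finset.sum_eq_zero fun J _ => ?_
    simp only [w, ← mul_assoc, η_mul_self]
    ring
  have hd : ∀ K β, pd μ (fun y => e y K β) x =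
      ∑ α, e x K α * christoffel (tetradMetric e) x α μ β - ∑ J, lcSpin e x μ K J * e x J β := by
    intro K β
    have h := he.tetrad_mul_fullConn w K μ β
    have h2 : ∀ J, η K * w x μ K J = lcSpin e x μ K J := fun J => by
      simp only [w, ← mul_assoc, η_mul_self, one_mul]
    simp only [h2, hQ, fullConn, Pi.zero_apply, add_zero] at h
    linarith
  -- Metric compatibility, written in terms of the tetrad.
  have hm : ∀ α β, ∑ K, (η K * (∑ J, lcSpin e x μ K J * e x J α) * e x K β
      + η K * e x K α * ∑ J, lcSpin e x μ K J * e x J β) = 0 := by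
    intro α β
    have h1 := hg.pd_metric μ α β
    have h2 : pd μ (fun y => tetradMetric e y α β) x =
        ∑ K, η K * (pd μ (fun y => e y K α) x * e x K β + e x K α * pd μ (fun y => e y K β) x) := by
      have hd2 : ∀ K, DiffAt (fun y => e y K α * e y K β) x := fun K =>
        (he.diffAt K α).mul (he.diffAt K β)
      unfold tetradMetric
      rw [pd_sum (F := fun K y => η K * (e y K α * e y K β)) he.mem μ
        fun K _ => (hd2 K).const_mul _]
      refine Finset.sum_congr rfl fun K _ => ?_
      rw [pd_const_mul he.mem μ _ (hd2 K),
        pd_mul he.mem μ (he.diffAt K α) (he.diffAt K β)]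
    have h3 : ∀ α β, ∑ s, tetradMetric e x α s * christoffel (tetradMetric e) x s μ β =
        ∑ K, η K * e x K α * ∑ s, e x K s * christoffel (tetradMetric e) x s μ β := by
      intro α β
      simp only [tetradMetric, Finset.sum_mul, Finset.mul_sum]
      rw [Finset.sum_comm]
      exact Finset.sum_congr rfl fun K _ => Finset.sum_congr rfl fun s _ => by ring
    rw [h2, Finset.sum_add_distrib, h3, h3, ← Finset.sum_add_distrib, ← sub_eq_zero,
      ← Finset.sum_sub_distrib] at h1
    rw [← neg_eq_zero, ← Finset.sum_neg_distrib, ← h1]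
    refine Finset.sum_congr rfl fun K _ => ?_
    rw [hd, hd]
    ring
  let me : Matrix (Fin 4) (Fin 4) ℝ := Matrix.of (e x)
  let mL : Matrix (Fin 4) (Fin 4) ℝ := Matrix.of fun K J => η K * lcSpin e x μ K J
  have hmat : me.transpose * (mL.transpose + mL) * me = 0 := by
    ext α β
    refine Eq.trans ?_ (hm α β)
    rw [Matrix.mul_add, Matrix.add_mul, ← Matrix.transpose_mul, Matrix.add_apply, Matrix.mul_assoc,
      Matrix.mul_apply, Matrix.mul_apply, ← Finset.sum_add_distrib]
    refine Finset.sum_congr rfl fun K _ => ?_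
    simp only [Matrix.transpose_apply, Matrix.mul_apply, me, mL, Matrix.of_apply, Finset.mul_sum,
      Finset.sum_mul]
    congr 1 <;> exact Finset.sum_congr rfl fun J _ => by ring
  have hu : IsUnit me.det := isUnit_iff_ne_zero.2 he.det_ne
  have hzero : mL.transpose + mL = 0 := by
    have hu' : IsUnit me.transpose.det := by rwa [Matrix.det_transpose]
    calc mL.transpose + mL = me.transpose⁻¹ * (me.transpose * (mL.transpose + mL) * me) * me⁻¹ := by
          rw [Matrix.mul_assoc me.transpose, Matrix.nonsing_inv_mul_cancel_left _ _ hu',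
            Matrix.mul_nonsing_inv_cancel_right _ _ hu]
      _ = 0 := by rw [hmat, Matrix.mul_zero, Matrix.zero_mul]
  have := congrFun₂ hzero I J
  simp only [Matrix.add_apply, Matrix.transpose_apply, mL, Matrix.of_apply, Matrix.zero_apply] at this
  linarith

/-- The change of `Q` under the change `v` of the connection form. -/
noncomputable def connVar (e : LTetrad) (v : LSpin) : LConn := fun x β μ α =>
  ∑ K, ∑ J, dualTetrad e x β K * e x J α * (η K * v x μ K J)

theorem tetradQ_add_smul (e : LTetrad) (w v : LSpin) (t : ℝ) :
    tetradQ e (w + t • v) = tetradQ e w + t • connVar e v := by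
  funext x β μ α
  simp only [tetradQ, connVar, Pi.add_apply, Pi.smul_apply, smul_eq_mul, Finset.mul_sum,
    ← Finset.sum_add_distrib]
  exact Finset.sum_congr rfl fun K _ => Finset.sum_congr rfl fun J _ => by ring

theorem fromFrame_apply (e E : Matrix (Fin 4) (Fin 4) ℝ) (p : Arr3) (β μ α : Fin 4) :
    fromFrame e E p β μ α = ∑ K, ∑ L, E β K * e L α * ∑ J, e J μ * p K J L := by
  simp only [fromFrame, Matrix.sum_apply, Matrix.smul_apply, Matrix.mul_apply, slice, Matrix.of_apply,
    smul_eq_mul, Finset.mul_sum, Finset.sum_mul]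
  have h : ∀ f : Fin 4 → Fin 4 → Fin 4 → ℝ,
      ∑ J, ∑ L, ∑ K, f J L K = ∑ K, ∑ L, ∑ J, f J L K := by
    intro f
    rw [Finset.sum_comm, Finset.sum_congr rfl fun L _ => Finset.sum_comm, Finset.sum_comm]
  rw [h]
  exact Finset.sum_congr rfl fun K _ => Finset.sum_congr rfl fun L _ =>
    Finset.sum_congr rfl fun J _ => by ring

section Frame

variable {e : LTetrad} {x : E4} (h : (Matrix.of (e x)).det ≠ 0)

/-- Every array arises from a change of the connection form. -/
theorem connVar_const (e : LTetrad) (x : E4) (p : Arr3) :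
    connVar e (fun _ μ K L => η K * ∑ J, e x J μ * p K J L) x =
      fromFrame (Matrix.of (e x)) (Matrix.of (e x))⁻¹ p := by
  funext β μ α
  rw [fromFrame_apply, connVar]
  simp only [← mul_assoc, η_mul_self, one_mul]
  rfl

include h

/-- The components of `Q` in the frame. -/
theorem tetradQ_eq_fromFrame (w : LSpin) : tetradQ e w x =
    fromFrame (Matrix.of (e x)) (Matrix.of (e x))⁻¹
      fun K J L => ∑ μ, dualTetrad e x μ J * (η K * w x μ K L - lcSpin e x μ K L) := by
  funext β μ α
  rw [fromFrame_apply, tetradQ]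
  refine Finset.sum_congr rfl fun K _ => Finset.sum_congr rfl fun L _ => ?_
  congr 1
  simp only [Finset.mul_sum]
  rw [Finset.sum_comm]
  have : ∀ ν, ∑ J, Matrix.of (e x) J μ * (dualTetrad e x ν J * (η K * w x ν K L - lcSpin e x ν K L)) =
      (if ν = μ then 1 else 0) * (η K * w x ν K L - lcSpin e x ν K L) := by
    intro ν
    rw [← sum_dual_mul_tetrad h, Finset.sum_mul]
    exact Finset.sum_congr rfl fun J _ => by rw [Matrix.of_apply]; ring
  simp only [this, ite_mul, one_mul, zero_mul, Finset.sum_ite_eq', Finset.mem_univ, if_true]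

/-- `Q = δ^α_σ U_β` means that the connection form differs from the Levi-Civita spin connection by
a multiple of the identity. -/
theorem tetradQ_eq_deltaArr_iff (w : LSpin) (U : Fin 4 → ℝ) : tetradQ e w x = deltaArr U ↔
    ∀ μ K J, η K * w x μ K J - lcSpin e x μ K J = if K = J then U μ else 0 := by
  let V : Fin 4 → Matrix (Fin 4) (Fin 4) ℝ := fun μ =>
    Matrix.of fun K J => η K * w x μ K J - lcSpin e x μ K J
  have hu := isUnit_iff_ne_zero.2 h
  have h1 : ∀ μ, slice (tetradQ e w x) μ = (Matrix.of (e x))⁻¹ * V μ * Matrix.of (e x) := by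
    intro μ
    ext β α
    simp only [slice, Matrix.of_apply, tetradQ, Matrix.mul_apply, Finset.sum_mul]
    rw [Finset.sum_comm]
    refine Finset.sum_congr rfl fun J _ => Finset.sum_congr rfl fun K _ => ?_
    simp only [V, Matrix.of_apply, dualTetrad]
    ring
  have h2 : ∀ μ, slice (deltaArr U) μ = U μ • (1 : Matrix (Fin 4) (Fin 4) ℝ) := by
    intro μ
    ext β α
    simp [slice, deltaArr, Matrix.one_apply]
  have h3 : ∀ μ, V μ = U μ • (1 : Matrix (Fin 4) (Fin 4) ℝ) ↔
      slice (tetradQ e w x) μ = slice (deltaArr U) μ := by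
    intro μ
    rw [h1, h2]
    constructor
    · intro hV
      rw [hV, Matrix.mul_smul, Matrix.mul_one, Matrix.smul_mul, Matrix.nonsing_inv_mul _ hu]
    · intro hV
      calc V μ = Matrix.of (e x) * ((Matrix.of (e x))⁻¹ * V μ * Matrix.of (e x)) *
            (Matrix.of (e x))⁻¹ := by
            rw [Matrix.mul_assoc (Matrix.of (e x))⁻¹, Matrix.mul_nonsing_inv_cancel_left _ _ hu,
              Matrix.mul_nonsing_inv_cancel_right _ _ hu]
        _ = U μ • (1 : Matrix (Fin 4) (Fin 4) ℝ) := by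
            rw [hV, Matrix.mul_smul, Matrix.mul_one, Matrix.smul_mul, Matrix.mul_nonsing_inv _ hu]
  have h4 : (∀ μ K J, η K * w x μ K J - lcSpin e x μ K J = if K = J then U μ else 0) ↔
      ∀ μ, V μ = U μ • (1 : Matrix (Fin 4) (Fin 4) ℝ) := by
    refine forall_congr' fun μ => ⟨fun hV => ?_, fun hV K J => ?_⟩
    · ext K J
      simp [V, hV, Matrix.one_apply]
    · have := congrFun₂ hV K J
      simpa [V, Matrix.one_apply] using this
  rw [h4]
  constructor
  · intro hQ μ
    rw [h3, hQ]
  · intro hV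
    funext α β σ
    exact congrFun₂ ((h3 β).1 (hV β)) α σ

end Frame

/-- For `ω̃ = ω̂ + S` with `ω̂` antisymmetric and `S` symmetric, `Q = δ^α_σ U_β` means that `ω̂` is the
Levi-Civita spin connection and `S_{IJ} = η_{IJ} U`. -/
theorem TetradAt.tetradQ_add_eq_deltaArr_iff {e : LTetrad} {x : E4} (he : TetradAt e x) {w s : LSpin}
    (hw : ∀ μ I J, w x μ I J = -w x μ J I) (hs : ∀ μ I J, s x μ I J = s x μ J I)
    (U : Fin 4 → ℝ) : tetradQ e (w + s) x = deltaArr U ↔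
      tetradQ e w x = 0 ∧ ∀ μ I J, s x μ I J = minkowski I J * U μ := by
  have h0 : (0 : Arr3) = deltaArr 0 := by
    funext α β σ
    simp [deltaArr]
  have hη : ∀ {K : Fin 4} {a b : ℝ}, η K * a = b → a = η K * b := fun {K a b} h => by
    rw [← h, ← mul_assoc, η_mul_self, one_mul]
  rw [h0, tetradQ_eq_deltaArr_iff he.det_ne, tetradQ_eq_deltaArr_iff he.det_ne]
  simp only [Pi.add_apply, Pi.zero_apply, ite_self]
  constructor
  · intro H
    have h1 : ∀ μ K J, w x μ K J + s x μ K J =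
        η K * lcSpin e x μ K J + minkowski K J * U μ := by
      intro μ K J
      have := hη (sub_eq_iff_eq_add.1 (H μ K J))
      rw [this, minkowski]
      split_ifs <;> ring
    have hmk : ∀ K J, minkowski K J = minkowski J K := fun K J => by
      unfold minkowski
      by_cases hKJ : K = J
      · rw [hKJ]
      · rw [if_neg hKJ, if_neg (Ne.symm hKJ)]
    have h2 : ∀ μ K J, w x μ K J = η K * lcSpin e x μ K J ∧ s x μ K J = minkowski K J * U μ := by
      intro μ K J
      have e1 := h1 μ K J
      have e2 := h1 μ J K
      rw [hw μ J K, hs μ J K, hmk J K, ← neg_eq_iff_eq_neg.2 (he.lcSpin_antisymm μ K J)] at e2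
      constructor <;> linarith
    refine ⟨fun μ K J => ?_, fun μ K J => (h2 μ K J).2⟩
    rw [(h2 μ K J).1, ← mul_assoc, η_mul_self, one_mul, sub_self]
  · rintro ⟨H1, H2⟩ μ K J
    have := H1 μ K J
    rw [H2, mul_add, minkowski]
    split_ifs with hKJ
    · rw [← mul_assoc, η_mul_self]
      linarith
    · simpa using this

/-! ### Stationary tetrads on a coordinate domain -/

/-- Smooth dependence of a family of tetrads on the parameter and the point, near the parameter
value `0`, together with nondegeneracy. -/
structure TetradFamilyAt (e : ℝ → LTetrad) (x : E4) : Prop where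
  mem : x ∈ halfSpace
  det_ne : (Matrix.of (e 0 x)).det ≠ 0
  smooth : ∀ I α, SmoothFamilyAt (fun t y => e t y I α) x

namespace TetradFamilyAt

variable {e : ℝ → LTetrad} {x : E4} (he : TetradFamilyAt e x)

include he

theorem metricFamilyAt : MetricFamilyAt (fun t => tetradMetric (e t)) x where
  mem := he.mem
  symm t := tetradMetric_symm (e t)
  det_ne := by
    rw [det_tetradMetric]
    exact neg_ne_zero.2 (mul_ne_zero he.det_ne he.det_ne)
  smooth α β := SmoothFamilyAt.sum fun I _ =>
    (SmoothFamilyAt.const _).mul ((he.smooth I α).mul (he.smooth I β))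

theorem dual (α I : Fin 4) : SmoothFamilyAt (fun t y => dualTetrad (e t) y α I) x :=
  SmoothFamilyAt.matrix_inv (F := fun t y => Matrix.of (e t y)) he.smooth he.det_ne α I

theorem lcSpin (μ K I : Fin 4) : SmoothFamilyAt (fun t y => lcSpin (e t) y μ K I) x :=
  SmoothFamilyAt.sum fun α _ => (he.smooth K α).mul (((he.dual α I).pd he.mem μ).add
    (SmoothFamilyAt.sum fun l _ => (he.metricFamilyAt.christoffel α μ l).mul (he.dual l I)))

theorem tetradQ {w : ℝ → LSpin} (hw : ∀ μ I J, SmoothFamilyAt (fun t y => w t y μ I J) x)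
    (β μ α : Fin 4) : SmoothFamilyAt (fun t y => tetradQ (e t) (w t) y β μ α) x :=
  SmoothFamilyAt.sum fun K _ => SmoothFamilyAt.sum fun J _ =>
    ((he.dual β K).mul (he.smooth J α)).mul
      (((SmoothFamilyAt.const _).mul (hw μ K J)).sub (he.lcSpin μ K J))

theorem det : SmoothFamilyAt (fun t y => (Matrix.of (e t y)).det) x :=
  SmoothFamilyAt.det (F := fun t y => Matrix.of (e t y)) he.smooth

theorem eventually_tetradAt : ∀ᶠ t in 𝓝 (0 : ℝ), TetradAt (e t) x := by
  filter_upwards [he.det.eventually_ne he.mem he.det_ne, eventually_all.2 fun I =>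
    eventually_all.2 fun α => (he.smooth I α).eventually_contDiffWithinAt he.mem] with t h1 h2
  exact ⟨he.mem, h1, h2⟩

/-- The orientation of the tetrad does not change along the family. -/
theorem eventually_sign_det : ∀ᶠ t in 𝓝 (0 : ℝ),
    SignType.sign (Matrix.of (e 0 x)).det = SignType.sign (Matrix.of (e t x)).det := by
  have hc := (he.det.contDiffAt_param he.mem).continuousAt
  rcases lt_or_gt_of_ne he.det_ne with h | h
  · filter_upwards [hc.eventually (gt_mem_nhds h)] with t ht
    rw [sign_neg h, sign_neg ht]
  · filter_upwards [hc.eventually (lt_mem_nhds h)] with t ht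
    rw [sign_pos h, sign_pos ht]

end TetradFamilyAt

/-- The components of a smooth tetrad on a coordinate domain with timelike boundary. -/
structure PatchTetrad (T : Set E4) (e : LTetrad) : Prop where
  patch : IsPatch T
  smooth : ∀ I α, ContDiffOn ℝ ∞ (fun y => e y I α) T
  det_ne : ∀ x ∈ T, (Matrix.of (e x)).det ≠ 0
  bdry : ∀ x ∈ T, x 0 = 0 → 0 < gInv (tetradMetric e) x 0 0

/-- The sign of the determinant of a tetrad, which is its orientation. -/
noncomputable def orientation (e : LTetrad) (x : E4) : ℝ := SignType.sign (Matrix.of (e x)).det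

/-- The tetrad is stationary for the Einstein-Hilbert action of its metric. -/
def IsEinsteinTetrad (T : Set E4) (Λ : ℝ) (e : LTetrad) : Prop :=
  ∀ f : LTetrad, (∀ I α, IsVariation T fun x => f x I α) →
    firstVariation T (fun t => bulkEH Λ (tetradMetric (e + t • f)))
      (fun t => bdryGHY (tetradMetric (e + t • f))) = 0

theorem bulkEH_congr {g h : LMetric} {x : E4} (hx : x ∈ halfSpace)
    (hgh : ∀ᶠ y in 𝓝[halfSpace] x, g y = h y) (Λ : ℝ) : bulkEH Λ g x = bulkEH Λ h x := by
  have hp : ∀ {g h : LMetric} {x : E4}, x ∈ halfSpace → (∀ᶠ y in 𝓝[halfSpace] x, g y = h y) →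
      ∀ α β σ, christoffel g x α β σ = christoffel h x α β σ := by
    intro g h x hx hgh α β σ
    have : ∀ μ α β, pd μ (fun y => g y α β) x = pd μ (fun y => h y α β) x := fun μ α β =>
      pd_congr hx (hgh.mono fun y hy => by simp only [hy]) μ
    simp only [christoffel, this, gInv, hgh.self_of_nhdsWithin hx]
  have h2 : ∀ᶠ y in 𝓝[halfSpace] x, ∀ α β σ, christoffel g y α β σ = christoffel h y α β σ := by
    filter_upwards [eventually_eventually_nhdsWithin.2 hgh, self_mem_nhdsWithin] with y h1 h2
    exact hp h2 h1
  have h3 : ∀ μ α β σ, pd μ (fun y => christoffel g y α β σ) x =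
      pd μ (fun y => christoffel h y α β σ) x := fun μ α β σ =>
    pd_congr hx (h2.mono fun y hy => hy α β σ) μ
  simp only [bulkEH, scalarCurv, riemann, h3, h2.self_of_nhdsWithin hx, gInv, sqrtDet,
    hgh.self_of_nhdsWithin hx]

theorem bdryGHY_congr {g h : LMetric} {x : E4} (hx : x ∈ halfSpace)
    (hgh : ∀ᶠ y in 𝓝[halfSpace] x, g y = h y) : bdryGHY g x = bdryGHY h x := by
  have h1 : ∀ μ α β, pd μ (fun y => g y α β) x = pd μ (fun y => h y α β) x := fun μ α β =>
    pd_congr hx (hgh.mono fun y hy => by simp only [hy]) μ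
  have h2 : ∀ μ α, pd μ (fun y => nuLow g y α) x = pd μ (fun y => nuLow h y α) x := fun μ α =>
    pd_congr hx (hgh.mono fun y hy => by simp only [nuLow, gInv, hy]) μ
  have h3 : ∀ α, nuLow g x α = nuLow h x α := fun α => by
    simp only [nuLow, gInv, hgh.self_of_nhdsWithin hx]
  simp only [bdryGHY, meanCurv, sqrtDetBdry, gBdry, christoffel, h1, h2, h3, gInv,
    hgh.self_of_nhdsWithin hx]

/-- A locally constant weight in the Einstein-Hilbert action can be moved into the variation of the
tetrad. -/
theorem firstVariation_weight {T : Set E4} (hT : IsPatch T) {a : E4 → ℝ}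
    (ha : ∀ x ∈ T, ∀ᶠ y in 𝓝[halfSpace] x, a y = a x) (Λ : ℝ) (e f : LTetrad) :
    firstVariation T (fun t x => a x * bulkEH Λ (tetradMetric (e + t • f)) x)
      (fun t x => a x * bdryGHY (tetradMetric (e + t • f)) x) =
    firstVariation T (fun t => bulkEH Λ (tetradMetric (e + t • fun x I α => a x * f x I α)))
      (fun t => bdryGHY (tetradMetric (e + t • fun x I α => a x * f x I α))) := by
  have hev : ∀ x ∈ T, ∀ t : ℝ, ∀ᶠ y in 𝓝[halfSpace] x,
      tetradMetric (e + t • fun x I α => a x * f x I α) y = tetradMetric (e + (a x * t) • f) y := by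
    intro x hx t
    filter_upwards [ha x hx] with y hy
    funext α β
    simp only [tetradMetric, Pi.add_apply, Pi.smul_apply, smul_eq_mul, hy]
    exact Finset.sum_congr rfl fun I _ => by ring
  have hder : ∀ (F : ℝ → ℝ) (c : ℝ),
      deriv (fun t => c * F t) 0 = deriv (fun t => F (c * t)) 0 := by
    intro F c
    rw [deriv_const_mul_field, deriv_comp_mul_left, mul_zero, smul_eq_mul]
  unfold firstVariation
  congr 1
  · refine setIntegral_congr_fun hT.measurableSet fun x hx => ?_
    refine (hder (fun t => bulkEH Λ (tetradMetric (e + t • f)) x) (a x)).trans ?_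
    exact congrArg (fun F : ℝ → ℝ => deriv F 0) (funext fun t =>
      (bulkEH_congr (hT.subset hx) (hev x hx t) Λ).symm)
  · refine setIntegral_congr_fun (measurableSet_preimage_bdryPt hT) fun y hy => ?_
    refine (hder (fun t => bdryGHY (tetradMetric (e + t • f)) (bdryPt y)) (a (bdryPt y))).trans ?_
    exact congrArg (fun F : ℝ → ℝ => deriv F 0) (funext fun t =>
      (bdryGHY_congr (hT.subset hy) (hev _ hy t)).symm)

namespace PatchTetrad

variable {T : Set E4} {e : LTetrad} (he : PatchTetrad T e)

include he

theorem patchMetric : PatchMetric T (tetradMetric e) where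
  patch := he.patch
  symm := tetradMetric_symm e
  smooth α β := ContDiffOn.sum fun I _ =>
    contDiffOn_const.mul ((he.smooth I α).mul (he.smooth I β))
  frame x hx := ⟨Matrix.of (e x), he.det_ne x hx, fun _ _ => rfl⟩
  bdry := he.bdry

theorem tetradAt {x : E4} (hx : x ∈ T) : TetradAt e x :=
  ⟨he.patch.subset hx, he.det_ne x hx, fun I α => (he.patch.contDiffWithinAt (he.smooth I α) hx).of_le
    (WithTop.coe_le_coe.2 (le_top (a := (2 : ℕ∞))))⟩

theorem tetradFamilyAt {f : LTetrad} (hf : ∀ I α, IsVariation T fun x => f x I α) {x : E4}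
    (hx : x ∈ T) : TetradFamilyAt (fun t => e + t • f) x where
  mem := he.patch.subset hx
  det_ne := by
    rw [zero_smul, add_zero]
    exact he.det_ne x hx
  smooth I α := SmoothFamilyAt.affine (he.patch.contDiffWithinAt (he.smooth I α) hx)
    ((hf I α).contDiffWithinAt (he.patch.subset hx))

theorem orientation_eq {x : E4} (hx : x ∈ T) :
    ∀ᶠ y in 𝓝[halfSpace] x, orientation e y = orientation e x := by
  have hc : ContinuousWithinAt (fun y => (Matrix.of (e y)).det) halfSpace x :=
    (contDiffWithinAt_det (A := fun y => Matrix.of (e y))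
      fun I α => he.patch.contDiffWithinAt (he.smooth I α) hx).continuousWithinAt
  unfold orientation
  rcases lt_or_gt_of_ne (he.det_ne x hx) with h | h
  · filter_upwards [hc.eventually (gt_mem_nhds h)] with t ht
    rw [sign_neg h, sign_neg ht]
  · filter_upwards [hc.eventually (lt_mem_nhds h)] with t ht
    rw [sign_pos h, sign_pos ht]

theorem orientation_mul_self {x : E4} (hx : x ∈ T) : orientation e x * orientation e x = 1 := by
  unfold orientation
  rcases lt_or_gt_of_ne (he.det_ne x hx) with h | h
  · rw [sign_neg h]; simp
  · rw [sign_pos h]; simp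

theorem exists_isFamily {a : E4 → ℝ} (ha : ∀ x ∈ T, ∀ᶠ y in 𝓝[halfSpace] x, a y = a x) {w : LSpin}
    (hw : ∀ μ I J, ContDiffOn ℝ ∞ (fun y => w y μ I J) T) {f : LTetrad} {u : LSpin}
    (hf : ∀ I α, IsVariation T fun x => f x I α) (hu : ∀ μ I J, IsVariation T fun x => u x μ I J) :
    ∃ K, IsFamily T K a (fun t => tetradMetric (e + t • f))
      fun t => tetradQ (e + t • f) (w + t • u) := by
  obtain ⟨K, hK, hKT, h0⟩ := IsVariation.exists_compact (fun i : Fin 4 × Fin 4 => hf i.1 i.2)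
  obtain ⟨K', hK', hKT', h0'⟩ :=
    IsVariation.exists_compact (fun i : Fin 4 × Fin 4 × Fin 4 => hu i.1 i.2.1 i.2.2)
  have hefun : ∀ t : ℝ, ∀ x, x ∉ K ∪ K' → (e + t • f) x = (e + (0 : ℝ) • f) x := by
    intro t x hx
    rw [mem_union, not_or] at hx
    funext I α
    have := h0 (I, α) x hx.1
    simp_all
  have hwfun : ∀ t : ℝ, ∀ x, x ∉ K ∪ K' → (w + t • u) x = (w + (0 : ℝ) • u) x := by
    intro t x hx
    rw [mem_union, not_or] at hx
    funext μ I J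
    have := h0' (μ, I, J) x hx.2
    simp_all
  have hmetric : ∀ t : ℝ, ∀ x, x ∉ K ∪ K' →
      tetradMetric (e + t • f) x = tetradMetric (e + (0 : ℝ) • f) x := by
    intro t x hx
    funext α β
    simp only [tetradMetric, hefun t x hx]
  have hb : ∀ x ∈ T, x 0 = 0 → 0 < gInv (tetradMetric (e + (0 : ℝ) • f)) x 0 0 := by
    rw [zero_smul, add_zero]
    exact he.bdry
  have hKK : K ∪ K' ⊆ T := union_subset hKT hKT'
  have hF : IsFamily T (K ∪ K') a (fun t => tetradMetric (e + t • f)) fun _ => 0 :=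
    ⟨he.patch, hK.union hK', hKK, fun x hx => (he.tetradFamilyAt hf hx).metricFamilyAt,
      fun _ _ _ _ _ => SmoothFamilyAt.const 0, ha, hb, hmetric, fun _ _ _ => rfl⟩
  refine ⟨K ∪ K', he.patch, hK.union hK', hKK, hF.metric, fun x hx =>
    (he.tetradFamilyAt hf hx).tetradQ fun μ I J => SmoothFamilyAt.affine
      (he.patch.contDiffWithinAt (hw μ I J) hx) ((hu μ I J).contDiffWithinAt (he.patch.subset hx)),
    ha, hb, hmetric, fun t x hx => ?_⟩
  have hp : ∀ μ α I, pd μ (fun y => dualTetrad (e + t • f) y α I) x =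
      pd μ (fun y => dualTetrad (e + (0 : ℝ) • f) y α I) x := fun μ α I =>
    pd_congr_of_notMem hF.compact.isClosed (fun y hy => by simp only [dualTetrad, hefun t y hy]) hx μ
  funext β μ α
  have hd : ∀ α I, dualTetrad (e + t • f) x α I = dualTetrad (e + (0 : ℝ) • f) x α I := fun α I => by
    simp only [dualTetrad, hefun t x hx]
  simp only [tetradQ, lcSpin, hp, hF.christoffel_eq t hx, hd, hefun t x hx, hwfun t x hx]

/-- If a weighted generalised action is stationary under all multiples `χ V` of a change `V` of the
connection form, then the polarised quadratic part vanishes on the corresponding change of `Q`. -/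
theorem genPolar_connVar_eq_zero {a : E4 → ℝ} (ha : ∀ x ∈ T, ∀ᶠ y in 𝓝[halfSpace] x, a y = a x)
    (b Λ : ℝ) {w : LSpin} (hw : ∀ μ I J, ContDiffOn ℝ ∞ (fun y => w y μ I J) T) (V : Arr3)
    (h : ∀ χ, IsVariation T χ → firstVariation T
      (fun t => bulkGen a b Λ (tetradMetric (e + t • (0 : LTetrad)))
        (tetradQ (e + t • (0 : LTetrad)) (w + t • fun x => χ x • V)))
      (fun t => bdryGen a b (tetradMetric (e + t • (0 : LTetrad)))
        (tetradQ (e + t • (0 : LTetrad)) (w + t • fun x => χ x • V))) = 0) :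
    ∀ x ∈ T, genPolar (a x) b (tetradMetric e x) (gInv (tetradMetric e) x)
      (sqrtDet (tetradMetric e) x) (tetradQ e w x) (connVar e (fun _ => V) x) = 0 := by
  have hconst : ∀ x ∈ T, TetradFamilyAt (fun _ => e) x := fun x hx =>
    ⟨he.patch.subset hx, he.det_ne x hx, fun I α => SmoothFamilyAt.of_contDiffWithinAt
      (he.patch.contDiffWithinAt (he.smooth I α) hx)⟩
  refine genPolar_eq_zero_of_integral he.patchMetric ha b
    (fun α β σ => he.patch.contDiffOn fun x hx => ((hconst x hx).tetradQ (w := fun _ => w)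
      (fun μ I J => SmoothFamilyAt.of_contDiffWithinAt
        (he.patch.contDiffWithinAt (hw μ I J) hx)) α β σ).slice)
    (fun α β σ => he.patch.contDiffOn fun x hx => ?_) fun χ hχ => ?_
  · exact (SmoothFamilyAt.sum fun K _ => SmoothFamilyAt.sum fun J _ =>
      (((hconst x hx).dual α K).mul ((hconst x hx).smooth J σ)).mul
        (SmoothFamilyAt.const (η K * V β K J))).slice
  · have hu : ∀ μ I J, IsVariation T fun x => (fun x => χ x • V) x μ I J := fun μ I J =>
      hχ.mul_const (V μ I J)
    obtain ⟨K, hF⟩ := he.exists_isFamily ha hw (f := 0) (fun _ _ => IsVariation.zero) hu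
    have h1 := h χ hχ
    have hsm : connVar e (fun x => χ x • V) = fun x => χ x • connVar e (fun _ => V) x := by
      funext x β μ α
      simp only [connVar, Pi.smul_apply, smul_eq_mul, Finset.mul_sum]
      exact Finset.sum_congr rfl fun K _ => Finset.sum_congr rfl fun J _ => by ring
    rw [hF.firstVariation_gen_of_metric_const b Λ (P := connVar e fun x => χ x • V)
      (fun t => by simp only [smul_zero]) fun t => by
        simp only [smul_zero, add_zero, zero_smul, tetradQ_add_smul], hsm] at h1
    simpa using h1

/-- If `Q = δ^α_σ U_β`, then the generalised action is stationary if and only if the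
Einstein-Hilbert action is. -/
theorem firstVariation_gen_eq {a : E4 → ℝ} (ha : ∀ x ∈ T, ∀ᶠ y in 𝓝[halfSpace] x, a y = a x)
    (b Λ : ℝ) {w : LSpin} (hw : ∀ μ I J, ContDiffOn ℝ ∞ (fun y => w y μ I J) T)
    (hU : ∀ x ∈ T, ∃ U, tetradQ e w x = deltaArr U) {f : LTetrad} {u : LSpin}
    (hf : ∀ I α, IsVariation T fun x => f x I α) (hu : ∀ μ I J, IsVariation T fun x => u x μ I J) :
    firstVariation T
      (fun t => bulkGen a b Λ (tetradMetric (e + t • f)) (tetradQ (e + t • f) (w + t • u)))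
      (fun t => bdryGen a b (tetradMetric (e + t • f)) (tetradQ (e + t • f) (w + t • u))) =
    firstVariation T (fun t => bulkEH Λ (tetradMetric (e + t • fun x I α => a x * f x I α)))
      (fun t => bdryGHY (tetradMetric (e + t • fun x I α => a x * f x I α))) := by
  obtain ⟨K, hF⟩ := he.exists_isFamily ha hw hf hu
  rw [← firstVariation_weight he.patch ha, hF.firstVariation_gen_of_delta b Λ fun x hx => by
    simpa only [zero_smul, add_zero] using hU x hx]

/-- On a coordinate domain, a pair `(e, ω̃)` is stationary for the generalised action if and only if
`Q = δ^α_σ U_β` and `e` is stationary for the Einstein-Hilbert action. -/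
theorem stationary_gen_iff (b Λ : ℝ) {w : LSpin}
    (hw : ∀ μ I J, ContDiffOn ℝ ∞ (fun y => w y μ I J) T) :
    (∀ (f : LTetrad) (u : LSpin), (∀ I α, IsVariation T fun x => f x I α) →
      (∀ μ I J, IsVariation T fun x => u x μ I J) →
      firstVariation T
        (fun t => bulkGen (fun _ => 1) b Λ (tetradMetric (e + t • f))
          (tetradQ (e + t • f) (w + t • u)))
        (fun t => bdryGen (fun _ => 1) b (tetradMetric (e + t • f))
          (tetradQ (e + t • f) (w + t • u))) = 0) ↔
    (∀ x ∈ T, ∃ U, tetradQ e w x = deltaArr U) ∧ IsEinsteinTetrad T Λ e := by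
  have ha : ∀ x ∈ T, ∀ᶠ y in 𝓝[halfSpace] x, (fun _ : E4 => (1 : ℝ)) y = (fun _ => 1) x :=
    fun _ _ => Eventually.of_forall fun _ => rfl
  constructor
  · intro H
    have hU : ∀ x ∈ T, ∃ U, tetradQ e w x = deltaArr U := by
      intro x hx
      have hdet := he.det_ne x hx
      have hinv := Matrix.nonsing_inv_mul (Matrix.of (e x)) (isUnit_iff_ne_zero.2 hdet)
      have hr : sqrtDet (tetradMetric e) x ≠ 0 := by
        rw [sqrtDet_tetradMetric]
        exact abs_ne_zero.2 hdet
      refine genPolar_kernel hinv (G := tetradMetric e x) (fun _ _ => rfl) (gInv_tetradMetric hdet)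
        one_ne_zero hr (b := b) fun P => ?_
      rw [← fromFrame_toFrame hinv P, ← connVar_const]
      exact he.genPolar_connVar_eq_zero ha b Λ hw _ (fun χ hχ =>
        H 0 _ (fun _ _ => IsVariation.zero) fun _ _ _ => hχ.mul_const _) x hx
    refine ⟨hU, fun f hf => ?_⟩
    have h1 := H f 0 hf fun _ _ _ => IsVariation.zero
    rw [he.firstVariation_gen_eq ha b Λ hw hU (u := 0) hf fun _ _ _ => IsVariation.zero] at h1
    simpa only [one_mul] using h1
  · rintro ⟨hU, H⟩ f u hf hu
    rw [he.firstVariation_gen_eq ha b Λ hw hU hf hu]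
    simpa only [one_mul] using H f hf

/-- The Holst action is the generalised action with the orientation of the tetrad as weight. -/
theorem firstVariation_holst_eq (Λ γ : ℝ) {w : LSpin}
    (hw : ∀ μ I J, ContDiffOn ℝ ∞ (fun y => w y μ I J) T)
    (hanti : ∀ x μ I J, w x μ I J = -w x μ J I) {f : LTetrad} {u : LSpin}
    (hf : ∀ I α, IsVariation T fun x => f x I α) (hu : ∀ μ I J, IsVariation T fun x => u x μ I J)
    (hua : ∀ x μ I J, u x μ I J = -u x μ J I) :
    firstVariation T (fun t => bulkHolst Λ γ (e + t • f) (w + t • u))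
      (fun t => bdryHolst γ (e + t • f) (w + t • u)) =
    firstVariation T
      (fun t => bulkGen (orientation e) (1 / γ) Λ (tetradMetric (e + t • f))
        (tetradQ (e + t • f) (w + t • u)))
      (fun t => bdryGen (orientation e) (1 / γ) (tetradMetric (e + t • f))
        (tetradQ (e + t • f) (w + t • u))) := by
  have hev : ∀ x ∈ T, ∀ᶠ t in 𝓝 (0 : ℝ), TetradAt (e + t • f) x ∧
      orientation e x = SignType.sign (Matrix.of ((e + t • f) x)).det := by
    intro x hx
    filter_upwards [(he.tetradFamilyAt hf hx).eventually_tetradAt,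
      (he.tetradFamilyAt hf hx).eventually_sign_det] with t h1 h2
    rw [zero_smul, add_zero] at h2
    exact ⟨h1, by rw [orientation, h2]⟩
  unfold firstVariation
  congr 1
  · refine setIntegral_congr_fun he.patch.measurableSet fun x hx => Filter.EventuallyEq.deriv_eq ?_
    filter_upwards [hev x hx] with t ht
    exact ht.1.bulkHolst_eq (fun μ I J =>
      ((he.patch.contDiffWithinAt (hw μ I J) hx).differentiableWithinAt (by simp)).add
        ((((hu μ I J).contDiffWithinAt (he.patch.subset hx)).differentiableWithinAt
          (by simp)).const_smul t)) ht.2 Λ γ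
  · refine setIntegral_congr_fun (measurableSet_preimage_bdryPt he.patch) fun y hy =>
      Filter.EventuallyEq.deriv_eq ?_
    have h00 : 0 < gInv (tetradMetric (e + (0 : ℝ) • f)) (bdryPt y) 0 0 := by
      rw [zero_smul, add_zero]
      exact he.bdry _ hy (bdryPt_zero y)
    filter_upwards [hev _ hy,
      (he.tetradFamilyAt hf hy).metricFamilyAt.eventually_gInv_pos h00] with t ht h1
    refine ht.1.bdryHolst_eq h1 (fun μ I J => ?_) ht.2 γ
    simp only [Pi.add_apply, Pi.smul_apply, smul_eq_mul]
    rw [hanti, hua]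
    ring

/-- On a coordinate domain, a pair `(e, ω̂)` with antisymmetric `ω̂` is stationary for the Holst
action if and only if `ω̂` is the Levi-Civita spin connection and `e` is stationary for the
Einstein-Hilbert action. -/
theorem stationary_holst_iff (Λ γ : ℝ) {w : LSpin}
    (hw : ∀ μ I J, ContDiffOn ℝ ∞ (fun y => w y μ I J) T)
    (hanti : ∀ x μ I J, w x μ I J = -w x μ J I) :
    (∀ (f : LTetrad) (u : LSpin), (∀ I α, IsVariation T fun x => f x I α) →
      (∀ μ I J, IsVariation T fun x => u x μ I J) → (∀ x μ I J, u x μ I J = -u x μ J I) →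
      firstVariation T (fun t => bulkHolst Λ γ (e + t • f) (w + t • u))
        (fun t => bdryHolst γ (e + t • f) (w + t • u)) = 0) ↔
    (∀ x ∈ T, tetradQ e w x = 0) ∧ IsEinsteinTetrad T Λ e := by
  have ha : ∀ x ∈ T, ∀ᶠ y in 𝓝[halfSpace] x, orientation e y = orientation e x :=
    fun x hx => he.orientation_eq hx
  have hdelta : (∀ x ∈ T, tetradQ e w x = 0) → ∀ x ∈ T, ∃ U, tetradQ e w x = deltaArr U :=
    fun hQ x hx => ⟨0, by rw [hQ x hx]; funext α β σ; simp [deltaArr]⟩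
  constructor
  · intro H
    have hQ : ∀ x ∈ T, tetradQ e w x = 0 := by
      intro x hx
      have hdet := he.det_ne x hx
      have hT := he.tetradAt hx
      have hinv := Matrix.nonsing_inv_mul (Matrix.of (e x)) (isUnit_iff_ne_zero.2 hdet)
      have hr : sqrtDet (tetradMetric e) x ≠ 0 := by
        rw [sqrtDet_tetradMetric]
        exact abs_ne_zero.2 hdet
      have ho : orientation e x ≠ 0 := fun h0 => by
        have := he.orientation_mul_self hx
        simp [h0] at this
      have hq : (fun K J L => ∑ μ, dualTetrad e x μ J * (η K * w x μ K L - lcSpin e x μ K L) :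
          Arr3) = 0 := by
        refine eq_zero_of_polarForm_lorentz (mul_ne_zero ho hr) (b := 1 / γ * (Matrix.of (e x)).det)
          (fun I J K => ?_) fun p hp => ?_
        · rw [Finset.mul_sum, Finset.mul_sum, ← Finset.sum_neg_distrib]
          refine Finset.sum_congr rfl fun μ _ => ?_
          have h1 := hT.lcSpin_antisymm μ I K
          have h2 := hanti x μ I K
          linear_combination (dualTetrad e x μ J * w x μ I K) * η_mul_self I
            + (dualTetrad e x μ J * w x μ K I) * η_mul_self K + dualTetrad e x μ J * h2
            - dualTetrad e x μ J * h1
        · rw [← genPolar_fromFrame hinv (fun _ _ => rfl) (gInv_tetradMetric hdet),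
            ← tetradQ_eq_fromFrame hdet w, ← connVar_const]
          have hV : ∀ μ K L, η K * ∑ J, e x J μ * p K J L = -(η L * ∑ J, e x J μ * p L J K) := by
            intro μ K L
            rw [Finset.mul_sum, Finset.mul_sum, ← Finset.sum_neg_distrib]
            refine Finset.sum_congr rfl fun J _ => ?_
            linear_combination e x J μ * hp K J L
          refine he.genPolar_connVar_eq_zero ha (1 / γ) Λ hw _ (fun χ hχ => ?_) x hx
          have hu : ∀ μ I J', IsVariation T fun y =>
              (fun y : E4 => χ y • fun μ K L => η K * ∑ J, e x J μ * p K J L) y μ I J' :=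
            fun _ _ _ => hχ.mul_const _
          have hua : ∀ (y : E4) μ K L,
              (fun y : E4 => χ y • fun μ K L => η K * ∑ J, e x J μ * p K J L) y μ K L =
              -(fun y : E4 => χ y • fun μ K L => η K * ∑ J, e x J μ * p K J L) y μ L K := by
            intro y μ K L
            simp only [Pi.smul_apply, smul_eq_mul]
            rw [hV]
            ring
          rw [← he.firstVariation_holst_eq Λ γ hw hanti (f := 0) (fun _ _ => IsVariation.zero) hu hua]
          exact H 0 _ (fun _ _ => IsVariation.zero) hu hua
      rw [tetradQ_eq_fromFrame hdet w, hq]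
      funext β μ α
      rw [fromFrame_apply]
      simp
    refine ⟨hQ, fun f hf => ?_⟩
    -- The variation `a f` of the weighted action corresponds to the variation `f`, as `a² = 1`.
    have hf' : ∀ I α, IsVariation T fun x =>
        (fun x I α => orientation e x * f x I α : LTetrad) x I α :=
      fun I α => (hf I α).weight_mul he.patch ha
    have h1 := H _ 0 hf' (fun _ _ _ => IsVariation.zero) fun _ _ _ _ => neg_zero.symm
    rw [he.firstVariation_holst_eq Λ γ hw hanti hf' (u := 0) (fun _ _ _ => IsVariation.zero)
      fun _ _ _ _ => neg_zero.symm, he.firstVariation_gen_eq ha _ Λ hw (hdelta hQ) hf' (u := 0)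
      fun _ _ _ => IsVariation.zero] at h1
    have h2 : (fun x I α => orientation e x * (orientation e x * f x I α) : LTetrad) = f := by
      obtain ⟨K, -, hKT, h0⟩ := IsVariation.exists_compact (fun i : Fin 4 × Fin 4 => hf i.1 i.2)
      funext x I α
      by_cases hx : x ∈ T
      · rw [← mul_assoc, he.orientation_mul_self hx, one_mul]
      · have h3 : f x I α = 0 := h0 (I, α) x fun h => hx (hKT h)
        rw [h3, mul_zero, mul_zero]
    rwa [h2] at h1
  · rintro ⟨hQ, H⟩ f u hf hu hua
    rw [he.firstVariation_holst_eq Λ γ hw hanti hf hu hua,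
      he.firstVariation_gen_eq ha _ Λ hw (hdelta hQ) hf hu]
    exact H _ fun I α => (hf I α).weight_mul he.patch ha

end PatchTetrad

/-! ### Coordinate bases on a manifold with boundary -/

section Chart

variable {M : Type*} [TopologicalSpace M]

theorem isPatch_target (φ : OpenPartialHomeomorph M (EuclideanHalfSpace 4)) :
    IsPatch (φ.extend (𝓡∂ 4)).target := by
  refine ⟨(𝓡∂ 4).symm ⁻¹' φ.target, φ.open_target.preimage (𝓡∂ 4).continuous_symm, ?_⟩
  rw [φ.extend_target, halfSpace_eq_range]

variable [ChartedSpace (EuclideanHalfSpace 4) M]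
  {φ : OpenPartialHomeomorph M (EuclideanHalfSpace 4)}
  (hφ : φ ∈ IsManifold.maximalAtlas (𝓡∂ 4) ∞ M)

include hφ

theorem contMDiffOn_chart : ContMDiffOn (𝓡∂ 4) 𝓘(ℝ, E4) ∞ (φ.extend (𝓡∂ 4)) φ.source :=
  OpenPartialHomeomorph.contMDiffOn_extend hφ

theorem contMDiffOn_chart_symm :
    ContMDiffOn 𝓘(ℝ, E4) (𝓡∂ 4) ∞ (φ.extend (𝓡∂ 4)).symm (φ.extend (𝓡∂ 4)).target := by
  rw [φ.extend_target']
  exact contMDiffOn_extend_symm hφ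

theorem mfderiv_chart_symm {y : E4} (hy : y ∈ (φ.extend (𝓡∂ 4)).target) (v : E4) :
    (show E4 from mfderiv (𝓡∂ 4) 𝓘(ℝ, E4) (φ.extend (𝓡∂ 4)) ((φ.extend (𝓡∂ 4)).symm y)
      (mfderivWithin 𝓘(ℝ, E4) (𝓡∂ 4) (φ.extend (𝓡∂ 4)).symm halfSpace y v)) = v := by
  have hT := isPatch_target φ
  have hyH : y ∈ halfSpace := hT.subset hy
  have hU : UniqueMDiffWithinAt 𝓘(ℝ, E4) halfSpace y :=
    (uniqueDiffOn_halfSpace y hyH).uniqueMDiffWithinAt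
  have hs : (φ.extend (𝓡∂ 4)).symm y ∈ φ.source := by
    rw [← φ.extend_source (I := 𝓡∂ 4)]
    exact (φ.extend (𝓡∂ 4)).map_target hy
  have h1 : MDifferentiableAt (𝓡∂ 4) 𝓘(ℝ, E4) (φ.extend (𝓡∂ 4)) ((φ.extend (𝓡∂ 4)).symm y) :=
    ((contMDiffOn_chart hφ).contMDiffAt (φ.open_source.mem_nhds hs)).mdifferentiableAt (by simp)
  have h2 : MDifferentiableWithinAt 𝓘(ℝ, E4) (𝓡∂ 4) (φ.extend (𝓡∂ 4)).symm halfSpace y :=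
    ((contMDiffOn_chart_symm hφ y hy).mono_of_mem_nhdsWithin (hT.mem_nhdsWithin hy)).mdifferentiableWithinAt
      (by simp)
  have h3 := mfderiv_comp_mfderivWithin y h1 h2 hU
  have h4 : mfderivWithin 𝓘(ℝ, E4) 𝓘(ℝ, E4) (φ.extend (𝓡∂ 4) ∘ (φ.extend (𝓡∂ 4)).symm) halfSpace y =
      mfderivWithin 𝓘(ℝ, E4) 𝓘(ℝ, E4) id halfSpace y := by
    refine Filter.EventuallyEq.mfderivWithin_eq ?_ ?_
    · filter_upwards [hT.mem_nhdsWithin hy] with z hz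
      exact (φ.extend (𝓡∂ 4)).right_inv hz
    · exact (φ.extend (𝓡∂ 4)).right_inv hy
  rw [h4, mfderivWithin_id hU] at h3
  exact (congrArg (fun L => (show E4 from L v)) h3).symm

theorem coordOf_coordVec {y : E4} (hy : y ∈ (φ.extend (𝓡∂ 4)).target) (α μ : Fin 4) :
    coordOf φ (coordVec φ y μ) α = if α = μ then 1 else 0 := by
  have := congrArg (fun v : E4 => v α) (mfderiv_chart_symm hφ hy (EuclideanSpace.single μ (1 : ℝ)))
  refine this.trans ?_
  simp

/-- The coordinate vectors of a chart, as a basis of the tangent space. -/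
noncomputable def coordBasis {y : E4} (hy : y ∈ (φ.extend (𝓡∂ 4)).target) :
    Module.Basis (Fin 4) ℝ (TangentSpace (𝓡∂ 4) ((φ.extend (𝓡∂ 4)).symm y)) :=
  haveI : FiniteDimensional ℝ (TangentSpace (𝓡∂ 4) ((φ.extend (𝓡∂ 4)).symm y)) :=
    inferInstanceAs (FiniteDimensional ℝ E4)
  (EuclideanSpace.basisFun (Fin 4) ℝ).toBasis.map
    (LinearMap.linearEquivOfInjective
      (mfderivWithin 𝓘(ℝ, E4) (𝓡∂ 4) (φ.extend (𝓡∂ 4)).symm halfSpace y).toLinearMap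
      (fun u v h => by
        rw [← mfderiv_chart_symm hφ hy u, ← mfderiv_chart_symm hφ hy v]
        exact congrArg _ h) rfl)

theorem coordBasis_apply {y : E4} (hy : y ∈ (φ.extend (𝓡∂ 4)).target) (μ : Fin 4) :
    coordBasis hφ hy μ = coordVec φ y μ := by
  simp only [coordBasis, Module.Basis.map_apply, OrthonormalBasis.coe_toBasis,
    EuclideanSpace.basisFun_apply]
  rfl

omit hφ in
theorem coordOf_add {p : M} (u v : TangentSpace (𝓡∂ 4) p) (α : Fin 4) :
    coordOf φ (u + v) α = coordOf φ u α + coordOf φ v α := by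
  unfold coordOf
  rw [map_add]
  rfl

omit hφ in
theorem coordOf_smul {p : M} (c : ℝ) (v : TangentSpace (𝓡∂ 4) p) (α : Fin 4) :
    coordOf φ (c • v) α = c * coordOf φ v α := by
  unfold coordOf
  rw [map_smul]
  rfl

theorem coordBasis_repr {y : E4} (hy : y ∈ (φ.extend (𝓡∂ 4)).target)
    (v : TangentSpace (𝓡∂ 4) ((φ.extend (𝓡∂ 4)).symm y)) (α : Fin 4) :
    (coordBasis hφ hy).repr v α = coordOf φ v α := by
  let L : TangentSpace (𝓡∂ 4) ((φ.extend (𝓡∂ 4)).symm y) →ₗ[ℝ] ℝ :=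
    { toFun := fun v => coordOf φ v α
      map_add' := fun u v => coordOf_add u v α
      map_smul' := fun c v => coordOf_smul c v α }
  have h : (coordBasis hφ hy).coord α = L := by
    refine (coordBasis hφ hy).ext fun μ => ?_
    rw [Module.Basis.coord_apply, Module.Basis.repr_self, Finsupp.single_apply]
    change _ = coordOf φ (coordBasis hφ hy μ) α
    rw [coordBasis_apply, coordOf_coordVec hφ hy]
    simp only [eq_comm]
  exact LinearMap.congr_fun h v

end Chart

/-! ### Fields on the manifold and their components -/

/-- The reverse Cauchy-Schwarz inequality: a causal vector orthogonal to a timelike one vanishes. -/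
theorem eq_zero_of_timelike {n₀ n₁ n₂ n₃ u₀ u₁ u₂ u₃ : ℝ}
    (h : n₀ * u₀ = -(n₁ * u₁ + n₂ * u₂ + n₃ * u₃)) (hu : u₁ ^ 2 + u₂ ^ 2 + u₃ ^ 2 < u₀ ^ 2)
    (hn : n₁ ^ 2 + n₂ ^ 2 + n₃ ^ 2 ≤ n₀ ^ 2) : n₀ = 0 ∧ n₁ = 0 ∧ n₂ = 0 ∧ n₃ = 0 := by
  have h1 : (n₀ * u₀) ^ 2 ≤ (n₁ ^ 2 + n₂ ^ 2 + n₃ ^ 2) * (u₁ ^ 2 + u₂ ^ 2 + u₃ ^ 2) := by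
    rw [h]
    linarith [sq_nonneg (n₁ * u₂ - n₂ * u₁), sq_nonneg (n₁ * u₃ - n₃ * u₁),
      sq_nonneg (n₂ * u₃ - n₃ * u₂)]
  have h2 := h1.trans (mul_le_mul_of_nonneg_right hn (by positivity))
  rw [mul_pow] at h2
  have h3 : n₀ ^ 2 = 0 := by
    by_contra h0
    exact hu.not_ge (le_of_mul_le_mul_left h2 (lt_of_le_of_ne (sq_nonneg _) (Ne.symm h0)))
  rw [h3] at hn
  refine ⟨pow_eq_zero_iff two_ne_zero |>.1 h3, ?_, ?_, ?_⟩ <;>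
    refine pow_eq_zero_iff two_ne_zero |>.1 (le_antisymm ?_ (sq_nonneg _)) <;>
    linarith [sq_nonneg n₁, sq_nonneg n₂, sq_nonneg n₃]

/-- In a Lorentzian vector space, the conormal of a hyperplane that contains a timelike vector is
spacelike. -/
theorem gInv_zero_zero_pos {g : LMetric} {x : E4} {e : Matrix (Fin 4) (Fin 4) ℝ} (he : e.det ≠ 0)
    (hg : ∀ α β, g x α β = ∑ J, η J * (e J α * e J β)) {v : Fin 4 → ℝ} (hv : v 0 = 0)
    (hneg : ∑ α, ∑ β, g x α β * (v α * v β) < 0) : 0 < gInv g x 0 0 := by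
  obtain ⟨n, hn⟩ : ∃ n : Fin 4 → ℝ, ∀ J, n J = e⁻¹ 0 J := ⟨_, fun _ => rfl⟩
  obtain ⟨u, hu⟩ : ∃ u : Fin 4 → ℝ, ∀ J, u J = ∑ α, e J α * v α := ⟨_, fun _ => rfl⟩
  have hinv := Matrix.nonsing_inv_mul e (isUnit_iff_ne_zero.2 he)
  -- The vector is tangent to the hyperplane, so it is annihilated by the conormal.
  have hnu : ∑ J, n J * u J = 0 := by
    simp only [hn, hu, Finset.mul_sum]
    rw [Finset.sum_comm]
    simp only [← mul_assoc, ← Finset.sum_mul, ← Matrix.mul_apply, hinv, Matrix.one_apply, ite_mul,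
      one_mul, zero_mul, Finset.sum_ite_eq, Finset.mem_univ, if_true, hv]
  have hne : ∑ J, n J * e J 0 = 1 := by
    simp only [hn, ← Matrix.mul_apply, hinv, Matrix.one_apply_eq]
  have huu : ∑ J, η J * (u J * u J) < 0 := by
    refine lt_of_eq_of_lt ?_ hneg
    simp only [hg, hu, Finset.sum_mul, Finset.mul_sum]
    rw [Finset.sum_comm]
    refine Finset.sum_congr rfl fun α _ => ?_
    rw [Finset.sum_comm]
    exact Finset.sum_congr rfl fun β _ => Finset.sum_congr rfl fun J _ => by ring
  have e0 : η 0 = -1 := if_pos rfl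
  have e1 : η 1 = 1 := if_neg (by decide)
  have e2 : η 2 = 1 := if_neg (by decide)
  have e3 : η 3 = 1 := if_neg (by decide)
  rw [(inverse_of_frame he hg).2]
  simp only [← hn]
  simp only [Fin.sum_univ_four, e0, e1, e2, e3, one_mul, neg_one_mul] at huu hnu hne ⊢
  by_contra hcon
  obtain ⟨h0, h1, h2, h3⟩ := eq_zero_of_timelike (n₀ := n 0) (n₁ := n 1) (n₂ := n 2) (n₃ := n 3)
    (u₀ := u 0) (u₁ := u 1) (u₂ := u 2) (u₃ := u 3) (by linarith) (by linarith)
    (by linarith [not_lt.1 hcon])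
  rw [h0, h1, h2, h3] at hne
  linarith

section Fields

variable {M : Type*} [TopologicalSpace M] [ChartedSpace (EuclideanHalfSpace 4) M]
  [IsManifold (𝓡∂ 4) ∞ M] {A : OrientedAtlas M}
  {φ : OpenPartialHomeomorph M (EuclideanHalfSpace 4)}

theorem IsMetric.symm {g : BilinField M} (hg : IsMetric A g) (p : M) (X Y : TangentSpace (𝓡∂ 4) p) :
    g p X Y = g p Y X := by
  obtain ⟨b, hb⟩ := hg.lorentzian p
  have h : g p = (g p).flip := by
    refine b.ext fun I => b.ext fun J => ?_
    rw [LinearMap.flip_apply, hb, hb, minkowski, minkowski]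
    by_cases hIJ : I = J
    · rw [hIJ]
    · rw [if_neg hIJ, if_neg (Ne.symm hIJ)]
  exact LinearMap.congr_fun₂ h X Y

theorem IsMetric.exists_frame {g : BilinField M} (hg : IsMetric A g) (hφ : φ ∈ A.charts) {y : E4}
    (hy : y ∈ (φ.extend (𝓡∂ 4)).target) : ∃ e : Matrix (Fin 4) (Fin 4) ℝ, e.det ≠ 0 ∧
      ∀ α β, compBilin φ g y α β = ∑ J, η J * (e J α * e J β) := by
  obtain ⟨b, hb⟩ := hg.lorentzian ((φ.extend (𝓡∂ 4)).symm y)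
  let c := coordBasis (A.smooth hφ) hy
  refine ⟨b.toMatrix c, ?_, fun α β => ?_⟩
  · have h := congrArg Matrix.det (b.toMatrix_mul_toMatrix_flip c)
    rw [Matrix.det_mul, Matrix.det_one] at h
    exact left_ne_zero_of_mul (h.trans_ne one_ne_zero)
  · have h : ∀ X Y, g ((φ.extend (𝓡∂ 4)).symm y) X Y = ∑ J, η J * (b.repr X J * b.repr Y J) := by
      intro X Y
      conv_lhs => rw [← b.sum_repr X, ← b.sum_repr Y]
      simp only [map_sum, map_smul, LinearMap.sum_apply, LinearMap.smul_apply, hb, smul_eq_mul,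
        minkowski, mul_ite, mul_zero, Finset.sum_ite_eq', Finset.mem_univ, if_true]
      exact Finset.sum_congr rfl fun J _ => by ring
    simp only [compBilin, h, Module.Basis.toMatrix_apply, c, coordBasis_apply]

theorem IsMetric.patchMetric {g : BilinField M} (hg : IsMetric A g) (hφ : φ ∈ A.charts) :
    PatchMetric (φ.extend (𝓡∂ 4)).target (compBilin φ g) where
  patch := isPatch_target φ
  symm _ _ _ := hg.symm _ _ _
  smooth := hg.smooth φ hφ
  frame _ hy := hg.exists_frame hφ hy
  bdry y hy hy0 := by
    obtain ⟨e, he, hge⟩ := hg.exists_frame hφ hy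
    obtain ⟨v, hv0, hv⟩ := hg.timelikeBdry φ hφ y hy hy0
    exact gInv_zero_zero_pos he hge hv0 hv

omit [IsManifold (𝓡∂ 4) ∞ M] in
theorem compBilin_metricOf (φ : OpenPartialHomeomorph M (EuclideanHalfSpace 4))
    (e : Fin 4 → FormField M) : compBilin φ (metricOf e) = tetradMetric (compTetrad φ e) := by
  funext y α β
  simp only [compBilin, metricOf, LinearMap.sum_apply, LinearMap.smul_apply,
    LinearMap.smulRight_apply, smul_eq_mul, tetradMetric, compTetrad, compForm]

theorem IsTetrad.patchTetrad {e : Fin 4 → FormField M} (he : IsTetrad A e) (hφ : φ ∈ A.charts) :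
    PatchTetrad (φ.extend (𝓡∂ 4)).target (compTetrad φ e) := by
  have hg := he.2.patchMetric hφ
  rw [compBilin_metricOf] at hg
  refine ⟨hg.patch, fun I α => he.1 I φ hφ α, fun x hx h0 => ?_, hg.bdry⟩
  obtain ⟨c, hc, hgc⟩ := hg.frame x hx
  refine (inverse_of_frame hc hgc).1 ?_
  rw [det_tetradMetric, h0, mul_zero, neg_zero]

/-- Every point of the manifold lies in the domain of a chart of the oriented atlas. -/
theorem exists_chart (A : OrientedAtlas M) (p : M) :
    ∃ φ ∈ A.charts, ∃ y ∈ (φ.extend (𝓡∂ 4)).target, (φ.extend (𝓡∂ 4)).symm y = p := by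
  obtain ⟨φ, hφ, hp⟩ := A.cover p
  rw [← φ.extend_source (I := 𝓡∂ 4)] at hp
  exact ⟨φ, hφ, _, (φ.extend (𝓡∂ 4)).map_source hp, (φ.extend (𝓡∂ 4)).left_inv hp⟩

theorem compDiff_deltaTensor (hφ : φ ∈ A.charts) (U : FormField M) {y : E4}
    (hy : y ∈ (φ.extend (𝓡∂ 4)).target) :
    compDiff φ (deltaTensor U) y = deltaArr (compForm φ U y) := by
  funext α β σ
  simp only [compDiff, deltaTensor, LinearMap.smulRight_apply, LinearMap.smul_apply, LinearMap.id_apply,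
    coordOf_smul, coordOf_coordVec (A.smooth hφ) hy, deltaArr, compForm, mul_ite, mul_one, mul_zero]

theorem isSmoothDiff_deltaTensor {U : FormField M} (hU : IsSmoothForm A U) :
    IsSmoothDiff A (deltaTensor U) := by
  intro φ hφ α β σ
  refine ContDiffOn.congr ?_ fun y hy => by rw [compDiff_deltaTensor hφ U hy]
  by_cases h : α = σ
  · simpa only [deltaArr, h, if_true] using hU φ hφ β
  · simpa only [deltaArr, h, if_false] using contDiffOn_const

/-- A tensor field whose components are of the form `δ^α_σ U_β` in every chart comes from a smooth
one-form. -/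
theorem exists_eq_deltaTensor {Q : DiffField M} (hQ : IsSmoothDiff A Q)
    (h : ∀ φ ∈ A.charts, ∀ y ∈ (φ.extend (𝓡∂ 4)).target, ∃ U, compDiff φ Q y = deltaArr U) :
    ∃ U, IsSmoothForm A U ∧ Q = deltaTensor U := by
  have hp : ∀ p, ∃ u : TangentSpace (𝓡∂ 4) p →ₗ[ℝ] ℝ, Q p = u.smulRight LinearMap.id := by
    intro p
    obtain ⟨φ, hφ, y, hy, rfl⟩ := exists_chart A p
    obtain ⟨U, hU⟩ := h φ hφ y hy
    let c := coordBasis (A.smooth hφ) hy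
    refine ⟨c.constr ℝ U, c.ext fun β => c.ext fun σ => c.ext_elem fun α => ?_⟩
    have h1 := congrFun (congrFun (congrFun hU α) β) σ
    rw [LinearMap.smulRight_apply, LinearMap.smul_apply, LinearMap.id_apply, Module.Basis.constr_basis,
      coordBasis_repr, coordBasis_repr, coordOf_smul, coordBasis_apply, coordBasis_apply,
      coordOf_coordVec (A.smooth hφ) hy, mul_ite, mul_one, mul_zero]
    exact h1
  choose U hU using hp
  have hQU : Q = deltaTensor U := funext hU
  refine ⟨U, fun φ hφ μ => (hQ φ hφ 0 μ 0).congr fun y hy => ?_, hQU⟩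
  rw [hQU, compDiff_deltaTensor hφ U hy, deltaArr, if_pos rfl]

end Fields

/-! ### Solution spaces -/

section Solutions

variable {M : Type*} [TopologicalSpace M] [ChartedSpace (EuclideanHalfSpace 4) M]
  [IsManifold (𝓡∂ 4) ∞ M] (A : OrientedAtlas M)

/-- The solutions of the generalised action in metric variables do not depend on the coefficient
`b` of the dual term. -/
theorem solMetricAffine_gen (b Λ : ℝ) :
    solMetricAffine A (bulkGen (fun _ => 1) b Λ) (bdryGen (fun _ => 1) b) =
      {x | ∃ (g : BilinField M) (U : FormField M),
        g ∈ solEH A Λ ∧ IsSmoothForm A U ∧ x = (g, deltaTensor U)} := by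
  ext ⟨g, Q⟩
  constructor
  · rintro ⟨hg, hQ, H⟩
    have h := fun φ (hφ : φ ∈ A.charts) =>
      ((hg.patchMetric hφ).stationary_gen_iff b Λ (hQ φ hφ)).1 (H φ hφ)
    obtain ⟨U, hU, rfl⟩ := exists_eq_deltaTensor hQ fun φ hφ => (h φ hφ).1
    exact ⟨g, U, ⟨hg, fun φ hφ => (h φ hφ).2⟩, hU, rfl⟩
  · rintro ⟨g, U, ⟨hg, H⟩, hU, hx⟩
    obtain ⟨rfl, rfl⟩ := Prod.mk.inj hx
    have hQ := isSmoothDiff_deltaTensor hU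
    exact ⟨hg, hQ, fun φ hφ => ((hg.patchMetric hφ).stationary_gen_iff b Λ (hQ φ hφ)).2
      ⟨fun y hy => ⟨_, compDiff_deltaTensor hφ U hy⟩, H φ hφ⟩⟩

variable {A}

theorem isSymm_etaTensor {e : Fin 4 → FormField M} (he : ∀ I, IsSmoothForm A (e I))
    {U : Fin 4 → M → ℝ} (hU : ∀ K, ContMDiff (𝓡∂ 4) 𝓘(ℝ, ℝ) ∞ (U K)) :
    IsSymm A (etaTensor U e) := by
  constructor
  · intro I J φ hφ μ
    have hc : ∀ K, ContDiffOn ℝ ∞ (fun y => U K ((φ.extend (𝓡∂ 4)).symm y))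
        (φ.extend (𝓡∂ 4)).target := fun K =>
      contMDiffOn_iff_contDiffOn.1 ((hU K).comp_contMDiffOn (contMDiffOn_chart_symm (A.smooth hφ)))
    have h : (fun y => compForm φ (etaTensor U e I J) y μ) = fun y => minkowski I J *
        ∑ K, U K ((φ.extend (𝓡∂ 4)).symm y) * compForm φ (e K) y μ := by
      funext y
      simp only [compForm, etaTensor, LinearMap.smul_apply, LinearMap.sum_apply, smul_eq_mul]
    rw [h]
    exact contDiffOn_const.mul (ContDiffOn.sum fun K _ => (hc K).mul (he K φ hφ μ))
  · intro I J p
    have : minkowski I J = minkowski J I := by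
      unfold minkowski
      by_cases hIJ : I = J
      · rw [hIJ]
      · rw [if_neg hIJ, if_neg (Ne.symm hIJ)]
    rw [etaTensor, etaTensor, this]

/-- A smooth one-form has smooth components with respect to a smooth tetrad. -/
theorem IsTetrad.exists_components {e : Fin 4 → FormField M} (he : IsTetrad A e) {θ : FormField M}
    (hθ : IsSmoothForm A θ) : ∃ U : Fin 4 → M → ℝ, (∀ K, ContMDiff (𝓡∂ 4) 𝓘(ℝ, ℝ) ∞ (U K)) ∧
      ∀ p, θ p = ∑ K, U K p • e K p := by
  have hp : ∀ p, ∃ u : Fin 4 → ℝ, θ p = ∑ K, u K • e K p := by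
    intro p
    obtain ⟨φ, hφ, y, hy, rfl⟩ := exists_chart A p
    have hdet := (he.patchTetrad hφ).det_ne y hy
    let c := coordBasis (A.smooth hφ) hy
    refine ⟨fun K => ∑ α, compForm φ θ y α * dualTetrad (compTetrad φ e) y α K,
      c.ext fun μ => ?_⟩
    have h1 : ∑ K, (∑ α, compForm φ θ y α * dualTetrad (compTetrad φ e) y α K) *
        compTetrad φ e y K μ = compForm φ θ y μ := by
      simp only [Finset.sum_mul, mul_assoc]
      rw [Finset.sum_comm]
      simp only [← Finset.mul_sum, sum_dual_mul_tetrad hdet, mul_ite, mul_one, mul_zero,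
        Finset.sum_ite_eq', Finset.mem_univ, if_true]
    simp only [LinearMap.sum_apply, LinearMap.smul_apply, smul_eq_mul, c, coordBasis_apply]
    exact h1.symm
  choose u hu using hp
  refine ⟨fun K p => u p K, fun K p => ?_, hu⟩
  obtain ⟨φ, hφ, y, hy, rfl⟩ := exists_chart A p
  have hT := he.patchTetrad hφ
  let F : E4 → ℝ := fun y => ∑ α, compForm φ θ y α * dualTetrad (compTetrad φ e) y α K
  have hF : ContDiffOn ℝ ∞ F (φ.extend (𝓡∂ 4)).target := ContDiffOn.sum fun α _ =>
    (hθ φ hφ α).mul (hT.patch.contDiffOn fun x hx => contDiffWithinAt_matrix_inv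
      (A := fun y => Matrix.of (compTetrad φ e y))
      (fun I β => hT.patch.contDiffWithinAt (hT.smooth I β) hx) (hT.det_ne x hx) α K)
  have hval : ∀ z ∈ (φ.extend (𝓡∂ 4)).target, u ((φ.extend (𝓡∂ 4)).symm z) K = F z := by
    intro z hz
    have h1 : ∀ α, compForm φ θ z α =
        ∑ L, u ((φ.extend (𝓡∂ 4)).symm z) L * compTetrad φ e z L α := fun α => by
      rw [compForm, hu]
      simp only [LinearMap.sum_apply, LinearMap.smul_apply, smul_eq_mul, compTetrad, compForm]
    simp only [F, h1, Finset.sum_mul, mul_assoc]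
    rw [Finset.sum_comm]
    simp only [← Finset.mul_sum, sum_tetrad_mul_dual (hT.det_ne z hz), mul_ite, mul_one, mul_zero,
      Finset.sum_ite_eq', Finset.mem_univ, if_true]
  have hs : ∀ q ∈ φ.source, φ.extend (𝓡∂ 4) q ∈ (φ.extend (𝓡∂ 4)).target ∧
      (φ.extend (𝓡∂ 4)).symm (φ.extend (𝓡∂ 4) q) = q := by
    intro q hq
    rw [← φ.extend_source (I := 𝓡∂ 4)] at hq
    exact ⟨(φ.extend (𝓡∂ 4)).map_source hq, (φ.extend (𝓡∂ 4)).left_inv hq⟩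
  have hc : ContMDiffOn (𝓡∂ 4) 𝓘(ℝ, ℝ) ∞ (F ∘ φ.extend (𝓡∂ 4)) φ.source :=
    (contMDiffOn_iff_contDiffOn.2 hF).comp (contMDiffOn_chart (A.smooth hφ)) fun q hq => (hs q hq).1
  have hpS : (φ.extend (𝓡∂ 4)).symm y ∈ φ.source := by
    rw [← φ.extend_source (I := 𝓡∂ 4)]
    exact (φ.extend (𝓡∂ 4)).map_target hy
  refine (hc.congr fun q hq => ?_).contMDiffAt (φ.open_source.mem_nhds hpS)
  rw [Function.comp_apply, ← hval _ (hs q hq).1, (hs q hq).2]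

variable (A)

/-- The solutions of the generalised action in tetrad variables are those of the Holst action, up to
the term `η_{IJ} U_K e^K` in the symmetric part of the connection form. -/
theorem solTetradAffine_gen (b Λ γ : ℝ) :
    solTetradAffine A (bulkGen (fun _ => 1) b Λ) (bdryGen (fun _ => 1) b) =
      {x | ∃ (e : Fin 4 → FormField M) (w : Fin 4 → Fin 4 → FormField M) (U : Fin 4 → M → ℝ),
        (e, w) ∈ solHolst A Λ γ ∧ (∀ K, ContMDiff (𝓡∂ 4) 𝓘(ℝ, ℝ) ∞ (U K)) ∧
        x = (e, w, etaTensor U e)} := by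
  -- A variation of the connection form is a sum of an antisymmetric and a symmetric one.
  have split : ∀ (T : Set E4) (e : LTetrad) (w s : LSpin),
      ((∀ (f : LTetrad) (u s' : LSpin), (∀ I α, IsVariation T fun x => f x I α) →
        (∀ μ I J, IsVariation T fun x => u x μ I J) → (∀ x μ I J, u x μ I J = -u x μ J I) →
        (∀ μ I J, IsVariation T fun x => s' x μ I J) → (∀ x μ I J, s' x μ I J = s' x μ J I) →
        firstVariation T
          (fun t => bulkGen (fun _ => 1) b Λ (tetradMetric (e + t • f))
            (tetradQ (e + t • f) ((w + t • u) + (s + t • s'))))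
          (fun t => bdryGen (fun _ => 1) b (tetradMetric (e + t • f))
            (tetradQ (e + t • f) ((w + t • u) + (s + t • s')))) = 0) ↔
      ∀ (f : LTetrad) (u : LSpin), (∀ I α, IsVariation T fun x => f x I α) →
        (∀ μ I J, IsVariation T fun x => u x μ I J) →
        firstVariation T
          (fun t => bulkGen (fun _ => 1) b Λ (tetradMetric (e + t • f))
            (tetradQ (e + t • f) ((w + s) + t • u)))
          (fun t => bdryGen (fun _ => 1) b (tetradMetric (e + t • f))
            (tetradQ (e + t • f) ((w + s) + t • u))) = 0) := by
    intro T e w s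
    have hsum : ∀ (t : ℝ) (u s' : LSpin), (w + t • u) + (s + t • s') = (w + s) + t • (u + s') :=
      fun t u s' => by rw [smul_add]; abel
    simp only [hsum]
    constructor
    · intro H f u hf hu
      let v : LSpin := fun x μ I J => (u x μ I J + u x μ J I * (-1)) * (1 / 2)
      let s' : LSpin := fun x μ I J => (u x μ I J + u x μ J I) * (1 / 2)
      have h1 : v + s' = u := by
        funext x μ I J
        simp only [v, s', Pi.add_apply]
        ring
      have := H f v s' hf (fun μ I J => ((hu μ I J).add ((hu μ J I).mul_const _)).mul_const _)
        (fun x μ I J => by simp only [v]; ring)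
        (fun μ I J => ((hu μ I J).add (hu μ J I)).mul_const _)
        (fun x μ I J => by simp only [s']; ring)
      rwa [h1] at this
    · intro H f u s' hf hu _ hs' _
      exact H f (u + s') hf fun μ I J => (hu μ I J).add (hs' μ I J)
  have hsm : ∀ {w : Fin 4 → Fin 4 → FormField M}, (∀ I J, IsSmoothForm A (w I J)) →
      ∀ φ ∈ A.charts, ∀ μ I J, ContDiffOn ℝ ∞ (fun y => compSpin φ w y μ I J)
        (φ.extend (𝓡∂ 4)).target := fun hw φ hφ μ I J => hw I J φ hφ μ
  have hanti : ∀ {w : Fin 4 → Fin 4 → FormField M}, IsAntisymm A w →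
      ∀ φ (y : E4) μ I J, compSpin φ w y μ I J = -compSpin φ w y μ J I := by
    intro w hw φ y μ I J
    simp only [compSpin, compForm]
    rw [hw.2 I J, LinearMap.neg_apply]
  have hsymm : ∀ {w : Fin 4 → Fin 4 → FormField M}, IsSymm A w →
      ∀ φ (y : E4) μ I J, compSpin φ w y μ I J = compSpin φ w y μ J I := by
    intro w hw φ y μ I J
    simp only [compSpin, compForm]
    rw [hw.2 I J]
  ext ⟨e, w, S⟩
  constructor
  · rintro ⟨he, hw, hS, H⟩
    have h := fun φ (hφ : φ ∈ A.charts) => ((he.patchTetrad hφ).stationary_gen_iff b Λ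
      (w := compSpin φ w + compSpin φ S) fun μ I J =>
        (hsm hw.1 φ hφ μ I J).add (hsm hS.1 φ hφ μ I J)).1 ((split _ _ _ _).1 (H φ hφ))
    have h2 : ∀ φ ∈ A.charts, ∀ y ∈ (φ.extend (𝓡∂ 4)).target, ∃ U : Fin 4 → ℝ,
        tetradQ (compTetrad φ e) (compSpin φ w) y = 0 ∧
        ∀ μ I J, compSpin φ S y μ I J = minkowski I J * U μ := by
      intro φ hφ y hy
      obtain ⟨U, hU⟩ := (h φ hφ).1 y hy
      exact ⟨U, ((he.patchTetrad hφ).tetradAt hy).tetradQ_add_eq_deltaArr_iff (hanti hw φ y)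
        (hsymm hS φ y) U |>.1 hU⟩
    obtain ⟨U, hU, hUS⟩ := he.exists_components (hS.1 1 1)
    refine ⟨e, w, U, ⟨he, hw, fun φ hφ => ((he.patchTetrad hφ).stationary_holst_iff Λ γ
      (hsm hw.1 φ hφ) (hanti hw φ)).2 ⟨fun y hy => (h2 φ hφ y hy).choose_spec.1, (h φ hφ).2⟩⟩,
      hU, ?_⟩
    have hSeq : S = etaTensor U e := by
      funext I J p
      rw [etaTensor, ← hUS p]
      obtain ⟨φ, hφ, y, hy, rfl⟩ := exists_chart A p
      obtain ⟨V, -, hV⟩ := h2 φ hφ y hy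
      refine (coordBasis (A.smooth hφ) hy).ext fun μ => ?_
      have h11 : minkowski 1 1 = 1 := by simp [minkowski, η]
      have h3 := hV μ I J
      have h4 := hV μ 1 1
      rw [h11, one_mul] at h4
      rw [← h4] at h3
      rw [LinearMap.smul_apply, coordBasis_apply]
      exact h3
    rw [hSeq]
  · rintro ⟨e, w, U, ⟨he, hw, H⟩, hU, hx⟩
    obtain ⟨rfl, h'⟩ := Prod.mk.inj hx
    obtain ⟨rfl, rfl⟩ := Prod.mk.inj h'
    have hS := isSymm_etaTensor he.1 hU
    refine ⟨he, hw, hS, fun φ hφ => (split _ _ _ _).2 ?_⟩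
    have h := ((he.patchTetrad hφ).stationary_holst_iff Λ γ (hsm hw.1 φ hφ) (hanti hw φ)).1 (H φ hφ)
    refine ((he.patchTetrad hφ).stationary_gen_iff b Λ fun μ I J =>
      (hsm hw.1 φ hφ μ I J).add (hsm hS.1 φ hφ μ I J)).2 ⟨fun y hy => ?_, h.2⟩
    refine ⟨fun μ => ∑ K, U K ((φ.extend (𝓡∂ 4)).symm y) * compForm φ (e K) y μ,
      (((he.patchTetrad hφ).tetradAt hy).tetradQ_add_eq_deltaArr_iff (hanti hw φ y)
        (hsymm hS φ y) _).2 ⟨h.1 y hy, fun μ I J => ?_⟩⟩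
    simp only [compSpin, compForm, etaTensor, LinearMap.smul_apply, LinearMap.sum_apply, smul_eq_mul]

end Solutions

end HMS

theorem mainTheorem6 {M : Type*} [TopologicalSpace M] [T2Space M] [SecondCountableTopology M]
    [ChartedSpace (EuclideanHalfSpace 4) M] [IsManifold (𝓡∂ 4) ∞ M]
    (A : HMS.OrientedAtlas M) (Λ γ : ℝ) (hγ : γ ≠ 0) :
    (HMS.solHMS A Λ γ =
      {x | ∃ (g : HMS.BilinField M) (U : HMS.FormField M),
        g ∈ HMS.solEH A Λ ∧ HMS.IsSmoothForm A U ∧ x = (g, HMS.deltaTensor U)}) ∧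
    HMS.solHMS A Λ γ = HMS.solPT A Λ ∧
    (HMS.solHMSTetrad A Λ γ =
      {x | ∃ (e : Fin 4 → HMS.FormField M) (w : Fin 4 → Fin 4 → HMS.FormField M)
          (U : Fin 4 → M → ℝ),
        (e, w) ∈ HMS.solHolst A Λ γ ∧ (∀ K, ContMDiff (𝓡∂ 4) 𝓘(ℝ, ℝ) ∞ (U K)) ∧
        x = (e, w, HMS.etaTensor U e)}) ∧
    HMS.solHMSTetrad A Λ γ = HMS.solPTTetrad A Λ := by
  have hHMS := HMS.solMetricAffine_gen A (1 / γ) Λ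
  have hPT := HMS.solMetricAffine_gen A 0 Λ
  have hHMSt := HMS.solTetradAffine_gen A (1 / γ) Λ γ
  have hPTt := HMS.solTetradAffine_gen A 0 Λ γ
  rw [← HMS.bulkHMS_eq_bulkGen, ← HMS.bdryHMS_eq_bdryGen] at hHMS hHMSt
  rw [← HMS.bulkPT_eq_bulkGen, ← HMS.bdryPT_eq_bdryGen] at hPT hPTt
  exact ⟨hHMS, hHMS.trans hPT.symm, hHMSt, hHMSt.trans hPTt.symm⟩
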